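/- **Notation.** $\mathbb{C}_+=\{z\in\mathbb{C}:\Im z>0\}$, $\mathbb{R}_+=[0,\infty)$, $[K]=\{1,\dots,K\}$. The Stieltjes transform of a finite Borel measure $\mu$ on $\mathbb{R}$ is $s_\mu(z)=\int \frac{\mu(dx)}{x-z}$, $z\in\mathbb{C}_+$. For a Hermitian matrix $S$ of order $p$, $F^S$ is the normalized counting measure of its $p$ eigenvalues. If $M_1,\dots,M_K$ are commuting Hermitian matrices of order $m$, their joint eigenvalues are the vectors $\lambda_j=(\lambda_j^{(1)},\dots,\lambda_j^{(K)})$, $j=1,\dots,m$, where $\lambda_j^{(r)}$ is the eigenvalue of $M_r$ at the $j$-th vector of a common orthonormal eigenbasis, and their joint empirical spectral distribution (JESD) is $F^{(M_1,\dots,M_K)}=\frac1m\sum_{j=1}^m\delta_{\lambda_j}$. For a probability measure $\mu$ on $\mathbb{R}_+^K$, $z\in\mathbb{C}_+$ and $\mathbf{q}\in\mathbb{C}_+^K$ put $$\mathbf{O}(z,\mathbf{q},\mu)=\int\frac{\boldsymbol\lambda\,\mu(d\boldsymbol\lambda)}{-z(1+\boldsymbol\lambda^T\mathbf{q})}\in\mathbb{C}^K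 .$$ **Model.** Let $K\ge1$ be fixed. For each $n$ let $p=p(n)$, let $Z_n^{(r)}$ ($r\in[K]$) be complex random $p\times n$ matrices, and let $A_n^{(r)}\in\mathbb{C}^{p\times p}$, $B_n^{(r)}\in\mathbb{C}^{n\times n}$ ($r\in[K]$) be matrices that are either deterministic or random; all of them are defined on one probability space, and the family $(A_n^{(r)},B_n^{(r)})_{n,r}$ is independent of the family $(Z_n^{(r)})_{n,r}$. Let $$X_n=\sum_{r=1}^K (A_n^{(r)})^{1/2}Z_n^{(r)}(B_n^{(r)})^{1/2},\qquad S_n=\frac1n X_nX_n^* .$$ **Theorem.** Suppose that * **T1** $p/n\to c\in(0,\infty)$; * **T2** for each $n$, the entries of $Z_n^{(1)},\dots,Z_n^{(K)}$ are jointly independent, each entry $\zeta$ satisfies $\mathbb{E}\zeta=0$ and $\mathbb{E}|\zeta|^2=1$, and for some $\eta_0>0$ the moments $\mathbb{E}|\zeta|^{4+\eta_0}$ are bounded uniformly over all entries and all $n$, $r$; * **T3** almost surely, all $A_n^{(r)},B_n^{(r)}$ are positive semi-definite, and the JESDs of $(A_n^{(1)},\dots,A_n^{(K)})$ and of $(B_n^{(1)},\dots,B_n^{(K)})$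 converge weakly to non-random probability measures $H$ and $G$ on $\mathbb{R}_+^K$ respectively; moreover $H\ne\delta_{\mathbf 0}$, $G\neq\delta_{\mathbf 0}$, and neither $H$ nor $G$ is concentrated on a coordinate hyperplane: $H(\{\lambda_r=0\})<1$ and $G(\{\lambda_r=0\})<1$ for every $r\in[K]$; * **T4** there is a constant $C_0>0$ such that, almost surely, $\limsup_{n}\max_{r\in[K]}\max\{\frac1p\operatorname{tr}A_n^{(r)},\frac1n\operatorname{tr}B_n^{(r)}\}<C_0$; * **T5** almost surely, $A_n^{(r)}A_n^{(s)}=A_n^{(s)}A_n^{(r)}$ and $B_n^{(r)}B_n^{(s)}=B_n^{(s)}B_n^{(r)}$ for all $n$ and all $r,s\in[K]$. Then there are a function $\mathbf{h}=(h_1,\dots,h_K):\mathbb{C}_+\to\mathbb{C}_+^K$ and a (non-random) probability measure $F$ on $\mathbb{R}$ such that: 1. each $h_r$ is the Stieltjes transform of a finite measure on $\mathbb{R}_+$, and for all $z\in\mathbb{C}_+$ $$\mathbf{h}(z)=\int_{\mathbb{R}_+^K}\frac{\boldsymbol\lambda\,dH(\boldsymbol\lambda)}{-z\bigl(1+\boldsymbol\lambda^T\mathbf{O}(z,c\,\mathbf{h}(z),G)\bigr)}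 ;$$ 2. $\mathbf{h}$ is the only function $\mathbb{C}_+\to\mathbb{C}_+^K$ satisfying this equation on $\mathbb{C}_+$ whose components are Stieltjes transforms of finite measures on $\mathbb{R}$; 3. the Stieltjes transform of $F$ is $$s_F(z)=\int_{\mathbb{R}_+^K}\frac{dH(\boldsymbol\lambda)}{-z\bigl(1+\boldsymbol\lambda^T\mathbf{O}(z,c\,\mathbf{h}(z),G)\bigr)},\qquad z\in\mathbb{C}_+ ;$$ 4. almost surely, $F^{S_n}\to F$ weakly as $n\to\infty$. -/

import Mathlib

open MeasureTheory ProbabilityTheory Filter Topology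
open scoped ENNReal NNReal ComplexOrder MatrixOrder Matrix

noncomputable section

namespace SumSeparable

/-- The normalized counting measure `(1/|ι|) ∑ i, δ_{x i}` of a finite family of points.  (It is the
zero measure when the family is empty, and a probability measure otherwise.) -/
def empirical {ι E : Type*} [Fintype ι] [MeasurableSpace E] (x : ι → E) : FiniteMeasure E :=
  (Fintype.card ι : ℝ≥0)⁻¹ • ∑ i, (diracProba (x i)).toFiniteMeasure

/-- The empirical spectral distribution of a Hermitian matrix: the normalized counting measure of
its eigenvalues, with multiplicity. -/
def esd {m : ℕ} {S : Matrix (Fin m) (Fin m) ℂ} (hS : S.IsHermitian) : FiniteMeasure ℝ :=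
  empirical hS.eigenvalues

/-- `lam j = (lam j 1, …, lam j K)`, `j = 1, …, m`, are the joint eigenvalues of the matrices
`A 1, …, A K`: in a common orthonormal basis of eigenvectors (the columns of `U`), the `j`-th one has
the eigenvalue `lam j r` for `A r`. -/
def IsJointSpectrum {K m : ℕ} (A : Fin K → Matrix (Fin m) (Fin m) ℂ)
    (lam : Fin m → Fin K → ℝ) : Prop :=
  ∃ U ∈ Matrix.unitaryGroup (Fin m) ℂ,
    ∀ r, A r = U * Matrix.diagonal (fun j => (lam j r : ℂ)) * Uᴴ

/-- A choice of joint eigenvalues of a family of commuting Hermitian matrices; it is unique up to the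
order of the `m` vectors. -/
def jointEigenvalues {K m : ℕ} (A : Fin K → Matrix (Fin m) (Fin m) ℂ) : Fin m → Fin K → ℝ :=
  Classical.epsilon (IsJointSpectrum A)

/-- The joint empirical spectral distribution of a family of commuting Hermitian matrices. -/
def jointESD {K m : ℕ} (A : Fin K → Matrix (Fin m) (Fin m) ℂ) : FiniteMeasure (Fin K → ℝ) :=
  empirical (jointEigenvalues A)

/-- Joint eigenvalues are unique up to order. -/
theorem IsJointSpectrum.exists_perm {K m : ℕ} {A : Fin K → Matrix (Fin m) (Fin m) ℂ}
    {lam mu : Fin m → Fin K → ℝ} (h₁ : IsJointSpectrum A lam) (h₂ : IsJointSpectrum A mu) :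
    ∃ σ : Equiv.Perm (Fin m), ∀ i, lam (σ i) = mu i := by
  obtain ⟨U, hU, h₁⟩ := h₁
  obtain ⟨V, hV, h₂⟩ := h₂
  have hU' : Uᴴ * U = 1 := Matrix.mem_unitaryGroup_iff'.1 hU
  have hV' : Vᴴ * V = 1 := Matrix.mem_unitaryGroup_iff'.1 hV
  have hW : (Uᴴ * V).det ≠ 0 := by
    intro h0
    have h1 : (Vᴴ * U) * (Uᴴ * V) = 1 := by
      have hU'' : U * Uᴴ = 1 := Matrix.mem_unitaryGroup_iff.1 hU
      calc (Vᴴ * U) * (Uᴴ * V) = Vᴴ * (U * Uᴴ) * V := by simp only [Matrix.mul_assoc]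
        _ = 1 := by rw [hU'', Matrix.mul_one, hV']
    have h2 := congrArg Matrix.det h1
    rw [Matrix.det_mul, h0, mul_zero, Matrix.det_one] at h2
    exact zero_ne_one h2
  have hcomm : ∀ r, Matrix.diagonal (fun j => (lam j r : ℂ)) * (Uᴴ * V) =
      (Uᴴ * V) * Matrix.diagonal (fun j => (mu j r : ℂ)) := by
    intro r
    have h : U * Matrix.diagonal (fun j => (lam j r : ℂ)) * Uᴴ =
        V * Matrix.diagonal (fun j => (mu j r : ℂ)) * Vᴴ := (h₁ r).symm.trans (h₂ r)
    calc Matrix.diagonal (fun j => (lam j r : ℂ)) * (Uᴴ * V)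
        = (Uᴴ * U) * Matrix.diagonal (fun j => (lam j r : ℂ)) * (Uᴴ * V) := by
          rw [hU', Matrix.one_mul]
      _ = Uᴴ * (U * Matrix.diagonal (fun j => (lam j r : ℂ)) * Uᴴ) * V := by
          simp only [Matrix.mul_assoc]
      _ = Uᴴ * V * Matrix.diagonal (fun j => (mu j r : ℂ)) * (Vᴴ * V) := by
          rw [h]; simp only [Matrix.mul_assoc]
      _ = _ := by rw [hV', Matrix.mul_one]
  rw [Matrix.det_apply] at hW
  obtain ⟨σ, -, hσ⟩ := Finset.exists_ne_zero_of_sum_ne_zero hW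
  have hσ' : ∏ i, (Uᴴ * V) (σ i) i ≠ 0 := fun h => hσ (by rw [h, smul_zero])
  refine ⟨σ, fun i => funext fun r => ?_⟩
  have hi := Finset.prod_ne_zero_iff.1 hσ' i (Finset.mem_univ i)
  have he := congrFun (congrFun (hcomm r) (σ i)) i
  rw [Matrix.diagonal_mul, Matrix.mul_diagonal, mul_comm] at he
  exact_mod_cast mul_left_cancel₀ hi he

/-- The joint empirical spectral distribution does not depend on the choice of the joint
eigenvalues. -/
theorem IsJointSpectrum.jointESD_eq {K m : ℕ} {A : Fin K → Matrix (Fin m) (Fin m) ℂ}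
    {lam : Fin m → Fin K → ℝ} (h : IsJointSpectrum A lam) : jointESD A = empirical lam := by
  have h' : IsJointSpectrum A (jointEigenvalues A) := Classical.epsilon_spec_aux _ _ ⟨lam, h⟩
  obtain ⟨σ, hσ⟩ := h.exists_perm h'
  unfold jointESD empirical
  congr 1
  rw [← Equiv.sum_comp σ fun i => (diracProba (lam i)).toFiniteMeasure]
  simp only [hσ]

/-- The data matrix `X = ∑ r, A_r^{1/2} Z_r B_r^{1/2}`; `CFC.sqrt` is the positive semi-definite
square root. -/
def dataMatrix {K p n : ℕ} (A : Fin K → Matrix (Fin p) (Fin p) ℂ)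
    (B : Fin K → Matrix (Fin n) (Fin n) ℂ) (Z : Fin K → Matrix (Fin p) (Fin n) ℂ) :
    Matrix (Fin p) (Fin n) ℂ :=
  ∑ r, CFC.sqrt (A r) * Z r * CFC.sqrt (B r)

/-- The sample covariance matrix `S = (1/n) X X^*`. -/
def sampleCov {p n : ℕ} (X : Matrix (Fin p) (Fin n) ℂ) : Matrix (Fin p) (Fin p) ℂ :=
  ((n : ℝ)⁻¹) • (X * Xᴴ)

theorem sampleCov_isHermitian {p n : ℕ} (X : Matrix (Fin p) (Fin n) ℂ) :
    (sampleCov X).IsHermitian := by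
  simp [sampleCov, Matrix.IsHermitian, Matrix.conjTranspose_smul]

/-- The Stieltjes transform `z ↦ ∫ μ(dx) / (x - z)`. -/
def stieltjes (μ : Measure ℝ) (z : ℂ) : ℂ := ∫ x : ℝ, 1 / ((x : ℂ) - z) ∂μ

/-- `s` is, on the upper half-plane, the Stieltjes transform of a finite (nonnegative) Borel measure
on the real line that is carried by the set `E`. -/
def IsStieltjesOf (E : Set ℝ) (s : ℂ → ℂ) : Prop :=
  ∃ μ : Measure ℝ, IsFiniteMeasure μ ∧ μ Eᶜ = 0 ∧ ∀ z : ℂ, 0 < z.im → s z = stieltjes μ z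

/-- `O_r(z, q, μ) = ∫ λ_r μ(dλ) / (-z (1 + λᵀ q))`. -/
def opO {K : ℕ} (z : ℂ) (q : Fin K → ℂ) (μ : Measure (Fin K → ℝ)) (r : Fin K) : ℂ :=
  ∫ x : Fin K → ℝ, (x r : ℂ) / (-z * (1 + ∑ s, (x s : ℂ) * q s)) ∂μ

/-- `h` takes values in `ℂ₊^K` on the upper half-plane and satisfies there
`h(z) = ∫ λ dH(λ) / (-z (1 + λᵀ O(z, c h(z), G)))`. -/
def SolvesSystem {K : ℕ} (c : ℝ) (H G : Measure (Fin K → ℝ)) (h : ℂ → Fin K → ℂ) : Prop :=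
  ∀ z : ℂ, 0 < z.im → ∀ r, 0 < (h z r).im ∧
    h z r = ∫ x : Fin K → ℝ,
      (x r : ℂ) / (-z * (1 + ∑ s, (x s : ℂ) * opO z (fun t => (c : ℂ) * h z t) G s)) ∂H

end SumSeparable

end

/-! ### Stieltjes transforms: holomorphy, total mass, compactness -/

noncomputable section

namespace SumSeparable

/-! Let W be the Hermitian matrix with off-diagonal blocks n^{-1/2} X and its adjoint, and let G =
(W - w)⁻¹ with Im w > 0. The upper left block of G is w (S - w²)⁻¹, so z = w² recovers the resolvent
of S. Unlike S, the matrix W is linear in the innovations: it is a sum of matrices ζ u v* + ζ̄ v u*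
of rank at most two, one for each entry ζ (`sepModel_cols`).

Self-consistent equation. Expand G to second order in one entry, using mean zero, variance one and a
third absolute moment (`norm_integral_trace_add_mainTerm_le`), and sum over the entries with W G = 1
+ w G. The result is E tr(M G) ≈ -tr(M D⁻¹), where D is w plus a combination of the A_r and the B_r
whose coefficients are expected traces of G against the B_r and the A_r
(`norm_integral_trace_add_trace_mul_inv_le`). Coefficients may be replaced by their expectations
because tr(M G) concentrates: changing one column of the innovations is a perturbation of bounded
rank, so McDiarmid's inequality applies. Since the A_r commute and the B_r commute, D is diagonal in
the joint eigenbasis, and a closed system of 2K scalar equations appears, with integrals against the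
joint empirical spectral distributions (`norm_dyson_le`). The errors are small if all joint
eigenvalues are at most n^{1/16}. By the trace bound, cutting off larger ones affects o(n) of them
and changes W by rank o(n).

Limits. Along an ultrafilter the traces converge to Stieltjes transforms, and `limit_system` passes
to the limit in the equations. As neither H nor G is carried by a coordinate hyperplane, the
limiting unknowns have positive imaginary parts, and this makes the integrands λ_r / (w + λᵀb)
bounded, so that weak convergence suffices. This proves existence. For uniqueness (`eq_of_solves`):
high on the imaginary axis every solution behaves like i k / y with k > 0, and there the system is
Lipschitz with a constant tending to zero. Two solutions therefore agree for large y, and everywhere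
by the identity theorem. Hence all ultrafilters give the same limit, and the whole sequence
converges.

Conclusion. The fourth moments of the fluctuations are summable, which gives almost sure
convergence. Stieltjes transforms at the points -(1 + 1/q), together with the masses, determine weak
limits (`tendsto_integral_of_tendsto_stieltjes`). Random scaling matrices are frozen by independence
and Fubini (`ae_of_indepFun`). -/

theorem stieltjes_eq_resolventTransform (μ : Measure ℝ) (z : ℂ) :
    stieltjes μ z = resolventTransform μ z := by
  simp [stieltjes, resolventTransform_apply, resolvent, Ring.inverse_eq_inv']

/-- A point off the support of `μ` is a point of holomorphy of the Stieltjes transform. -/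
theorem differentiableAt_stieltjes {μ : Measure ℝ} [IsFiniteMeasure μ] {E : Set ℝ}
    (hE : IsClosed E) (hμ : μ Eᶜ = 0) {z : ℂ} (hz : ∀ x ∈ E, (x : ℂ) ≠ z) :
    DifferentiableAt ℂ (stieltjes μ) z := by
  have h : stieltjes μ = resolventTransform μ := funext (stieltjes_eq_resolventTransform μ)
  rw [h]
  refine (hasDerivAt_resolventTransform z ?_).differentiableAt
  rintro ⟨x, hx, rfl⟩
  refine hz x ?_ rfl
  by_contra hxE
  exact (Measure.notMem_support_iff_exists.2 ⟨Eᶜ, hE.isOpen_compl.mem_nhds hxE, hμ⟩) hx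

theorem ofReal_ne_of_im_pos {z : ℂ} (hz : 0 < z.im) (x : ℝ) : (x : ℂ) ≠ z := by
  rintro rfl
  simp at hz

theorem differentiableOn_stieltjes (μ : Measure ℝ) [IsFiniteMeasure μ] :
    DifferentiableOn ℂ (stieltjes μ) {z | 0 < z.im} := fun z hz =>
  (differentiableAt_stieltjes (E := Set.univ) isClosed_univ (by simp)
    fun x _ => ofReal_ne_of_im_pos hz x).differentiableWithinAt

/-- `w ^ 2` avoids `[0, ∞)` when `w` lies in the upper half-plane. -/
theorem ofReal_ne_sq {w : ℂ} (hw : 0 < w.im) {x : ℝ} (hx : 0 ≤ x) : (x : ℂ) ≠ w ^ 2 := by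
  intro h
  have h1 := congrArg Complex.re h
  have h2 := congrArg Complex.im h
  simp only [pow_two, Complex.mul_re, Complex.mul_im, Complex.ofReal_re, Complex.ofReal_im]
    at h1 h2
  have h3 : w.re = 0 := by
    have : w.re * w.im = 0 := by linarith
    rcases mul_eq_zero.1 this with h | h
    · exact h
    · exact absurd h hw.ne'
  rw [h3] at h1
  nlinarith [mul_pos hw hw]

theorem norm_sub_ge_im (x : ℝ) (z : ℂ) : |z.im| ≤ ‖(x : ℂ) - z‖ := by
  have := Complex.abs_im_le_norm ((x : ℂ) - z)
  simpa using this

theorem integrable_one_div_sub (μ : Measure ℝ) [IsFiniteMeasure μ] {z : ℂ} (hz : z.im ≠ 0) :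
    Integrable (fun x : ℝ => 1 / ((x : ℂ) - z)) μ := by
  refine Integrable.of_bound (C := 1 / |z.im|) (by fun_prop : Measurable _).aestronglyMeasurable (ae_of_all _ fun x => ?_)
  rw [norm_div, norm_one]
  exact one_div_le_one_div_of_le (abs_pos.2 hz) (norm_sub_ge_im x z)

/-- The total mass is read off the Stieltjes transform along the imaginary axis. -/
theorem tendsto_mul_stieltjes (μ : Measure ℝ) [IsFiniteMeasure μ] :
    Tendsto (fun y : ℝ => (y : ℂ) * stieltjes μ (Complex.I * y)) atTop
      (𝓝 (Complex.I * (μ.real Set.univ : ℂ))) := by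
  have h1 : ∀ y : ℝ, (y : ℂ) * stieltjes μ (Complex.I * y) =
      ∫ x : ℝ, (y : ℂ) * (1 / ((x : ℂ) - Complex.I * y)) ∂μ := fun y => by
    rw [stieltjes, integral_const_mul]
  have h2 : Complex.I * (μ.real Set.univ : ℂ) = ∫ _ : ℝ, Complex.I ∂μ := by
    simp [mul_comm]
  rw [h2]
  simp_rw [h1]
  refine tendsto_integral_filter_of_dominated_convergence (fun _ => 1) ?_ ?_
    (integrable_const _) (ae_of_all _ fun x => ?_)
  · exact Eventually.of_forall fun y => (by fun_prop : Measurable _).aestronglyMeasurable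
  -- The integrand is dominated by 1 because |x - iy| ≥ y.
  · filter_upwards [eventually_gt_atTop 0] with y hy
    refine ae_of_all _ fun x => ?_
    have h := norm_sub_ge_im x (Complex.I * y)
    simp only [Complex.mul_im, Complex.I_re, Complex.ofReal_im, Complex.I_im, Complex.ofReal_re,
      zero_mul, one_mul, zero_add, abs_of_pos hy] at h
    rw [norm_mul, norm_div, norm_one, Complex.norm_real, Real.norm_of_nonneg hy.le, mul_one_div]
    exact div_le_one_of_le₀ h (norm_nonneg _)
  · have h3 : Tendsto (fun y : ℝ => (x : ℂ) / y - Complex.I) atTop (𝓝 (0 - Complex.I)) := by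
      refine Tendsto.sub_const ?_ _
      have : Tendsto (fun y : ℝ => x / y) atTop (𝓝 0) := tendsto_const_nhds.div_atTop tendsto_id
      have h4 := (Complex.continuous_ofReal.tendsto 0).comp this
      simpa [Function.comp_def] using h4
    have h5 := h3.inv₀ (by simp)
    have h6 : (0 - Complex.I)⁻¹ = Complex.I := by simp
    rw [h6] at h5
    refine h5.congr' ?_
    filter_upwards [eventually_gt_atTop 0] with y hy
    have hy' : (y : ℂ) ≠ 0 := by exact_mod_cast hy.ne'
    rw [one_div, ← div_eq_mul_inv, ← inv_div]
    field_simp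

theorem im_one_div_sub_pos {z : ℂ} (hz : 0 < z.im) (x : ℝ) : 0 < (1 / ((x : ℂ) - z)).im := by
  have h : 0 < Complex.normSq ((x : ℂ) - z) :=
    Complex.normSq_pos.2 (sub_ne_zero.2 (ofReal_ne_of_im_pos hz x))
  simp only [one_div, Complex.inv_im, Complex.sub_im, Complex.ofReal_im, zero_sub, neg_neg]
  exact div_pos hz h

theorem im_stieltjes_pos {μ : Measure ℝ} [IsFiniteMeasure μ] (hμ : μ ≠ 0) {z : ℂ}
    (hz : 0 < z.im) : 0 < (stieltjes μ z).im := by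
  have hi := integrable_one_div_sub μ hz.ne'
  have h := integral_im (𝕜 := ℂ) hi
  simp only [RCLike.im_to_complex] at h
  rw [stieltjes, ← h, integral_pos_iff_support_of_nonneg
    (fun x => (im_one_div_sub_pos hz x).le) hi.im]
  have : Function.support (fun x : ℝ => (1 / ((x : ℂ) - z)).im) = Set.univ :=
    Set.eq_univ_of_forall fun x => (im_one_div_sub_pos hz x).ne'
  rw [this]
  exact (Measure.measure_univ_pos).2 hμ

/-- The map `x ↦ 1 / (1 + x)` from `[0, ∞)` onto `(0, 1]`, extended to the real line. -/
def invOneAdd (x : ℝ) : unitInterval :=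
  ⟨(1 + max x 0)⁻¹, by positivity, inv_le_one_of_one_le₀ (by simp)⟩

theorem coe_invOneAdd {x : ℝ} (hx : 0 ≤ x) : (invOneAdd x : ℝ) = (1 + x)⁻¹ := by
  simp [invOneAdd, max_eq_left hx]

theorem continuous_invOneAdd : Continuous invOneAdd := by
  refine Continuous.subtype_mk (Continuous.inv₀ (by fun_prop) fun x => ?_) _
  positivity

theorem invOneAdd_pos (x : ℝ) : 0 < (invOneAdd x : ℝ) := by
  simp only [invOneAdd]; positivity

/-- In the coordinate t = 1/(1+x) the kernel 1/(x - z) becomes t / (1 - t(1+z)), which extends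
continuously to t = 0, the point at infinity, with value 0. A zero of the denominator would mean x =
z. -/
theorem unitInterval_denominator_ne_zero {z : ℂ} (hz : ∀ x : ℝ, 0 ≤ x → (x : ℂ) ≠ z)
    (t : unitInterval) : (1 : ℂ) - (t : ℝ) * (1 + z) ≠ 0 := by
  intro h
  have ht : (t : ℝ) ≠ 0 := by
    intro h0
    rw [h0] at h
    simp at h
  have ht' : ((t : ℝ) : ℂ) ≠ 0 := by exact_mod_cast ht
  refine hz ((t : ℝ)⁻¹ - 1) ?_ ?_
  · have : 1 ≤ (t : ℝ)⁻¹ := (one_le_inv₀ (lt_of_le_of_ne t.2.1 ht.symm)).2 t.2.2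
    linarith
  · push_cast
    field_simp
    linear_combination h

/-- Finite measures on `[0, ∞)` of bounded mass are relatively compact, in the sense of convergence
of Stieltjes transforms off `[0, ∞)`. -/
theorem exists_tendsto_stieltjes {ι : Type*} (𝒰 : Ultrafilter ι) (μ : ι → Measure ℝ)
    [∀ i, IsFiniteMeasure (μ i)] (hμ : ∀ i, μ i (Set.Ici 0)ᶜ = 0) (C : ℝ≥0)
    (hC : ∀ᶠ i in (𝒰 : Filter ι), μ i Set.univ ≤ C) :
    ∃ ν : Measure ℝ, IsFiniteMeasure ν ∧ ν (Set.Ici 0)ᶜ = 0 ∧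
      ∀ z : ℂ, (∀ x : ℝ, 0 ≤ x → (x : ℂ) ≠ z) →
        Tendsto (fun i => stieltjes (μ i) z) 𝒰 (𝓝 (stieltjes ν z)) := by
  have hmeas : Measurable invOneAdd := continuous_invOneAdd.measurable
  let κ : ι → FiniteMeasure unitInterval := fun i =>
    ⟨(μ i).map invOneAdd, inferInstance⟩
  have hκ : ∀ᶠ i in (𝒰 : Filter ι), κ i ∈ {m : FiniteMeasure unitInterval | m.mass ≤ C} := by
    filter_upwards [hC] with i hi
    have : ((κ i).mass : ℝ≥0∞) ≤ C := by
      rw [FiniteMeasure.ennreal_mass]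
      simpa [κ, Measure.map_apply hmeas MeasurableSet.univ] using hi
    exact_mod_cast this
  obtain ⟨m, -, hm⟩ := (isCompact_setOfPred_finiteMeasure_le_of_compactSpace unitInterval C)
    |>.ultrafilter_le_nhds (𝒰.map κ) (by
      rw [le_principal_iff]
      exact hκ)
  have hm' : Tendsto κ 𝒰 (𝓝 m) := hm
  -- Mass escaping to infinity collects at t = 0, where the kernel vanishes. Only the part of the
  -- limit with t ≠ 0 is carried back to [0, ∞), and no transform notices the loss.
  set S : Set unitInterval := {t | (t : ℝ) ≠ 0} with hS
  have hSm : MeasurableSet S :=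
    (measurableSet_singleton (0 : ℝ)).compl.preimage measurable_subtype_coe
  let g : unitInterval → ℝ := fun t => (t : ℝ)⁻¹ - 1
  have hg : Measurable g := by
    have : Measurable fun t : unitInterval => (t : ℝ) := measurable_subtype_coe
    exact this.inv.sub_const 1
  refine ⟨((m : Measure unitInterval).restrict S).map g, inferInstance, ?_, fun z hz => ?_⟩
  · rw [Measure.map_apply hg measurableSet_Ici.compl, Measure.restrict_apply
      (hg measurableSet_Ici.compl)]
    have : g ⁻¹' (Set.Ici 0)ᶜ ∩ S = ∅ := by
      ext t
      simp only [Set.mem_inter_iff, Set.mem_preimage, Set.mem_compl_iff, Set.mem_Ici, not_le,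
        Set.mem_empty_iff_false, iff_false, not_and]
      intro h h0
      have : 1 ≤ (t : ℝ)⁻¹ := (one_le_inv₀ (lt_of_le_of_ne t.2.1 (Ne.symm h0))).2 t.2.2
      simp only [g] at h
      linarith
    rw [this, measure_empty]
  · let φ : unitInterval → ℂ := fun t => (t : ℝ) / (1 - (t : ℝ) * (1 + z))
    have hφ : Continuous φ := by
      refine Continuous.div ?_ ?_ (unitInterval_denominator_ne_zero hz)
      · exact Complex.continuous_ofReal.comp continuous_subtype_val
      · exact continuous_const.sub
          ((Complex.continuous_ofReal.comp continuous_subtype_val).mul continuous_const)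
    have h1 := (FiniteMeasure.tendsto_iff_forall_integral_rclike_tendsto ℂ).1 hm'
      (BoundedContinuousFunction.mkOfCompact ⟨φ, hφ⟩)
    simp only [BoundedContinuousFunction.mkOfCompact_apply, ContinuousMap.coe_mk] at h1
    have h2 : ∀ i, ∫ t, φ t ∂(κ i : Measure unitInterval) = stieltjes (μ i) z := fun i => by
      have : (κ i : Measure unitInterval) = (μ i).map invOneAdd := rfl
      rw [this, integral_map hmeas.aemeasurable hφ.aestronglyMeasurable, stieltjes]
      refine integral_congr_ae ?_
      have : ∀ᵐ x ∂(μ i), x ∈ Set.Ici (0 : ℝ) := by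
        rw [ae_iff]; exact hμ i
      filter_upwards [this] with x hx
      simp only [φ, coe_invOneAdd hx]
      have h3 : (1 + (x : ℂ)) ≠ 0 := by
        have : (0 : ℝ) < 1 + x := by have : (0:ℝ) ≤ x := hx; linarith
        exact_mod_cast this.ne'
      have h4 : (x : ℂ) - z ≠ 0 := sub_ne_zero.2 (hz x hx)
      push_cast
      have h5 : (1 : ℂ) - (1 + (x : ℂ))⁻¹ * (1 + z) = (x - z) / (1 + x) := by
        field_simp; ring
      rw [h5]
      field_simp
    have h3 : ∫ t, φ t ∂(m : Measure unitInterval) =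
        stieltjes (((m : Measure unitInterval).restrict S).map g) z := by
      rw [stieltjes, integral_map hg.aemeasurable
        (by fun_prop : Measurable fun x : ℝ => 1 / ((x : ℂ) - z)).aestronglyMeasurable]
      have h4 : ∫ t in S, 1 / (((g t : ℝ) : ℂ) - z) ∂(m : Measure unitInterval) =
          ∫ t in S, φ t ∂(m : Measure unitInterval) := by
        refine setIntegral_congr_fun hSm fun t ht => ?_
        have ht' : ((t : ℝ) : ℂ) ≠ 0 := by exact_mod_cast ht
        have h5 := unitInterval_denominator_ne_zero hz t
        simp only [φ, g]
        push_cast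
        have h6 : (((t : ℝ) : ℂ)⁻¹ - 1 - z) = (1 - (t : ℝ) * (1 + z)) / (t : ℝ) := by
          field_simp; ring
        rw [h6, one_div_div]
      rw [h4, setIntegral_eq_integral_of_forall_compl_eq_zero]
      intro t ht
      have : (t : ℝ) = 0 := by simpa [hS] using ht
      simp [φ, this]
    rw [← h3]
    simpa only [h2] using h1

end SumSeparable
end

/-! ### From Stieltjes transforms on the negative axis to weak convergence -/

noncomputable section

namespace SumSeparable

section WeakConvergence

variable {ι : Type*} {l : Filter ι} {μ : ι → Measure ℝ} {ν : Measure ℝ}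

theorem integrable_comp_invOneAdd (ρ : Measure ℝ) [IsFiniteMeasure ρ] (f : C(unitInterval, ℝ)) :
    Integrable (fun x => f (invOneAdd x)) ρ :=
  Integrable.of_bound (C := ‖f‖)
    (f.continuous.comp continuous_invOneAdd).aestronglyMeasurable
    (ae_of_all _ fun _ => f.norm_coe_le_norm _)

/-- Limits of integrals may be taken under uniform approximation of the integrand. -/
theorem tendsto_integral_comp_of_approx [∀ i, IsFiniteMeasure (μ i)] [IsFiniteMeasure ν]
    (hmass : Tendsto (fun i => (μ i).real Set.univ) l (𝓝 (ν.real Set.univ)))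
    {f : C(unitInterval, ℝ)}
    (hf : ∀ ε > 0, ∃ g : C(unitInterval, ℝ), ‖g - f‖ ≤ ε ∧
      Tendsto (fun i => ∫ x, g (invOneAdd x) ∂(μ i)) l (𝓝 (∫ x, g (invOneAdd x) ∂ν))) :
    Tendsto (fun i => ∫ x, f (invOneAdd x) ∂(μ i)) l (𝓝 (∫ x, f (invOneAdd x) ∂ν)) := by
  have key : ∀ (ρ : Measure ℝ) [IsFiniteMeasure ρ] (g : C(unitInterval, ℝ)),
      |∫ x, g (invOneAdd x) ∂ρ - ∫ x, f (invOneAdd x) ∂ρ| ≤ ‖g - f‖ * ρ.real Set.univ := by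
    intro ρ _ g
    rw [← integral_sub (integrable_comp_invOneAdd ρ g) (integrable_comp_invOneAdd ρ f)]
    exact norm_integral_le_of_norm_le_const (ae_of_all _ fun x => (g - f).norm_coe_le_norm _)
  rw [Metric.tendsto_nhds]
  intro ε hε
  set m := ν.real Set.univ with hm
  have hm0 : 0 ≤ m := measureReal_nonneg
  -- The masses are eventually below m + 1, so this accuracy leaves an error of at most ε / 3 in
  -- each integral.
  obtain ⟨g, hg, hgt⟩ := hf (ε / (3 * (m + 1))) (by positivity)
  filter_upwards [Metric.tendsto_nhds.1 hgt (ε / 3) (by positivity),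
    hmass.eventually (gt_mem_nhds (lt_add_one m))] with i hi hi2
  have h1 := key (μ i) g
  have h2 := key ν g
  rw [Real.dist_eq] at hi ⊢
  have hb : ∀ x : ℝ, 0 ≤ x → x ≤ m + 1 → ‖g - f‖ * x ≤ ε / 3 := fun x hx0 hx => by
    calc ‖g - f‖ * x ≤ ε / (3 * (m + 1)) * (m + 1) := by gcongr
      _ = ε / 3 := by field_simp
  have h3 := hb _ measureReal_nonneg hi2.le
  have h4 := hb m hm0 (by linarith)
  rw [abs_lt] at hi ⊢
  have h5 := abs_le.1 (h1.trans h3)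
  have h6 := abs_le.1 (h2.trans h4)
  constructor <;> linarith [hi.1, hi.2, h5.1, h5.2, h6.1, h6.2]

/-- The continuous function `t ^ k / (1 + t / q)` on the unit interval (for `q = 0`: `t ^ k`). -/
def powDiv (k q : ℕ) : C(unitInterval, ℝ) where
  toFun t := (t : ℝ) ^ k / (1 + (t : ℝ) * (q : ℝ)⁻¹)
  continuous_toFun := by
    refine Continuous.div (by fun_prop) (by fun_prop) fun t => ?_
    have := t.2.1
    positivity

theorem powDiv_apply (k q : ℕ) (t : unitInterval) :
    powDiv k q t = (t : ℝ) ^ k / (1 + (t : ℝ) * (q : ℝ)⁻¹) := rfl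

/-- For q ≠ 0 the identity t^(k+2)/(1+t/q) = q (t^(k+1) - t^(k+1)/(1+t/q)) raises the exponent. The
pure power t^(k+2), coded by q = 0, is then the uniform limit as q → ∞. -/
theorem tendsto_integral_powDiv [∀ i, IsFiniteMeasure (μ i)] [IsFiniteMeasure ν]
    (hmass : Tendsto (fun i => (μ i).real Set.univ) l (𝓝 (ν.real Set.univ)))
    (h1 : ∀ q, Tendsto (fun i => ∫ x, powDiv 1 q (invOneAdd x) ∂(μ i)) l
      (𝓝 (∫ x, powDiv 1 q (invOneAdd x) ∂ν))) (k : ℕ) (q : ℕ) :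
    Tendsto (fun i => ∫ x, powDiv (k + 1) q (invOneAdd x) ∂(μ i)) l
      (𝓝 (∫ x, powDiv (k + 1) q (invOneAdd x) ∂ν)) := by
  induction k generalizing q with
  | zero => exact h1 q
  | succ k ih =>
    have hpos : ∀ q : ℕ, q ≠ 0 → Tendsto (fun i => ∫ x, powDiv (k + 2) q (invOneAdd x) ∂(μ i)) l
        (𝓝 (∫ x, powDiv (k + 2) q (invOneAdd x) ∂ν)) := by
      intro q hq
      have heq : ∀ t : unitInterval,
          powDiv (k + 2) q t = (q : ℝ) * (powDiv (k + 1) 0 t - powDiv (k + 1) q t) := fun t => by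
        have ht := t.2.1
        have hq' : (q : ℝ) ≠ 0 := by exact_mod_cast hq
        simp only [powDiv_apply]
        have : (q : ℝ) + t ≠ 0 := by positivity
        simp only [Nat.cast_zero, inv_zero, mul_zero, add_zero, div_one]
        field_simp
        ring
      have hInt : ∀ (ρ : Measure ℝ) [IsFiniteMeasure ρ],
          ∫ x, powDiv (k + 2) q (invOneAdd x) ∂ρ = (q : ℝ) *
            (∫ x, powDiv (k + 1) 0 (invOneAdd x) ∂ρ - ∫ x, powDiv (k + 1) q (invOneAdd x) ∂ρ) := by
        intro ρ _
        rw [← integral_sub (integrable_comp_invOneAdd ρ _) (integrable_comp_invOneAdd ρ _),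
          ← integral_const_mul]
        exact integral_congr_ae (ae_of_all _ fun x => heq _)
      simp_rw [hInt]
      exact ((ih 0).sub (ih q)).const_mul _
    by_cases hq : q = 0
    · subst hq
      refine tendsto_integral_comp_of_approx hmass fun ε hε => ?_
      obtain ⟨n, hn⟩ := exists_nat_one_div_lt hε
      refine ⟨powDiv (k + 2) (n + 1), ?_, hpos _ (by omega)⟩
      refine (ContinuousMap.norm_le _ hε.le).2 fun t => ?_
      have ht0 := t.2.1
      have ht1 := t.2.2
      simp only [ContinuousMap.sub_apply, powDiv_apply, Nat.cast_zero, inv_zero, mul_zero,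
        add_zero, div_one]
      have hpow : (t : ℝ) ^ (k + 2) ≤ 1 := pow_le_one₀ ht0 ht1
      have hpow0 : 0 ≤ (t : ℝ) ^ (k + 2) := by positivity
      set d : ℝ := (t : ℝ) * ((n + 1 : ℕ) : ℝ)⁻¹ with hd
      have hd0 : 0 ≤ d := by positivity
      have hd1 : d ≤ ε := by
        have : d ≤ 1 * ((n + 1 : ℕ) : ℝ)⁻¹ := by rw [hd]; gcongr
        have h2 : 1 * ((n + 1 : ℕ) : ℝ)⁻¹ = 1 / ((n : ℝ) + 1) := by push_cast; ring
        linarith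
      have h3 : (t : ℝ) ^ (k + 2) / (1 + d) - (t : ℝ) ^ (k + 2) =
          - ((t : ℝ) ^ (k + 2) * (d / (1 + d))) := by field_simp; ring
      rw [h3, norm_neg, Real.norm_of_nonneg (by positivity)]
      calc (t : ℝ) ^ (k + 2) * (d / (1 + d)) ≤ 1 * d := by
            gcongr
            exact div_le_self hd0 (by linarith)
        _ ≤ ε := by linarith
    · exact hpos q hq

/-- Convergence of the integrals of the functions `1 / (x + s)` for suitable `s` accumulating at
`1`, and of the total masses, determines convergence of the measures, transported to `[0, 1]`. -/
theorem tendsto_integral_comp_invOneAdd [∀ i, IsFiniteMeasure (μ i)] [IsFiniteMeasure ν]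
    (hmass : Tendsto (fun i => (μ i).real Set.univ) l (𝓝 (ν.real Set.univ)))
    (h1 : ∀ q, Tendsto (fun i => ∫ x, powDiv 1 q (invOneAdd x) ∂(μ i)) l
      (𝓝 (∫ x, powDiv 1 q (invOneAdd x) ∂ν))) (f : C(unitInterval, ℝ)) :
    Tendsto (fun i => ∫ x, f (invOneAdd x) ∂(μ i)) l (𝓝 (∫ x, f (invOneAdd x) ∂ν)) := by
  have hpow : ∀ k : ℕ, Tendsto (fun i => ∫ x, (invOneAdd x : ℝ) ^ k ∂(μ i)) l
      (𝓝 (∫ x, (invOneAdd x : ℝ) ^ k ∂ν)) := by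
    intro k
    cases k with
    | zero => simpa using hmass
    | succ k =>
      have := tendsto_integral_powDiv hmass h1 k 0
      simpa [powDiv_apply] using this
  refine tendsto_integral_comp_of_approx hmass fun ε hε => ?_
  -- Weierstrass approximation reduces to monomials in t.
  obtain ⟨P, hP⟩ := exists_polynomial_near_continuousMap 0 1 f ε hε
  refine ⟨P.toContinuousMapOn _, hP.le, ?_⟩
  have hInt : ∀ (ρ : Measure ℝ) [IsFiniteMeasure ρ],
      ∫ x, (P.toContinuousMapOn (Set.Icc (0:ℝ) 1)) (invOneAdd x) ∂ρ =
        ∑ k ∈ Finset.range (P.natDegree + 1), P.coeff k * ∫ x, (invOneAdd x : ℝ) ^ k ∂ρ := by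
    intro ρ _
    simp only [Polynomial.toContinuousMapOn_apply, Polynomial.toContinuousMap_apply,
      Polynomial.eval_eq_sum_range]
    rw [integral_finsetSum]
    · simp_rw [integral_const_mul]
    · intro k _
      refine Integrable.const_mul ?_ _
      have := integrable_comp_invOneAdd ρ (powDiv k 0)
      simpa [powDiv_apply] using this
  have hgoal := tendsto_finsetSum (Finset.range (P.natDegree + 1))
    fun k _ => (hpow k).const_mul (P.coeff k)
  have e1 := hInt ν
  have e2 := fun i => hInt (μ i)
  rw [e1]
  simp_rw [e2]
  exact hgoal

/-- Cut-off of a function on `[0, ∞)`, transported to `[0, 1]`. -/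
theorem exists_cutoff (f : BoundedContinuousFunction ℝ ℝ) (k : ℕ) :
    ∃ g : C(unitInterval, ℝ), ∀ x : ℝ, 0 ≤ x →
      g (invOneAdd x) = f x * min 1 (k * (invOneAdd x : ℝ)) := by
  refine ⟨⟨fun t => f ((t : ℝ)⁻¹ - 1) * min 1 (k * (t : ℝ)), ?_⟩, fun x hx => ?_⟩
  · rw [continuous_iff_continuousAt]
    intro t
    -- As t → 0 the factor f(1/t - 1) need not converge, but it is bounded and the factor k t tends
    -- to zero.
    by_cases ht : (t : ℝ) = 0
    · have h0 : f ((t : ℝ)⁻¹ - 1) * min 1 (k * (t : ℝ)) = 0 := by rw [ht]; simp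
      rw [ContinuousAt, h0]
      refine squeeze_zero_norm (a := fun s : unitInterval => ‖f‖ * (k * (s : ℝ))) (fun s => ?_) ?_
      · rw [norm_mul]
        have hs := s.2.1
        gcongr
        · exact f.norm_coe_le_norm _
        · rw [Real.norm_of_nonneg (by positivity)]
          exact min_le_right _ _
      · have : Continuous fun s : unitInterval => ‖f‖ * (k * (s : ℝ)) := by fun_prop
        have h2 := this.tendsto t
        rwa [ht, mul_zero, mul_zero] at h2
    · refine ContinuousAt.mul ?_ (by fun_prop)
      refine f.continuous.continuousAt.comp ?_
      exact (continuous_subtype_val.continuousAt.inv₀ ht).sub continuousAt_const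
  · simp only [ContinuousMap.coe_mk]
    rw [coe_invOneAdd hx, inv_inv]
    simp

/-- Weak convergence of measures on `[0, ∞)` from convergence of their Stieltjes transforms at
suitable negative points and of their masses. -/
theorem tendsto_integral_of_tendsto_stieltjes [∀ i, IsFiniteMeasure (μ i)] [IsFiniteMeasure ν]
    (hμ : ∀ i, μ i (Set.Ici 0)ᶜ = 0) (hν : ν (Set.Ici 0)ᶜ = 0)
    (hmass : Tendsto (fun i => (μ i).real Set.univ) l (𝓝 (ν.real Set.univ)))
    (h1 : ∀ q : ℕ, Tendsto (fun i => stieltjes (μ i) (-(1 + (q : ℝ)⁻¹ : ℝ))) l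
      (𝓝 (stieltjes ν (-(1 + (q : ℝ)⁻¹ : ℝ))))) (f : BoundedContinuousFunction ℝ ℝ) :
    Tendsto (fun i => ∫ x, f x ∂(μ i)) l (𝓝 (∫ x, f x ∂ν)) := by
  have hae : ∀ {ρ : Measure ℝ}, ρ (Set.Ici 0)ᶜ = 0 → ∀ᵐ x ∂ρ, 0 ≤ x := fun h => by
    rw [ae_iff]
    exact h
  have hst : ∀ (ρ : Measure ℝ) [IsFiniteMeasure ρ], ρ (Set.Ici 0)ᶜ = 0 → ∀ q : ℕ,
      (stieltjes ρ (-(1 + (q : ℝ)⁻¹ : ℝ))).re = ∫ x, powDiv 1 q (invOneAdd x) ∂ρ := by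
    intro ρ _ hρ q
    have e : stieltjes ρ (-(1 + (q : ℝ)⁻¹ : ℝ)) =
        ∫ x, ((powDiv 1 q (invOneAdd x) : ℝ) : ℂ) ∂ρ := by
      refine integral_congr_ae ?_
      filter_upwards [hae hρ] with x hx
      have hx1 : (1 + x) ≠ 0 := by positivity
      have hx2 : x + (1 + (q : ℝ)⁻¹) ≠ 0 := by positivity
      have : powDiv 1 q (invOneAdd x) = 1 / (x + (1 + (q : ℝ)⁻¹)) := by
        rw [powDiv_apply, coe_invOneAdd hx, pow_one]
        have h3 : 1 + (1 + x)⁻¹ * (q : ℝ)⁻¹ = (x + (1 + (q : ℝ)⁻¹)) * (1 + x)⁻¹ := by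
          rw [← sub_eq_zero]
          have : (1 + x) * (1 + x)⁻¹ = 1 := mul_inv_cancel₀ hx1
          linear_combination - this
        rw [h3]
        field_simp
      rw [this]
      push_cast
      ring
    rw [e, integral_complex_ofReal, Complex.ofReal_re]
  have hconv : ∀ g : C(unitInterval, ℝ),
      Tendsto (fun i => ∫ x, g (invOneAdd x) ∂(μ i)) l (𝓝 (∫ x, g (invOneAdd x) ∂ν)) := by
    refine tendsto_integral_comp_invOneAdd hmass fun q => ?_
    have := (Complex.continuous_re.tendsto _).comp (h1 q)
    rw [hst ν hν q] at this
    refine this.congr fun i => ?_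
    exact hst (μ i) (hμ i) q
  choose g hg using fun k => exists_cutoff f k
  -- Tightness: the complementary cut-off χ is itself continuous on [0, 1], so its integrals against
  -- μ_i converge to the one against ν, which is small for large k.
  obtain ⟨χ, hχ⟩ : ∃ χ : ℕ → C(unitInterval, ℝ), ∀ k t, χ k t = 1 - min 1 (k * (t : ℝ)) :=
    ⟨fun k => ⟨fun t => 1 - min 1 (k * (t : ℝ)), by fun_prop⟩, fun k t => rfl⟩
  have herr : ∀ (ρ : Measure ℝ) [IsFiniteMeasure ρ], ρ (Set.Ici 0)ᶜ = 0 → ∀ k : ℕ,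
      |∫ x, f x ∂ρ - ∫ x, g k (invOneAdd x) ∂ρ| ≤ ‖f‖ * ∫ x, χ k (invOneAdd x) ∂ρ := by
    intro ρ _ hρ k
    have hf : Integrable f ρ := f.integrable ρ
    rw [← integral_sub hf (integrable_comp_invOneAdd ρ _), ← integral_const_mul]
    rw [← Real.norm_eq_abs]
    refine norm_integral_le_of_norm_le ((integrable_comp_invOneAdd ρ _).const_mul _) ?_
    filter_upwards [hae hρ] with x hx
    rw [hg k x hx, hχ]
    have h4 : f x - f x * min 1 (k * (invOneAdd x : ℝ)) =
        f x * (1 - min 1 (k * (invOneAdd x : ℝ))) := by ring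
    rw [h4, norm_mul, Real.norm_of_nonneg (sub_nonneg.2 (min_le_left _ _))]
    gcongr
    · exact sub_nonneg.2 (min_le_left _ _)
    · exact f.norm_coe_le_norm x
  have hχ0 : Tendsto (fun k => ∫ x, χ k (invOneAdd x) ∂ν) atTop (𝓝 0) := by
    have e : (0 : ℝ) = ∫ _ : ℝ, (0 : ℝ) ∂ν := by simp
    rw [e]
    refine tendsto_integral_of_dominated_convergence (fun _ => 1)
      (fun k => (integrable_comp_invOneAdd ν _).aestronglyMeasurable) (integrable_const _)
      (fun k => ae_of_all _ fun x => ?_) (ae_of_all _ fun x => ?_)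
    · rw [hχ, Real.norm_of_nonneg (sub_nonneg.2 (min_le_left _ _))]
      have : 0 ≤ min 1 ((k : ℝ) * (invOneAdd x : ℝ)) :=
        le_min zero_le_one (mul_nonneg k.cast_nonneg (invOneAdd_pos x).le)
      linarith
    · have ht := invOneAdd_pos x
      obtain ⟨N, hN⟩ := exists_nat_gt ((invOneAdd x : ℝ)⁻¹)
      refine tendsto_const_nhds.congr' ?_
      filter_upwards [eventually_ge_atTop N] with k hk
      rw [hχ, min_eq_left, sub_self]
      have : (invOneAdd x : ℝ)⁻¹ ≤ k := hN.le.trans (by exact_mod_cast hk)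
      exact (inv_le_iff_one_le_mul₀ ht).1 this
  rw [Metric.tendsto_nhds]
  intro ε hε
  have hlim : Tendsto (fun k => ‖f‖ * ∫ x, χ k (invOneAdd x) ∂ν) atTop (𝓝 0) := by
    simpa using hχ0.const_mul ‖f‖
  obtain ⟨k, hk⟩ := (hlim.eventually (gt_mem_nhds (by positivity : (0:ℝ) < ε / 4))).exists
  have h5 := (hconv (χ k)).const_mul ‖f‖
  filter_upwards [h5.eventually (gt_mem_nhds hk),
    Metric.tendsto_nhds.1 (hconv (g k)) (ε / 4) (by positivity)] with i h6 h7
  have h8 := abs_le.1 ((herr (μ i) (hμ i) k).trans h6.le)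
  have h9 := abs_le.1 ((herr ν hν k).trans hk.le)
  rw [Real.dist_eq, abs_lt] at h7 ⊢
  constructor <;> linarith [h7.1, h7.2, h8.1, h8.2, h9.1, h9.2]

end WeakConvergence

end SumSeparable
end

/-! ### Uniqueness of the solution of the system -/

noncomputable section

namespace SumSeparable

section Uniqueness

variable {K : ℕ}

/-- The vector function `q` behaves like `i k / y` as `y → ∞`, with a positive vector `k`. -/
def AsympPos (q : ℝ → Fin K → ℂ) : Prop :=
  ∃ k : Fin K → ℝ, (∀ r, 0 < k r) ∧
    ∀ r, Tendsto (fun y : ℝ => (y : ℂ) * q y r) atTop (𝓝 (Complex.I * k r))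

theorem AsympPos.const_mul {q : ℝ → Fin K → ℂ} (hq : AsympPos q) {c : ℝ} (hc : 0 < c) :
    AsympPos fun y r => (c : ℂ) * q y r := by
  obtain ⟨k, hk, h⟩ := hq
  refine ⟨fun r => c * k r, fun r => mul_pos hc (hk r), fun r => ?_⟩
  have h1 := (h r).const_mul (c : ℂ)
  have e : (c : ℂ) * (Complex.I * k r) = Complex.I * ((c * k r : ℝ) : ℂ) := by push_cast; ring
  rw [e] at h1
  exact h1.congr fun y => by ring

theorem AsympPos.tendsto_zero {q : ℝ → Fin K → ℂ} (hq : AsympPos q) (r : Fin K) :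
    Tendsto (fun y => q y r) atTop (𝓝 0) := by
  obtain ⟨k, -, h⟩ := hq
  have h1 : Tendsto (fun y : ℝ => ((y⁻¹ : ℝ) : ℂ)) atTop (𝓝 0) := by
    have := (Complex.continuous_ofReal.tendsto 0).comp tendsto_inv_atTop_zero
    simpa [Function.comp_def] using this
  have h2 := h1.mul (h r)
  rw [zero_mul] at h2
  refine h2.congr' ?_
  filter_upwards [eventually_gt_atTop 0] with y hy
  have : (y : ℂ) ≠ 0 := by exact_mod_cast hy.ne'
  push_cast
  field_simp

/-- Lower bounds for the denominators, uniform over the nonnegative orthant. -/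
theorem AsympPos.le_norm {q : ℝ → Fin K → ℂ} (hq : AsympPos q) :
    ∃ k : Fin K → ℝ, (∀ r, 0 < k r) ∧ ∀ᶠ y : ℝ in atTop, 0 < y ∧ ∀ x : Fin K → ℝ,
      (∀ r, 0 ≤ x r) → 1 / 2 ≤ ‖1 + ∑ s, (x s : ℂ) * q y s‖ ∧
        ∀ s, k s * x s ≤ y * ‖1 + ∑ s, (x s : ℂ) * q y s‖ := by
  obtain ⟨k, hk, h⟩ := hq
  refine ⟨fun r => k r / 2, fun r => half_pos (hk r), ?_⟩
  have h1 : ∀ r, ∀ᶠ y : ℝ in atTop, |y * (q y r).re| < k r / 2 ∧ k r / 2 < y * (q y r).im := by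
    intro r
    have hre := (Complex.continuous_re.tendsto _).comp (h r)
    have him := (Complex.continuous_im.tendsto _).comp (h r)
    simp only [Complex.mul_re, Complex.I_re, Complex.ofReal_re, zero_mul, Complex.I_im,
      Complex.ofReal_im, mul_zero, sub_self, Complex.mul_im, one_mul, zero_add,
      Function.comp_def, sub_zero, add_zero] at hre him
    have hre' := hre.abs
    rw [abs_zero] at hre'
    exact (hre'.eventually (gt_mem_nhds (half_pos (hk r)))).and
      (him.eventually (lt_mem_nhds (half_lt_self (hk r))))
  filter_upwards [eventually_gt_atTop 0, eventually_all.2 h1] with y hy h2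
  refine ⟨hy, fun x hx => ?_⟩
  set D : ℂ := 1 + ∑ s, (x s : ℂ) * q y s with hD
  have hDre : D.re = 1 + ∑ s, x s * (q y s).re := by
    simp [hD]
  have hDim : D.im = ∑ s, x s * (q y s).im := by
    simp [hD]
  have him : ∀ s, 0 < (q y s).im := fun s => by
    have := (half_pos (hk s)).trans (h2 s).2
    exact pos_of_mul_pos_right this hy.le
  have hre : ∀ s, |(q y s).re| ≤ (q y s).im := fun s => by
    have := (h2 s).1.trans (h2 s).2
    rw [abs_mul, abs_of_pos hy] at this
    exact (lt_of_mul_lt_mul_left this hy.le).le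
  have hsum : |∑ s, x s * (q y s).re| ≤ D.im := by
    rw [hDim]
    refine (Finset.abs_sum_le_sum_abs _ _).trans (Finset.sum_le_sum fun s _ => ?_)
    rw [abs_mul, abs_of_nonneg (hx s)]
    exact mul_le_mul_of_nonneg_left (hre s) (hx s)
  have hDim' : D.im ≤ ‖D‖ := Complex.im_le_norm D
  constructor
  -- Re D ≥ 1 - Im D, hence 1 ≤ Re D + Im D ≤ 2 ‖D‖.
  · have h3 : D.re ≤ ‖D‖ := Complex.re_le_norm D
    have := (abs_le.1 hsum).1
    linarith
  · intro s
    have h4 : x s * (q y s).im ≤ D.im := by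
      rw [hDim]
      exact Finset.single_le_sum (f := fun s => x s * (q y s).im)
        (fun i _ => mul_nonneg (hx i) (him i).le) (Finset.mem_univ s)
    calc k s / 2 * x s ≤ (y * (q y s).im) * x s := mul_le_mul_of_nonneg_right (h2 s).2.le (hx s)
      _ = y * (x s * (q y s).im) := by ring
      _ ≤ y * ‖D‖ := by gcongr; exact h4.trans hDim'

theorem AsympPos.tendsto_sum {q : ℝ → Fin K → ℂ} (hq : AsympPos q) (x : Fin K → ℝ) :
    Tendsto (fun y => 1 + ∑ s, (x s : ℂ) * q y s) atTop (𝓝 1) := by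
  have := (tendsto_finsetSum Finset.univ fun s _ => (hq.tendsto_zero s).const_mul (x s : ℂ))
  simpa using this.const_add 1

variable {H G : Measure (Fin K → ℝ)}

theorem measurable_opO_integrand (z : ℂ) (q : Fin K → ℂ) (r : Fin K) :
    Measurable fun x : Fin K → ℝ => (x r : ℂ) / (-z * (1 + ∑ s, (x s : ℂ) * q s)) := by
  fun_prop

/-- The denominators 1 + λᵀq tend to 1 and have modulus at least 1/2, so the first moment alone
dominates the integrand, and -1/(iy) = i/y provides the factor i. -/
theorem AsympPos.tendsto_opO (hH : ∀ᵐ x ∂H, ∀ r, 0 ≤ x r) {r : Fin K}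
    (hInt : Integrable (fun x => x r) H) {q : ℝ → Fin K → ℂ} (hq : AsympPos q) :
    Tendsto (fun y : ℝ => (y : ℂ) * opO (Complex.I * y) (q y) H r) atTop
      (𝓝 (Complex.I * ((∫ x, x r ∂H : ℝ) : ℂ))) := by
  obtain ⟨k, hk, hlow⟩ := hq.le_norm
  have e : Complex.I * ((∫ x, x r ∂H : ℝ) : ℂ) = ∫ x, Complex.I * (x r : ℂ) ∂H := by
    rw [integral_const_mul, integral_complex_ofReal]
  rw [e]
  have e2 : ∀ y : ℝ, (y : ℂ) * opO (Complex.I * y) (q y) H r = ∫ x : Fin K → ℝ,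
      (y : ℂ) * ((x r : ℂ) / (-(Complex.I * y) * (1 + ∑ s, (x s : ℂ) * q y s))) ∂H := fun y => by
    rw [opO, integral_const_mul]
  simp_rw [e2]
  refine tendsto_integral_filter_of_dominated_convergence (fun x => 2 * x r) ?_ ?_
    (hInt.const_mul 2) ?_
  · exact Eventually.of_forall fun y =>
      ((measurable_opO_integrand _ _ r).const_mul _).aestronglyMeasurable
  · filter_upwards [hlow] with y hy
    filter_upwards [hH] with x hx
    have h1 := (hy.2 x hx).1
    have hD : 0 < ‖1 + ∑ s, (x s : ℂ) * q y s‖ := by linarith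
    have hy0 := hy.1
    rw [norm_mul, norm_div, norm_mul, norm_neg, norm_mul, Complex.norm_I, one_mul,
      Complex.norm_real, Complex.norm_real, Real.norm_of_nonneg hy0.le,
      Real.norm_of_nonneg (hx r)]
    have : y * (x r / (y * ‖1 + ∑ s, (x s : ℂ) * q y s‖)) =
        x r / ‖1 + ∑ s, (x s : ℂ) * q y s‖ := by field_simp
    rw [this, div_le_iff₀ hD]
    nlinarith [hx r]
  · refine ae_of_all _ fun x => ?_
    have h1 := (hq.tendsto_sum x).inv₀ one_ne_zero
    have h2 := h1.const_mul (Complex.I * (x r : ℂ))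
    rw [inv_one, mul_one] at h2
    refine h2.congr' ?_
    filter_upwards [eventually_gt_atTop 0] with y hy
    have : (y : ℂ) ≠ 0 := by exact_mod_cast hy.ne'
    rw [div_eq_mul_inv, mul_inv, neg_mul_eq_neg_mul, mul_inv, inv_neg, Complex.inv_I, neg_neg]
    field_simp

/-- Keeps the inner argument O(iy, c h, G) in the same class, so that the estimates apply a second
time to the outer integral. -/
theorem AsympPos.opO (hH : ∀ᵐ x ∂H, ∀ r, 0 ≤ x r) (hInt : ∀ r, Integrable (fun x => x r) H)
    (hpos : ∀ r, 0 < ∫ x, x r ∂H) {q : ℝ → Fin K → ℂ} (hq : AsympPos q) :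
    AsympPos fun y => opO (Complex.I * y) (q y) H :=
  ⟨fun r => ∫ x, x r ∂H, hpos, fun r => hq.tendsto_opO hH (hInt r)⟩

theorem AsympPos.integrable_opO (hH : ∀ᵐ x ∂H, ∀ r, 0 ≤ x r) {r : Fin K}
    (hInt : Integrable (fun x => x r) H) {q : ℝ → Fin K → ℂ} (hq : AsympPos q) :
    ∀ᶠ y : ℝ in atTop, Integrable (fun x : Fin K → ℝ =>
      (x r : ℂ) / (-(Complex.I * y) * (1 + ∑ s, (x s : ℂ) * q y s))) H := by
  obtain ⟨k, hk, hlow⟩ := hq.le_norm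
  filter_upwards [hlow] with y hy
  refine Integrable.mono' (hInt.const_mul (2 / y))
    (measurable_opO_integrand _ _ r).aestronglyMeasurable ?_
  filter_upwards [hH] with x hx
  have h1 := (hy.2 x hx).1
  have hD : 0 < ‖1 + ∑ s, (x s : ℂ) * q y s‖ := by linarith
  have hy0 := hy.1
  rw [norm_div, norm_mul, norm_neg, norm_mul, Complex.norm_I, one_mul, Complex.norm_real,
    Complex.norm_real, Real.norm_of_nonneg hy0.le, Real.norm_of_nonneg (hx r),
    div_le_iff₀ (by positivity)]
  have : 2 / y * x r * (y * ‖1 + ∑ s, (x s : ℂ) * q y s‖) =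
      x r * (2 * ‖1 + ∑ s, (x s : ℂ) * q y s‖) := by field_simp
  rw [this]
  nlinarith [hx r]

/-- The Lipschitz kernel of `O(iy, ·, H)`. -/
def lipKernel (q q' : ℝ → Fin K → ℂ) (r s : Fin K) (y : ℝ) (x : Fin K → ℝ) : ℝ :=
  x r * x s / (y * ‖1 + ∑ t, (x t : ℂ) * q y t‖ * ‖1 + ∑ t, (x t : ℂ) * q' y t‖)

theorem measurable_lipKernel (q q' : ℝ → Fin K → ℂ) (r s : Fin K) (y : ℝ) :
    Measurable (lipKernel q q' r s y) := by
  unfold lipKernel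
  fun_prop

/-- The second bound gives pointwise decay but involves a product of two coordinates. The first
absorbs x_s into the denominator and dominates with a first moment only. Together they allow
dominated convergence to zero. -/
theorem lipKernel_bound {q q' : ℝ → Fin K → ℂ} (hq : AsympPos q) (hq' : AsympPos q')
    (r s : Fin K) : ∃ C : ℝ, ∀ᶠ y : ℝ in atTop, ∀ x : Fin K → ℝ, (∀ t, 0 ≤ x t) →
      ‖lipKernel q q' r s y x‖ ≤ C * x r ∧ ‖lipKernel q q' r s y x‖ ≤ 4 * (x r * x s) / y := by
  obtain ⟨k, hk, hlow⟩ := hq.le_norm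
  obtain ⟨k', hk', hlow'⟩ := hq'.le_norm
  refine ⟨2 / k' s, ?_⟩
  filter_upwards [hlow, hlow'] with y hy hy' x hx
  have h1 := (hy.2 x hx).1
  have h1' := (hy'.2 x hx).1
  have h2 := (hy'.2 x hx).2 s
  have hy0 := hy.1
  have hxr := hx r
  have hxs := hx s
  have hks := hk' s
  rw [lipKernel]
  set D := ‖1 + ∑ t, (x t : ℂ) * q y t‖
  set D' := ‖1 + ∑ t, (x t : ℂ) * q' y t‖
  have hD : 0 < D := by linarith
  have hD' : 0 < D' := by linarith
  rw [Real.norm_of_nonneg (by positivity)]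
  constructor
  · rw [div_le_iff₀ (by positivity)]
    calc x r * x s = x r * (k' s * x s) / k' s := by field_simp
      _ ≤ x r * (y * D') / k' s := by gcongr
      _ ≤ x r * (y * D') / k' s * (2 * D) :=
        le_mul_of_one_le_right (by positivity) (by linarith)
      _ = _ := by field_simp
  · rw [div_le_div_iff₀ (by positivity) hy0]
    have h4 : 1 ≤ 4 * (D * D') := by nlinarith
    calc x r * x s * y ≤ x r * x s * y * (4 * (D * D')) :=
        le_mul_of_one_le_right (by positivity) h4
      _ = _ := by ring

/-- `O(iy, ·, H)` is Lipschitz along asymptotically positive arguments, with a constant that tends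
to zero. -/
theorem AsympPos.opO_contracts (hH : ∀ᵐ x ∂H, ∀ r, 0 ≤ x r)
    (hInt : ∀ r, Integrable (fun x => x r) H) {q q' : ℝ → Fin K → ℂ}
    (hq : AsympPos q) (hq' : AsympPos q') :
    ∃ ε : ℝ → ℝ, Tendsto ε atTop (𝓝 0) ∧ ∀ᶠ y : ℝ in atTop,
      ∑ r, ‖SumSeparable.opO (Complex.I * y) (q y) H r -
        SumSeparable.opO (Complex.I * y) (q' y) H r‖ ≤ ε y * ∑ s, ‖q y s - q' y s‖ := by
  have hker : ∀ r s, Tendsto (fun y => ∫ x, lipKernel q q' r s y x ∂H) atTop (𝓝 0) := by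
    intro r s
    obtain ⟨C, hC⟩ := lipKernel_bound hq hq' r s
    have e : (0 : ℝ) = ∫ _ : Fin K → ℝ, (0 : ℝ) ∂H := by simp
    rw [e]
    refine tendsto_integral_filter_of_dominated_convergence (fun x => C * x r) ?_ ?_
      ((hInt r).const_mul C) ?_
    · exact Eventually.of_forall fun y => (measurable_lipKernel q q' r s y).aestronglyMeasurable
    · filter_upwards [hC] with y hy
      filter_upwards [hH] with x hx using (hy x hx).1
    · filter_upwards [hH] with x hx
      refine squeeze_zero_norm' (a := fun y => 4 * (x r * x s) / y) ?_
        (tendsto_const_nhds.div_atTop tendsto_id)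
      filter_upwards [hC] with y hy using (hy x hx).2
  refine ⟨fun y => ∑ r, ∑ s, ∫ x, lipKernel q q' r s y x ∂H, ?_, ?_⟩
  · have := tendsto_finsetSum Finset.univ fun r _ =>
      tendsto_finsetSum Finset.univ fun s _ => hker r s
    simpa using this
  have hCall : ∀ r s, ∀ᶠ y : ℝ in atTop, Integrable (lipKernel q q' r s y) H := by
    intro r s
    obtain ⟨C, hC⟩ := lipKernel_bound hq hq' r s
    filter_upwards [hC] with y hy
    refine Integrable.mono' ((hInt r).const_mul C)
      (measurable_lipKernel q q' r s y).aestronglyMeasurable ?_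
    filter_upwards [hH] with x hx using (hy x hx).1
  obtain ⟨k, hk, hlow⟩ := hq.le_norm
  obtain ⟨k', hk', hlow'⟩ := hq'.le_norm
  filter_upwards [hlow, hlow', eventually_all.2 fun r => hq.integrable_opO hH (hInt r),
    eventually_all.2 fun r => hq'.integrable_opO hH (hInt r),
    eventually_all.2 fun r => eventually_all.2 fun s => hCall r s] with y hy hy' hi hi' hik
  have hy0 := hy.1
  have hker0 : ∀ r s, 0 ≤ ∫ x, lipKernel q q' r s y x ∂H := fun r s => by
    refine integral_nonneg_of_ae ?_
    filter_upwards [hH] with x hx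
    have := hx r
    have := hx s
    simp only [lipKernel, Pi.zero_apply]
    positivity
  rw [Finset.sum_mul]
  refine Finset.sum_le_sum fun r _ => ?_
  rw [SumSeparable.opO, SumSeparable.opO, ← integral_sub (hi r) (hi' r)]
  have h1 : ‖∫ x : Fin K → ℝ, ((x r : ℂ) / (-(Complex.I * y) * (1 + ∑ s, (x s : ℂ) * q y s)) -
      (x r : ℂ) / (-(Complex.I * y) * (1 + ∑ s, (x s : ℂ) * q' y s))) ∂H‖ ≤
      ∫ x, ∑ s, lipKernel q q' r s y x * ‖q y s - q' y s‖ ∂H := by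
    refine norm_integral_le_of_norm_le
      (integrable_finsetSum _ fun s _ => (hik r s).mul_const _) ?_
    filter_upwards [hH] with x hx
    have hD := (hy.2 x hx).1
    have hD' := (hy'.2 x hx).1
    have hD0 : 1 + ∑ s, (x s : ℂ) * q y s ≠ 0 := by
      intro h; rw [h, norm_zero] at hD; linarith
    have hD0' : 1 + ∑ s, (x s : ℂ) * q' y s ≠ 0 := by
      intro h; rw [h, norm_zero] at hD'; linarith
    have hyc : (y : ℂ) ≠ 0 := by exact_mod_cast hy0.ne'
    have hz : -(Complex.I * y) ≠ 0 := by simp [hyc]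
    have e : (x r : ℂ) / (-(Complex.I * y) * (1 + ∑ s, (x s : ℂ) * q y s)) -
        (x r : ℂ) / (-(Complex.I * y) * (1 + ∑ s, (x s : ℂ) * q' y s)) =
        (x r : ℂ) * (∑ s, (x s : ℂ) * (q' y s - q y s)) / (-(Complex.I * y) *
          (1 + ∑ s, (x s : ℂ) * q y s) * (1 + ∑ s, (x s : ℂ) * q' y s)) := by
      rw [div_sub_div _ _ (mul_ne_zero hz hD0) (mul_ne_zero hz hD0')]
      simp_rw [mul_sub, Finset.sum_sub_distrib]
      rw [div_eq_div_iff (by positivity) (by positivity)]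
      ring
    rw [e, norm_div, norm_mul, norm_mul, norm_mul, norm_neg, norm_mul, Complex.norm_I, one_mul,
      Complex.norm_real, Complex.norm_real, Real.norm_of_nonneg hy0.le, Real.norm_of_nonneg (hx r)]
    have hn : ‖∑ s, (x s : ℂ) * (q' y s - q y s)‖ ≤ ∑ s, x s * ‖q y s - q' y s‖ := by
      refine (norm_sum_le _ _).trans (Finset.sum_le_sum fun s _ => ?_)
      rw [norm_mul, Complex.norm_real, Real.norm_of_nonneg (hx s), norm_sub_rev]
    have hxr := hx r
    calc _ ≤ x r * (∑ s, x s * ‖q y s - q' y s‖) / (y * ‖1 + ∑ s, (x s : ℂ) * q y s‖ *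
          ‖1 + ∑ s, (x s : ℂ) * q' y s‖) := by gcongr
      _ = _ := by
        rw [Finset.mul_sum, Finset.sum_div]
        refine Finset.sum_congr rfl fun s _ => ?_
        rw [lipKernel]
        ring
  refine h1.trans ?_
  rw [integral_finsetSum _ fun s _ => (hik r s).mul_const _]
  simp_rw [integral_mul_const]
  rw [Finset.sum_mul]
  refine Finset.sum_le_sum fun s _ => ?_
  exact mul_le_mul_of_nonneg_left
    (Finset.single_le_sum (f := fun s => ‖q y s - q' y s‖) (fun i _ => norm_nonneg _)
      (Finset.mem_univ s)) (hker0 r s)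

/-- Two asymptotically positive solutions of the system agree far up the imaginary axis. -/
theorem eventually_eq_of_solves {c : ℝ}
    (hc : 0 < c) (hH : ∀ᵐ x ∂H, ∀ r, 0 ≤ x r) (hG : ∀ᵐ x ∂G, ∀ r, 0 ≤ x r)
    (hHint : ∀ r, Integrable (fun x => x r) H) (hGint : ∀ r, Integrable (fun x => x r) G)
    (hGpos : ∀ r, 0 < ∫ x, x r ∂G) {q q' : ℝ → Fin K → ℂ}
    (hq : AsympPos q) (hq' : AsympPos q')
    (hs : ∀ y : ℝ, 0 < y → ∀ r, q y r =
      opO (Complex.I * y) (opO (Complex.I * y) (fun t => (c : ℂ) * q y t) G) H r)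
    (hs' : ∀ y : ℝ, 0 < y → ∀ r, q' y r =
      opO (Complex.I * y) (opO (Complex.I * y) (fun t => (c : ℂ) * q' y t) G) H r) :
    ∀ᶠ y in atTop, q y = q' y := by
  obtain ⟨ε, hε, h1⟩ := (hq.const_mul hc).opO_contracts hG hGint (hq'.const_mul hc)
  obtain ⟨ε', hε', h2⟩ := ((hq.const_mul hc).opO hG hGint hGpos).opO_contracts hH hHint
    ((hq'.const_mul hc).opO hG hGint hGpos)
  -- Composing the inner and the outer map multiplies the Lipschitz constants. Once the product is
  -- below 1, a distance S with S ≤ (product) · S must vanish.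
  have h3 : Tendsto (fun y => |ε' y| * (|ε y| * c)) atTop (𝓝 0) := by
    have := hε'.abs.mul (hε.abs.mul_const c)
    simpa using this
  filter_upwards [h1, h2, h3.eventually (gt_mem_nhds zero_lt_one), eventually_gt_atTop 0]
    with y h1 h2 h3 hy
  have e : ∑ s, ‖(c : ℂ) * q y s - (c : ℂ) * q' y s‖ = c * ∑ s, ‖q y s - q' y s‖ := by
    rw [Finset.mul_sum]
    refine Finset.sum_congr rfl fun s _ => ?_
    rw [← mul_sub, norm_mul, Complex.norm_real, Real.norm_of_nonneg hc.le]
  rw [e] at h1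
  set S := ∑ s, ‖q y s - q' y s‖ with hS
  have hS0 : 0 ≤ S := Finset.sum_nonneg fun _ _ => norm_nonneg _
  have e2 : ∑ r, ‖opO (Complex.I * y) (opO (Complex.I * y) (fun t => (c : ℂ) * q y t) G) H r -
      opO (Complex.I * y) (opO (Complex.I * y) (fun t => (c : ℂ) * q' y t) G) H r‖ = S := by
    rw [hS]
    exact Finset.sum_congr rfl fun s _ => by rw [← hs y hy s, ← hs' y hy s]
  rw [e2] at h2
  have h4 : S ≤ |ε' y| * (|ε y| * c) * S := by
    have h5 : ε y * (c * S) ≤ |ε y| * (c * S) :=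
      mul_le_mul_of_nonneg_right (le_abs_self _) (by positivity)
    calc S ≤ _ := h2
      _ ≤ |ε' y| * (|ε y| * (c * S)) := by
        refine mul_le_mul (le_abs_self _) (h1.trans h5) (Finset.sum_nonneg fun _ _ => norm_nonneg _)
          (abs_nonneg _)
      _ = _ := by ring
  have hS1 : S = 0 := by nlinarith
  rw [hS, Finset.sum_eq_zero_iff_of_nonneg fun _ _ => norm_nonneg _] at hS1
  funext r
  exact sub_eq_zero.1 (norm_eq_zero.1 (hS1 r (Finset.mem_univ r)))

/-- The constants k_r are the total masses of the representing measures. They are positive because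
Im h_r > 0 at the point i excludes the zero measure. -/
theorem asympPos_of_solves {c : ℝ} {g : ℂ → Fin K → ℂ}
    (hg : ∀ r, IsStieltjesOf Set.univ fun z => g z r) (hsg : SolvesSystem c H G g) :
    AsympPos fun y : ℝ => g (Complex.I * y) := by
  choose μ hfin _ hμ using hg
  beta_reduce at hμ
  refine ⟨fun r => (μ r).real Set.univ, fun r => ?_, fun r => ?_⟩
  · have := hfin r
    refine (measureReal_nonneg).lt_of_ne' fun h0 => ?_
    have hz : μ r = 0 := by
      rw [measureReal_eq_zero_iff] at h0
      exact Measure.measure_univ_eq_zero.1 h0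
    have h1 := (hsg Complex.I (by simp) r).1
    rw [hμ r Complex.I (by simp), hz] at h1
    simp [stieltjes] at h1
  · have := hfin r
    refine (tendsto_mul_stieltjes (μ r)).congr' ?_
    filter_upwards [eventually_gt_atTop 0] with y hy
    rw [hμ r (Complex.I * y) (by simpa using hy)]

/-- Uniqueness of the solution in the class of Stieltjes transforms, on the imaginary axis. -/
theorem eventually_stieltjes_eq_of_solves {c : ℝ} (hc : 0 < c) (hH : ∀ᵐ x ∂H, ∀ r, 0 ≤ x r)
    (hG : ∀ᵐ x ∂G, ∀ r, 0 ≤ x r)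
    (hHint : ∀ r, Integrable (fun x => x r) H) (hGint : ∀ r, Integrable (fun x => x r) G)
    (hGpos : ∀ r, 0 < ∫ x, x r ∂G) {h h' : ℂ → Fin K → ℂ}
    (hst : ∀ r, IsStieltjesOf Set.univ fun z => h z r)
    (hst' : ∀ r, IsStieltjesOf Set.univ fun z => h' z r)
    (hs : SolvesSystem c H G h) (hs' : SolvesSystem c H G h') :
    ∀ᶠ y : ℝ in atTop, h (Complex.I * y) = h' (Complex.I * y) := by
  refine eventually_eq_of_solves hc hH hG hHint hGint hGpos (asympPos_of_solves hst hs)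
    (asympPos_of_solves hst' hs') ?_ ?_
  · exact fun y hy r => (hs (Complex.I * y) (by simpa using hy) r).2
  · exact fun y hy r => (hs' (Complex.I * y) (by simpa using hy) r).2

theorem isPreconnected_upperHalfPlane : IsPreconnected {z : ℂ | 0 < z.im} :=
  (convex_halfSpace_im_gt 0).isPreconnected

theorem isOpen_upperHalfPlane : IsOpen {z : ℂ | 0 < z.im} :=
  isOpen_lt continuous_const Complex.continuous_im

/-- Supplies the accumulation point needed by the identity theorem. -/
theorem frequently_imaginary {P : ℂ → Prop} {y₀ : ℝ}
    (h : ∀ y > y₀, P (Complex.I * y)) : ∃ᶠ z in 𝓝[≠] (Complex.I * ((y₀ + 1 : ℝ) : ℂ)), P z := by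
  have ht : Tendsto (fun y : ℝ => Complex.I * (y : ℂ)) (𝓝[≠] (y₀ + 1))
      (𝓝[≠] (Complex.I * ((y₀ + 1 : ℝ) : ℂ))) := by
    refine tendsto_nhdsWithin_of_tendsto_nhds_of_eventually_within _ ?_ ?_
    · have : Continuous fun y : ℝ => Complex.I * (y : ℂ) := by fun_prop
      exact (this.tendsto _).mono_left nhdsWithin_le_nhds
    · filter_upwards [self_mem_nhdsWithin] with y hy
      intro h'
      refine hy ?_
      have := mul_left_cancel₀ Complex.I_ne_zero h'
      exact_mod_cast this
  refine ht.frequently (Eventually.frequently ?_)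
  have h1 : ∀ᶠ y in 𝓝 (y₀ + 1), y₀ < y := lt_mem_nhds (lt_add_one y₀)
  filter_upwards [h1.filter_mono nhdsWithin_le_nhds] with y hy using h y hy

/-- Uniqueness of the solution in the class of Stieltjes transforms. -/
theorem eq_of_solves {c : ℝ} (hc : 0 < c) (hH : ∀ᵐ x ∂H, ∀ r, 0 ≤ x r) (hG : ∀ᵐ x ∂G, ∀ r, 0 ≤ x r)
    (hHint : ∀ r, Integrable (fun x => x r) H) (hGint : ∀ r, Integrable (fun x => x r) G)
    (hGpos : ∀ r, 0 < ∫ x, x r ∂G) {h h' : ℂ → Fin K → ℂ}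
    (hst : ∀ r, IsStieltjesOf Set.univ fun z => h z r)
    (hst' : ∀ r, IsStieltjesOf Set.univ fun z => h' z r)
    (hs : SolvesSystem c H G h) (hs' : SolvesSystem c H G h') {z : ℂ} (hz : 0 < z.im) :
    h z = h' z := by
  obtain ⟨y₀, hy₀⟩ := eventually_atTop.1
    (eventually_stieltjes_eq_of_solves hc hH hG hHint hGint hGpos hst hst' hs hs')
  funext r
  have hd : ∀ g : ℂ → ℂ, IsStieltjesOf Set.univ g → AnalyticOnNhd ℂ g {z | 0 < z.im} := by
    rintro g ⟨μ, hμ, -, hg⟩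
    refine DifferentiableOn.analyticOnNhd ?_ isOpen_upperHalfPlane
    exact (differentiableOn_stieltjes μ).congr fun z hz => hg z hz
  refine (hd _ (hst r)).eqOn_of_preconnected_of_frequently_eq (hd _ (hst' r))
    isPreconnected_upperHalfPlane (z₀ := Complex.I * ((max y₀ 0 + 1 : ℝ) : ℂ)) ?_
    (frequently_imaginary fun y hy => ?_) hz
  · have : (0 : ℝ) ≤ max y₀ 0 := le_max_right _ _
    simp only [Set.mem_ofPred_eq, Complex.mul_im, Complex.I_re, Complex.ofReal_im, mul_zero,
      Complex.I_im, Complex.ofReal_re, one_mul, zero_add]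
    linarith
  · exact congrFun (hy₀ y ((le_max_left _ _).trans hy.le)) r

/-- The extensions of two Stieltjes transforms of measures on `[0, ∞)` to the complement of
`[0, ∞)` agree when the transforms agree on the upper half-plane. -/
theorem stieltjes_sq_eq {μ ν : Measure ℝ} [IsFiniteMeasure μ] [IsFiniteMeasure ν]
    (hμ : μ (Set.Ici 0)ᶜ = 0) (hν : ν (Set.Ici 0)ᶜ = 0)
    (h : ∀ z : ℂ, 0 < z.im → stieltjes μ z = stieltjes ν z) {w : ℂ} (hw : 0 < w.im) :
    stieltjes μ (w ^ 2) = stieltjes ν (w ^ 2) := by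
  have hd : ∀ (ρ : Measure ℝ) [IsFiniteMeasure ρ], ρ (Set.Ici 0)ᶜ = 0 →
      AnalyticOnNhd ℂ (fun w => stieltjes ρ (w ^ 2)) {z | 0 < z.im} := by
    intro ρ _ hρ
    refine DifferentiableOn.analyticOnNhd (fun w hw => ?_) isOpen_upperHalfPlane
    refine DifferentiableAt.differentiableWithinAt ?_
    exact DifferentiableAt.comp (g := stieltjes ρ) (f := fun w : ℂ => w ^ 2) w
      (differentiableAt_stieltjes isClosed_Ici hρ fun x hx => ofReal_ne_sq hw hx)
      (differentiableAt_pow 2)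
  refine (hd μ hμ).eqOn_of_preconnected_of_eventuallyEq (hd ν hν)
    isPreconnected_upperHalfPlane (z₀ := 1 + Complex.I) (by simp) ?_ hw
  -- Near 1 + i the square lies in the upper half-plane, where the transforms agree by assumption.
  -- The identity theorem in the variable w spreads this to all squares.
  have hcont : Continuous fun w : ℂ => (w ^ 2).im := by fun_prop
  have : ∀ᶠ w in 𝓝 (1 + Complex.I), 0 < (w ^ 2).im := by
    refine hcont.continuousAt.eventually (lt_mem_nhds ?_)
    simp [pow_two]
  filter_upwards [this] with w hw' using h _ hw'

end Uniqueness

end SumSeparable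
end

/-! ### Passing to the limit in the finite-dimensional system -/

noncomputable section

namespace SumSeparable

section LimitSystem

variable {K : ℕ}

/-- The denominators `w + λᵀ b`. -/
def den (w : ℂ) (b : Fin K → ℂ) (x : Fin K → ℝ) : ℂ := w + ∑ s, (x s : ℂ) * b s

theorem den_im (w : ℂ) (b : Fin K → ℂ) (x : Fin K → ℝ) :
    (den w b x).im = w.im + ∑ s, x s * (b s).im := by
  simp [den]

@[fun_prop]
theorem continuous_den (w : ℂ) (b : Fin K → ℂ) : Continuous (den w b) := by
  unfold den
  fun_prop

theorem im_le_norm_den {w : ℂ} {b : Fin K → ℂ} (hb : ∀ s, 0 ≤ (b s).im) {x : Fin K → ℝ}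
    (hx : ∀ s, 0 ≤ x s) : w.im ≤ ‖den w b x‖ := by
  have h1 := Complex.im_le_norm (den w b x)
  have h2 : 0 ≤ ∑ s, x s * (b s).im := Finset.sum_nonneg fun s _ => mul_nonneg (hx s) (hb s)
  rw [den_im] at h1
  linarith

/-- Each term of Im(w + λᵀb) is nonnegative and bounds the modulus from below. Thus λ_r / (w + λᵀb)
is bounded in λ as soon as Im b_r > 0, and weak convergence suffices without uniform integrability.
-/
theorem mul_im_le_norm_den {w : ℂ} (hw : 0 < w.im) {b : Fin K → ℂ} (hb : ∀ s, 0 ≤ (b s).im)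
    {x : Fin K → ℝ} (hx : ∀ s, 0 ≤ x s) (r : Fin K) : x r * (b r).im ≤ ‖den w b x‖ := by
  have h1 := Complex.im_le_norm (den w b x)
  have h2 : x r * (b r).im ≤ ∑ s, x s * (b s).im :=
    Finset.single_le_sum (f := fun s => x s * (b s).im)
      (fun s _ => mul_nonneg (hx s) (hb s)) (Finset.mem_univ r)
  rw [den_im] at h1
  linarith

theorem den_ne_zero {w : ℂ} (hw : 0 < w.im) {b : Fin K → ℂ} (hb : ∀ s, 0 ≤ (b s).im)
    {x : Fin K → ℝ} (hx : ∀ s, 0 ≤ x s) : den w b x ≠ 0 := by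
  intro h
  have := im_le_norm_den (w := w) hb hx
  rw [h, norm_zero] at this
  linarith

variable {ι : Type*} {l : Filter ι}

/-- Weak convergence of measures carried by the nonnegative orthant, as convergence of integrals. -/
structure WeakLimit (l : Filter ι) (Hn : ι → Measure (Fin K → ℝ)) (H : Measure (Fin K → ℝ)) :
    Prop where
  prob : ∀ᶠ i in l, IsProbabilityMeasure (Hn i)
  nonneg : ∀ i, ∀ᵐ x ∂(Hn i), ∀ r, 0 ≤ x r
  integrable : ∀ i r, Integrable (fun x => x r) (Hn i)
  nonneg_lim : ∀ᵐ x ∂H, ∀ r, 0 ≤ x r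
  tendsto : ∀ f : BoundedContinuousFunction (Fin K → ℝ) ℝ,
    Tendsto (fun i => ∫ x, f x ∂(Hn i)) l (𝓝 (∫ x, f x ∂H))

variable {Hn : ι → Measure (Fin K → ℝ)} {H : Measure (Fin K → ℝ)}

/-- Composition with coordinatewise absolute values turns a function controlled on the orthant only
into a test function on the whole space without changing its integrals. -/
theorem WeakLimit.integral_congr_abs {ρ : Measure (Fin K → ℝ)} (hρ : ∀ᵐ x ∂ρ, ∀ r, 0 ≤ x r)
    {E : Type*} [NormedAddCommGroup E] [NormedSpace ℝ E] (f : (Fin K → ℝ) → E) :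
    ∫ x, f (fun r => |x r|) ∂ρ = ∫ x, f x ∂ρ := by
  refine integral_congr_ae ?_
  filter_upwards [hρ] with x hx
  congr 1
  funext r
  exact abs_of_nonneg (hx r)

/-- Only the values on the nonnegative orthant matter for the test functions. -/
theorem WeakLimit.tendsto_integral (h : WeakLimit l Hn H) (f : (Fin K → ℝ) → ℝ)
    (hf : Continuous fun x : Fin K → ℝ => f fun r => |x r|) (C : ℝ)
    (hC : ∀ x : Fin K → ℝ, (∀ r, 0 ≤ x r) → |f x| ≤ C) :
    Tendsto (fun i => ∫ x, f x ∂(Hn i)) l (𝓝 (∫ x, f x ∂H)) := by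
  have h1 := h.tendsto (BoundedContinuousFunction.ofNormedAddCommGroup
    (fun x : Fin K → ℝ => f fun r => |x r|) hf C fun x => hC _ fun r => abs_nonneg _)
  simp only [BoundedContinuousFunction.coe_ofNormedAddCommGroup] at h1
  rw [integral_congr_abs h.nonneg_lim] at h1
  exact h1.congr fun i => integral_congr_abs (h.nonneg i) f

theorem WeakLimit.tendsto_integral_complex [IsProbabilityMeasure H] (h : WeakLimit l Hn H) (f : (Fin K → ℝ) → ℂ)
    (hf : Continuous fun x : Fin K → ℝ => f fun r => |x r|) (hfm : Measurable f) (C : ℝ)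
    (hC : ∀ x : Fin K → ℝ, (∀ r, 0 ≤ x r) → ‖f x‖ ≤ C) :
    Tendsto (fun i => ∫ x, f x ∂(Hn i)) l (𝓝 (∫ x, f x ∂H)) := by
  have hInt : ∀ (ρ : Measure (Fin K → ℝ)) [IsProbabilityMeasure ρ], (∀ᵐ x ∂ρ, ∀ r, 0 ≤ x r) →
      Integrable f ρ := by
    intro ρ _ hρ
    refine Integrable.of_bound (C := C) hfm.aestronglyMeasurable ?_
    filter_upwards [hρ] with x hx using hC x hx
  have hsplit : ∀ (ρ : Measure (Fin K → ℝ)) [IsProbabilityMeasure ρ], (∀ᵐ x ∂ρ, ∀ r, 0 ≤ x r) →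
      ∫ x, f x ∂ρ = ((∫ x, (f x).re ∂ρ : ℝ) : ℂ) + ((∫ x, (f x).im ∂ρ : ℝ) : ℂ) * Complex.I := by
    intro ρ _ hρ
    exact (integral_re_add_im (𝕜 := ℂ) (hInt ρ hρ)).symm
  have hre := h.tendsto_integral (fun x => (f x).re) (Complex.continuous_re.comp hf) C
    fun x hx => (Complex.abs_re_le_norm _).trans (hC x hx)
  have him := h.tendsto_integral (fun x => (f x).im) (Complex.continuous_im.comp hf) C
    fun x hx => (Complex.abs_im_le_norm _).trans (hC x hx)
  rw [hsplit H h.nonneg_lim]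
  refine (((Complex.continuous_ofReal.tendsto _).comp hre).add
    (((Complex.continuous_ofReal.tendsto _).comp him).mul_const Complex.I)).congr' ?_
  filter_upwards [h.prob] with i hi
  exact (hsplit (Hn i) (h.nonneg i)).symm

/-- Passing to the limit in `∫ g / (w + λᵀ b_n) dH_n`. -/
theorem WeakLimit.tendsto_integral_div_den [IsProbabilityMeasure H] (h : WeakLimit l Hn H) {w : ℂ} (hw : 0 < w.im)
    {b : ι → Fin K → ℂ} {b₀ : Fin K → ℂ} (hb : ∀ᶠ i in l, ∀ s, 0 ≤ (b i s).im)
    (hb₀ : ∀ s, 0 < (b₀ s).im) (hlim : ∀ s, Tendsto (fun i => b i s) l (𝓝 (b₀ s)))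
    {g : (Fin K → ℝ) → ℝ} (hg : Continuous g) {C : ℝ}
    (hg0 : ∀ x, (∀ s, 0 ≤ x s) → 0 ≤ g x)
    (hC : ∀ᶠ i in l, ∀ x, (∀ s, 0 ≤ x s) → g x ≤ C * ‖den w (b i) x‖)
    (hC₀ : ∀ x, (∀ s, 0 ≤ x s) → g x ≤ C * ‖den w b₀ x‖) :
    Tendsto (fun i => ∫ x, (g x : ℂ) / den w (b i) x ∂(Hn i)) l
      (𝓝 (∫ x, (g x : ℂ) / den w b₀ x ∂H)) := by
  have hm : ∀ b : Fin K → ℂ, Measurable fun x => (g x : ℂ) / den w b x := fun b =>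
    (Complex.measurable_ofReal.comp hg.measurable).div (continuous_den w b).measurable
  have hbd : ∀ {b : Fin K → ℂ}, (∀ s, 0 ≤ (b s).im) →
      (∀ x, (∀ s, 0 ≤ x s) → g x ≤ C * ‖den w b x‖) →
      ∀ x, (∀ s, 0 ≤ x s) → ‖(g x : ℂ) / den w b x‖ ≤ C := by
    intro b hb hC x hx
    rw [norm_div, Complex.norm_real, Real.norm_of_nonneg (hg0 x hx)]
    exact div_le_of_le_mul₀ (norm_nonneg _)
      (by
        have h1 := hC x hx
        have h2 : 0 < ‖den w b x‖ := norm_pos_iff.2 (den_ne_zero hw hb hx)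
        have h3 := (hg0 x hx).trans h1
        exact nonneg_of_mul_nonneg_left h3 h2) (hC x hx)
  have h1 : Tendsto (fun i => ∫ x, (g x : ℂ) / den w b₀ x ∂(Hn i)) l
      (𝓝 (∫ x, (g x : ℂ) / den w b₀ x ∂H)) := by
    refine h.tendsto_integral_complex _ ?_ (hm _) C (hbd (fun s => (hb₀ s).le) hC₀)
    refine Continuous.div ?_ ?_ fun x => den_ne_zero hw (fun s => (hb₀ s).le) fun r => abs_nonneg _
    · exact Complex.continuous_ofReal.comp (hg.comp (by fun_prop))
    · exact (continuous_den w b₀).comp (by fun_prop)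
  -- This sum bounds the difference of the two integrands: the integrand with `b i` is at most C,
  -- and x_s / ‖den w b₀ x‖ ≤ 1 / Im b₀_s.
  have h2 : Tendsto (fun i => ∑ s, C * (‖b i s - b₀ s‖ / (b₀ s).im)) l (𝓝 0) := by
    have : ∀ s, Tendsto (fun i => C * (‖b i s - b₀ s‖ / (b₀ s).im)) l (𝓝 0) := fun s => by
      have h3 := ((tendsto_iff_norm_sub_tendsto_zero.1 (hlim s)).div_const (b₀ s).im).const_mul C
      simpa using h3
    simpa using tendsto_finsetSum Finset.univ fun s _ => this s
  have h3 : Tendsto (fun i => ∫ x, (g x : ℂ) / den w (b i) x ∂(Hn i) -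
      ∫ x, (g x : ℂ) / den w b₀ x ∂(Hn i)) l (𝓝 0) := by
    refine squeeze_zero_norm' ?_ h2
    filter_upwards [h.prob, hb, hC] with i hi hbi hCi
    have hInt : ∀ {b : Fin K → ℂ}, (∀ s, 0 ≤ (b s).im) →
        (∀ x, (∀ s, 0 ≤ x s) → g x ≤ C * ‖den w b x‖) →
        Integrable (fun x => (g x : ℂ) / den w b x) (Hn i) := by
      intro b hb hC
      refine Integrable.of_bound (C := C) (hm b).aestronglyMeasurable ?_
      filter_upwards [h.nonneg i] with x hx using hbd hb hC x hx
    rw [← integral_sub (hInt hbi hCi) (hInt (fun s => (hb₀ s).le) hC₀)]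
    have h4 : ∀ᵐ x ∂(Hn i), ‖(g x : ℂ) / den w (b i) x - (g x : ℂ) / den w b₀ x‖ ≤
        ∑ s, C * (‖b i s - b₀ s‖ / (b₀ s).im) := by
      filter_upwards [h.nonneg i] with x hx
      have hd := den_ne_zero hw hbi hx
      have hd₀ := den_ne_zero hw (fun s => (hb₀ s).le) hx
      have hdp : 0 < ‖den w (b i) x‖ := norm_pos_iff.2 hd
      have hdp₀ : 0 < ‖den w b₀ x‖ := norm_pos_iff.2 hd₀
      have e : (g x : ℂ) / den w (b i) x - (g x : ℂ) / den w b₀ x =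
          ∑ s, (g x : ℂ) / den w (b i) x * ((x s : ℂ) * (b₀ s - b i s) / den w b₀ x) := by
        rw [← Finset.mul_sum, ← Finset.sum_div]
        have : ∑ s, (x s : ℂ) * (b₀ s - b i s) = den w b₀ x - den w (b i) x := by
          simp only [den, mul_sub, Finset.sum_sub_distrib]
          ring
        rw [this]
        field_simp
      rw [e]
      refine (norm_sum_le _ _).trans (Finset.sum_le_sum fun s _ => ?_)
      rw [norm_mul]
      have hCn : 0 ≤ C := (norm_nonneg _).trans (hbd hbi hCi x hx)
      refine mul_le_mul (hbd hbi hCi x hx) ?_ (norm_nonneg _) hCn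
      rw [norm_div, norm_mul, Complex.norm_real, Real.norm_of_nonneg (hx s), norm_sub_rev,
        div_le_div_iff₀ hdp₀ (hb₀ s)]
      have := mul_im_le_norm_den hw (fun s => (hb₀ s).le) hx s
      calc x s * ‖b i s - b₀ s‖ * (b₀ s).im = ‖b i s - b₀ s‖ * (x s * (b₀ s).im) := by ring
        _ ≤ _ := by gcongr
    have h5 := norm_integral_le_of_norm_le_const h4
    simpa using h5
  have h6 := h3.add h1
  rw [zero_add] at h6
  exact h6.congr fun i => by ring

theorem WeakLimit.tendsto_integral_coord_div_den [IsProbabilityMeasure H] (h : WeakLimit l Hn H) {w : ℂ} (hw : 0 < w.im)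
    {b : ι → Fin K → ℂ} {b₀ : Fin K → ℂ} (hb : ∀ᶠ i in l, ∀ s, 0 ≤ (b i s).im)
    (hb₀ : ∀ s, 0 < (b₀ s).im) (hlim : ∀ s, Tendsto (fun i => b i s) l (𝓝 (b₀ s))) (r : Fin K) :
    Tendsto (fun i => ∫ x, (x r : ℂ) / den w (b i) x ∂(Hn i)) l
      (𝓝 (∫ x, (x r : ℂ) / den w b₀ x ∂H)) := by
  have hr := hb₀ r
  -- The factor 2 in C allows for Im b_i, which is only known to exceed half of Im b₀ eventually.
  refine h.tendsto_integral_div_den hw hb hb₀ hlim (g := fun x => x r) (C := 2 / (b₀ r).im)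
    (by fun_prop) (fun x hx => hx r) ?_ fun x hx => ?_
  · have h1 := ((Complex.continuous_im.tendsto _).comp (hlim r)).eventually
      (lt_mem_nhds (half_lt_self hr))
    filter_upwards [hb, h1] with i hi h1 x hx
    have h2 := mul_im_le_norm_den hw hi hx r
    simp only [Function.comp_apply] at h1
    rw [div_mul_eq_mul_div, le_div_iff₀ hr]
    nlinarith [hx r]
  · have h2 := mul_im_le_norm_den hw (fun s => (hb₀ s).le) hx r
    rw [div_mul_eq_mul_div, le_div_iff₀ hr]
    nlinarith [hx r, norm_nonneg (den w b₀ x)]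

theorem WeakLimit.tendsto_integral_inv_den [IsProbabilityMeasure H] (h : WeakLimit l Hn H) {w : ℂ} (hw : 0 < w.im)
    {b : ι → Fin K → ℂ} {b₀ : Fin K → ℂ} (hb : ∀ᶠ i in l, ∀ s, 0 ≤ (b i s).im)
    (hb₀ : ∀ s, 0 < (b₀ s).im) (hlim : ∀ s, Tendsto (fun i => b i s) l (𝓝 (b₀ s))) :
    Tendsto (fun i => ∫ x, 1 / den w (b i) x ∂(Hn i)) l (𝓝 (∫ x, 1 / den w b₀ x ∂H)) := by
  have := h.tendsto_integral_div_den hw hb hb₀ hlim (g := fun _ => 1) (C := 1 / w.im)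
    continuous_const (fun _ _ => zero_le_one) ?_ fun x hx => ?_
  · simpa using this
  · filter_upwards [hb] with i hi x hx
    have := im_le_norm_den (w := w) hi hx
    rw [div_mul_eq_mul_div, one_mul, le_div_iff₀ hw]
    linarith
  · have := im_le_norm_den (w := w) (fun s => (hb₀ s).le) hx
    rw [div_mul_eq_mul_div, one_mul, le_div_iff₀ hw]
    linarith

/-- The imaginary part of `-∫ λ_r / (w + λᵀ a_n) dH_n` stays away from zero when the `a_n` are
bounded. -/
theorem WeakLimit.im_pos_of_tendsto [l.NeBot] [IsProbabilityMeasure H] (h : WeakLimit l Hn H) {w : ℂ} (hw : 0 < w.im)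
    {a : ι → Fin K → ℂ} (ha : ∀ᶠ i in l, ∀ s, 0 ≤ (a i s).im) {A : ℝ}
    (hA : ∀ᶠ i in l, ∀ s, ‖a i s‖ ≤ A) {r : Fin K} (hr : ¬ ∀ᵐ x ∂H, x r = 0) {b : ℂ}
    (hb : Tendsto (fun i => -∫ x, (x r : ℂ) / den w (a i) x ∂(Hn i)) l (𝓝 b)) : 0 < b.im := by
  wlog hA1 : 1 ≤ A generalizing A
  · exact this (A := max A 1) (hA.mono fun i hi s => (hi s).trans (le_max_left _ _))
      (le_max_right _ _)
  have hw0 : 0 < ‖w‖ := hw.trans_le (Complex.im_le_norm w)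
  -- A lower bound for Im(-x_r / den) on the orthant that does not depend on the index: Im den ≥ Im
  -- w in the numerator and |den| ≤ ‖w‖ + ∑ x_s A below. With A ≥ 1 it is at most 1 there, hence an
  -- admissible test function.
  let f : (Fin K → ℝ) → ℝ := fun x => x r * w.im / (‖w‖ + ∑ s, x s * A) ^ 2
  have hden : ∀ x : Fin K → ℝ, (∀ s, 0 ≤ x s) → 0 < ‖w‖ + ∑ s, x s * A := fun x hx => by
    have : 0 ≤ ∑ s, x s * A := Finset.sum_nonneg fun s _ => mul_nonneg (hx s) (by linarith)
    linarith
  have hf0 : ∀ x : Fin K → ℝ, (∀ s, 0 ≤ x s) → 0 ≤ f x := fun x hx => by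
    have := hden x hx
    have := hx r
    simp only [f]
    positivity
  have hfC : ∀ x : Fin K → ℝ, (∀ s, 0 ≤ x s) → |f x| ≤ 1 := fun x hx => by
    rw [abs_of_nonneg (hf0 x hx)]
    have h1 := hden x hx
    have h2 : x r * A ≤ ∑ s, x s * A := Finset.single_le_sum (f := fun s => x s * A)
      (fun s _ => mul_nonneg (hx s) (by linarith)) (Finset.mem_univ r)
    simp only [f]
    rw [div_le_one (by positivity), pow_two]
    have h3 := Complex.im_le_norm w
    refine mul_le_mul ?_ ?_ hw.le h1.le
    · nlinarith [hx r]
    · have : 0 ≤ x r * A := mul_nonneg (hx r) (by linarith)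
      linarith
  have hfm : Measurable f := by
    simp only [f]
    fun_prop
  have hfcont : Continuous fun x : Fin K → ℝ => f fun r => |x r| := by
    refine Continuous.div (by fun_prop) (by fun_prop) fun x => ?_
    exact (pow_pos (hden _ fun s => abs_nonneg _) 2).ne'
  have h1 := h.tendsto_integral f hfcont 1 hfC
  have hpos : 0 < ∫ x, f x ∂H := by
    have hInt : Integrable f H := by
      refine Integrable.of_bound (C := 1) hfm.aestronglyMeasurable ?_
      filter_upwards [h.nonneg_lim] with x hx using hfC x hx
    have hnn : 0 ≤ᵐ[H] f := by
      filter_upwards [h.nonneg_lim] with x hx using hf0 x hx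
    refine (integral_nonneg_of_ae hnn).lt_of_ne' fun h0 => hr ?_
    rw [integral_eq_zero_iff_of_nonneg_ae hnn hInt] at h0
    filter_upwards [h0, h.nonneg_lim] with x hx hx0
    have h2 := hden x hx0
    simp only [f, Pi.zero_apply] at hx
    rcases div_eq_zero_iff.1 hx with h3 | h3
    · rcases mul_eq_zero.1 h3 with h4 | h4
      · exact h4
      · exact absurd h4 hw.ne'
    · exact absurd h3 (pow_pos h2 2).ne'
  refine hpos.trans_le (le_of_tendsto_of_tendsto h1
    ((Complex.continuous_im.tendsto _).comp hb) ?_)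
  filter_upwards [h.prob, ha, hA] with i hi ha hA
  simp only [Function.comp_apply]
  have hInt : Integrable (fun x : Fin K → ℝ => (x r : ℂ) / den w (a i) x) (Hn i) := by
    refine Integrable.mono' ((h.integrable i r).div_const w.im)
      (by fun_prop : Measurable _).aestronglyMeasurable ?_
    filter_upwards [h.nonneg i] with x hx
    have hxr := hx r
    rw [norm_div, Complex.norm_real, Real.norm_of_nonneg hxr]
    gcongr
    exact im_le_norm_den ha hx
  rw [← integral_neg]
  have h2 := integral_im (𝕜 := ℂ) hInt.neg
  simp only [RCLike.im_to_complex, Pi.neg_apply] at h2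
  rw [← h2]
  refine integral_mono_ae ?_ hInt.neg.im ?_
  · refine Integrable.of_bound (C := 1) hfm.aestronglyMeasurable ?_
    filter_upwards [h.nonneg i] with x hx using hfC x hx
  · filter_upwards [h.nonneg i] with x hx
    have h3 := hden x hx
    have hd := den_ne_zero hw ha hx
    have hd2 : 0 < Complex.normSq (den w (a i) x) := Complex.normSq_pos.2 hd
    have h4 : Complex.normSq (den w (a i) x) ≤ (‖w‖ + ∑ s, x s * A) ^ 2 := by
      rw [Complex.normSq_eq_norm_sq]
      refine pow_le_pow_left₀ (norm_nonneg _) ?_ 2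
      refine (norm_add_le _ _).trans (add_le_add le_rfl ((norm_sum_le _ _).trans
        (Finset.sum_le_sum fun s _ => ?_)))
      rw [norm_mul, Complex.norm_real, Real.norm_of_nonneg (hx s)]
      exact mul_le_mul_of_nonneg_left (hA s) (hx s)
    have e : (-((x r : ℂ) / den w (a i) x)).im =
        x r * (den w (a i) x).im / Complex.normSq (den w (a i) x) := by
      rw [Complex.neg_im, Complex.div_im]
      simp
    change f x ≤ (-((x r : ℂ) / den w (a i) x)).im
    rw [e]
    have h5 : w.im ≤ (den w (a i) x).im := by
      rw [den_im]
      have : 0 ≤ ∑ s, x s * (a i s).im := Finset.sum_nonneg fun s _ => mul_nonneg (hx s) (ha s)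
      linarith
    have hxr := hx r
    have h6 : 0 ≤ x r * (den w (a i) x).im := mul_nonneg hxr (hw.le.trans h5)
    simp only [f]
    gcongr

/-- Limits of approximate solutions of the finite-dimensional system solve the limiting system. -/
theorem limit_system [l.NeBot] {Gn : ι → Measure (Fin K → ℝ)} {G : Measure (Fin K → ℝ)}
    [IsProbabilityMeasure H] [IsProbabilityMeasure G] (hH : WeakLimit l Hn H)
    (hG : WeakLimit l Gn G) (hHr : ∀ r, ¬ ∀ᵐ x ∂H, x r = 0) (hGr : ∀ r, ¬ ∀ᵐ x ∂G, x r = 0)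
    {c : ι → ℝ} {c₀ : ℝ} (hc₀ : 0 < c₀) (hc : Tendsto c l (𝓝 c₀)) {w : ℂ} (hw : 0 < w.im)
    {a b : ι → Fin K → ℂ} {a₀ b₀ : Fin K → ℂ}
    (ha : ∀ᶠ i in l, ∀ s, 0 ≤ (a i s).im) (hb : ∀ᶠ i in l, ∀ s, 0 ≤ (b i s).im)
    (halim : ∀ s, Tendsto (fun i => a i s) l (𝓝 (a₀ s)))
    (hblim : ∀ s, Tendsto (fun i => b i s) l (𝓝 (b₀ s)))
    (hae : ∀ r, Tendsto (fun i => a i r + c i * ∫ x, (x r : ℂ) / den w (b i) x ∂(Hn i)) l (𝓝 0))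
    (hbe : ∀ r, Tendsto (fun i => b i r + ∫ x, (x r : ℂ) / den w (a i) x ∂(Gn i)) l (𝓝 0)) :
    (∀ r, 0 < (a₀ r).im) ∧ (∀ r, 0 < (b₀ r).im) ∧
      (∀ r, a₀ r = -(c₀ * ∫ x, (x r : ℂ) / den w b₀ x ∂H)) ∧
      (∀ r, b₀ r = -∫ x, (x r : ℂ) / den w a₀ x ∂G) ∧
      Tendsto (fun i => ∫ x, 1 / den w (b i) x ∂(Hn i)) l (𝓝 (∫ x, 1 / den w b₀ x ∂H)) := by
  have hbdd : ∀ {f : ι → Fin K → ℂ} {f₀ : Fin K → ℂ},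
      (∀ s, Tendsto (fun i => f i s) l (𝓝 (f₀ s))) →
      ∃ A : ℝ, ∀ᶠ i in l, ∀ s, ‖f i s‖ ≤ A := by
    intro f f₀ hf
    refine ⟨∑ s, (‖f₀ s‖ + 1), ?_⟩
    filter_upwards [eventually_all.2 fun s => (hf s).norm.eventually
      (gt_mem_nhds (lt_add_one ‖f₀ s‖))] with i hi s
    exact (hi s).le.trans (Finset.single_le_sum (f := fun s => ‖f₀ s‖ + 1)
      (fun s _ => by positivity) (Finset.mem_univ s))
  obtain ⟨A, hA⟩ := hbdd halim
  obtain ⟨A', hA'⟩ := hbdd hblim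
  have hcc : Tendsto (fun i => (c i : ℂ)) l (𝓝 (c₀ : ℂ)) :=
    (Complex.continuous_ofReal.tendsto _).comp hc
  have hc₀' : (c₀ : ℂ) ≠ 0 := by exact_mod_cast hc₀.ne'
  -- Strict positivity has to precede the limits of the integrals. It needs only the boundedness of
  -- the arguments and the coordinate condition, and it then provides the bounds on the integrands.
  have hbpos : ∀ r, 0 < (b₀ r).im := fun r => by
    refine hG.im_pos_of_tendsto hw ha hA (hGr r) ?_
    have := (hblim r).sub (hbe r)
    rw [sub_zero] at this
    exact this.congr fun i => by ring
  have hapos : ∀ r, 0 < (a₀ r).im := fun r => by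
    have h1 : 0 < (a₀ r / c₀).im := by
      refine hH.im_pos_of_tendsto hw hb hA' (hHr r) ?_
      have := ((halim r).sub (hae r)).div hcc hc₀'
      rw [sub_zero] at this
      refine this.congr' ?_
      filter_upwards [hc.eventually (lt_mem_nhds hc₀)] with i hi
      have hi' : (c i : ℂ) ≠ 0 := by exact_mod_cast hi.ne'
      simp only [Pi.div_apply]
      field_simp
      ring
    rw [Complex.div_ofReal_im] at h1
    exact (div_pos_iff_of_pos_right hc₀).1 h1
  refine ⟨hapos, hbpos, fun r => ?_, fun r => ?_, hH.tendsto_integral_inv_den hw hb hbpos hblim⟩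
  · have h1 := hcc.mul (hH.tendsto_integral_coord_div_den hw hb hbpos hblim r)
    have h2 := tendsto_nhds_unique ((halim r).add h1) (hae r)
    exact eq_neg_of_add_eq_zero_left h2
  · have h1 := hG.tendsto_integral_coord_div_den hw ha hapos halim r
    have h2 := tendsto_nhds_unique ((hblim r).add h1) (hbe r)
    exact eq_neg_of_add_eq_zero_left h2

/-- The limiting system in the variable `w = √z`, restated in the variable `z`. -/
theorem opO_sq_eq {G : Measure (Fin K → ℝ)} {w : ℂ} (hw : w ≠ 0) (a : Fin K → ℂ) (r : Fin K) :
    opO (w ^ 2) (fun s => a s / w) G r = (-∫ x, (x r : ℂ) / den w a x ∂G) / w := by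
  rw [opO, ← integral_neg, ← integral_div]
  refine integral_congr_ae (ae_of_all _ fun x => ?_)
  have e : -w ^ 2 * (1 + ∑ s, (x s : ℂ) * (a s / w)) = -(w * den w a x) := by
    have : ∑ s, (x s : ℂ) * (a s / w) = (∑ s, (x s : ℂ) * a s) / w := by
      rw [Finset.sum_div]
      exact Finset.sum_congr rfl fun s _ => by ring
    rw [this, den]
    field_simp
  simp only [e]
  rw [div_neg, neg_div, div_div, mul_comm w]

theorem one_div_sq_eq {w : ℂ} (hw : w ≠ 0) (b : Fin K → ℂ) (x : Fin K → ℝ) :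
    1 / (-w ^ 2 * (1 + ∑ s, (x s : ℂ) * (b s / w))) = -(1 / den w b x) / w := by
  have e : -w ^ 2 * (1 + ∑ s, (x s : ℂ) * (b s / w)) = -(w * den w b x) := by
    have : ∑ s, (x s : ℂ) * (b s / w) = (∑ s, (x s : ℂ) * b s) / w := by
      rw [Finset.sum_div]
      exact Finset.sum_congr rfl fun s _ => by ring
    rw [this, den]
    field_simp
  rw [e, div_neg, neg_div, div_div, mul_comm w]

end LimitSystem

end SumSeparable
end

/-! ### Resolvents of Hermitian matrices and rank bounds for traces -/

noncomputable section

namespace SumSeparable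

open scoped Matrix.Norms.L2Operator

section Resolvent

variable {ι : Type*} [Fintype ι]

/-- The Euclidean norm of a vector. -/
def vnorm (x : ι → ℂ) : ℝ := ‖WithLp.toLp 2 x‖

theorem vnorm_nonneg (x : ι → ℂ) : 0 ≤ vnorm x := norm_nonneg _

theorem vnorm_sq (x : ι → ℂ) : vnorm x ^ 2 = ∑ i, ‖x i‖ ^ 2 := by
  rw [vnorm, EuclideanSpace.norm_sq_eq]

theorem star_dotProduct_self (x : ι → ℂ) : star x ⬝ᵥ x = ((vnorm x ^ 2 : ℝ) : ℂ) := by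
  rw [vnorm_sq, dotProduct]
  push_cast
  refine Finset.sum_congr rfl fun i _ => ?_
  rw [Pi.star_apply, Complex.star_def, ← Complex.normSq_eq_conj_mul_self,
    Complex.normSq_eq_norm_sq]
  push_cast
  rfl

theorem norm_star_dotProduct_le (x y : ι → ℂ) : ‖star x ⬝ᵥ y‖ ≤ vnorm x * vnorm y := by
  have h := norm_inner_le_norm (𝕜 := ℂ) (WithLp.toLp 2 x) (WithLp.toLp 2 y)
  rwa [EuclideanSpace.inner_toLp_toLp, dotProduct_comm] at h

/-- The sesquilinear form `x^* A y`. -/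
def bil (A : Matrix ι ι ℂ) (x y : ι → ℂ) : ℂ := star x ⬝ᵥ A *ᵥ y

theorem bil_add (A B : Matrix ι ι ℂ) (x y : ι → ℂ) : bil (A + B) x y = bil A x y + bil B x y := by
  simp [bil, Matrix.add_mulVec]

theorem bil_sub (A B : Matrix ι ι ℂ) (x y : ι → ℂ) : bil (A - B) x y = bil A x y - bil B x y := by
  simp [bil, Matrix.sub_mulVec]

theorem bil_smul (c : ℂ) (A : Matrix ι ι ℂ) (x y : ι → ℂ) : bil (c • A) x y = c * bil A x y := by
  simp [bil, Matrix.smul_mulVec]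

theorem trace_mul_vecMulVec_mul (M Y : Matrix ι ι ℂ) (x y : ι → ℂ) :
    (M * Matrix.vecMulVec x (star y) * Y).trace = bil (Y * M) y x := by
  rw [Matrix.trace_mul_comm, ← Matrix.mul_assoc, Matrix.mul_vecMulVec, Matrix.trace_vecMulVec,
    dotProduct_comm, bil]

theorem bil_im_of_isHermitian {W : Matrix ι ι ℂ} (hW : W.IsHermitian) (x : ι → ℂ) :
    (bil W x x).im = 0 := by
  simpa [bil] using hW.im_star_dotProduct_mulVec_self x

variable [DecidableEq ι]

theorem vnorm_mulVec_le {κ : Type*} [Fintype κ] (A : Matrix κ ι ℂ) (x : ι → ℂ) :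
    vnorm (A *ᵥ x) ≤ ‖A‖ * vnorm x :=
  Matrix.l2_opNorm_mulVec A (WithLp.toLp 2 x)

theorem opNorm_le_of_vnorm {A : Matrix ι ι ℂ} {C : ℝ} (hC : 0 ≤ C)
    (h : ∀ x, vnorm (A *ᵥ x) ≤ C * vnorm x) : ‖A‖ ≤ C := by
  rw [Matrix.l2_opNorm_def]
  refine ContinuousLinearMap.opNorm_le_bound _ hC fun x => ?_
  exact h x.ofLp

theorem norm_bil_le (A : Matrix ι ι ℂ) (x y : ι → ℂ) :
    ‖bil A x y‖ ≤ ‖A‖ * (vnorm x * vnorm y) := by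
  refine (norm_star_dotProduct_le _ _).trans ?_
  calc vnorm x * vnorm (A *ᵥ y) ≤ vnorm x * (‖A‖ * vnorm y) := by
        gcongr
        · exact vnorm_nonneg x
        · exact vnorm_mulVec_le A y
    _ = _ := by ring

theorem norm_vecMulVec_star_le (x y : ι → ℂ) :
    ‖Matrix.vecMulVec x (star y)‖ ≤ vnorm x * vnorm y := by
  refine opNorm_le_of_vnorm (mul_nonneg (vnorm_nonneg _) (vnorm_nonneg _)) fun z => ?_
  have e : Matrix.vecMulVec x (star y) *ᵥ z = (star y ⬝ᵥ z) • x := by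
    rw [Matrix.vecMulVec_mulVec]
    ext i
    simp [mul_comm]
  have h1 : vnorm ((star y ⬝ᵥ z) • x) = ‖star y ⬝ᵥ z‖ * vnorm x := by
    rw [vnorm, WithLp.toLp_smul, norm_smul, vnorm]
  rw [e, h1]
  have := norm_star_dotProduct_le y z
  calc _ ≤ vnorm y * vnorm z * vnorm x := mul_le_mul_of_nonneg_right this (vnorm_nonneg x)
    _ = _ := by ring

/-- A matrix whose numerical range keeps away from zero is invertible, with a bound. -/
theorem isUnit_of_bil_ge {D : Matrix ι ι ℂ} {η : ℝ} (hη : 0 < η)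
    (h : ∀ x, η * vnorm x ^ 2 ≤ ‖bil D x x‖) : IsUnit D.det ∧ ‖D⁻¹‖ ≤ η⁻¹ := by
  have h1 : ∀ x, η * vnorm x ≤ vnorm (D *ᵥ x) := fun x => by
    rcases (vnorm_nonneg x).eq_or_lt with h0 | h0
    · rw [← h0, mul_zero]; exact vnorm_nonneg _
    · have h2 := (h x).trans (norm_star_dotProduct_le _ _)
      have h3 : vnorm x * (η * vnorm x) ≤ vnorm x * vnorm (D *ᵥ x) := by
        calc _ = η * vnorm x ^ 2 := by ring
          _ ≤ _ := h2
      exact le_of_mul_le_mul_left h3 h0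
  have hinj : Function.Injective D.mulVec := by
    intro x y hxy
    have h2 := h1 (x - y)
    rw [Matrix.mulVec_sub, sub_eq_zero.2 hxy] at h2
    have h3 : vnorm (0 : ι → ℂ) = 0 := by simp [vnorm]
    rw [h3] at h2
    have h4 : vnorm (x - y) = 0 := le_antisymm (by
      by_contra hlt
      push Not at hlt
      have := mul_pos hη hlt
      linarith) (vnorm_nonneg _)
    have h5 : WithLp.toLp 2 (x - y) = 0 := norm_eq_zero.1 h4
    have h6 : x - y = 0 := by
      have := congrArg WithLp.ofLp h5
      simpa using this
    exact sub_eq_zero.1 h6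
  have hu : IsUnit D := Matrix.mulVec_injective_iff_isUnit.1 hinj
  have hdet := (Matrix.isUnit_iff_isUnit_det D).1 hu
  refine ⟨hdet, opNorm_le_of_vnorm (inv_nonneg.2 hη.le) fun y => ?_⟩
  have h2 := h1 (D⁻¹ *ᵥ y)
  rw [Matrix.mulVec_mulVec, Matrix.mul_nonsing_inv _ hdet, Matrix.one_mulVec] at h2
  rw [inv_mul_eq_div, le_div_iff₀ hη]
  linarith

theorem bil_one (x : ι → ℂ) : bil 1 x x = ((vnorm x ^ 2 : ℝ) : ℂ) := by
  rw [bil, Matrix.one_mulVec, star_dotProduct_self]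

/-- The resolvent `(W - w)⁻¹`. -/
def resolv (W : Matrix ι ι ℂ) (w : ℂ) : Matrix ι ι ℂ := (W - w • 1)⁻¹

/-- For Hermitian W the form x*(W - w)x has imaginary part -Im w |x|², so the numerical range stays
at distance Im w from zero. -/
theorem resolv_aux {W : Matrix ι ι ℂ} (hW : W.IsHermitian) {w : ℂ} (hw : 0 < w.im) :
    IsUnit (W - w • 1).det ∧ ‖resolv W w‖ ≤ (w.im)⁻¹ := by
  refine isUnit_of_bil_ge hw fun x => ?_
  have h1 : (bil (W - w • 1) x x).im = -(w.im * vnorm x ^ 2) := by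
    rw [bil_sub, bil_smul, bil_one, Complex.sub_im, bil_im_of_isHermitian hW, zero_sub,
      Complex.im_mul_ofReal]
  have h2 := Complex.abs_im_le_norm (bil (W - w • 1) x x)
  rw [h1, abs_neg, abs_of_nonneg (by positivity)] at h2
  exact h2

theorem norm_resolv_le {W : Matrix ι ι ℂ} (hW : W.IsHermitian) {w : ℂ} (hw : 0 < w.im) :
    ‖resolv W w‖ ≤ (w.im)⁻¹ := (resolv_aux hW hw).2

theorem sub_mul_resolv {W : Matrix ι ι ℂ} (hW : W.IsHermitian) {w : ℂ} (hw : 0 < w.im) :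
    (W - w • 1) * resolv W w = 1 := Matrix.mul_nonsing_inv _ (resolv_aux hW hw).1

theorem resolv_mul_sub {W : Matrix ι ι ℂ} (hW : W.IsHermitian) {w : ℂ} (hw : 0 < w.im) :
    resolv W w * (W - w • 1) = 1 := Matrix.nonsing_inv_mul _ (resolv_aux hW hw).1

theorem mul_resolv {W : Matrix ι ι ℂ} (hW : W.IsHermitian) {w : ℂ} (hw : 0 < w.im) :
    W * resolv W w = 1 + w • resolv W w := by
  have h := sub_mul_resolv hW hw
  rw [Matrix.sub_mul, Matrix.smul_mul, Matrix.one_mul] at h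
  rw [← h]
  abel

theorem resolv_sub_resolv {W W' : Matrix ι ι ℂ} (hW : W.IsHermitian) (hW' : W'.IsHermitian)
    {w : ℂ} (hw : 0 < w.im) :
    resolv W w - resolv W' w = resolv W w * (W' - W) * resolv W' w := by
  have h1 := resolv_mul_sub hW hw
  have h2 := sub_mul_resolv hW' hw
  have e : W' - W = (W' - w • 1) - (W - w • 1) := by abel
  rw [e, Matrix.mul_sub, Matrix.sub_mul, h1, Matrix.mul_assoc, h2, Matrix.mul_one, Matrix.one_mul]

/-- With y = (W - w)⁻¹x the form x*y is the conjugate of y*(W - w)y, whose imaginary part is -Im w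
|y|². -/
theorem resolv_im_nonneg {W : Matrix ι ι ℂ} (hW : W.IsHermitian) {w : ℂ} (hw : 0 < w.im)
    (x : ι → ℂ) : 0 ≤ (bil (resolv W w) x x).im := by
  set y := resolv W w *ᵥ x with hy
  have hx : x = (W - w • 1) *ᵥ y := by
    rw [hy, Matrix.mulVec_mulVec, sub_mul_resolv hW hw, Matrix.one_mulVec]
  have h1 : bil (resolv W w) x x = star x ⬝ᵥ y := rfl
  have h2 : star (star x ⬝ᵥ y) = bil (W - w • 1) y y := by
    rw [bil, ← hx, ← Matrix.star_dotProduct_star, star_star, dotProduct_comm]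
  have h3 : (bil (W - w • 1) y y).im = -(w.im * vnorm y ^ 2) := by
    rw [bil_sub, bil_smul, bil_one, Complex.sub_im, bil_im_of_isHermitian hW, zero_sub,
      Complex.im_mul_ofReal]
  rw [← h2] at h3
  rw [h1]
  have h4 : (star (star x ⬝ᵥ y)).im = -(star x ⬝ᵥ y).im := by
    rw [Complex.star_def, Complex.conj_im]
  rw [h4, neg_inj] at h3
  rw [h3]
  positivity

theorem norm_diag_le (C : Matrix ι ι ℂ) (i : ι) : ‖C i i‖ ≤ ‖C‖ := by
  have e : C i i = bil C (Pi.single i 1) (Pi.single i 1) := by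
    rw [bil, Matrix.mulVec_single_one]
    have : star (Pi.single i (1 : ℂ) : ι → ℂ) = Pi.single i 1 := by
      rw [← Pi.single_star, star_one]
    rw [this, single_one_dotProduct]
    rfl
  have h2 : vnorm (Pi.single i (1 : ℂ) : ι → ℂ) = 1 := by
    simp [vnorm]
  have := norm_bil_le C (Pi.single i 1) (Pi.single i 1)
  rw [← e, h2, mul_one, mul_one] at this
  exact this

theorem norm_trace_le (C : Matrix ι ι ℂ) : ‖C.trace‖ ≤ Fintype.card ι * ‖C‖ := by
  rw [Matrix.trace]
  refine (norm_sum_le _ _).trans ?_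
  calc ∑ i, ‖C.diag i‖ ≤ ∑ _i : ι, ‖C‖ := Finset.sum_le_sum fun i _ => norm_diag_le C i
    _ = _ := by simp

/-- The trace is bounded by the rank times the operator norm. -/
theorem norm_trace_le_rank (C : Matrix ι ι ℂ) : ‖C.trace‖ ≤ C.rank * ‖C‖ := by
  -- The trace is computed in an orthonormal eigenbasis of C C*. A basis vector b with eigenvalue
  -- zero satisfies C*b = 0 and contributes nothing, and exactly rank C vectors remain.
  have hH : (C * Cᴴ).IsHermitian := Matrix.isHermitian_mul_conjTranspose_self C
  have hrank : Fintype.card {i // hH.eigenvalues i ≠ 0} = C.rank := by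
    rw [← hH.rank_eq_card_non_zero_eigs, Matrix.rank_self_mul_conjTranspose]
  set b := hH.eigenvectorBasis with hb
  have htr : C.trace = ∑ i, bil C (b i).ofLp (b i).ofLp := by
    have h1 := LinearMap.trace_eq_sum_inner (𝕜 := ℂ) (Matrix.toEuclideanLin C) b
    have h2 : LinearMap.trace ℂ _ (Matrix.toEuclideanLin C) = C.trace := by
      rw [Matrix.toEuclideanLin_eq_toLin_orthonormal, Matrix.trace_toLin_eq]
    rw [← h2, h1]
    refine Finset.sum_congr rfl fun i _ => ?_
    rw [bil, EuclideanSpace.inner_eq_star_dotProduct, dotProduct_comm]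
    rfl
  have hnorm : ∀ i, vnorm (b i).ofLp = 1 := fun i => b.orthonormal.1 i
  have hzero : ∀ i, hH.eigenvalues i = 0 → bil C (b i).ofLp (b i).ofLp = 0 := by
    intro i hi
    have h1 := hH.mulVec_eigenvectorBasis i
    rw [hi, zero_smul] at h1
    have h2 : star (Cᴴ *ᵥ (b i).ofLp) ⬝ᵥ (Cᴴ *ᵥ (b i).ofLp) = 0 := by
      rw [Matrix.star_mulVec, Matrix.conjTranspose_conjTranspose, ← Matrix.dotProduct_mulVec,
        Matrix.mulVec_mulVec, hb, h1, dotProduct_zero]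
    have h3 : Cᴴ *ᵥ (b i).ofLp = 0 := dotProduct_star_self_eq_zero.1 h2
    have h4 := congrArg star h3
    rw [Matrix.star_mulVec, Matrix.conjTranspose_conjTranspose, star_zero] at h4
    rw [bil, Matrix.dotProduct_mulVec, h4, zero_dotProduct]
  rw [htr]
  refine (norm_sum_le _ _).trans ?_
  have h5 : ∀ i, ‖bil C (b i).ofLp (b i).ofLp‖ ≤ if hH.eigenvalues i ≠ 0 then ‖C‖ else 0 := by
    intro i
    split_ifs with h
    · have := norm_bil_le C (b i).ofLp (b i).ofLp
      rwa [hnorm, mul_one, mul_one] at this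
    · rw [hzero i (not_not.1 h), norm_zero]
  calc _ ≤ ∑ i, (if hH.eigenvalues i ≠ 0 then ‖C‖ else 0) := Finset.sum_le_sum fun i _ => h5 i
    _ = (Finset.univ.filter fun i => hH.eigenvalues i ≠ 0).card * ‖C‖ := by
        rw [← Finset.sum_filter, Finset.sum_const, nsmul_eq_mul]
    _ = _ := by rw [← hrank, Fintype.card_subtype]

/-- Finite-rank perturbations move traces of resolvents by a bounded amount. -/
theorem norm_trace_mul_resolv_sub_le {W W' : Matrix ι ι ℂ} (hW : W.IsHermitian)
    (hW' : W'.IsHermitian) {w : ℂ} (hw : 0 < w.im) (M : Matrix ι ι ℂ) :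
    ‖(M * resolv W w).trace - (M * resolv W' w).trace‖ ≤
      (W' - W).rank * (‖M‖ * (2 * (w.im)⁻¹)) := by
  have h1 : (M * resolv W w).trace - (M * resolv W' w).trace =
      (M * (resolv W w - resolv W' w)).trace := by
    rw [Matrix.mul_sub, Matrix.trace_sub]
  rw [h1]
  refine (norm_trace_le_rank _).trans ?_
  have hr : (M * (resolv W w - resolv W' w)).rank ≤ (W' - W).rank := by
    refine (Matrix.rank_mul_le_right _ _).trans ?_
    rw [resolv_sub_resolv hW hW' hw]
    exact (Matrix.rank_mul_le_left _ _).trans (Matrix.rank_mul_le_right _ _)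
  have hn : ‖M * (resolv W w - resolv W' w)‖ ≤ ‖M‖ * (2 * (w.im)⁻¹) := by
    refine (norm_mul_le _ _).trans ?_
    gcongr
    refine (norm_sub_le _ _).trans ?_
    linarith [norm_resolv_le hW hw, norm_resolv_le hW' hw]
  have : ((M * (resolv W w - resolv W' w)).rank : ℝ) ≤ (W' - W).rank := by exact_mod_cast hr
  gcongr

end Resolvent

end SumSeparable
end

/-! ### Rank-two perturbations to second order -/

noncomputable section

namespace SumSeparable

open scoped Matrix.Norms.L2Operator

section RankTwo

variable {ι : Type*}

/-- The Hermitian matrix `ζ u v^* + ζ̄ v u^*`. -/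
def rankTwo (u v : ι → ℂ) (ζ : ℂ) : Matrix ι ι ℂ :=
  ζ • Matrix.vecMulVec u (star v) + star ζ • Matrix.vecMulVec v (star u)

theorem rankTwo_isHermitian (u v : ι → ℂ) (ζ : ℂ) : (rankTwo u v ζ).IsHermitian := by
  ext i j
  simp only [rankTwo, Matrix.conjTranspose_apply, Matrix.add_apply, Matrix.smul_apply,
    Matrix.vecMulVec_apply, Pi.star_apply, smul_eq_mul, star_add, star_mul', star_star]
  ring

variable [Fintype ι]

theorem trace_mul_rankTwo_mul (M Y : Matrix ι ι ℂ) (u v : ι → ℂ) (ζ : ℂ) :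
    (M * rankTwo u v ζ * Y).trace = ζ * bil (Y * M) v u + star ζ * bil (Y * M) u v := by
  rw [rankTwo, Matrix.mul_add, Matrix.add_mul, Matrix.trace_add, Matrix.mul_smul, Matrix.mul_smul,
    Matrix.smul_mul, Matrix.smul_mul, Matrix.trace_smul, Matrix.trace_smul,
    trace_mul_vecMulVec_mul, trace_mul_vecMulVec_mul, smul_eq_mul, smul_eq_mul]

theorem bil_mul_vecMulVec_mul (Y Z : Matrix ι ι ℂ) (x y p q : ι → ℂ) :
    bil (Y * Matrix.vecMulVec p (star q) * Z) x y = bil Y x p * bil Z q y := by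
  simp only [bil]
  rw [← Matrix.mulVec_mulVec, ← Matrix.mulVec_mulVec, Matrix.vecMulVec_mulVec, Matrix.mulVec_smul]
  simp [mul_comm]

/-- The main term of the second-order expansion. -/
def mainTerm (M : Matrix ι ι ℂ) (u v : ι → ℂ) (Y : Matrix ι ι ℂ) : ℂ :=
  bil Y v v * bil (Y * M) u u + bil Y u u * bil (Y * M) v v

/-- The term of the second-order expansion that carries the pseudo-variance. -/
def pseudoTerm (M : Matrix ι ι ℂ) (u v : ι → ℂ) (Y : Matrix ι ι ℂ) : ℂ :=
  bil Y v u * bil (Y * M) v u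

/-- Sorting by powers of ζ and ζ̄ separates the part with |ζ|², of mean one, which produces the
self-energy, from the parts with ζ² and ζ̄², whose means are not prescribed and which must be
negligible after summation. -/
theorem trace_mul_rankTwo_mul_rankTwo_mul (M Y : Matrix ι ι ℂ) (u v : ι → ℂ) (ζ : ℂ) :
    (M * rankTwo u v ζ * (Y * rankTwo u v ζ * Y)).trace =
      (ζ * star ζ) * mainTerm M u v Y + ζ ^ 2 * pseudoTerm M u v Y +
        star ζ ^ 2 * pseudoTerm M v u Y := by
  have h : ∀ x y : ι → ℂ, bil (Y * rankTwo u v ζ * Y * M) x y =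
      ζ * (bil Y x u * bil (Y * M) v y) + star ζ * (bil Y x v * bil (Y * M) u y) := by
    intro x y
    rw [Matrix.mul_assoc _ Y M, rankTwo, Matrix.mul_add, Matrix.add_mul, bil_add, Matrix.mul_smul,
      Matrix.mul_smul, Matrix.smul_mul, Matrix.smul_mul, bil_smul, bil_smul,
      bil_mul_vecMulVec_mul, bil_mul_vecMulVec_mul]
  rw [trace_mul_rankTwo_mul, h, h, mainTerm, pseudoTerm, pseudoTerm]
  ring

variable [DecidableEq ι]

theorem norm_rankTwo_le (u v : ι → ℂ) (ζ : ℂ) :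
    ‖rankTwo u v ζ‖ ≤ 2 * ‖ζ‖ * (vnorm u * vnorm v) := by
  rw [rankTwo]
  refine (norm_add_le _ _).trans ?_
  rw [norm_smul, norm_smul, norm_star]
  have h1 := mul_le_mul_of_nonneg_left (norm_vecMulVec_star_le u v) (norm_nonneg ζ)
  have h2 := mul_le_mul_of_nonneg_left (norm_vecMulVec_star_le v u) (norm_nonneg ζ)
  nlinarith

/-- Deviation of products of two sesquilinear forms. -/
theorem norm_bil_mul_bil_sub_le (M Y Y' : Matrix ι ι ℂ) {B δ : ℝ} (hB : 0 ≤ B) (hY : ‖Y‖ ≤ B)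
    (hY' : ‖Y'‖ ≤ B) (hδ : ‖Y - Y'‖ ≤ δ) (x y x' y' : ι → ℂ) :
    ‖bil Y x y * bil (Y * M) x' y' - bil Y' x y * bil (Y' * M) x' y'‖ ≤
      2 * (δ * B * ‖M‖ * (vnorm x * vnorm y * (vnorm x' * vnorm y'))) := by
  have hx := vnorm_nonneg x
  have hy := vnorm_nonneg y
  have hx' := vnorm_nonneg x'
  have hy' := vnorm_nonneg y'
  have hδ0 : 0 ≤ δ := (norm_nonneg _).trans hδ
  have e : bil Y x y * bil (Y * M) x' y' - bil Y' x y * bil (Y' * M) x' y' =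
      bil (Y - Y') x y * bil (Y * M) x' y' + bil Y' x y * bil ((Y - Y') * M) x' y' := by
    rw [Matrix.sub_mul, bil_sub, bil_sub]; ring
  rw [e]
  refine (norm_add_le _ _).trans ?_
  rw [norm_mul, norm_mul]
  have h1 : ‖bil (Y - Y') x y‖ ≤ δ * (vnorm x * vnorm y) :=
    (norm_bil_le _ _ _).trans (by gcongr)
  have h2 : ‖bil (Y * M) x' y'‖ ≤ B * ‖M‖ * (vnorm x' * vnorm y') :=
    (norm_bil_le _ _ _).trans (by
      gcongr
      exact (norm_mul_le _ _).trans (by gcongr))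
  have h3 : ‖bil Y' x y‖ ≤ B * (vnorm x * vnorm y) :=
    (norm_bil_le _ _ _).trans (by gcongr)
  have h4 : ‖bil ((Y - Y') * M) x' y'‖ ≤ δ * ‖M‖ * (vnorm x' * vnorm y') :=
    (norm_bil_le _ _ _).trans (by
      gcongr
      exact (norm_mul_le _ _).trans (by gcongr))
  calc _ ≤ δ * (vnorm x * vnorm y) * (B * ‖M‖ * (vnorm x' * vnorm y')) +
        B * (vnorm x * vnorm y) * (δ * ‖M‖ * (vnorm x' * vnorm y')) := by gcongr
    _ = _ := by ring

theorem norm_resolv_add_rankTwo_sub_le {W₀ : Matrix ι ι ℂ} (hW₀ : W₀.IsHermitian) {w : ℂ}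
    (hw : 0 < w.im) (u v : ι → ℂ) (ζ : ℂ) :
    ‖resolv (W₀ + rankTwo u v ζ) w - resolv W₀ w‖ ≤
      2 * ‖ζ‖ * (vnorm u * vnorm v) * (w.im)⁻¹ ^ 2 := by
  have hW := hW₀.add (rankTwo_isHermitian u v ζ)
  rw [resolv_sub_resolv hW hW₀ hw]
  have h1 := norm_resolv_le hW hw
  have h2 := norm_resolv_le hW₀ hw
  have h3 : ‖W₀ - (W₀ + rankTwo u v ζ)‖ ≤ 2 * ‖ζ‖ * (vnorm u * vnorm v) := by
    rw [sub_add_cancel_left, norm_neg]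
    exact norm_rankTwo_le u v ζ
  have hη : 0 ≤ (w.im)⁻¹ := inv_nonneg.2 hw.le
  have hκ : 0 ≤ 2 * ‖ζ‖ * (vnorm u * vnorm v) := (norm_nonneg _).trans h3
  calc _ ≤ ‖resolv (W₀ + rankTwo u v ζ) w‖ * ‖W₀ - (W₀ + rankTwo u v ζ)‖ * ‖resolv W₀ w‖ :=
        (norm_mul_le _ _).trans (by gcongr; exact norm_mul_le _ _)
    _ ≤ (w.im)⁻¹ * (2 * ‖ζ‖ * (vnorm u * vnorm v)) * (w.im)⁻¹ := by gcongr
    _ = _ := by ring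

/-- Second-order expansion of the resolvent in a rank-two perturbation, inside a trace. -/
theorem norm_trace_expansion_le {W₀ : Matrix ι ι ℂ} (hW₀ : W₀.IsHermitian) {w : ℂ}
    (hw : 0 < w.im) (M : Matrix ι ι ℂ) (u v : ι → ℂ) (ζ : ℂ) :
    ‖(M * rankTwo u v ζ * resolv (W₀ + rankTwo u v ζ) w).trace -
        (ζ * bil (resolv W₀ w * M) v u + star ζ * bil (resolv W₀ w * M) u v) +
        ((ζ * star ζ) * mainTerm M u v (resolv W₀ w) + ζ ^ 2 * pseudoTerm M u v (resolv W₀ w) +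
          star ζ ^ 2 * pseudoTerm M v u (resolv W₀ w))‖ ≤
      8 * ‖ζ‖ ^ 3 * (vnorm u * vnorm v) ^ 3 * ‖M‖ * (w.im)⁻¹ ^ 3 := by
  have hW := hW₀.add (rankTwo_isHermitian u v ζ)
  set V := rankTwo u v ζ with hV
  set G := resolv (W₀ + V) w with hG
  set G₀ := resolv W₀ w with hG₀
  have e1 : G - G₀ = -(G * V * G₀) := by
    rw [hG, hG₀, resolv_sub_resolv hW hW₀ hw, sub_add_cancel_left, Matrix.mul_neg, Matrix.neg_mul]
  -- The resolvent identity used twice. Only the last term still contains the full resolvent, and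
  -- together with the V in front of G in the trace it is of third order.
  have e2 : G = G₀ - G₀ * V * G₀ + G * V * G₀ * V * G₀ := by
    have h1 : G = G₀ - G * V * G₀ := by
      rw [sub_eq_add_neg, ← e1]
      abel
    have h2 : G * V * G₀ = G₀ * V * G₀ - G * V * G₀ * V * G₀ := by
      conv_lhs => rw [h1]
      rw [Matrix.sub_mul, Matrix.sub_mul]
    conv_lhs => rw [h1, h2]
    abel
  have e3 : (M * V * G).trace - (ζ * bil (G₀ * M) v u + star ζ * bil (G₀ * M) u v) +
      ((ζ * star ζ) * mainTerm M u v G₀ + ζ ^ 2 * pseudoTerm M u v G₀ +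
        star ζ ^ 2 * pseudoTerm M v u G₀) = (M * V * (G * V * G₀ * V * G₀)).trace := by
    rw [← trace_mul_rankTwo_mul, ← trace_mul_rankTwo_mul_rankTwo_mul, ← hV]
    conv_lhs => rw [e2]
    rw [Matrix.mul_add, Matrix.mul_sub, Matrix.trace_add, Matrix.trace_sub]
    ring
  rw [e3, hV, trace_mul_rankTwo_mul, ← hV]
  have hη : 0 ≤ (w.im)⁻¹ := inv_nonneg.2 hw.le
  have hu := vnorm_nonneg u
  have hv := vnorm_nonneg v
  have hVn : ‖V‖ ≤ 2 * ‖ζ‖ * (vnorm u * vnorm v) := norm_rankTwo_le u v ζ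
  have hGn : ‖G‖ ≤ (w.im)⁻¹ := norm_resolv_le hW hw
  have hGn₀ : ‖G₀‖ ≤ (w.im)⁻¹ := norm_resolv_le hW₀ hw
  have hn : ‖G * V * G₀ * V * G₀ * M‖ ≤ (w.im)⁻¹ * (2 * ‖ζ‖ * (vnorm u * vnorm v)) * (w.im)⁻¹ *
      (2 * ‖ζ‖ * (vnorm u * vnorm v)) * (w.im)⁻¹ * ‖M‖ := by
    calc _ ≤ ‖G‖ * ‖V‖ * ‖G₀‖ * ‖V‖ * ‖G₀‖ * ‖M‖ := by
          refine (norm_mul_le _ _).trans ?_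
          gcongr
          refine (norm_mul_le _ _).trans ?_
          gcongr
          refine (norm_mul_le _ _).trans ?_
          gcongr
          refine (norm_mul_le _ _).trans ?_
          gcongr
          exact norm_mul_le _ _
      _ ≤ _ := by gcongr
  refine (norm_add_le _ _).trans ?_
  rw [norm_mul, norm_mul, norm_star]
  have h1 := (norm_bil_le (G * V * G₀ * V * G₀ * M) v u).trans
    (mul_le_mul_of_nonneg_right hn (mul_nonneg hv hu))
  have h2 := (norm_bil_le (G * V * G₀ * V * G₀ * M) u v).trans
    (mul_le_mul_of_nonneg_right hn (mul_nonneg hu hv))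
  calc _ ≤ ‖ζ‖ * _ + ‖ζ‖ * _ := add_le_add (mul_le_mul_of_nonneg_left h1 (norm_nonneg _))
        (mul_le_mul_of_nonneg_left h2 (norm_nonneg _))
    _ = _ := by ring

/-- Serves to restore the full resolvent after expectations have been factorized with one entry
removed. The price is one more power of the entry. -/
theorem norm_mainTerm_sub_le {W₀ : Matrix ι ι ℂ} (hW₀ : W₀.IsHermitian) {w : ℂ}
    (hw : 0 < w.im) (M : Matrix ι ι ℂ) (u v : ι → ℂ) (ζ : ℂ) :
    ‖mainTerm M u v (resolv (W₀ + rankTwo u v ζ) w) - mainTerm M u v (resolv W₀ w)‖ ≤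
      8 * ‖ζ‖ * (vnorm u * vnorm v) ^ 3 * ‖M‖ * (w.im)⁻¹ ^ 3 := by
  have hW := hW₀.add (rankTwo_isHermitian u v ζ)
  have hη : 0 ≤ (w.im)⁻¹ := inv_nonneg.2 hw.le
  have h := fun x y x' y' => norm_bil_mul_bil_sub_le M _ _ hη (norm_resolv_le hW hw)
    (norm_resolv_le hW₀ hw) (norm_resolv_add_rankTwo_sub_le hW₀ hw u v ζ) x y x' y'
  rw [mainTerm, mainTerm, add_sub_add_comm]
  refine (norm_add_le _ _).trans ((add_le_add (h v v u u) (h u u v v)).trans_eq ?_)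
  ring

theorem norm_pseudoTerm_sub_le {W₀ : Matrix ι ι ℂ} (hW₀ : W₀.IsHermitian) {w : ℂ}
    (hw : 0 < w.im) (M : Matrix ι ι ℂ) (u v : ι → ℂ) (ζ : ℂ) :
    ‖pseudoTerm M u v (resolv (W₀ + rankTwo u v ζ) w) - pseudoTerm M u v (resolv W₀ w)‖ ≤
      4 * ‖ζ‖ * (vnorm u * vnorm v) ^ 3 * ‖M‖ * (w.im)⁻¹ ^ 3 := by
  have hW := hW₀.add (rankTwo_isHermitian u v ζ)
  have hη : 0 ≤ (w.im)⁻¹ := inv_nonneg.2 hw.le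
  have h := fun x y x' y' => norm_bil_mul_bil_sub_le M _ _ hη (norm_resolv_le hW hw)
    (norm_resolv_le hW₀ hw) (norm_resolv_add_rankTwo_sub_le hW₀ hw u v ζ) x y x' y'
  rw [pseudoTerm, pseudoTerm]
  refine (h v u v u).trans_eq ?_
  ring

end RankTwo

end SumSeparable
end

/-! ### The linear model: contribution of a single entry -/

noncomputable section

namespace SumSeparable

open scoped Matrix.Norms.L2Operator

section Dyson

variable {ι : Type*} {α : Type*} [Fintype α]

/-- The Hermitian matrix `∑ a, (x_a u_a v_a^* + x̄_a v_a u_a^*)`. -/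
def linModel (u v : α → ι → ℂ) (x : α → ℂ) : Matrix ι ι ℂ := ∑ a, rankTwo (u a) (v a) (x a)

theorem linModel_isHermitian (u v : α → ι → ℂ) (x : α → ℂ) : (linModel u v x).IsHermitian := by
  rw [linModel, Matrix.IsHermitian, Matrix.conjTranspose_sum]
  exact Finset.sum_congr rfl fun a _ => rankTwo_isHermitian _ _ _

theorem continuous_linModel (u v : α → ι → ℂ) : Continuous (linModel u v) := by
  refine continuous_finsetSum _ fun a _ => ?_
  unfold rankTwo
  exact ((continuous_apply a).smul continuous_const).add
    ((continuous_star.comp (continuous_apply a)).smul continuous_const)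

theorem linModel_update [DecidableEq α] (u v : α → ι → ℂ) (x : α → ℂ) (a : α) :
    linModel u v (Function.update x a 0) + rankTwo (u a) (v a) (x a) = linModel u v x := by
  have h0 : rankTwo (u a) (v a) 0 = 0 := by simp [rankTwo]
  rw [linModel, linModel, ← Finset.add_sum_erase _ _ (Finset.mem_univ a),
    ← Finset.add_sum_erase _ (fun b => rankTwo (u b) (v b) (x b)) (Finset.mem_univ a),
    Function.update_self, h0, zero_add, add_comm]
  congr 1
  refine Finset.sum_congr rfl fun b hb => ?_
  rw [Function.update_of_ne (Finset.ne_of_mem_erase hb)]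

variable {Ω : Type*} [MeasurableSpace Ω] {P : Measure Ω}

/-- Removing an entry leaves a function of the other entries alone. Functionals of the reduced
resolvent are therefore independent of that entry. -/
theorem indepFun_update [DecidableEq α] {ζ : α → Ω → ℂ} (hm : ∀ a, Measurable (ζ a))
    (hind : iIndepFun ζ P) (a : α) :
    IndepFun (ζ a) (fun ω => Function.update (fun b => ζ b ω) a 0) P := by
  have h := hind.indepFun_finset {a} (Finset.univ.erase a) (by simp) hm
  have hφ : Measurable fun x : ↥({a} : Finset α) → ℂ => x ⟨a, Finset.mem_singleton_self a⟩ :=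
    measurable_pi_apply _
  have hψ : Measurable fun (x : ↥(Finset.univ.erase a) → ℂ) (b : α) =>
      if hb : b ∈ Finset.univ.erase a then x ⟨b, hb⟩ else 0 := by
    refine measurable_pi_lambda _ fun b => ?_
    by_cases hb : b ∈ Finset.univ.erase a
    · simp only [hb, dite_true]; exact measurable_pi_apply _
    · simp only [hb, dite_false]; exact measurable_const
  have h2 := h.comp hφ hψ
  have e : (fun ω => Function.update (fun b => ζ b ω) a 0) = (fun (x : ↥(Finset.univ.erase a) → ℂ)
      (b : α) => if hb : b ∈ Finset.univ.erase a then x ⟨b, hb⟩ else 0) ∘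
      fun ω (i : ↥(Finset.univ.erase a)) => ζ i ω := by
    funext ω b
    by_cases hb : b = a
    · subst hb; simp
    · simp [hb]
  rw [e]
  exact h2

variable [IsProbabilityMeasure P] [Fintype ι]

theorem continuous_bil {X : Type*} [TopologicalSpace X] {f : X → Matrix ι ι ℂ}
    (hf : Continuous f) (x y : ι → ℂ) : Continuous fun t => bil (f t) x y :=
  Continuous.dotProduct continuous_const (hf.matrix_mulVec continuous_const)

variable [DecidableEq ι]

/-- By Cramer's formula, since the determinant does not vanish off the real axis. All measurability
statements about resolvents rest on it. -/
theorem continuous_resolv_comp {X : Type*} [TopologicalSpace X] {f : X → Matrix ι ι ℂ}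
    (hf : Continuous f) (hH : ∀ x, (f x).IsHermitian) {w : ℂ} (hw : 0 < w.im) :
    Continuous fun x => resolv (f x) w := by
  have h1 : Continuous fun x => f x - w • (1 : Matrix ι ι ℂ) := hf.sub continuous_const
  have h2 : ∀ x, (f x - w • (1 : Matrix ι ι ℂ)).det ≠ 0 := fun x => (resolv_aux (hH x) hw).1.ne_zero
  have e : (fun x => resolv (f x) w) = fun x =>
      (f x - w • (1 : Matrix ι ι ℂ)).det⁻¹ • (f x - w • (1 : Matrix ι ι ℂ)).adjugate := by
    funext x
    rw [resolv, Matrix.inv_def, Ring.inverse_eq_inv']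
  rw [e]
  exact (h1.matrix_det.inv₀ h2).smul h1.matrix_adjugate

theorem norm_mainTerm_le (M : Matrix ι ι ℂ) (u v : ι → ℂ) {Y : Matrix ι ι ℂ} {B : ℝ}
    (hY : ‖Y‖ ≤ B) : ‖mainTerm M u v Y‖ ≤ 2 * (B ^ 2 * ‖M‖ * (vnorm u * vnorm v) ^ 2) := by
  have hu := vnorm_nonneg u
  have hv := vnorm_nonneg v
  have hB : 0 ≤ B := (norm_nonneg _).trans hY
  have h1 : ∀ x : ι → ℂ, ‖bil Y x x‖ ≤ B * (vnorm x * vnorm x) := fun x =>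
    (norm_bil_le _ _ _).trans (mul_le_mul_of_nonneg_right hY
      (mul_nonneg (vnorm_nonneg x) (vnorm_nonneg x)))
  have h2 : ∀ x : ι → ℂ, ‖bil (Y * M) x x‖ ≤ B * ‖M‖ * (vnorm x * vnorm x) := fun x =>
    (norm_bil_le _ _ _).trans (mul_le_mul_of_nonneg_right
      ((norm_mul_le _ _).trans (mul_le_mul_of_nonneg_right hY (norm_nonneg _)))
      (mul_nonneg (vnorm_nonneg x) (vnorm_nonneg x)))
  rw [mainTerm]
  refine (norm_add_le _ _).trans ?_
  rw [norm_mul, norm_mul]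
  calc _ ≤ B * (vnorm v * vnorm v) * (B * ‖M‖ * (vnorm u * vnorm u)) +
        B * (vnorm u * vnorm u) * (B * ‖M‖ * (vnorm v * vnorm v)) :=
        add_le_add (mul_le_mul (h1 v) (h2 u) (norm_nonneg _) (by positivity))
          (mul_le_mul (h1 u) (h2 v) (norm_nonneg _) (by positivity))
    _ = _ := by ring

theorem norm_pseudoTerm_le (M : Matrix ι ι ℂ) (u v : ι → ℂ) {Y : Matrix ι ι ℂ} {B : ℝ}
    (hY : ‖Y‖ ≤ B) : ‖pseudoTerm M u v Y‖ ≤ B ^ 2 * ‖M‖ * (vnorm u * vnorm v) ^ 2 := by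
  have hu := vnorm_nonneg u
  have hv := vnorm_nonneg v
  have hB : 0 ≤ B := (norm_nonneg _).trans hY
  have h1 : ‖bil Y v u‖ ≤ B * (vnorm v * vnorm u) :=
    (norm_bil_le _ _ _).trans (mul_le_mul_of_nonneg_right hY (mul_nonneg hv hu))
  have h2 : ‖bil (Y * M) v u‖ ≤ B * ‖M‖ * (vnorm v * vnorm u) :=
    (norm_bil_le _ _ _).trans (mul_le_mul_of_nonneg_right
      ((norm_mul_le _ _).trans (mul_le_mul_of_nonneg_right hY (norm_nonneg _)))
      (mul_nonneg hv hu))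
  rw [pseudoTerm, norm_mul]
  calc _ ≤ B * (vnorm v * vnorm u) * (B * ‖M‖ * (vnorm v * vnorm u)) :=
        mul_le_mul h1 h2 (norm_nonneg _) (by positivity)
    _ = _ := by ring

set_option maxHeartbeats 800000 in
/-- The contribution of one entry to the expectation of `tr (M W G)`. -/
theorem norm_integral_trace_add_mainTerm_le [DecidableEq α] {ζ : α → Ω → ℂ}
    (hm : ∀ a, Measurable (ζ a)) (hind : iIndepFun ζ P) (a : α) (hmean : ∫ ω, ζ a ω ∂P = 0)
    (hvar : ∫ ω, ‖ζ a ω‖ ^ 2 ∂P = 1) {m : ℝ} (hInt : Integrable (fun ω => ‖ζ a ω‖ ^ 3) P)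
    (hm3 : ∫ ω, ‖ζ a ω‖ ^ 3 ∂P ≤ m) (u v : α → ι → ℂ) (M : Matrix ι ι ℂ) {w : ℂ}
    (hw : 0 < w.im) :
    ‖∫ ω, (M * rankTwo (u a) (v a) (ζ a ω) * resolv (linModel u v fun b => ζ b ω) w).trace ∂P +
        ∫ ω, mainTerm M (u a) (v a) (resolv (linModel u v fun b => ζ b ω) w) ∂P‖ ≤
      ∫ ω, ‖pseudoTerm M (u a) (v a) (resolv (linModel u v fun b => ζ b ω) w)‖ ∂P +
      ∫ ω, ‖pseudoTerm M (v a) (u a) (resolv (linModel u v fun b => ζ b ω) w)‖ ∂P +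
      (16 + 24 * m) * ((vnorm (u a) * vnorm (v a)) ^ 3 * ‖M‖ * (w.im)⁻¹ ^ 3) := by
  set κ := (vnorm (u a) * vnorm (v a)) ^ 3 * ‖M‖ * (w.im)⁻¹ ^ 3 with hκ
  have hκ0 : 0 ≤ κ := by
    have := vnorm_nonneg (u a)
    have := vnorm_nonneg (v a)
    positivity
  let Y : Ω → α → ℂ := fun ω => Function.update (fun b => ζ b ω) a 0
  have hζm : Measurable fun ω => (fun b => ζ b ω : α → ℂ) := measurable_pi_lambda _ hm
  have hYm : Measurable Y := measurable_pi_lambda _ fun b => by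
    by_cases hb : b = a
    · subst hb; simp only [Y, Function.update_self]; exact measurable_const
    · simp only [Y, Function.update_of_ne hb]; exact hm b
  have hI : IndepFun (ζ a) Y P := indepFun_update hm hind a
  obtain ⟨R, hR⟩ : ∃ R : (α → ℂ) → Matrix ι ι ℂ, ∀ x, resolv (linModel u v x) w = R x :=
    ⟨_, fun _ => rfl⟩
  have hRc : Continuous R := by
    rw [← funext hR]
    exact continuous_resolv_comp (continuous_linModel u v) (linModel_isHermitian u v) hw
  have hRn : ∀ x, ‖R x‖ ≤ (w.im)⁻¹ := fun x => by
    rw [← hR]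
    exact norm_resolv_le (linModel_isHermitian u v x) hw
  simp only [hR]
  have hRM : ∀ x, ‖R x * M‖ ≤ (w.im)⁻¹ * ‖M‖ := fun x =>
    (norm_mul_le _ _).trans (mul_le_mul_of_nonneg_right (hRn x) (norm_nonneg _))
  have hadd : ∀ ω, linModel u v (Y ω) + rankTwo (u a) (v a) (ζ a ω) =
      linModel u v fun b => ζ b ω := fun ω => linModel_update u v _ a
  -- continuous functions of the entries
  have hbc : ∀ x y : ι → ℂ, Continuous fun t => bil (R t) x y := fun x y => continuous_bil hRc x y
  have hbMc : ∀ x y : ι → ℂ, Continuous fun t => bil (R t * M) x y := fun x y =>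
    continuous_bil (hRc.matrix_mul continuous_const) x y
  have hTc : Continuous fun t => mainTerm M (u a) (v a) (R t) :=
    ((hbc _ _).mul (hbMc _ _)).add ((hbc _ _).mul (hbMc _ _))
  have hPc : ∀ x y : ι → ℂ, Continuous fun t => pseudoTerm M x y (R t) := fun x y =>
    (hbc _ _).mul (hbMc _ _)
  -- moments of the entry
  have hζa := hm a
  have hζs : Measurable fun ω => star (ζ a ω) := continuous_star.measurable.comp hζa
  have hi1 : Integrable (fun ω => ‖ζ a ω‖) P := by
    refine Integrable.mono' ((integrable_const (1 : ℝ)).add hInt) hζa.norm.aestronglyMeasurable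
      (ae_of_all _ fun ω => ?_)
    simp only [norm_norm, Pi.add_apply]
    have h0 := norm_nonneg (ζ a ω)
    nlinarith [sq_nonneg (‖ζ a ω‖ - 1), mul_nonneg h0 (sq_nonneg (‖ζ a ω‖ - 1))]
  have hi2 : Integrable (fun ω => ‖ζ a ω‖ ^ 2) P := by
    by_contra h
    rw [integral_undef h] at hvar
    exact zero_ne_one hvar
  have hm1 : ∫ ω, ‖ζ a ω‖ ∂P ≤ 1 + m := by
    calc ∫ ω, ‖ζ a ω‖ ∂P ≤ ∫ ω, (1 + ‖ζ a ω‖ ^ 3) ∂P := by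
          refine integral_mono hi1 ((integrable_const (1 : ℝ)).add hInt) fun ω => ?_
          have h0 := norm_nonneg (ζ a ω)
          nlinarith [sq_nonneg (‖ζ a ω‖ - 1), mul_nonneg h0 (sq_nonneg (‖ζ a ω‖ - 1))]
      _ = 1 + ∫ ω, ‖ζ a ω‖ ^ 3 ∂P := by
          rw [integral_add (integrable_const _) hInt]; simp
      _ ≤ 1 + m := by linarith
  -- factorization of expectations
  have hfac : ∀ (g : ℂ → ℂ) (Φ : (α → ℂ) → ℂ), Continuous g → Continuous Φ →
      ∫ ω, g (ζ a ω) * Φ (Y ω) ∂P = (∫ ω, g (ζ a ω) ∂P) * ∫ ω, Φ (Y ω) ∂P := by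
    intro g Φ hg hΦ
    exact (hI.comp hg.measurable hΦ.measurable).integral_fun_mul_eq_mul_integral
      (hg.measurable.comp hζa).aestronglyMeasurable (hΦ.measurable.comp hYm).aestronglyMeasurable
  have hbdd : ∀ (g : ℂ → ℂ) (Φ : (α → ℂ) → ℂ) (B : ℝ), Integrable (fun ω => g (ζ a ω)) P →
      Continuous Φ → (∀ x, ‖Φ x‖ ≤ B) → Integrable (fun ω => g (ζ a ω) * Φ (Y ω)) P := by
    intro g Φ B hg hΦ hB
    exact hg.mul_bdd (c := B) (hΦ.measurable.comp hYm).aestronglyMeasurable (ae_of_all _ fun ω => hB _)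
  have hiζ : Integrable (fun ω => ζ a ω) P :=
    (integrable_norm_iff hζa.aestronglyMeasurable).1 hi1
  have hiζs : Integrable (fun ω => star (ζ a ω)) P := by
    refine (integrable_norm_iff hζs.aestronglyMeasurable).1 ?_
    simpa using hi1
  have hiζ2 : Integrable (fun ω => ζ a ω ^ 2) P := by
    refine (integrable_norm_iff (hζa.pow_const 2).aestronglyMeasurable).1 ?_
    simpa using hi2
  have hiζs2 : Integrable (fun ω => star (ζ a ω) ^ 2) P := by
    refine (integrable_norm_iff (hζs.pow_const 2).aestronglyMeasurable).1 ?_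
    simpa using hi2
  have hiζζ : Integrable (fun ω => ζ a ω * star (ζ a ω)) P := by
    refine (integrable_norm_iff (hζa.mul hζs).aestronglyMeasurable).1 ?_
    simpa [pow_two] using hi2
  have hEs : ∫ ω, star (ζ a ω) ∂P = 0 := by
    have := integral_conj (μ := P) (f := fun ω => ζ a ω) (𝕜 := ℂ)
    rw [hmean, map_zero] at this
    exact this
  have hEζζ : ∫ ω, ζ a ω * star (ζ a ω) ∂P = 1 := by
    have e : ∀ ω, ζ a ω * star (ζ a ω) = ((‖ζ a ω‖ ^ 2 : ℝ) : ℂ) := fun ω => by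
      rw [Complex.star_def, Complex.mul_conj, Complex.normSq_eq_norm_sq]
    simp_rw [e]
    rw [integral_complex_ofReal, hvar, Complex.ofReal_one]
  have hξ : ‖∫ ω, ζ a ω ^ 2 ∂P‖ ≤ 1 := by
    rw [← hvar]
    refine (norm_integral_le_integral_norm _).trans_eq ?_
    simp
  have hξs : ‖∫ ω, star (ζ a ω) ^ 2 ∂P‖ ≤ 1 := by
    rw [← hvar]
    refine (norm_integral_le_integral_norm _).trans_eq ?_
    simp
  -- the expansion
  have hη : 0 ≤ (w.im)⁻¹ := inv_nonneg.2 hw.le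
  have hbM : ∀ (x y : ι → ℂ) t, ‖bil (R t * M) x y‖ ≤ (w.im)⁻¹ * ‖M‖ * (vnorm x * vnorm y) :=
    fun x y t => (norm_bil_le _ _ _).trans (mul_le_mul_of_nonneg_right (hRM t)
      (mul_nonneg (vnorm_nonneg x) (vnorm_nonneg y)))
  have hTn : ∀ t, ‖mainTerm M (u a) (v a) (R t)‖ ≤ _ := fun t =>
    norm_mainTerm_le M (u a) (v a) (hRn t)
  have hPn : ∀ (x y : ι → ℂ) t, ‖pseudoTerm M x y (R t)‖ ≤ _ := fun x y t =>
    norm_pseudoTerm_le M x y (hRn t)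
  let t : Ω → ℂ := fun ω =>
    (M * rankTwo (u a) (v a) (ζ a ω) * R fun b => ζ b ω).trace
  let L : Ω → ℂ := fun ω => ζ a ω * bil (R (Y ω) * M) (v a) (u a) +
    star (ζ a ω) * bil (R (Y ω) * M) (u a) (v a)
  let Q : Ω → ℂ := fun ω => (ζ a ω * star (ζ a ω)) * mainTerm M (u a) (v a) (R (Y ω)) +
    ζ a ω ^ 2 * pseudoTerm M (u a) (v a) (R (Y ω)) +
    star (ζ a ω) ^ 2 * pseudoTerm M (v a) (u a) (R (Y ω))
  have hL1 := hbdd (fun z => z) (fun y => bil (R y * M) (v a) (u a)) _ hiζ (hbMc _ _) (hbM _ _)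
  have hL2 := hbdd (fun z => star z) (fun y => bil (R y * M) (u a) (v a)) _ hiζs (hbMc _ _)
    (hbM _ _)
  have hQ1 := hbdd (fun z => z * star z) (fun y => mainTerm M (u a) (v a) (R y)) _ hiζζ hTc hTn
  have hQ2 := hbdd (fun z => z ^ 2) (fun y => pseudoTerm M (u a) (v a) (R y)) _ hiζ2 (hPc _ _)
    (hPn _ _)
  have hQ3 := hbdd (fun z => star z ^ 2) (fun y => pseudoTerm M (v a) (u a) (R y)) _ hiζs2
    (hPc _ _) (hPn _ _)
  have hiL : Integrable L P := hL1.add hL2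
  have hiQ : Integrable Q P := (hQ1.add hQ2).add hQ3
  -- Linear terms vanish: the entry is centred and independent of its cofactor.
  have hEL : ∫ ω, L ω ∂P = 0 := by
    rw [integral_add hL1 hL2, hfac (fun z => z) _ continuous_id (hbMc _ _),
      hfac (fun z => star z) _ continuous_star (hbMc _ _), hmean, hEs, zero_mul, zero_mul, add_zero]
  have hEQ : ∫ ω, Q ω ∂P = ∫ ω, mainTerm M (u a) (v a) (R (Y ω)) ∂P +
      (∫ ω, ζ a ω ^ 2 ∂P) * ∫ ω, pseudoTerm M (u a) (v a) (R (Y ω)) ∂P +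
      (∫ ω, star (ζ a ω) ^ 2 ∂P) * ∫ ω, pseudoTerm M (v a) (u a) (R (Y ω)) ∂P := by
    have e1 : ∫ ω, Q ω ∂P = _ := integral_add (hQ1.add hQ2) hQ3
    have e2 := integral_add hQ1 hQ2
    rw [e1, e2, hfac (fun z => z * star z) _ (continuous_id.mul continuous_star) hTc,
      hfac (fun z => z ^ 2) _ (continuous_pow 2) (hPc _ _),
      hfac (fun z => star z ^ 2) _ (continuous_star.pow 2) (hPc _ _), hEζζ, one_mul]
  have herr : ∀ ω, ‖t ω - L ω + Q ω‖ ≤ 8 * κ * ‖ζ a ω‖ ^ 3 := fun ω => by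
    have h := norm_trace_expansion_le (linModel_isHermitian u v (Y ω)) hw M (u a) (v a) (ζ a ω)
    rw [hadd ω, hR, hR] at h
    refine h.trans_eq ?_
    rw [hκ]
    ring
  have htm : Measurable t := by
    have hc : Continuous fun x : α → ℂ => (M * rankTwo (u a) (v a) (x a) * R x).trace := by
      refine Continuous.matrix_trace (Continuous.matrix_mul (continuous_const.matrix_mul ?_) hRc)
      unfold rankTwo
      exact ((continuous_apply a).smul continuous_const).add
        ((continuous_star.comp (continuous_apply a)).smul continuous_const)
    have hc' : Measurable fun x : α → ℂ => (M * rankTwo (u a) (v a) (x a) * R x).trace :=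
      hc.measurable
    have := hc'.comp hζm
    exact this
  have hie : Integrable (fun ω => t ω - L ω + Q ω) P :=
    Integrable.mono' (hInt.const_mul (8 * κ))
      ((htm.aestronglyMeasurable.sub hiL.aestronglyMeasurable).add hiQ.aestronglyMeasurable)
      (ae_of_all _ herr)
  have hEt : ∫ ω, t ω ∂P = ∫ ω, (t ω - L ω + Q ω) ∂P - ∫ ω, Q ω ∂P := by
    have hit : Integrable t P := ((hie.sub hiQ).add hiL).congr (ae_of_all _ fun ω => by simp)
    have e1 : ∫ ω, (t ω - L ω + Q ω) ∂P = ∫ ω, (t ω - L ω) ∂P + ∫ ω, Q ω ∂P :=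
      integral_add (hit.sub hiL) hiQ
    rw [e1, integral_sub hit hiL, hEL]
    ring
  have hE1 : ‖∫ ω, (t ω - L ω + Q ω) ∂P‖ ≤ 8 * κ * m := by
    refine (norm_integral_le_of_norm_le (hInt.const_mul (8 * κ)) (ae_of_all _ herr)).trans ?_
    rw [integral_const_mul]
    gcongr
  -- replacing the truncated resolvent by the full one
  have hcompm : ∀ (Φ : (α → ℂ) → ℂ) (B : ℝ), Continuous Φ → (∀ x, ‖Φ x‖ ≤ B) →
      Integrable (fun ω => Φ fun b => ζ b ω) P ∧ Integrable (fun ω => Φ (Y ω)) P := by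
    intro Φ B hΦ hB
    exact ⟨Integrable.of_bound (C := B) (hΦ.measurable.comp hζm).aestronglyMeasurable
        (ae_of_all _ fun ω => hB _),
      Integrable.of_bound (C := B) (hΦ.measurable.comp hYm).aestronglyMeasurable
        (ae_of_all _ fun ω => hB _)⟩
  obtain ⟨hT, hT₀⟩ := hcompm _ _ hTc hTn
  have hT2 : ‖∫ ω, mainTerm M (u a) (v a) (R fun b => ζ b ω) ∂P -
      ∫ ω, mainTerm M (u a) (v a) (R (Y ω)) ∂P‖ ≤ 8 * κ * (1 + m) := by
    rw [← integral_sub hT hT₀]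
    refine (norm_integral_le_of_norm_le (hi1.const_mul (8 * κ)) (ae_of_all _ fun ω => ?_)).trans ?_
    · have h := norm_mainTerm_sub_le (linModel_isHermitian u v (Y ω)) hw M (u a) (v a) (ζ a ω)
      rw [hadd ω, hR, hR] at h
      refine h.trans_eq ?_
      rw [hκ]
      ring
    · rw [integral_const_mul]
      gcongr
  have hP2 : ∀ x y : ι → ℂ, (∀ ω, ‖pseudoTerm M x y (R fun b => ζ b ω) -
      pseudoTerm M x y (R (Y ω))‖ ≤ 4 * κ * ‖ζ a ω‖) →
      ‖∫ ω, pseudoTerm M x y (R (Y ω)) ∂P‖ ≤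
        ∫ ω, ‖pseudoTerm M x y (R fun b => ζ b ω)‖ ∂P + 4 * κ * (1 + m) := by
    intro x y h
    obtain ⟨hp, hp₀⟩ := hcompm _ _ (hPc x y) (hPn x y)
    calc _ ≤ ∫ ω, (‖pseudoTerm M x y (R fun b => ζ b ω)‖ + 4 * κ * ‖ζ a ω‖) ∂P := by
          refine norm_integral_le_of_norm_le (hp.norm.add (hi1.const_mul (4 * κ)))
            (ae_of_all _ fun ω => ?_)
          have h1 := norm_sub_norm_le (pseudoTerm M x y (R (Y ω)))
            (pseudoTerm M x y (R fun b => ζ b ω))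
          rw [norm_sub_rev] at h1
          linarith [h ω]
      _ = ∫ ω, ‖pseudoTerm M x y (R fun b => ζ b ω)‖ ∂P + 4 * κ * ∫ ω, ‖ζ a ω‖ ∂P := by
          rw [integral_add hp.norm (hi1.const_mul (4 * κ)), integral_const_mul]
      _ ≤ _ := by gcongr
  have hP3 := hP2 (u a) (v a) fun ω => by
    have h := norm_pseudoTerm_sub_le (linModel_isHermitian u v (Y ω)) hw M (u a) (v a) (ζ a ω)
    rw [hadd ω, hR, hR] at h
    refine h.trans_eq ?_
    rw [hκ]
    ring
  -- Exchanging u and v amounts to conjugating the entry, so the second pseudo-variance term obeys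
  -- the same estimate.
  have hsymm : ∀ ω, rankTwo (v a) (u a) (star (ζ a ω)) = rankTwo (u a) (v a) (ζ a ω) := fun ω => by
    rw [rankTwo, rankTwo, star_star, add_comm]
  have hP4 := hP2 (v a) (u a) fun ω => by
    have h := norm_pseudoTerm_sub_le (linModel_isHermitian u v (Y ω)) hw M (v a) (u a)
      (star (ζ a ω))
    rw [hsymm, hadd ω, norm_star, hR, hR] at h
    refine h.trans_eq ?_
    rw [hκ]
    ring
  have hfin : ∫ ω, t ω ∂P + ∫ ω, mainTerm M (u a) (v a) (R fun b => ζ b ω) ∂P =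
      ∫ ω, (t ω - L ω + Q ω) ∂P + (∫ ω, mainTerm M (u a) (v a) (R fun b => ζ b ω) ∂P -
        ∫ ω, mainTerm M (u a) (v a) (R (Y ω)) ∂P) -
      (∫ ω, ζ a ω ^ 2 ∂P) * ∫ ω, pseudoTerm M (u a) (v a) (R (Y ω)) ∂P -
      (∫ ω, star (ζ a ω) ^ 2 ∂P) * ∫ ω, pseudoTerm M (v a) (u a) (R (Y ω)) ∂P := by
    rw [hEt, hEQ]
    ring
  have hmul : ∀ {x y : ℂ} {B : ℝ}, ‖x‖ ≤ 1 → ‖y‖ ≤ B → ‖x * y‖ ≤ B := fun hx hy => by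
    rw [norm_mul]
    exact (mul_le_of_le_one_left (norm_nonneg _) hx).trans hy
  change ‖∫ ω, t ω ∂P + ∫ ω, mainTerm M (u a) (v a) (R fun b => ζ b ω) ∂P‖ ≤ _
  rw [hfin]
  -- The coefficient of κ is 8m from the remainder, 8(1 + m) from the main term and 4(1 + m) from
  -- each pseudo-variance term, in total 16 + 24m.
  refine (norm_sub_le _ _).trans ((add_le_add ((norm_sub_le _ _).trans
    (add_le_add ((norm_add_le _ _).trans (add_le_add hE1 hT2)) (hmul hξ hP3)))
    (hmul hξs hP4)).trans_eq ?_)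
  ring

end Dyson

end SumSeparable
end

/-! ### McDiarmid's inequality and fourth central moments -/

noncomputable section

namespace SumSeparable

section BoundedDifferences

variable {E : Type*} [MeasurableSpace E]

theorem integral_pi_succ {n : ℕ} (μ : Fin (n + 1) → Measure E) [∀ i, IsProbabilityMeasure (μ i)]
    {g : (Fin (n + 1) → E) → ℝ} (hg : Integrable g (Measure.pi μ)) :
    ∫ x, g x ∂(Measure.pi μ) =
      ∫ a, ∫ y, g (Fin.cons a y) ∂(Measure.pi fun i => μ i.succ) ∂(μ 0) := by
  have hmp := (measurePreserving_piFinSuccAbove μ 0).symm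
  have e : ∀ q : E × (Fin n → E),
      (MeasurableEquiv.piFinSuccAbove (fun _ : Fin (n + 1) => E) 0).symm q = Fin.cons q.1 q.2 := by
    intro q
    simp [MeasurableEquiv.piFinSuccAbove, Fin.insertNthEquiv, Fin.insertNth_zero']
  have h1 := hmp.integral_comp' (g := g)
  rw [← h1]
  have h2 : Integrable (fun q : E × (Fin n → E) =>
      g ((MeasurableEquiv.piFinSuccAbove (fun _ : Fin (n + 1) => E) 0).symm q))
      ((μ 0).prod (Measure.pi fun i => μ i.succ)) := by
    have := (hmp.integrable_comp_emb
      (MeasurableEquiv.piFinSuccAbove (fun _ : Fin (n + 1) => E) 0).symm.measurableEmbedding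
      (g := g)).2 hg
    simpa [Function.comp_def] using this
  have h3 := integral_prod _ h2
  simp only [e] at h3 ⊢
  exact h3

/-- **McDiarmid's inequality**, in the form of a bound for the moment-generating function. -/
theorem integral_exp_sub_le_of_bounded_differences {n : ℕ} (μ : Fin n → Measure E)
    [∀ i, IsProbabilityMeasure (μ i)] {f : (Fin n → E) → ℝ} (hf : Measurable f) {B : ℝ}
    (hB : ∀ x, |f x| ≤ B) {c : ℝ} (hc0 : 0 ≤ c)
    (hc : ∀ x i e, |f (Function.update x i e) - f x| ≤ c) (t : ℝ) :
    ∫ x, Real.exp (t * (f x - ∫ y, f y ∂(Measure.pi μ))) ∂(Measure.pi μ) ≤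
      Real.exp (n * c ^ 2 * t ^ 2 / 2) := by
  induction n with
  | zero =>
    have h : ∀ x, f x = ∫ y, f y ∂(Measure.pi μ) := fun x => by
      have : ∀ y, f y = f x := fun y => by rw [Subsingleton.elim y x]
      simp [this]
    have h2 : ∀ x, t * (f x - ∫ y, f y ∂(Measure.pi μ)) = 0 := fun x => by rw [← h x]; simp
    simp only [h2]
    simp
  | succ n ih =>
    have hInt : ∀ {k : ℕ} (ν : Fin k → Measure E) [∀ i, IsProbabilityMeasure (ν i)]
        {g : (Fin k → E) → ℝ}, Measurable g → (∀ x, |g x| ≤ B) → Integrable g (Measure.pi ν) :=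
      fun ν _ g hg hgB => Integrable.of_bound (C := B) hg.aestronglyMeasurable (ae_of_all _ hgB)
    have hexp : ∀ {k : ℕ} (ν : Fin k → Measure E) [∀ i, IsProbabilityMeasure (ν i)]
        {g : (Fin k → E) → ℝ}, Measurable g → (∀ x, |g x| ≤ B) → ∀ m : ℝ,
        Integrable (fun x => Real.exp (t * (g x - m))) (Measure.pi ν) := fun ν _ g hg hgB m => by
      refine Integrable.of_bound (C := Real.exp (|t| * (B + |m|)))
        (by fun_prop) (ae_of_all _ fun x => ?_)
      rw [Real.norm_of_nonneg (Real.exp_pos _).le]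
      refine Real.exp_le_exp.2 ((le_abs_self _).trans ?_)
      rw [abs_mul]
      gcongr
      exact (abs_sub _ _).trans (add_le_add (hgB x) le_rfl)
    have hconsm : Measurable fun q : E × (Fin n → E) => f (Fin.cons q.1 q.2) := by
      refine hf.comp (measurable_pi_lambda _ fun i => ?_)
      refine Fin.cases ?_ (fun j => ?_) i
      · simpa using measurable_fst
      · simp only [Fin.cons_succ]
        exact (measurable_pi_apply j).comp measurable_snd
    have hFm : ∀ a, Measurable fun y : Fin n → E => f (Fin.cons a y) := fun a =>
      hconsm.comp measurable_prodMk_left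
    set ν : Fin n → Measure E := fun i => μ i.succ with hν
    -- All coordinates but the first are averaged out. The values of g lie in an interval of length
    -- 2c, so Hoeffding's lemma gives variance proxy c² for the first coordinate. The induction
    -- hypothesis handles the others with the first one fixed.
    let g : E → ℝ := fun a => ∫ y, f (Fin.cons a y) ∂(Measure.pi ν)
    have hgm : Measurable g :=
      (hconsm.stronglyMeasurable.integral_prod_right (ν := Measure.pi ν)).measurable
    have hmean : ∫ y, f y ∂(Measure.pi μ) = ∫ a, g a ∂(μ 0) := integral_pi_succ μ (hInt μ hf hB)
    set m := ∫ y, f y ∂(Measure.pi μ) with hm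
    have hne : Nonempty E := by
      by_contra h
      rw [not_nonempty_iff] at h
      have := (inferInstance : IsProbabilityMeasure (μ 0)).measure_univ
      simp [Set.univ_eq_empty_iff.2 h] at this
    obtain ⟨e₀⟩ := hne
    have hgdiff : ∀ a, |g a - g e₀| ≤ c := fun a => by
      simp only [g]
      rw [← integral_sub (hInt ν (hFm a) fun y => hB _) (hInt ν (hFm e₀) fun y => hB _)]
      have := norm_integral_le_of_norm_le_const (μ := Measure.pi ν) (C := c)
        (f := fun y => f (Fin.cons a y) - f (Fin.cons e₀ y)) (ae_of_all _ fun y => by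
          have h := hc (Fin.cons e₀ y) 0 a
          rwa [Fin.update_cons_zero] at h)
      simpa using this
    have hgB : ∀ a, g a ∈ Set.Icc (g e₀ - c) (g e₀ + c) := fun a => by
      have := abs_le.1 (hgdiff a)
      constructor <;> linarith
    have hHoeff := hasSubgaussianMGF_of_mem_Icc (μ := μ 0) hgm.aemeasurable (ae_of_all _ hgB)
    have h1 := hHoeff.mgf_le t
    have hcc : ((‖g e₀ + c - (g e₀ - c)‖₊ / 2) ^ 2 : ℝ≥0) = (c ^ 2 : ℝ) := by
      push_cast
      rw [show g e₀ + c - (g e₀ - c) = 2 * c by ring,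
        Real.norm_of_nonneg (by positivity)]
      ring
    rw [hcc] at h1
    have hinner : ∀ a, ∫ y, Real.exp (t * (f (Fin.cons a y) - m)) ∂(Measure.pi ν) ≤
        Real.exp (n * c ^ 2 * t ^ 2 / 2) * Real.exp (t * (g a - m)) := fun a => by
      have h2 := ih ν (hFm a) (fun y => hB _) (fun y i e => by
        have h := hc (Fin.cons a y) i.succ e
        rwa [← Fin.cons_update] at h)
      have e : ∀ y, Real.exp (t * (f (Fin.cons a y) - m)) =
          Real.exp (t * (f (Fin.cons a y) - g a)) * Real.exp (t * (g a - m)) := fun y => by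
        rw [← Real.exp_add]
        ring_nf
      simp_rw [e]
      rw [integral_mul_const]
      exact mul_le_mul_of_nonneg_right h2 (Real.exp_pos _).le
    rw [integral_pi_succ μ (hexp μ hf hB m)]
    have hgexp : Integrable (fun a => Real.exp (t * (g a - m))) (μ 0) := by
      have h3 := hHoeff.integrable_exp_mul t
      simp only [hmean]
      exact h3
    calc _ ≤ ∫ a, Real.exp (n * c ^ 2 * t ^ 2 / 2) * Real.exp (t * (g a - m)) ∂(μ 0) := by
          refine integral_mono_of_nonneg (ae_of_all _ fun a => integral_nonneg fun y =>
            (Real.exp_pos _).le) (hgexp.const_mul _) (ae_of_all _ hinner)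
      _ = Real.exp (n * c ^ 2 * t ^ 2 / 2) * ∫ a, Real.exp (t * (g a - m)) ∂(μ 0) := by
          rw [integral_const_mul]
      _ ≤ Real.exp (n * c ^ 2 * t ^ 2 / 2) * Real.exp (c ^ 2 * t ^ 2 / 2) := by
          gcongr
          rw [mgf] at h1
          simp only [hmean]
          exact h1
      _ = _ := by
          rw [← Real.exp_add]
          push_cast
          ring_nf

/-- Fourth central moments of functions with bounded differences. -/
theorem integral_pow_four_le_of_bounded_differences {n : ℕ} (hn : 0 < n) (μ : Fin n → Measure E)
    [∀ i, IsProbabilityMeasure (μ i)] {f : (Fin n → E) → ℝ} (hf : Measurable f) {B : ℝ}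
    (hB : ∀ x, |f x| ≤ B) {c : ℝ} (hc0 : 0 < c)
    (hc : ∀ x i e, |f (Function.update x i e) - f x| ≤ c) :
    ∫ x, (f x - ∫ y, f y ∂(Measure.pi μ)) ^ 4 ∂(Measure.pi μ) ≤ 96 * (n * c ^ 2) ^ 2 := by
  set m := ∫ y, f y ∂(Measure.pi μ) with hm
  have hn' : (0 : ℝ) < n := by exact_mod_cast hn
  -- At t = ±1/σ the exponential moment is at most e^{1/2} ≤ 2. With y⁴ ≤ 4! (e^y + e^{-y}) this
  -- yields 24 · (2 + 2) = 96.
  set σ := Real.sqrt (n * c ^ 2) with hσ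
  have hσ0 : 0 < σ := Real.sqrt_pos.2 (by positivity)
  have hσ2 : σ ^ 2 = n * c ^ 2 := Real.sq_sqrt (by positivity)
  have hexp : ∀ t : ℝ, Integrable (fun x => Real.exp (t * (f x - m))) (Measure.pi μ) := fun t => by
    refine Integrable.of_bound (C := Real.exp (|t| * (B + |m|)))
      (by fun_prop) (ae_of_all _ fun x => ?_)
    rw [Real.norm_of_nonneg (Real.exp_pos _).le]
    refine Real.exp_le_exp.2 ((le_abs_self _).trans ?_)
    rw [abs_mul]
    gcongr
    exact (abs_sub _ _).trans (add_le_add (hB x) le_rfl)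
  have hbound : ∀ t : ℝ, t ^ 2 = σ⁻¹ ^ 2 →
      ∫ x, Real.exp (t * (f x - m)) ∂(Measure.pi μ) ≤ 2 := fun t ht => by
    refine (integral_exp_sub_le_of_bounded_differences μ hf hB hc0.le hc t).trans ?_
    have e : n * c ^ 2 * t ^ 2 / 2 = 1 / 2 := by
      rw [ht, ← hσ2]
      field_simp
    rw [e, ← Real.log_le_log_iff (Real.exp_pos _) two_pos, Real.log_exp]
    have := Real.log_two_gt_d9
    linarith
  have hpt : ∀ x, (f x - m) ^ 4 ≤ 24 * σ ^ 4 *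
      (Real.exp (σ⁻¹ * (f x - m)) + Real.exp (-σ⁻¹ * (f x - m))) := fun x => by
    set y := σ⁻¹ * (f x - m) with hy
    have h1 := Real.pow_div_factorial_le_exp |y| (abs_nonneg y) 4
    have h2 : Real.exp |y| ≤ Real.exp y + Real.exp (-y) := by
      rcases abs_cases y with ⟨h, _⟩ | ⟨h, _⟩ <;> rw [h]
      · linarith [Real.exp_pos (-y)]
      · linarith [Real.exp_pos y]
    have h3 : |y| ^ 4 = y ^ 4 := by
      rw [← abs_pow]
      exact abs_of_nonneg (by positivity)
    have h4 : f x - m = σ * y := by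
      rw [hy]; field_simp
    have h5 : -σ⁻¹ * (f x - m) = -y := by rw [hy]; ring
    rw [h5, h4]
    rw [h3] at h1
    have h6 : y ^ 4 ≤ 24 * (Real.exp y + Real.exp (-y)) := by
      have : (Nat.factorial 4 : ℝ) = 24 := by norm_num [Nat.factorial]
      rw [this] at h1
      linarith
    calc (σ * y) ^ 4 = σ ^ 4 * y ^ 4 := by ring
      _ ≤ σ ^ 4 * (24 * (Real.exp y + Real.exp (-y))) := by gcongr
      _ = _ := by ring
  calc _ ≤ ∫ x, 24 * σ ^ 4 * (Real.exp (σ⁻¹ * (f x - m)) + Real.exp (-σ⁻¹ * (f x - m)))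
        ∂(Measure.pi μ) :=
        integral_mono_of_nonneg (ae_of_all _ fun x => by positivity)
          (((hexp _).add (hexp _)).const_mul _) (ae_of_all _ hpt)
    _ = 24 * σ ^ 4 * (∫ x, Real.exp (σ⁻¹ * (f x - m)) ∂(Measure.pi μ) +
        ∫ x, Real.exp (-σ⁻¹ * (f x - m)) ∂(Measure.pi μ)) := by
        rw [integral_const_mul, integral_add (hexp _) (hexp _)]
    _ ≤ 24 * σ ^ 4 * (2 + 2) := by
        have h1 := hbound σ⁻¹ rfl
        have h2 := hbound (-σ⁻¹) (by ring)
        gcongr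
    _ = _ := by
        rw [← hσ2]
        ring

/-- The complex version. -/
theorem integral_norm_pow_four_le_of_bounded_differences {n : ℕ} (hn : 0 < n)
    (μ : Fin n → Measure E) [∀ i, IsProbabilityMeasure (μ i)] {f : (Fin n → E) → ℂ}
    (hf : Measurable f) {B : ℝ} (hB : ∀ x, ‖f x‖ ≤ B) {c : ℝ} (hc0 : 0 < c)
    (hc : ∀ x i e, ‖f (Function.update x i e) - f x‖ ≤ c) :
    ∫ x, ‖f x - ∫ y, f y ∂(Measure.pi μ)‖ ^ 4 ∂(Measure.pi μ) ≤ 384 * (n * c ^ 2) ^ 2 := by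
  have hfi : Integrable f (Measure.pi μ) :=
    Integrable.of_bound (C := B) hf.aestronglyMeasurable (ae_of_all _ hB)
  set m := ∫ y, f y ∂(Measure.pi μ) with hm
  have hre : ∫ y, (f y).re ∂(Measure.pi μ) = m.re := integral_re (𝕜 := ℂ) hfi
  have him : ∫ y, (f y).im ∂(Measure.pi μ) = m.im := integral_im (𝕜 := ℂ) hfi
  have h1 := integral_pow_four_le_of_bounded_differences hn μ (f := fun x => (f x).re)
    (Complex.measurable_re.comp hf) (fun x => (Complex.abs_re_le_norm _).trans (hB x)) hc0
    fun x i e => by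
      rw [← Complex.sub_re]
      exact (Complex.abs_re_le_norm _).trans (hc x i e)
  have h2 := integral_pow_four_le_of_bounded_differences hn μ (f := fun x => (f x).im)
    (Complex.measurable_im.comp hf) (fun x => (Complex.abs_im_le_norm _).trans (hB x)) hc0
    fun x i e => by
      rw [← Complex.sub_im]
      exact (Complex.abs_im_le_norm _).trans (hc x i e)
  rw [hre] at h1
  rw [him] at h2
  -- (a² + b²)² ≤ 2(a⁴ + b⁴), whence 2 · (96 + 96) = 384.
  have hpt : ∀ x, ‖f x - m‖ ^ 4 ≤ 2 * (((f x).re - m.re) ^ 4 + ((f x).im - m.im) ^ 4) := fun x => by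
    have e : ‖f x - m‖ ^ 2 = ((f x).re - m.re) ^ 2 + ((f x).im - m.im) ^ 2 := by
      rw [← Complex.normSq_eq_norm_sq, Complex.normSq_apply, Complex.sub_re, Complex.sub_im]
      ring
    have e2 : ‖f x - m‖ ^ 4 = (‖f x - m‖ ^ 2) ^ 2 := by ring
    rw [e2, e]
    nlinarith [sq_nonneg (((f x).re - m.re) ^ 2 - ((f x).im - m.im) ^ 2)]
  have hpow : ∀ g : (Fin n → E) → ℝ, Measurable g → (∀ x, |g x| ≤ B) → ∀ q : ℝ,
      Integrable (fun x => (g x - q) ^ 4) (Measure.pi μ) := fun g hg hgB q => by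
    refine Integrable.of_bound (C := (B + |q|) ^ 4) (by fun_prop) (ae_of_all _ fun x => ?_)
    rw [norm_pow]
    exact pow_le_pow_left₀ (norm_nonneg _)
      ((abs_sub _ _).trans (add_le_add (hgB x) le_rfl)) 4
  have hr := hpow (fun x => (f x).re) (Complex.measurable_re.comp hf)
    (fun x => (Complex.abs_re_le_norm _).trans (hB x)) m.re
  have hi := hpow (fun x => (f x).im) (Complex.measurable_im.comp hf)
    (fun x => (Complex.abs_im_le_norm _).trans (hB x)) m.im
  calc _ ≤ ∫ x, 2 * (((f x).re - m.re) ^ 4 + ((f x).im - m.im) ^ 4) ∂(Measure.pi μ) :=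
        integral_mono_of_nonneg (ae_of_all _ fun x => by positivity)
          ((hr.add hi).const_mul 2) (ae_of_all _ hpt)
    _ = 2 * (∫ x, ((f x).re - m.re) ^ 4 ∂(Measure.pi μ) +
        ∫ x, ((f x).im - m.im) ^ 4 ∂(Measure.pi μ)) := by
        rw [integral_const_mul, integral_add hr hi]
    _ ≤ 2 * (96 * (n * c ^ 2) ^ 2 + 96 * (n * c ^ 2) ^ 2) := by gcongr
    _ = _ := by ring

end BoundedDifferences

end SumSeparable
end

/-! ### Concentration of traces of the resolvent -/

noncomputable section

namespace SumSeparable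

open scoped Matrix.Norms.L2Operator

section Concentration

variable {Ω : Type*} [MeasurableSpace Ω] {P : Measure Ω}

/-- The law of an independent family indexed by triples, regrouped by the last index. -/
theorem map_regroup_eq_pi {α β γ : Type*} [Fintype α] [Fintype β] [Fintype γ]
    {ζ : α × β × γ → Ω → ℂ} (hm : ∀ a, Measurable (ζ a)) (hind : iIndepFun ζ P) :
    ∃ μ : γ → Measure (α × β → ℂ), (∀ j, IsProbabilityMeasure (μ j)) ∧
      P.map (fun ω j q => ζ (q.1, q.2, j) ω) = Measure.pi μ := by
  have hP := hind.isProbabilityMeasure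
  let X : γ × (α × β) → Ω → ℂ := fun q => ζ (q.2.1, q.2.2, q.1)
  have hXm : ∀ q, Measurable (X q) := fun q => hm _
  have hX : iIndepFun X P := by
    refine hind.precomp (g := fun q : γ × (α × β) => (q.2.1, q.2.2, q.1)) ?_
    rintro ⟨a, b, c⟩ ⟨a', b', c'⟩ h
    simp only [Prod.mk.injEq] at h ⊢
    tauto
  have hpr : ∀ q, IsProbabilityMeasure (P.map (X q)) := fun q =>
    Measure.isProbabilityMeasure_map (hXm q).aemeasurable
  have h1 := hX.map_fun_eq_infinitePi_map hXm
  refine ⟨fun j => Measure.pi fun q => P.map (X (j, q)), fun j => inferInstance, ?_⟩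
  have h2 : (fun ω j (q : α × β) => ζ (q.1, q.2, j) ω) =
      (MeasurableEquiv.curry γ (α × β) ℂ) ∘ fun ω q => X q ω := by
    ext ω j q
    rfl
  have hpr' : ∀ j (q : α × β), IsProbabilityMeasure (P.map (X (j, q))) := fun j q => hpr _
  rw [h2, ← Measure.map_map (MeasurableEquiv.measurable _) (measurable_pi_lambda _ hXm), h1]
  have h3 := Measure.infinitePi_map_curry (fun j (q : α × β) => P.map (X (j, q)))
  simp only [Prod.mk.eta] at h3
  rw [h3]
  simp only [Measure.infinitePi_eq_pi]

variable {ι : Type*}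

variable {α β γ : Type*} [Fintype α] [Fintype β] [Fintype γ]

/-- The linear model with coefficient vectors `u_{r,i}` and `v_{r,j}`. -/
def sepModel (u : α × β → ι → ℂ) (v : α × γ → ι → ℂ) (x : α × β × γ → ℂ) : Matrix ι ι ℂ :=
  linModel (fun a => u (a.1, a.2.1)) (fun a => v (a.1, a.2.2)) x

theorem sepModel_isHermitian (u : α × β → ι → ℂ) (v : α × γ → ι → ℂ) (x : α × β × γ → ℂ) :
    (sepModel u v x).IsHermitian := linModel_isHermitian _ _ _

theorem continuous_sepModel (u : α × β → ι → ℂ) (v : α × γ → ι → ℂ) :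
    Continuous (sepModel u v) := continuous_linModel _ _

/-- For a fixed second vector the matrix is additive in the first one, so a whole column of
coefficients costs rank two and not one rank per entry. -/
theorem sum_rankTwo {β : Type*} (s : Finset β) (u : β → ι → ℂ) (v : ι → ℂ) (x : β → ℂ) :
    ∑ i ∈ s, rankTwo (u i) v (x i) = rankTwo (∑ i ∈ s, x i • u i) v 1 := by
  classical
  induction s using Finset.induction_on with
  | empty => ext; simp [rankTwo]
  | insert a s ha ih =>
    rw [Finset.sum_insert ha, ih, Finset.sum_insert ha]
    ext k l
    simp only [rankTwo, Matrix.add_apply, Matrix.smul_apply, Matrix.vecMulVec_apply, Pi.star_apply,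
      Pi.add_apply, Pi.smul_apply, smul_eq_mul, star_add, star_mul', star_one]
    ring

theorem rankTwo_sub (u v : ι → ℂ) (x y : ℂ) :
    rankTwo u v x - rankTwo u v y = rankTwo u v (x - y) := by
  simp only [rankTwo, star_sub, sub_smul]
  abel

variable [Fintype ι]

theorem rank_vecMulVec_le_one (x y : ι → ℂ) : (Matrix.vecMulVec x y).rank ≤ 1 :=
  Matrix.rank_vecMulVec_le x y

theorem rank_add_le {κ : Type*} [Finite κ] (A B : Matrix κ ι ℂ) : (A + B).rank ≤ A.rank + B.rank := by
  have h : LinearMap.range (A + B).mulVecLin ≤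
      LinearMap.range A.mulVecLin ⊔ LinearMap.range B.mulVecLin := by
    rintro _ ⟨x, rfl⟩
    rw [Matrix.mulVecLin_add, LinearMap.add_apply]
    exact Submodule.add_mem_sup ⟨x, rfl⟩ ⟨x, rfl⟩
  exact (Submodule.finrank_mono h).trans (Submodule.finrank_add_le_finrank_add_finrank _ _)

theorem rank_sum_le {κ κ' : Type*} [Finite κ'] (s : Finset κ) (f : κ → Matrix κ' ι ℂ) :
    (∑ i ∈ s, f i).rank ≤ ∑ i ∈ s, (f i).rank := by
  classical
  induction s using Finset.induction_on with
  | empty => simp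
  | insert a s ha ih =>
    rw [Finset.sum_insert ha, Finset.sum_insert ha]
    exact (rank_add_le _ _).trans (by gcongr)

theorem rank_rankTwo_le (u v : ι → ℂ) (x : ℂ) : (rankTwo u v x).rank ≤ 2 := by
  rw [rankTwo, ← Matrix.smul_vecMulVec, ← Matrix.smul_vecMulVec]
  exact (rank_add_le _ _).trans
    (add_le_add (rank_vecMulVec_le_one _ _) (rank_vecMulVec_le_one _ _))

/-- Changing one column of the coefficients changes the model by a matrix of rank at most `2 |α|`. -/
theorem rank_sepModel_sub_le (u : α × β → ι → ℂ) (v : α × γ → ι → ℂ) {x y : α × β × γ → ℂ}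
    (j : γ) (h : ∀ r i k, k ≠ j → x (r, i, k) = y (r, i, k)) :
    (sepModel u v x - sepModel u v y).rank ≤ 2 * Fintype.card α := by
  classical
  have e : sepModel u v x - sepModel u v y =
      ∑ r, rankTwo (∑ i, (x (r, i, j) - y (r, i, j)) • u (r, i)) (v (r, j)) 1 := by
    rw [sepModel, sepModel, linModel, linModel, ← Finset.sum_sub_distrib]
    simp only [rankTwo_sub]
    rw [Fintype.sum_prod_type]
    refine Finset.sum_congr rfl fun r _ => ?_
    rw [← sum_rankTwo, Fintype.sum_prod_type]
    refine Finset.sum_congr rfl fun i _ => ?_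
    rw [Finset.sum_eq_single j]
    · intro k _ hk
      rw [h r i k hk, sub_self]
      simp [rankTwo]
    · simp
  rw [e]
  refine (rank_sum_le _ _).trans ((Finset.sum_le_sum fun r _ => rank_rankTwo_le _ _ _).trans ?_)
  simp [mul_comm]

variable [DecidableEq ι]

theorem continuous_trace_mul_resolv_sepModel (u : α × β → ι → ℂ) (v : α × γ → ι → ℂ)
    (M : Matrix ι ι ℂ) {w : ℂ} (hw : 0 < w.im) :
    Continuous fun x => (M * resolv (sepModel u v x) w).trace :=
  Continuous.matrix_trace (continuous_const.matrix_mul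
    (continuous_resolv_comp (continuous_sepModel u v) (sepModel_isHermitian u v) hw))

theorem norm_trace_mul_resolv_le {W : Matrix ι ι ℂ} (hW : W.IsHermitian) {w : ℂ} (hw : 0 < w.im)
    (M : Matrix ι ι ℂ) :
    ‖(M * resolv W w).trace‖ ≤ Fintype.card ι * (‖M‖ * (w.im)⁻¹) := by
  refine (norm_trace_le _).trans ?_
  gcongr
  exact (norm_mul_le _ _).trans (mul_le_mul_of_nonneg_left (norm_resolv_le hW hw) (norm_nonneg _))

/-- McDiarmid's inequality with the n columns as independent coordinates. Replacing a column changes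
the model by rank at most 2K and the trace by at most 2K · ‖M‖ · 2 / Im w, no matter how large the
entries are, so the entries need no truncation. -/
theorem integral_norm_trace_sub_pow_four_le {K p n : ℕ} (hn : 0 < n)
    {ζ : Fin K × Fin p × Fin n → Ω → ℂ} (hm : ∀ a, Measurable (ζ a)) (hind : iIndepFun ζ P)
    (u : Fin K × Fin p → ι → ℂ) (v : Fin K × Fin n → ι → ℂ) (M : Matrix ι ι ℂ) {w : ℂ}
    (hw : 0 < w.im) {c : ℝ} (hc : 0 < c) (hMc : 4 * K * (‖M‖ * (w.im)⁻¹) ≤ c) :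
    ∫ ω, ‖(M * resolv (sepModel u v fun a => ζ a ω) w).trace -
      ∫ ω', (M * resolv (sepModel u v fun a => ζ a ω') w).trace ∂P‖ ^ 4 ∂P ≤
      384 * (n * c ^ 2) ^ 2 := by
  obtain ⟨μ, hμ, hmap⟩ := map_regroup_eq_pi hm hind
  let F : (Fin n → Fin K × Fin p → ℂ) → ℂ := fun x =>
    (M * resolv (sepModel u v fun a => x a.2.2 (a.1, a.2.1)) w).trace
  have hFc : Continuous F := (continuous_trace_mul_resolv_sepModel u v M hw).comp (by fun_prop)
  have hreg : Measurable fun ω j (q : Fin K × Fin p) => ζ (q.1, q.2, j) ω := by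
    refine measurable_pi_lambda _ fun j => measurable_pi_lambda _ fun q => hm _
  have hdiff : ∀ x j e, ‖F (Function.update x j e) - F x‖ ≤ c := fun x j e => by
    refine (norm_trace_mul_resolv_sub_le (sepModel_isHermitian _ _ _) (sepModel_isHermitian _ _ _)
      hw M).trans (le_trans ?_ hMc)
    have hr := rank_sepModel_sub_le u v (x := fun a => x a.2.2 (a.1, a.2.1))
      (y := fun a => Function.update x j e a.2.2 (a.1, a.2.1)) j
      (fun r i k hk => by simp [Function.update_of_ne hk])
    rw [Fintype.card_fin] at hr
    have hr' : ((sepModel u v (fun a => x a.2.2 (a.1, a.2.1)) -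
      sepModel u v (fun a => Function.update x j e a.2.2 (a.1, a.2.1))).rank : ℝ) ≤ 2 * K := by
      exact_mod_cast hr
    have h0 : 0 ≤ ‖M‖ * (2 * (w.im)⁻¹) := by positivity
    nlinarith [mul_le_mul_of_nonneg_right hr' h0]
  have key := integral_norm_pow_four_le_of_bounded_differences hn μ hFc.measurable
    (fun x => norm_trace_mul_resolv_le (sepModel_isHermitian _ _ _) hw M) hc hdiff
  rw [← hmap, integral_map hreg.aemeasurable hFc.measurable.aestronglyMeasurable,
    integral_map hreg.aemeasurable (by
      have := hFc.measurable
      fun_prop)] at key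
  exact key

end Concentration

end SumSeparable
end

/-! ### Gram matrices and the Dyson equation -/

noncomputable section

namespace SumSeparable

open scoped Matrix.Norms.L2Operator

section Gram

variable {ι κ κ' : Type*} [Fintype κ] [Fintype κ']

/-- The matrix `∑ i, x_i x_i^*`. -/
def gram (x : κ → ι → ℂ) : Matrix ι ι ℂ := ∑ i, Matrix.vecMulVec (x i) (star (x i))

variable [Fintype ι]

theorem sum_bil_eq_trace (N : Matrix ι ι ℂ) (x : κ → ι → ℂ) :
    ∑ i, bil N (x i) (x i) = (N * gram x).trace := by
  classical
  rw [gram, Matrix.mul_sum, Matrix.trace_sum]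
  refine Finset.sum_congr rfl fun i _ => ?_
  have := trace_mul_vecMulVec_mul 1 N (x i) (x i)
  rw [Matrix.one_mul, Matrix.mul_one, Matrix.trace_mul_comm] at this
  exact this.symm

theorem bil_gram (x : κ → ι → ℂ) (z : ι → ℂ) :
    bil (gram x) z z = ((∑ i, ‖star (x i) ⬝ᵥ z‖ ^ 2 : ℝ) : ℂ) := by
  rw [gram, bil, Matrix.sum_mulVec, dotProduct_sum]
  push_cast
  refine Finset.sum_congr rfl fun i _ => ?_
  rw [Matrix.vecMulVec_mulVec, ← Complex.ofReal_pow, ← Complex.normSq_eq_norm_sq,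
    Complex.normSq_eq_conj_mul_self]
  have e : (starRingEnd ℂ) (star (x i) ⬝ᵥ z) = star z ⬝ᵥ x i := by
    rw [← Complex.star_def, ← Matrix.star_dotProduct_star, star_star]
  rw [e]
  simp [mul_comm]

variable [DecidableEq ι]

theorem sum_norm_dotProduct_sq_le (x : κ → ι → ℂ) (z : ι → ℂ) :
    ∑ i, ‖star (x i) ⬝ᵥ z‖ ^ 2 ≤ ‖gram x‖ * vnorm z ^ 2 := by
  have h := norm_bil_le (gram x) z z
  rw [bil_gram, Complex.norm_real, Real.norm_of_nonneg (by positivity)] at h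
  rwa [pow_two (vnorm z)]

theorem vnorm_sq_le_norm_gram (x : κ → ι → ℂ) (i : κ) : vnorm (x i) ^ 2 ≤ ‖gram x‖ := by
  rcases (sq_nonneg (vnorm (x i))).eq_or_lt with h0 | h0
  · rw [← h0]; exact norm_nonneg _
  have h := sum_norm_dotProduct_sq_le x (x i)
  have h1 := Finset.single_le_sum (f := fun k => ‖star (x k) ⬝ᵥ x i‖ ^ 2)
    (fun k _ => by positivity) (Finset.mem_univ i)
  simp only [star_dotProduct_self, Complex.norm_real, Real.norm_of_nonneg h0.le] at h1
  rw [← mul_le_mul_iff_left₀ h0]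
  nlinarith [h1.trans h]

theorem sum_norm_bil_sq_le (x : κ → ι → ℂ) (y : κ' → ι → ℂ) (N : Matrix ι ι ℂ) {b : ℝ}
    (hb : ‖gram y‖ ≤ b) :
    ∑ i, ∑ j, ‖bil N (y j) (x i)‖ ^ 2 ≤ b * ‖N‖ ^ 2 * ∑ i, vnorm (x i) ^ 2 := by
  rw [Finset.mul_sum]
  refine Finset.sum_le_sum fun i _ => ?_
  have hb0 := (norm_nonneg _).trans hb
  refine (sum_norm_dotProduct_sq_le y (N *ᵥ x i)).trans ?_
  have h1 : vnorm (N *ᵥ x i) ^ 2 ≤ (‖N‖ * vnorm (x i)) ^ 2 :=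
    pow_le_pow_left₀ (vnorm_nonneg _) (vnorm_mulVec_le _ _) 2
  calc ‖gram y‖ * vnorm (N *ᵥ x i) ^ 2 ≤ b * (‖N‖ * vnorm (x i)) ^ 2 := by gcongr
    _ = _ := by ring

/-- After the product is split into two squares, the Bessel-type inequality for the Gram matrix of y
disposes of the sum over j. Only the number of indices i enters the bound, which makes the
pseudo-variance negligible next to the main terms. -/
theorem sum_norm_pseudoTerm_le (M : Matrix ι ι ℂ) (x : κ → ι → ℂ) (y : κ' → ι → ℂ)
    {Y : Matrix ι ι ℂ} {a b B m : ℝ} (ha : ‖gram x‖ ≤ a) (hb : ‖gram y‖ ≤ b) (hY : ‖Y‖ ≤ B)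
    (hM : ‖M‖ ≤ m) :
    ∑ i, ∑ j, ‖pseudoTerm M (x i) (y j) Y‖ ≤ Fintype.card κ * (a * b) * (B ^ 2 * (1 + m ^ 2)) := by
  have hb0 := (norm_nonneg _).trans hb
  have ha0 := (norm_nonneg _).trans ha
  have hB0 := (norm_nonneg _).trans hY
  have hm0 := (norm_nonneg _).trans hM
  have h1 : ∑ i, ∑ j, ‖pseudoTerm M (x i) (y j) Y‖ ≤
      ∑ i, ∑ j, ‖bil Y (y j) (x i)‖ ^ 2 + ∑ i, ∑ j, ‖bil (Y * M) (y j) (x i)‖ ^ 2 := by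
    simp only [← Finset.sum_add_distrib]
    refine Finset.sum_le_sum fun i _ => Finset.sum_le_sum fun j _ => ?_
    rw [pseudoTerm, norm_mul]
    nlinarith [sq_nonneg (‖bil Y (y j) (x i)‖ - ‖bil (Y * M) (y j) (x i)‖),
      sq_nonneg (‖bil Y (y j) (x i)‖), sq_nonneg (‖bil (Y * M) (y j) (x i)‖)]
  have h2 : ∑ i, vnorm (x i) ^ 2 ≤ Fintype.card κ * a := by
    refine (Finset.sum_le_sum fun i _ => (vnorm_sq_le_norm_gram x i).trans ha).trans ?_
    simp
  have h3 : ‖Y * M‖ ≤ B * m := (norm_mul_le _ _).trans (by gcongr)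
  refine h1.trans ((add_le_add (sum_norm_bil_sq_le x y Y hb)
    (sum_norm_bil_sq_le x y (Y * M) hb)).trans ?_)
  calc _ ≤ b * B ^ 2 * (Fintype.card κ * a) + b * (B * m) ^ 2 * (Fintype.card κ * a) := by
        gcongr
    _ = _ := by ring

end Gram

section Dyson

variable {Ω : Type*} [MeasurableSpace Ω] {P : Measure Ω} {ι : Type*} [Fintype ι]
variable {α β γ : Type*} [Fintype α] [Fintype β] [Fintype γ]

/-- Each main term is a product of a factor in i and a factor in j, so the double sum becomes a
product of two traces. This is the self-energy. -/
theorem sum_mainTerm (u : α × β → ι → ℂ) (v : α × γ → ι → ℂ) (M Y : Matrix ι ι ℂ) :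
    ∑ a : α × β × γ, mainTerm M (u (a.1, a.2.1)) (v (a.1, a.2.2)) Y =
      ∑ r, ((Y * gram fun j => v (r, j)).trace * (M * (gram fun i => u (r, i)) * Y).trace +
        (Y * gram fun i => u (r, i)).trace * (M * (gram fun j => v (r, j)) * Y).trace) := by
  rw [Fintype.sum_prod_type]
  refine Finset.sum_congr rfl fun r _ => ?_
  have e : ∀ N : Matrix ι ι ℂ, (M * N * Y).trace = (Y * M * N).trace := fun N => by
    rw [Matrix.trace_mul_comm, Matrix.mul_assoc]
  rw [e, e, ← sum_bil_eq_trace, ← sum_bil_eq_trace, ← sum_bil_eq_trace, ← sum_bil_eq_trace,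
    Fintype.sum_prod_type]
  simp only [mainTerm, Finset.sum_add_distrib, Finset.sum_mul_sum]
  congr 1
  · exact Finset.sum_comm

variable [DecidableEq ι]

/-- The resolvent never leaves a fixed compact ball, on which a continuous functional is bounded. -/
theorem integrable_comp_resolv [IsProbabilityMeasure P] {ζ : α × β × γ → Ω → ℂ}
    (hm : ∀ a, Measurable (ζ a))
    (u : α × β → ι → ℂ) (v : α × γ → ι → ℂ) {w : ℂ} (hw : 0 < w.im)
    {E : Type*} [NormedAddCommGroup E] [MeasurableSpace E] [BorelSpace E]
    [SecondCountableTopology E]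
    {φ : Matrix ι ι ℂ → E} (hφ : Continuous φ) :
    Integrable (fun ω => φ (resolv (sepModel u v fun a => ζ a ω) w)) P := by
  have : ProperSpace (Matrix ι ι ℂ) := FiniteDimensional.proper ℂ _
  obtain ⟨C, hC⟩ := (isCompact_closedBall (0 : Matrix ι ι ℂ) (w.im)⁻¹).exists_bound_of_continuousOn
    hφ.continuousOn
  have h1 : Continuous fun x => φ (resolv (sepModel u v x) w) :=
    hφ.comp (continuous_resolv_comp (continuous_sepModel u v) (sepModel_isHermitian u v) hw)
  refine Integrable.of_bound (C := C)
    (h1.measurable.comp (measurable_pi_lambda _ hm)).aestronglyMeasurable (ae_of_all _ fun ω => ?_)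
  exact hC _ (by simpa using norm_resolv_le (sepModel_isHermitian u v _) hw)

/-- The operator `w + ∑ r, (β_r u_r u_r^* + α_r v_r v_r^*)`. -/
def dysonOp (u : α × β → ι → ℂ) (v : α × γ → ι → ℂ) (w : ℂ) (s t : α → ℂ) : Matrix ι ι ℂ :=
  w • 1 + ∑ r, (t r • gram (fun i => u (r, i)) + s r • gram (fun j => v (r, j)))

theorem trace_mul_dysonOp_mul (u : α × β → ι → ℂ) (v : α × γ → ι → ℂ) (w : ℂ) (s t : α → ℂ)
    (M Y : Matrix ι ι ℂ) :
    (M * dysonOp u v w s t * Y).trace = w * (M * Y).trace +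
      ∑ r, (t r * (M * (gram fun i => u (r, i)) * Y).trace +
        s r * (M * (gram fun j => v (r, j)) * Y).trace) := by
  rw [dysonOp, Matrix.mul_add, Matrix.add_mul, Matrix.trace_add, Matrix.mul_smul, Matrix.mul_one,
    Matrix.smul_mul, Matrix.trace_smul, smul_eq_mul, Matrix.mul_sum, Matrix.sum_mul,
    Matrix.trace_sum]
  congr 1
  refine Finset.sum_congr rfl fun r _ => ?_
  rw [Matrix.mul_add, Matrix.add_mul, Matrix.trace_add, Matrix.mul_smul, Matrix.mul_smul,
    Matrix.smul_mul, Matrix.smul_mul, Matrix.trace_smul, Matrix.trace_smul, smul_eq_mul,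
    smul_eq_mul]

/-- The quadratic forms of Gram matrices are real and nonnegative. Coefficients in the closed upper
half-plane therefore only increase the imaginary part of the numerical range beyond Im w. -/
theorem dysonOp_inv (u : α × β → ι → ℂ) (v : α × γ → ι → ℂ) {w : ℂ} (hw : 0 < w.im)
    {s t : α → ℂ} (hs : ∀ r, 0 ≤ (s r).im) (ht : ∀ r, 0 ≤ (t r).im) :
    IsUnit (dysonOp u v w s t).det ∧ ‖(dysonOp u v w s t)⁻¹‖ ≤ (w.im)⁻¹ := by
  refine isUnit_of_bil_ge hw fun x => ?_
  have hsum : ∀ f : α → Matrix ι ι ℂ, bil (∑ r, f r) x x = ∑ r, bil (f r) x x := fun f => by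
    simp only [bil, Matrix.sum_mulVec, dotProduct_sum]
  have h1 : w.im * vnorm x ^ 2 ≤ (bil (dysonOp u v w s t) x x).im := by
    rw [dysonOp, bil_add, bil_smul, bil_one, hsum, Complex.add_im, Complex.im_mul_ofReal,
      Complex.im_sum]
    refine le_add_of_nonneg_right (Finset.sum_nonneg fun r _ => ?_)
    rw [bil_add, bil_smul, bil_smul, bil_gram, bil_gram, Complex.add_im, Complex.im_mul_ofReal,
      Complex.im_mul_ofReal]
    have := hs r
    have := ht r
    positivity
  exact h1.trans ((le_abs_self _).trans (Complex.abs_im_le_norm _))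

/-- The Dyson equation before the self-energy is replaced by its expectation. -/
theorem norm_integral_trace_dysonOp_add_trace_le [IsProbabilityMeasure P] [DecidableEq α]
    [DecidableEq β] [DecidableEq γ] {ζ : α × β × γ → Ω → ℂ} (hm : ∀ a, Measurable (ζ a))
    (hind : iIndepFun ζ P) (hmean : ∀ a, ∫ ω, ζ a ω ∂P = 0)
    (hvar : ∀ a, ∫ ω, ‖ζ a ω‖ ^ 2 ∂P = 1) {m₃ : ℝ}
    (hInt : ∀ a, Integrable (fun ω => ‖ζ a ω‖ ^ 3) P) (hm₃ : ∀ a, ∫ ω, ‖ζ a ω‖ ^ 3 ∂P ≤ m₃)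
    (hm₃0 : 0 ≤ m₃) (u : α × β → ι → ℂ) (v : α × γ → ι → ℂ) (M : Matrix ι ι ℂ) {w : ℂ}
    (hw : 0 < w.im) {a b s m : ℝ} (ha : ∀ r, ‖gram fun i => u (r, i)‖ ≤ a)
    (hb : ∀ r, ‖gram fun j => v (r, j)‖ ≤ b) (hs : 0 ≤ s) (hab : a * b ≤ s ^ 2) (hM : ‖M‖ ≤ m) :
    ‖∫ ω, (M * dysonOp u v w
        (fun r => (resolv (sepModel u v fun q => ζ q ω) w * gram fun i => u (r, i)).trace)
        (fun r => (resolv (sepModel u v fun q => ζ q ω) w * gram fun j => v (r, j)).trace) *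
          resolv (sepModel u v fun q => ζ q ω) w).trace ∂P + M.trace‖ ≤
      Fintype.card α * (Fintype.card β + Fintype.card γ) * s ^ 2 *
        ((w.im)⁻¹ ^ 2 * (1 + m ^ 2)) +
      Fintype.card α * Fintype.card β * Fintype.card γ *
        ((16 + 24 * m₃) * (s ^ 3 * m * (w.im)⁻¹ ^ 3)) := by
  set B := (w.im)⁻¹ with hB
  set R : Ω → Matrix ι ι ℂ := fun ω => resolv (sepModel u v fun q => ζ q ω) w with hR
  have hB0 : 0 < B := inv_pos.2 hw
  have hm0 : 0 ≤ m := (norm_nonneg _).trans hM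
  have hRB : ∀ ω, ‖R ω‖ ≤ B := fun ω => norm_resolv_le (sepModel_isHermitian _ _ _) hw
  let U : α × β × γ → ι → ℂ := fun q => u (q.1, q.2.1)
  let V : α × β × γ → ι → ℂ := fun q => v (q.1, q.2.2)
  have hintg : ∀ φ : Matrix ι ι ℂ → ℂ, Continuous φ → Integrable (fun ω => φ (R ω)) P :=
    fun φ hφ => integrable_comp_resolv hm u v hw hφ
  have hcm : ∀ q, Continuous fun Y => mainTerm M (U q) (V q) Y := fun q => by
    have h1 := fun x : ι → ℂ => continuous_bil (continuous_id (X := Matrix ι ι ℂ)) x x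
    have h2 := fun x : ι → ℂ =>
      continuous_bil ((continuous_id (X := Matrix ι ι ℂ)).matrix_mul continuous_const
        (B := fun _ => M)) x x
    exact ((h1 _).mul (h2 _)).add ((h1 _).mul (h2 _))
  have hcp : ∀ x y, Continuous fun Y => pseudoTerm M x y Y := fun x y =>
    (continuous_bil (continuous_id (X := Matrix ι ι ℂ)) _ _).mul
      (continuous_bil ((continuous_id (X := Matrix ι ι ℂ)).matrix_mul continuous_const
        (B := fun _ => M)) _ _)
  have hIt : ∀ q, Integrable (fun ω => (M * rankTwo (U q) (V q) (ζ q ω) * R ω).trace) P :=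
    fun q => by
      have hζ : Integrable (ζ q) P := by
        refine ((integrable_const (1 : ℝ)).add (hInt q)).mono' (hm q).aestronglyMeasurable
          (ae_of_all _ fun ω => ?_)
        have h0 := norm_nonneg (ζ q ω)
        simp only [Pi.add_apply]
        nlinarith [mul_nonneg h0 (sq_nonneg (‖ζ q ω‖ - 1)), sq_nonneg (‖ζ q ω‖ - 1)]
      have hζ' : Integrable (fun ω => star (ζ q ω)) P :=
        hζ.norm.mono' (continuous_star.measurable.comp (hm q)).aestronglyMeasurable
          (ae_of_all _ fun ω => by simp)
      have hbil : ∀ x y : ι → ℂ, Integrable (fun ω => bil (R ω * M) x y) P := fun x y =>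
        hintg (fun Y => bil (Y * M) x y)
          (continuous_bil ((continuous_id (X := Matrix ι ι ℂ)).matrix_mul continuous_const) _ _)
      have hbd : ∀ (x y : ι → ℂ) ω, ‖bil (R ω * M) x y‖ ≤ B * ‖M‖ * (vnorm x * vnorm y) :=
        fun x y ω => (norm_bil_le _ _ _).trans (mul_le_mul_of_nonneg_right
          ((norm_mul_le _ _).trans (mul_le_mul_of_nonneg_right (hRB ω) (norm_nonneg _)))
          (mul_nonneg (vnorm_nonneg _) (vnorm_nonneg _)))
      simp only [trace_mul_rankTwo_mul]
      exact (hζ.mul_bdd (hbil _ _).aestronglyMeasurable (ae_of_all _ (hbd _ _))).add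
        (hζ'.mul_bdd (hbil _ _).aestronglyMeasurable (ae_of_all _ (hbd _ _)))
  have hent := fun q => norm_integral_trace_add_mainTerm_le hm hind q (hmean q) (hvar q) (hInt q)
    (hm₃ q) U V M hw
  -- Summing M V_a G over the entries gives M W G = M + w M G. The main terms add the self-energy,
  -- and together they form tr(M D G) + tr M.
  have hmain : ∫ ω, (M * dysonOp u v w
        (fun r => (R ω * gram fun i => u (r, i)).trace)
        (fun r => (R ω * gram fun j => v (r, j)).trace) * R ω).trace ∂P + M.trace =
      ∑ q, (∫ ω, (M * rankTwo (U q) (V q) (ζ q ω) * R ω).trace ∂P +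
        ∫ ω, mainTerm M (U q) (V q) (R ω) ∂P) := by
    rw [Finset.sum_add_distrib, ← integral_finsetSum _ fun q _ => hIt q,
      ← integral_finsetSum _ fun q _ => hintg _ (hcm q)]
    have e1 : ∀ ω, ∑ q, (M * rankTwo (U q) (V q) (ζ q ω) * R ω).trace =
        M.trace + w * (M * R ω).trace := fun ω => by
      rw [← Matrix.trace_sum, ← Matrix.sum_mul, ← Matrix.mul_sum]
      have : ∑ q, rankTwo (U q) (V q) (ζ q ω) = sepModel u v fun q => ζ q ω := rfl
      rw [this, Matrix.mul_assoc, mul_resolv (sepModel_isHermitian _ _ _) hw, Matrix.mul_add,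
        Matrix.mul_one, Matrix.trace_add, Matrix.mul_smul, Matrix.trace_smul, smul_eq_mul]
    have hMR : Integrable (fun ω => w * (M * R ω).trace) P :=
      hintg (fun Y => w * (M * Y).trace)
        (continuous_const.mul (Continuous.matrix_trace (continuous_const.matrix_mul continuous_id)))
    have hsum : Integrable (fun ω => ∑ q, mainTerm M (U q) (V q) (R ω)) P :=
      integrable_finsetSum _ fun q _ => hintg _ (hcm q)
    simp only [e1]
    rw [integral_add (integrable_const _) hMR, integral_const, probReal_univ, one_smul]
    have e2 : ∀ ω, (M * dysonOp u v w
        (fun r => (R ω * gram fun i => u (r, i)).trace)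
        (fun r => (R ω * gram fun j => v (r, j)).trace) * R ω).trace =
        w * (M * R ω).trace + ∑ q, mainTerm M (U q) (V q) (R ω) := fun ω => by
      rw [trace_mul_dysonOp_mul, sum_mainTerm]
    simp only [e2]
    rw [integral_add hMR hsum]
    ring
  rw [hmain]
  refine (norm_sum_le _ _).trans ((Finset.sum_le_sum fun q _ => hent q).trans ?_)
  rw [Finset.sum_add_distrib, Finset.sum_add_distrib]
  have hp1 : ∑ q, ∫ ω, ‖pseudoTerm M (U q) (V q) (R ω)‖ ∂P ≤
      Fintype.card α * Fintype.card β * s ^ 2 * (B ^ 2 * (1 + m ^ 2)) := by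
    rw [← integral_finsetSum _ fun q _ => (hintg _ (hcp _ _)).norm]
    have hpt : ∀ ω, ∑ q, ‖pseudoTerm M (U q) (V q) (R ω)‖ ≤
        Fintype.card α * Fintype.card β * s ^ 2 * (B ^ 2 * (1 + m ^ 2)) := fun ω => by
      rw [Fintype.sum_prod_type]
      have h1 : ∀ r, ∑ q : β × γ, ‖pseudoTerm M (U (r, q)) (V (r, q)) (R ω)‖ ≤
          Fintype.card β * s ^ 2 * (B ^ 2 * (1 + m ^ 2)) := fun r => by
        rw [Fintype.sum_prod_type]
        refine (sum_norm_pseudoTerm_le M (fun i => u (r, i)) (fun j => v (r, j)) (ha r) (hb r)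
          (hRB ω) hM).trans ?_
        gcongr
      refine (Finset.sum_le_sum fun r _ => h1 r).trans (le_of_eq ?_)
      simp
      ring
    refine (integral_mono (integrable_finsetSum _ fun q _ => (hintg _ (hcp _ _)).norm)
      (integrable_const _) hpt).trans (le_of_eq ?_)
    simp
  have hp2 : ∑ q, ∫ ω, ‖pseudoTerm M (V q) (U q) (R ω)‖ ∂P ≤
      Fintype.card α * Fintype.card γ * s ^ 2 * (B ^ 2 * (1 + m ^ 2)) := by
    rw [← integral_finsetSum _ fun q _ => (hintg _ (hcp _ _)).norm]
    have hpt : ∀ ω, ∑ q, ‖pseudoTerm M (V q) (U q) (R ω)‖ ≤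
        Fintype.card α * Fintype.card γ * s ^ 2 * (B ^ 2 * (1 + m ^ 2)) := fun ω => by
      rw [Fintype.sum_prod_type]
      have h1 : ∀ r, ∑ q : β × γ, ‖pseudoTerm M (V (r, q)) (U (r, q)) (R ω)‖ ≤
          Fintype.card γ * s ^ 2 * (B ^ 2 * (1 + m ^ 2)) := fun r => by
        rw [Fintype.sum_prod_type_right]
        refine (sum_norm_pseudoTerm_le M (fun j => v (r, j)) (fun i => u (r, i)) (hb r) (ha r)
          (hRB ω) hM).trans ?_
        gcongr
        linarith
      refine (Finset.sum_le_sum fun r _ => h1 r).trans (le_of_eq ?_)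
      simp
      ring
    refine (integral_mono (integrable_finsetSum _ fun q _ => (hintg _ (hcp _ _)).norm)
      (integrable_const _) hpt).trans (le_of_eq ?_)
    simp
  have hp3 : ∑ q, (16 + 24 * m₃) * ((vnorm (U q) * vnorm (V q)) ^ 3 * ‖M‖ * B ^ 3) ≤
      Fintype.card α * Fintype.card β * Fintype.card γ *
        ((16 + 24 * m₃) * (s ^ 3 * m * B ^ 3)) := by
    have h1 : ∀ q, vnorm (U q) * vnorm (V q) ≤ s := fun q => by
      refine (sq_le_sq₀ (mul_nonneg (vnorm_nonneg _) (vnorm_nonneg _)) hs).1 ?_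
      rw [mul_pow]
      refine (mul_le_mul ((vnorm_sq_le_norm_gram (fun i => u (q.1, i)) q.2.1).trans (ha _))
        ((vnorm_sq_le_norm_gram (fun j => v (q.1, j)) q.2.2).trans (hb _)) (sq_nonneg _)
        ((norm_nonneg _).trans (ha q.1))).trans hab
    have h2 : ∀ q, (16 + 24 * m₃) * ((vnorm (U q) * vnorm (V q)) ^ 3 * ‖M‖ * B ^ 3) ≤
        (16 + 24 * m₃) * (s ^ 3 * m * B ^ 3) := fun q => by
      have := mul_nonneg (vnorm_nonneg (U q)) (vnorm_nonneg (V q))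
      gcongr
      exact h1 q
    refine (Finset.sum_le_sum fun q _ => h2 q).trans (le_of_eq ?_)
    simp only [Finset.sum_const, Finset.card_univ, Fintype.card_prod, nsmul_eq_mul]
    push_cast
    ring
  refine (add_le_add (add_le_add hp1 hp2) hp3).trans (le_of_eq ?_)
  ring

/-- Replaces Hölder's inequality: t is taken to be the expected size √n c of the fluctuation. -/
theorem le_add_pow_four_div {x t : ℝ} (hx : 0 ≤ x) (ht : 0 < t) : x ≤ t + x ^ 4 / t ^ 3 := by
  rcases le_total x t with h | h
  · have : 0 ≤ x ^ 4 / t ^ 3 := by positivity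
    linarith
  · have : x ≤ x ^ 4 / t ^ 3 := by
      rw [le_div_iff₀ (by positivity)]
      calc x * t ^ 3 ≤ x * x ^ 3 := by gcongr
        _ = x ^ 4 := by ring
    linarith

theorem integral_norm_trace_sub_le [IsProbabilityMeasure P] {K p n : ℕ} (hn : 0 < n)
    {ζ : Fin K × Fin p × Fin n → Ω → ℂ} (hm : ∀ a, Measurable (ζ a)) (hind : iIndepFun ζ P)
    (u : Fin K × Fin p → ι → ℂ) (v : Fin K × Fin n → ι → ℂ) (M : Matrix ι ι ℂ) {w : ℂ}
    (hw : 0 < w.im) {c : ℝ} (hc : 0 < c) (hMc : 4 * K * (‖M‖ * (w.im)⁻¹) ≤ c) :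
    ∫ ω, ‖(M * resolv (sepModel u v fun a => ζ a ω) w).trace -
      ∫ ω', (M * resolv (sepModel u v fun a => ζ a ω') w).trace ∂P‖ ∂P ≤ 385 * (√n * c) := by
  set f : Ω → ℂ := fun ω => (M * resolv (sepModel u v fun a => ζ a ω) w).trace with hf
  have h4 := integral_norm_trace_sub_pow_four_le hn hm hind u v M hw hc hMc
  have hcont : Continuous fun Y : Matrix ι ι ℂ => (M * Y).trace - ∫ ω', f ω' ∂P :=
    (Continuous.matrix_trace (continuous_const.matrix_mul continuous_id)).sub continuous_const
  have hn' : (0 : ℝ) < √n := Real.sqrt_pos.2 (by exact_mod_cast hn)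
  have hnn : (n : ℝ) = √n ^ 2 := (Real.sq_sqrt (Nat.cast_nonneg n)).symm
  have i1 : Integrable (fun ω => ‖f ω - ∫ ω', f ω' ∂P‖) P :=
    integrable_comp_resolv hm u v hw (φ := fun Y => ‖(M * Y).trace - ∫ ω', f ω' ∂P‖) hcont.norm
  have i4 : Integrable (fun ω => ‖f ω - ∫ ω', f ω' ∂P‖ ^ 4) P :=
    integrable_comp_resolv hm u v hw (φ := fun Y => ‖(M * Y).trace - ∫ ω', f ω' ∂P‖ ^ 4)
      (hcont.norm.pow 4)
  -- 385 = 1 + 384, because 384 (n c²)² / (√n c)³ = 384 √n c.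
  have ht : 0 < √n * c := by positivity
  calc ∫ ω, ‖f ω - ∫ ω', f ω' ∂P‖ ∂P
      ≤ ∫ ω, (√n * c + ‖f ω - ∫ ω', f ω' ∂P‖ ^ 4 / (√n * c) ^ 3) ∂P :=
        integral_mono i1 ((integrable_const _).add (i4.div_const _)) fun ω =>
          le_add_pow_four_div (norm_nonneg _) ht
    _ = √n * c + (∫ ω, ‖f ω - ∫ ω', f ω' ∂P‖ ^ 4 ∂P) / (√n * c) ^ 3 := by
        rw [integral_add (integrable_const _) (i4.div_const _), integral_div]
        simp
    _ ≤ √n * c + (384 * (n * c ^ 2) ^ 2) / (√n * c) ^ 3 := by gcongr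
    _ = 385 * (√n * c) := by
        rw [hnn, Real.sqrt_sq hn'.le]
        field_simp
        ring

theorem trace_resolv_mul_gram_im_nonneg {κ : Type*} [Fintype κ] {W : Matrix ι ι ℂ}
    (hW : W.IsHermitian) {w : ℂ} (hw : 0 < w.im) (x : κ → ι → ℂ) :
    0 ≤ ((resolv W w * gram x).trace).im := by
  rw [← sum_bil_eq_trace, Complex.im_sum]
  exact Finset.sum_nonneg fun i _ => resolv_im_nonneg hW hw _

/-- The Dyson equation for the expected resolvent. -/
theorem norm_integral_trace_add_trace_mul_inv_le [IsProbabilityMeasure P] {K p n : ℕ} (hn : 0 < n)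
    {ζ : Fin K × Fin p × Fin n → Ω → ℂ} (hm : ∀ a, Measurable (ζ a))
    (hind : iIndepFun ζ P) (hmean : ∀ a, ∫ ω, ζ a ω ∂P = 0)
    (hvar : ∀ a, ∫ ω, ‖ζ a ω‖ ^ 2 ∂P = 1) {m₃ : ℝ}
    (hInt : ∀ a, Integrable (fun ω => ‖ζ a ω‖ ^ 3) P) (hm₃ : ∀ a, ∫ ω, ‖ζ a ω‖ ^ 3 ∂P ≤ m₃)
    (hm₃0 : 0 ≤ m₃) (u : Fin K × Fin p → ι → ℂ) (v : Fin K × Fin n → ι → ℂ) (M : Matrix ι ι ℂ)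
    {w : ℂ} (hw : 0 < w.im) {a b s m : ℝ} (ha : ∀ r, ‖gram fun i => u (r, i)‖ ≤ a)
    (hb : ∀ r, ‖gram fun j => v (r, j)‖ ≤ b) (ha0 : 0 < a) (hb0 : 0 < b) (hs : 0 ≤ s)
    (hab : a * b ≤ s ^ 2) (hM : ‖M‖ ≤ m) :
    ‖∫ ω, (M * resolv (sepModel u v fun q => ζ q ω) w).trace ∂P +
      (M * (dysonOp u v w
        (fun r => ∫ ω, ((gram fun i => u (r, i)) * resolv (sepModel u v fun q => ζ q ω) w).trace ∂P)
        (fun r => ∫ ω, ((gram fun j => v (r, j)) * resolv (sepModel u v fun q => ζ q ω) w).trace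
          ∂P))⁻¹).trace‖ ≤
      K * (p + n) * s ^ 2 * ((w.im)⁻¹ ^ 2 * (1 + (m * (w.im)⁻¹) ^ 2)) +
      K * p * n * ((16 + 24 * m₃) * (s ^ 3 * (m * (w.im)⁻¹) * (w.im)⁻¹ ^ 3)) +
      3080 * (K * (K + 1) * (Fintype.card ι * s ^ 2 * √n * (m * (w.im)⁻¹ * (w.im)⁻¹ ^ 2))) := by
  set B := (w.im)⁻¹ with hB
  set R : Ω → Matrix ι ι ℂ := fun ω => resolv (sepModel u v fun q => ζ q ω) w with hR
  set A' : Fin K → Matrix ι ι ℂ := fun r => gram fun i => u (r, i) with hA'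
  set B' : Fin K → Matrix ι ι ℂ := fun r => gram fun j => v (r, j) with hB'
  set α : Fin K → ℂ := fun r => ∫ ω, (A' r * R ω).trace ∂P with hα
  set β : Fin K → ℂ := fun r => ∫ ω, (B' r * R ω).trace ∂P with hβ
  have hB0 : 0 < B := inv_pos.2 hw
  have hm0 : 0 ≤ m := (norm_nonneg _).trans hM
  have hRB : ∀ ω, ‖R ω‖ ≤ B := fun ω => norm_resolv_le (sepModel_isHermitian _ _ _) hw
  have hintg : ∀ φ : Matrix ι ι ℂ → ℂ, Continuous φ → Integrable (fun ω => φ (R ω)) P :=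
    fun φ hφ => integrable_comp_resolv hm u v hw hφ
  have hctr : ∀ N : Matrix ι ι ℂ, Continuous fun Y : Matrix ι ι ℂ => (N * Y).trace := fun N =>
    Continuous.matrix_trace (continuous_const.matrix_mul continuous_id)
  have him : ∀ (κ : Type) [Fintype κ] (x : κ → ι → ℂ), 0 ≤ (∫ ω, (gram x * R ω).trace ∂P).im :=
    fun κ _ x => by
      have h1 := hintg _ (hctr (gram x))
      have h2 : (∫ ω, (gram x * R ω).trace ∂P).im = ∫ ω, ((gram x * R ω).trace).im ∂P :=
        (integral_im h1).symm
      rw [h2]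
      refine integral_nonneg fun ω => ?_
      rw [Matrix.trace_mul_comm]
      exact trace_resolv_mul_gram_im_nonneg (sepModel_isHermitian _ _ _) hw x
  obtain ⟨hDu, hDn⟩ := dysonOp_inv u v hw (s := α) (t := β) (fun r => him _ _) (fun r => him _ _)
  set D := dysonOp u v w α β with hD
  -- D carries the expected coefficients and is deterministic, so the preceding equation may be
  -- applied to N. Then N D = M isolates tr(M G).
  set N := M * D⁻¹ with hN
  have hNm : ‖N‖ ≤ m * B := (norm_mul_le _ _).trans (by gcongr)
  have hND : N * D = M := by
    rw [hN, Matrix.mul_assoc, Matrix.nonsing_inv_mul _ hDu, Matrix.mul_one]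
  have h1 := norm_integral_trace_dysonOp_add_trace_le hm hind hmean hvar hInt hm₃ hm₃0 u v N hw
    ha hb hs hab hNm
  simp only [Fintype.card_fin] at h1
  set X : Ω → ℂ := fun ω => (N * dysonOp u v w (fun r => (R ω * A' r).trace)
    (fun r => (R ω * B' r).trace) * R ω).trace with hX
  -- Replacing random coefficients by expected ones costs products of a centred trace, which is
  -- small by concentration, and a bounded trace.
  have hXeq : ∀ ω, (M * R ω).trace = X ω -
      ∑ r, (((B' r * R ω).trace - β r) * (N * A' r * R ω).trace +
      ((A' r * R ω).trace - α r) * (N * B' r * R ω).trace) := fun ω => by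
    have e1 : (M * R ω).trace = (N * D * R ω).trace := by rw [hND]
    rw [e1, hD, hX]
    simp only [trace_mul_dysonOp_mul]
    rw [add_sub_assoc, ← Finset.sum_sub_distrib]
    congr 1
    refine Finset.sum_congr rfl fun r _ => ?_
    rw [Matrix.trace_mul_comm (R ω), Matrix.trace_mul_comm (R ω)]
    simp only [hA', hB']
    ring
  have hTc : ∀ (E E' : Matrix ι ι ℂ) (e : ℂ), Continuous fun Y : Matrix ι ι ℂ =>
      ((E * Y).trace - e) * (N * E' * Y).trace := fun E E' e =>
    ((hctr E).sub continuous_const).mul (hctr _)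
  have hTi : Integrable (fun ω => ∑ r, (((B' r * R ω).trace - β r) * (N * A' r * R ω).trace +
      ((A' r * R ω).trace - α r) * (N * B' r * R ω).trace)) P :=
    integrable_finsetSum _ fun r _ => (hintg _ (hTc _ _ _)).add (hintg _ (hTc _ _ _))
  have hXi : Integrable X P := by
    have : X = fun ω => (M * R ω).trace +
        ∑ r, (((B' r * R ω).trace - β r) * (N * A' r * R ω).trace +
          ((A' r * R ω).trace - α r) * (N * B' r * R ω).trace) := by
      funext ω
      rw [hXeq ω]
      ring
    rw [this]
    exact (hintg _ (hctr M)).add hTi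
  have e2 : ∫ ω, (M * R ω).trace ∂P + N.trace = (∫ ω, X ω ∂P + N.trace) -
      ∫ ω, ∑ r, (((B' r * R ω).trace - β r) * (N * A' r * R ω).trace +
      ((A' r * R ω).trace - α r) * (N * B' r * R ω).trace) ∂P := by
    simp only [hXeq]
    rw [integral_sub hXi hTi]
    ring
  rw [e2]
  refine (norm_sub_le _ _).trans (add_le_add h1 ?_)
  have hone : ∀ (E E' : Matrix ι ι ℂ) {e e' : ℝ}, 0 < e → 0 < e' → ‖E‖ ≤ e → ‖E'‖ ≤ e' →
      e * e' ≤ s ^ 2 → ∫ ω, ‖((E * R ω).trace - ∫ ω', (E * R ω').trace ∂P) *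
        (N * E' * R ω).trace‖ ∂P ≤
        1540 * ((K + 1) * (Fintype.card ι * s ^ 2 * √n * (m * B * B ^ 2))) := by
    intro E E' e e' he he' hE hE' hee
    -- K + 1 instead of K keeps the constant positive for K = 0. The result is 385 · 4 = 1540 for
    -- one product and 3080 for the two products of each r.
    have hc0 : 0 < 4 * (K + 1) * (e * B) := by positivity
    have hcc : 4 * K * (‖E‖ * B) ≤ 4 * (K + 1) * (e * B) := by gcongr; linarith
    have h2 := integral_norm_trace_sub_le hn hm hind u v E hw hc0 hcc
    have h3 : ∀ ω, ‖(N * E' * R ω).trace‖ ≤ Fintype.card ι * (m * B * e' * B) := fun ω => by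
      refine (norm_trace_mul_resolv_le (sepModel_isHermitian _ _ _) hw _).trans ?_
      gcongr
      exact (norm_mul_le _ _).trans (by gcongr)
    have i1 : Integrable (fun ω => ‖(E * R ω).trace - ∫ ω', (E * R ω').trace ∂P‖) P :=
      (hintg _ ((hctr E).sub continuous_const)).norm
    calc _ ≤ ∫ ω, ‖(E * R ω).trace - ∫ ω', (E * R ω').trace ∂P‖ *
          (Fintype.card ι * (m * B * e' * B)) ∂P := by
          refine integral_mono (hintg _ (hTc _ _ _)).norm (i1.mul_const _) fun ω => ?_
          simp only [norm_mul]
          exact mul_le_mul_of_nonneg_left (h3 ω) (norm_nonneg _)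
      _ = (∫ ω, ‖(E * R ω).trace - ∫ ω', (E * R ω').trace ∂P‖ ∂P) *
          (Fintype.card ι * (m * B * e' * B)) := integral_mul_const _ _
      _ ≤ 385 * (√n * (4 * (K + 1) * (e * B))) * (Fintype.card ι * (m * B * e' * B)) := by gcongr
      _ = 1540 * ((K + 1) * (Fintype.card ι * (e * e') * √n * (m * B * B ^ 2))) := by ring
      _ ≤ _ := by gcongr
  have hab' : b * a ≤ s ^ 2 := by rwa [mul_comm]
  have hTr : ∀ r ∈ Finset.univ, Integrable (fun ω => ((B' r * R ω).trace - β r) *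
      (N * A' r * R ω).trace + ((A' r * R ω).trace - α r) * (N * B' r * R ω).trace) P :=
    fun r _ => (hintg _ (hTc _ _ _)).add (hintg _ (hTc _ _ _))
  rw [integral_finsetSum _ hTr]
  refine (norm_sum_le _ _).trans ((Finset.sum_le_sum (g := fun _ =>
    2 * (1540 * ((K + 1) * (Fintype.card ι * s ^ 2 * √n * (m * B * B ^ 2)))))
      fun r _ => ?_).trans (le_of_eq ?_))
  · rw [integral_add (hintg _ (hTc (B' r) (A' r) (β r))) (hintg _ (hTc (A' r) (B' r) (α r))),
      two_mul]
    refine (norm_add_le _ _).trans (add_le_add ?_ ?_)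
    · exact (norm_integral_le_integral_norm _).trans
        (hone (B' r) (A' r) hb0 ha0 (hb r) (ha r) hab')
    · exact (norm_integral_le_integral_norm _).trans
        (hone (A' r) (B' r) ha0 hb0 (ha r) (hb r) hab)
  · simp only [Finset.sum_const, Finset.card_univ, Fintype.card_fin, nsmul_eq_mul]
    ring

end Dyson

end SumSeparable
end

/-! ### Diagonalization, Hermitization and the columns of the model -/

noncomputable section

namespace SumSeparable

open scoped Matrix.Norms.L2Operator

section ConjDiag

variable {ι : Type*} [Fintype ι] [DecidableEq ι]

/-- The matrix `U diag(d) U^*`. -/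
def conjDiag (U : Matrix ι ι ℂ) (d : ι → ℂ) : Matrix ι ι ℂ := U * Matrix.diagonal d * Uᴴ

theorem conjDiag_apply (U : Matrix ι ι ℂ) (d : ι → ℂ) (x y : ι) :
    conjDiag U d x y = ∑ k, U x k * d k * star (U y k) := by
  rw [conjDiag, Matrix.mul_apply]
  simp [Matrix.mul_diagonal, Matrix.conjTranspose_apply]

theorem conjDiag_add (U : Matrix ι ι ℂ) (d e : ι → ℂ) :
    conjDiag U (d + e) = conjDiag U d + conjDiag U e := by
  rw [conjDiag, conjDiag, conjDiag, ← Matrix.add_mul, ← Matrix.mul_add, Matrix.diagonal_add]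
  rfl

theorem conjDiag_smul (U : Matrix ι ι ℂ) (c : ℂ) (d : ι → ℂ) :
    conjDiag U (c • d) = c • conjDiag U d := by
  rw [conjDiag, conjDiag, Matrix.diagonal_smul, Matrix.mul_smul, Matrix.smul_mul]

theorem conjDiag_sum {κ : Type*} (s : Finset κ) (U : Matrix ι ι ℂ) (d : κ → ι → ℂ) :
    conjDiag U (∑ k ∈ s, d k) = ∑ k ∈ s, conjDiag U (d k) := by
  classical
  induction s using Finset.induction_on with
  | empty =>
    ext x y
    simp [conjDiag_apply]
  | insert a s ha ih => rw [Finset.sum_insert ha, Finset.sum_insert ha, conjDiag_add, ih]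

theorem conjTranspose_conjDiag (U : Matrix ι ι ℂ) (d : ι → ℂ) :
    (conjDiag U d)ᴴ = conjDiag U (star d) := by
  rw [conjDiag, conjDiag, Matrix.conjTranspose_mul, Matrix.conjTranspose_mul,
    Matrix.conjTranspose_conjTranspose, Matrix.diagonal_conjTranspose, Matrix.mul_assoc]

variable {U : Matrix ι ι ℂ}

theorem conjDiag_mul (hU : U ∈ Matrix.unitaryGroup ι ℂ) (d e : ι → ℂ) :
    conjDiag U d * conjDiag U e = conjDiag U (d * e) := by
  have hU' : Uᴴ * U = 1 := Matrix.mem_unitaryGroup_iff'.1 hU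
  calc conjDiag U d * conjDiag U e = U * Matrix.diagonal d * (Uᴴ * U) * Matrix.diagonal e * Uᴴ := by
        simp only [conjDiag, Matrix.mul_assoc]
    _ = _ := by
        rw [hU', Matrix.mul_one, Matrix.mul_assoc U, Matrix.diagonal_mul_diagonal, conjDiag]
        rfl

theorem conjDiag_one (hU : U ∈ Matrix.unitaryGroup ι ℂ) : conjDiag U 1 = 1 := by
  have hU' : U * Uᴴ = 1 := Matrix.mem_unitaryGroup_iff.1 hU
  have e : (Matrix.diagonal 1 : Matrix ι ι ℂ) = 1 := Matrix.diagonal_one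
  rw [conjDiag, e, Matrix.mul_one, hU']

theorem conjDiag_inv (hU : U ∈ Matrix.unitaryGroup ι ℂ) {d : ι → ℂ} (hd : ∀ i, d i ≠ 0) :
    (conjDiag U d)⁻¹ = conjDiag U fun i => (d i)⁻¹ := by
  refine Matrix.inv_eq_right_inv ?_
  rw [conjDiag_mul hU, ← conjDiag_one hU]
  congr 1
  ext i
  simp [hd i]

theorem trace_mul_conjDiag (N : Matrix ι ι ℂ) (U : Matrix ι ι ℂ) (d : ι → ℂ) :
    (N * conjDiag U d).trace = ∑ i, (Uᴴ * N * U) i i * d i := by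
  rw [conjDiag, ← Matrix.mul_assoc, Matrix.trace_mul_comm, ← Matrix.mul_assoc, ← Matrix.mul_assoc,
    Matrix.trace]
  simp [Matrix.mul_diagonal]

theorem trace_conjDiag (hU : U ∈ Matrix.unitaryGroup ι ℂ) (d : ι → ℂ) :
    (conjDiag U d).trace = ∑ i, d i := by
  have hU' : Uᴴ * U = 1 := Matrix.mem_unitaryGroup_iff'.1 hU
  have := trace_mul_conjDiag 1 U d
  rw [Matrix.one_mul, Matrix.mul_one, hU'] at this
  simpa using this

theorem norm_conjDiag_le (hU : U ∈ Matrix.unitaryGroup ι ℂ) {d : ι → ℂ} {C : ℝ} (hC : 0 ≤ C)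
    (hd : ∀ i, ‖d i‖ ≤ C) : ‖conjDiag U d‖ ≤ C := by
  have hU' : Uᴴ ∈ unitary (Matrix ι ι ℂ) := Unitary.star_mem hU
  rw [conjDiag, CStarRing.norm_mul_mem_unitary _ hU',
    CStarRing.norm_mem_unitary_mul _ hU, Matrix.l2_opNorm_diagonal]
  exact (pi_norm_le_iff_of_nonneg hC).2 hd

theorem posSemidef_conjDiag (U : Matrix ι ι ℂ) {d : ι → ℝ} (hd : ∀ i, 0 ≤ d i) :
    (conjDiag U fun i => (d i : ℂ)).PosSemidef := by
  refine Matrix.PosSemidef.mul_mul_conjTranspose_same (Matrix.PosSemidef.diagonal fun i => ?_) U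
  simpa using hd i

theorem rank_conjDiag_le (U : Matrix ι ι ℂ) (d : ι → ℂ) :
    (conjDiag U d).rank ≤ (Finset.univ.filter fun i => d i ≠ 0).card := by
  refine (Matrix.rank_mul_le_left _ _).trans ((Matrix.rank_mul_le_right _ _).trans ?_)
  rw [Matrix.rank_diagonal, Fintype.card_subtype]

/-- Trace functionals of the resolvent in terms of a diagonalization. -/
theorem trace_mul_inv_sub (hU : U ∈ Matrix.unitaryGroup ι ℂ) (N : Matrix ι ι ℂ) (d : ι → ℂ) {z : ℂ}
    (hz : ∀ i, d i ≠ z) :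
    (N * (conjDiag U d - z • 1)⁻¹).trace = ∑ i, (Uᴴ * N * U) i i / (d i - z) := by
  have e : conjDiag U d - z • 1 = conjDiag U fun i => d i - z := by
    rw [← conjDiag_one hU, ← conjDiag_smul, sub_eq_add_neg, ← neg_one_smul ℂ, ← conjDiag_smul,
      ← conjDiag_add]
    congr 1
    ext i
    simp [sub_eq_add_neg]
  rw [e, conjDiag_inv hU fun i => sub_ne_zero.2 (hz i), trace_mul_conjDiag]
  simp only [div_eq_mul_inv]

theorem _root_.Matrix.IsHermitian.eq_conjDiag {S : Matrix ι ι ℂ} (hS : S.IsHermitian) :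
    S = conjDiag (hS.eigenvectorUnitary : Matrix ι ι ℂ) fun i => (hS.eigenvalues i : ℂ) :=
  hS.spectral_theorem

/-- The functional `z ↦ tr (N (S - z)⁻¹)` is a Stieltjes transform. -/
theorem exists_stieltjes_eq_trace {S N : Matrix ι ι ℂ} (hS : S.PosSemidef) (hN : N.PosSemidef) :
    ∃ μ : Measure ℝ, IsFiniteMeasure μ ∧ μ (Set.Ici 0)ᶜ = 0 ∧
      μ Set.univ = ENNReal.ofReal N.trace.re ∧ ∀ z : ℂ, (∀ x : ℝ, 0 ≤ x → (x : ℂ) ≠ z) →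
        (N * (S - z • 1)⁻¹).trace = stieltjes μ z := by
  set V : Matrix ι ι ℂ := (hS.isHermitian.eigenvectorUnitary : Matrix ι ι ℂ) with hV
  have hVu : V ∈ Matrix.unitaryGroup ι ℂ := hS.isHermitian.eigenvectorUnitary.2
  have hpos : (Vᴴ * N * V).PosSemidef := hN.conjTranspose_mul_mul_same V
  let m : ι → ℝ := fun i => ((Vᴴ * N * V) i i).re
  have hm : ∀ i, ((Vᴴ * N * V) i i) = m i := fun i =>
    Complex.ext rfl (by simpa using (Complex.nonneg_iff.1 hpos.diag_nonneg).2.symm)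
  have hm0 : ∀ i, 0 ≤ m i := fun i => (Complex.nonneg_iff.1 (hpos.diag_nonneg (i := i))).1
  let μ : Measure ℝ := ∑ i, ENNReal.ofReal (m i) • Measure.dirac (hS.isHermitian.eigenvalues i)
  have hfin : IsFiniteMeasure μ := by
    refine ⟨?_⟩
    simp only [μ, Measure.coe_finsetSum, Finset.sum_apply, Measure.smul_apply, smul_eq_mul]
    exact ENNReal.sum_lt_top.2 fun i _ => by simp
  refine ⟨μ, hfin, ?_, ?_, fun z hz => ?_⟩
  · simp only [μ, Measure.coe_finsetSum, Finset.sum_apply, Measure.smul_apply, smul_eq_mul]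
    refine Finset.sum_eq_zero fun i _ => ?_
    rw [Measure.dirac_apply' _ measurableSet_Ici.compl, Set.indicator_of_notMem, mul_zero]
    simpa using hS.eigenvalues_nonneg i
  · simp only [μ, Measure.coe_finsetSum, Finset.sum_apply, Measure.smul_apply, smul_eq_mul,
      measure_univ, mul_one]
    rw [← ENNReal.ofReal_sum_of_nonneg fun i _ => hm0 i]
    congr 1
    have hVV : V * Vᴴ = 1 := Matrix.mem_unitaryGroup_iff.1 hVu
    have h1 : N.trace = (Vᴴ * N * V).trace := by
      rw [Matrix.trace_mul_comm, ← Matrix.mul_assoc, hVV, Matrix.one_mul]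
    rw [h1, Matrix.trace, Complex.re_sum]
    rfl
  · have h1 : (N * (S - z • 1)⁻¹).trace = ∑ i, (m i : ℂ) / (hS.isHermitian.eigenvalues i - z) := by
      conv_lhs => rw [hS.isHermitian.eq_conjDiag]
      rw [trace_mul_inv_sub hVu N _ fun i => hz _ (hS.eigenvalues_nonneg i)]
      exact Finset.sum_congr rfl fun i _ => by rw [← hm]
    rw [h1, stieltjes, integral_finsetSum_measure fun i _ => by
      refine Integrable.smul_measure ?_ ENNReal.ofReal_ne_top
      exact integrable_dirac (by simp)]
    refine Finset.sum_congr rfl fun i _ => ?_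
    rw [integral_smul_measure, integral_dirac, ENNReal.toReal_ofReal (hm0 i), Complex.real_smul,
      mul_one_div]

end ConjDiag

section Blocks

variable {ι κ : Type*}

theorem isHermitian_fromBlocks_off (Y : Matrix ι κ ℂ) :
    (Matrix.fromBlocks 0 Y Yᴴ 0).IsHermitian := by
  rw [Matrix.IsHermitian, Matrix.fromBlocks_conjTranspose]
  simp

variable [Fintype ι] [DecidableEq ι] [Fintype κ] [DecidableEq κ]

theorem fromBlocks_mem_unitaryGroup {U : Matrix ι ι ℂ} {V : Matrix κ κ ℂ}
    (hU : U ∈ Matrix.unitaryGroup ι ℂ) (hV : V ∈ Matrix.unitaryGroup κ ℂ) :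
    Matrix.fromBlocks U 0 0 V ∈ Matrix.unitaryGroup (ι ⊕ κ) ℂ := by
  have hU' : U * Uᴴ = 1 := Matrix.mem_unitaryGroup_iff.1 hU
  have hV' : V * Vᴴ = 1 := Matrix.mem_unitaryGroup_iff.1 hV
  rw [Matrix.mem_unitaryGroup_iff, Matrix.star_eq_conjTranspose, Matrix.fromBlocks_conjTranspose,
    Matrix.fromBlocks_multiply]
  simp [hU', hV', Matrix.fromBlocks_one]

theorem fromBlocks_conjDiag (U : Matrix ι ι ℂ) (V : Matrix κ κ ℂ) (d : ι → ℂ) (e : κ → ℂ) :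
    Matrix.fromBlocks (conjDiag U d) 0 0 (conjDiag V e) =
      conjDiag (Matrix.fromBlocks U 0 0 V) (Sum.elim d e) := by
  rw [conjDiag, conjDiag, conjDiag, ← Matrix.fromBlocks_diagonal, Matrix.fromBlocks_conjTranspose,
    Matrix.fromBlocks_multiply, Matrix.fromBlocks_multiply]
  simp

theorem conjDiag_zero (U : Matrix ι ι ℂ) : conjDiag U 0 = 0 := by
  ext x y
  simp [conjDiag_apply]

/-- The upper left block of the resolvent of the Hermitization of `Y`. -/
theorem trace_mul_resolv_fromBlocks (Y : Matrix ι κ ℂ) (M : Matrix ι ι ℂ) {w : ℂ} (hw : 0 < w.im) :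
    (Matrix.fromBlocks M 0 0 0 * resolv (Matrix.fromBlocks 0 Y Yᴴ 0) w).trace =
      w * (M * (Y * Yᴴ - w ^ 2 • 1)⁻¹).trace := by
  have hw0 : w ≠ 0 := fun h => by simp [h] at hw
  set R := resolv (Matrix.fromBlocks 0 Y Yᴴ 0) w with hR
  have h1 : (Matrix.fromBlocks 0 Y Yᴴ 0 - w • 1) * R = 1 :=
    sub_mul_resolv (isHermitian_fromBlocks_off Y) hw
  have e1 : (Matrix.fromBlocks 0 Y Yᴴ 0 - w • 1 : Matrix (ι ⊕ κ) (ι ⊕ κ) ℂ) =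
      Matrix.fromBlocks (-(w • 1)) Y Yᴴ (-(w • 1)) := by
    rw [← Matrix.fromBlocks_one, Matrix.fromBlocks_smul, sub_eq_add_neg, Matrix.fromBlocks_neg,
      Matrix.fromBlocks_add]
    simp
  rw [e1, ← Matrix.fromBlocks_toBlocks R, Matrix.fromBlocks_multiply, ← Matrix.fromBlocks_one,
    Matrix.fromBlocks_inj] at h1
  obtain ⟨h11, -, h21, -⟩ := h1
  rw [Matrix.neg_mul, Matrix.smul_mul, Matrix.one_mul] at h11 h21
  have h3 : Yᴴ * R.toBlocks₁₁ = w • R.toBlocks₂₁ := by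
    rw [← sub_eq_zero, sub_eq_add_neg]
    exact h21
  have h4 : (Y * Yᴴ - w ^ 2 • 1) * (w⁻¹ • R.toBlocks₁₁) = 1 := by
    rw [Matrix.mul_smul, Matrix.sub_mul, Matrix.mul_assoc, h3, Matrix.smul_mul, Matrix.one_mul,
      Matrix.mul_smul, smul_sub, smul_smul, smul_smul, inv_mul_cancel₀ hw0, one_smul,
      show w⁻¹ * w ^ 2 = w by field_simp, ← h11]
    abel
  rw [Matrix.inv_eq_right_inv h4, Matrix.mul_smul, Matrix.trace_smul, smul_eq_mul, ← mul_assoc,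
    mul_inv_cancel₀ hw0, one_mul]
  conv_lhs => rw [← Matrix.fromBlocks_toBlocks R, Matrix.fromBlocks_multiply]
  simp [Matrix.trace, Fintype.sum_sum_type]

/-- The two off-diagonal blocks factor through X and through Xᴴ. -/
theorem rank_fromBlocks_off_le (X : Matrix ι κ ℂ) :
    (Matrix.fromBlocks 0 X Xᴴ 0).rank ≤ 2 * X.rank := by
  have e : (Matrix.fromBlocks 0 X Xᴴ 0 : Matrix (ι ⊕ κ) (ι ⊕ κ) ℂ) =
      Matrix.fromRows (1 : Matrix ι ι ℂ) (0 : Matrix κ ι ℂ) * X *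
          Matrix.fromCols (0 : Matrix κ ι ℂ) (1 : Matrix κ κ ℂ) +
        Matrix.fromRows (0 : Matrix ι κ ℂ) (1 : Matrix κ κ ℂ) * Xᴴ *
          Matrix.fromCols (1 : Matrix ι ι ℂ) (0 : Matrix ι κ ℂ) := by
    rw [Matrix.mul_assoc, Matrix.mul_assoc, Matrix.mul_fromCols X, Matrix.mul_fromCols Xᴴ,
      Matrix.fromRows_mul_fromCols,
      Matrix.fromRows_mul_fromCols, Matrix.fromBlocks_add]
    simp
  rw [e, two_mul]
  refine (rank_add_le _ _).trans (add_le_add ?_ ?_)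
  · exact (Matrix.rank_mul_le_left _ _).trans (Matrix.rank_mul_le_right _ _)
  · refine ((Matrix.rank_mul_le_left _ _).trans (Matrix.rank_mul_le_right _ _)).trans ?_
    rw [Matrix.rank_conjTranspose]

end Blocks

section Columns

variable {K p n : ℕ}

/-- The columns of the left factors, as vectors of the direct sum. -/
def leftCols (n : ℕ) (R : Fin K → Matrix (Fin p) (Fin p) ℂ) (q : Fin K × Fin p) :
    Fin p ⊕ Fin n → ℂ := Sum.elim (fun x => R q.1 x q.2) 0

/-- The normalized columns of the right factors, as vectors of the direct sum. -/
def rightCols (p : ℕ) (T : Fin K → Matrix (Fin n) (Fin n) ℂ) (q : Fin K × Fin n) :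
    Fin p ⊕ Fin n → ℂ := Sum.elim 0 (fun y => (√n : ℂ)⁻¹ * T q.1 y q.2)

theorem gram_leftCols (R : Fin K → Matrix (Fin p) (Fin p) ℂ) (r : Fin K) :
    gram (fun i => leftCols n R (r, i)) = Matrix.fromBlocks (R r * (R r)ᴴ) 0 0 0 := by
  ext x y
  rw [gram, Matrix.sum_apply]
  rcases x with x | x <;> rcases y with y | y <;>
    simp [leftCols, Matrix.vecMulVec_apply, Matrix.mul_apply]

theorem gram_rightCols (T : Fin K → Matrix (Fin n) (Fin n) ℂ) (r : Fin K) :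
    gram (fun j => rightCols p T (r, j)) =
      Matrix.fromBlocks 0 0 0 ((n : ℂ)⁻¹ • (T r * (T r)ᴴ)) := by
  have hn : (√n : ℂ)⁻¹ * (√n : ℂ)⁻¹ = (n : ℂ)⁻¹ := by
    rw [← mul_inv, ← Complex.ofReal_mul, Real.mul_self_sqrt (Nat.cast_nonneg n)]
    simp
  ext x y
  rw [gram, Matrix.sum_apply]
  rcases x with x | x <;> rcases y with y | y <;>
    simp [rightCols, Matrix.vecMulVec_apply, Matrix.mul_apply]
  rw [Finset.mul_sum]
  refine Finset.sum_congr rfl fun j _ => ?_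
  rw [← hn]
  ring

/-- The link between the linear model and the data matrix. Only the upper right block is computed:
the diagonal blocks vanish by the supports of the columns, and the lower left block follows from
Hermitian symmetry. -/
theorem sepModel_cols (R : Fin K → Matrix (Fin p) (Fin p) ℂ) (T : Fin K → Matrix (Fin n) (Fin n) ℂ)
    (Z : Fin K → Matrix (Fin p) (Fin n) ℂ) :
    sepModel (leftCols n R) (rightCols p T) (fun q => Z q.1 q.2.1 q.2.2) =
      Matrix.fromBlocks 0 ((√n : ℂ)⁻¹ • ∑ r, R r * Z r * (T r)ᴴ)
        ((√n : ℂ)⁻¹ • ∑ r, R r * Z r * (T r)ᴴ)ᴴ 0 := by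
  have key : ∀ x y, sepModel (leftCols n R) (rightCols p T) (fun q => Z q.1 q.2.1 q.2.2)
      (Sum.inl x) (Sum.inr y) = ((√n : ℂ)⁻¹ • ∑ r, R r * Z r * (T r)ᴴ) x y := fun x y => by
    rw [sepModel, linModel, Matrix.sum_apply, Fintype.sum_prod_type, Matrix.smul_apply,
      Matrix.sum_apply, smul_eq_mul, Finset.mul_sum]
    refine Finset.sum_congr rfl fun r _ => ?_
    rw [Fintype.sum_prod_type, Finset.sum_comm, Matrix.mul_apply, Finset.mul_sum]
    refine Finset.sum_congr rfl fun j _ => ?_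
    rw [Matrix.mul_apply, Finset.sum_mul, Finset.mul_sum]
    refine Finset.sum_congr rfl fun i _ => ?_
    simp [rankTwo, leftCols, rightCols, Matrix.vecMulVec_apply]
    ring
  have hH := sepModel_isHermitian (leftCols n R) (rightCols p T)
    (fun q : Fin K × Fin p × Fin n => Z q.1 q.2.1 q.2.2)
  ext x y
  rcases x with x | x <;> rcases y with y | y
  · simp [sepModel, linModel, Matrix.sum_apply, rankTwo, leftCols, rightCols,
      Matrix.vecMulVec_apply]
  · rw [key]
    simp
  · rw [← hH.apply, key]
    simp only [Matrix.fromBlocks_apply₂₁, Matrix.conjTranspose_apply]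
  · simp [sepModel, linModel, Matrix.sum_apply, rankTwo, leftCols, rightCols,
      Matrix.vecMulVec_apply]

end Columns

end SumSeparable
end

/-! ### The quantitative Dyson equation in terms of joint eigenvalues -/

noncomputable section

namespace SumSeparable

open scoped Matrix.Norms.L2Operator

section ScalarDyson

variable {K p n : ℕ}

/-- The square roots of the matrices with joint eigenvectors `U` and joint eigenvalues `lam`. -/
def sqrtFactor {m : ℕ} (U : Matrix (Fin m) (Fin m) ℂ) (lam : Fin m → Fin K → ℝ) (r : Fin K) :
    Matrix (Fin m) (Fin m) ℂ := conjDiag U fun j => (√(lam j r) : ℂ)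

theorem sqrtFactor_mul_conjTranspose {m : ℕ} {U : Matrix (Fin m) (Fin m) ℂ}
    (hU : U ∈ Matrix.unitaryGroup (Fin m) ℂ) {lam : Fin m → Fin K → ℝ} (hlam : ∀ j r, 0 ≤ lam j r)
    (r : Fin K) :
    sqrtFactor U lam r * (sqrtFactor U lam r)ᴴ = conjDiag U fun j => (lam j r : ℂ) := by
  rw [sqrtFactor, conjTranspose_conjDiag, conjDiag_mul hU]
  congr 1
  ext j
  simp only [Pi.mul_apply, Pi.star_apply, Complex.star_def, Complex.conj_ofReal]
  rw [← Complex.ofReal_mul, Real.mul_self_sqrt (hlam j r)]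

/-- The Hermitization of the normalized data matrix with the given joint eigenvectors and
eigenvalues. -/
def hermModel (U : Matrix (Fin p) (Fin p) ℂ) (V : Matrix (Fin n) (Fin n) ℂ)
    (lam : Fin p → Fin K → ℝ) (mu : Fin n → Fin K → ℝ) (x : Fin K × Fin p × Fin n → ℂ) :
    Matrix (Fin p ⊕ Fin n) (Fin p ⊕ Fin n) ℂ :=
  sepModel (leftCols n (sqrtFactor U lam)) (rightCols p (sqrtFactor V mu)) x

theorem hermModel_isHermitian (U : Matrix (Fin p) (Fin p) ℂ) (V : Matrix (Fin n) (Fin n) ℂ)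
    (lam : Fin p → Fin K → ℝ) (mu : Fin n → Fin K → ℝ) (x : Fin K × Fin p × Fin n → ℂ) :
    (hermModel U V lam mu x).IsHermitian := sepModel_isHermitian _ _ _

/-- The functional `(1/n) tr (diag(d) G)` of the resolvent `G` of the Hermitization, in the basis
of the joint eigenvectors. -/
def resolvTrace (U : Matrix (Fin p) (Fin p) ℂ) (V : Matrix (Fin n) (Fin n) ℂ)
    (lam : Fin p → Fin K → ℝ) (mu : Fin n → Fin K → ℝ) (w : ℂ) (d : Fin p ⊕ Fin n → ℂ)
    (x : Fin K × Fin p × Fin n → ℂ) : ℂ :=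
  (n : ℂ)⁻¹ * (conjDiag (Matrix.fromBlocks U 0 0 V) d * resolv (hermModel U V lam mu x) w).trace

theorem continuous_resolvTrace (U : Matrix (Fin p) (Fin p) ℂ) (V : Matrix (Fin n) (Fin n) ℂ)
    (lam : Fin p → Fin K → ℝ) (mu : Fin n → Fin K → ℝ) {w : ℂ} (hw : 0 < w.im)
    (d : Fin p ⊕ Fin n → ℂ) : Continuous (resolvTrace U V lam mu w d) :=
  continuous_const.mul (continuous_trace_mul_resolv_sepModel _ _ _ hw)

/-- The constant in the quantitative Dyson equation. -/
def dysonConst (K : ℕ) (c₁ m₃ B : ℝ) : ℝ :=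
  K * (c₁ + 1) * (B ^ 2 * (1 + B ^ 2)) + K * c₁ * ((16 + 24 * m₃) * B ^ 4) +
    3080 * (K * (K + 1) * ((c₁ + 1) * B ^ 3))

/-- Here N, P, κ stand for n, p, K. The Gram matrices have norms at most τ and τ / n, so s = τ / √n.
After division by n each of the three error terms is of order at most τ⁴ / √n. -/
theorem dysonConst_bound {P N κ c₁ m₃ B τ : ℝ} (hκ : 0 ≤ κ) (hN : 1 ≤ N) (hP : 0 ≤ P)
    (hPN : P ≤ c₁ * N)
    (hm₃ : 0 ≤ m₃) (hB : 0 < B) (hτ : 1 ≤ τ) :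
    N⁻¹ * (κ * (P + N) * (τ / √N) ^ 2 * (B ^ 2 * (1 + (τ * B) ^ 2)) +
      κ * P * N * ((16 + 24 * m₃) * ((τ / √N) ^ 3 * (τ * B) * B ^ 3)) +
      3080 * (κ * (κ + 1) * ((P + N) * (τ / √N) ^ 2 * √N * (τ * B * B ^ 2)))) ≤
    (κ * (c₁ + 1) * (B ^ 2 * (1 + B ^ 2)) + κ * c₁ * ((16 + 24 * m₃) * B ^ 4) +
      3080 * (κ * (κ + 1) * ((c₁ + 1) * B ^ 3))) * (τ ^ 4 / √N) := by
  have hN0 : 0 < N := by linarith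
  have hc₁ : 0 ≤ c₁ := by
    by_contra h
    nlinarith [mul_neg_of_neg_of_pos (not_le.1 h) hN0]
  set t := √N with ht
  have ht1 : 1 ≤ t := Real.one_le_sqrt.2 hN
  have ht0 : 0 < t := by linarith
  have hNt : N = t ^ 2 := (Real.sq_sqrt hN0.le).symm
  have hτ0 : 0 < τ := by linarith
  have hPN' : P + N ≤ (c₁ + 1) * N := by linarith
  rw [hNt] at hPN hPN' ⊢
  have h1 : (t ^ 2)⁻¹ * (κ * (P + t ^ 2) * (τ / t) ^ 2 * (B ^ 2 * (1 + (τ * B) ^ 2))) ≤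
      κ * (c₁ + 1) * (B ^ 2 * (1 + B ^ 2)) * (τ ^ 4 / t) := by
    calc (t ^ 2)⁻¹ * (κ * (P + t ^ 2) * (τ / t) ^ 2 * (B ^ 2 * (1 + (τ * B) ^ 2)))
        ≤ (t ^ 2)⁻¹ * (κ * ((c₁ + 1) * t ^ 2) * (τ / t) ^ 2 * (B ^ 2 * (τ ^ 2 * (1 + B ^ 2)))) := by
          have h1 : 1 + (τ * B) ^ 2 ≤ τ ^ 2 * (1 + B ^ 2) := by nlinarith
          gcongr
      _ = κ * (c₁ + 1) * (B ^ 2 * (1 + B ^ 2)) * (τ ^ 4 / t ^ 2) := by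
          field_simp
      _ ≤ κ * (c₁ + 1) * (B ^ 2 * (1 + B ^ 2)) * (τ ^ 4 / t) := by
          have : t ≤ t ^ 2 := by nlinarith
          gcongr
  have h2 : (t ^ 2)⁻¹ * (κ * P * t ^ 2 * ((16 + 24 * m₃) * ((τ / t) ^ 3 * (τ * B) * B ^ 3))) ≤
      κ * c₁ * ((16 + 24 * m₃) * B ^ 4) * (τ ^ 4 / t) := by
    calc (t ^ 2)⁻¹ * (κ * P * t ^ 2 * ((16 + 24 * m₃) * ((τ / t) ^ 3 * (τ * B) * B ^ 3)))
        ≤ (t ^ 2)⁻¹ * (κ * (c₁ * t ^ 2) * t ^ 2 *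
          ((16 + 24 * m₃) * ((τ / t) ^ 3 * (τ * B) * B ^ 3))) := by gcongr
      _ = κ * c₁ * ((16 + 24 * m₃) * B ^ 4) * (τ ^ 4 / t) := by
          field_simp
  have h3 : (t ^ 2)⁻¹ * (3080 * (κ * (κ + 1) * ((P + t ^ 2) * (τ / t) ^ 2 * t *
      (τ * B * B ^ 2)))) ≤ 3080 * (κ * (κ + 1) * ((c₁ + 1) * B ^ 3)) * (τ ^ 4 / t) := by
    calc (t ^ 2)⁻¹ * (3080 * (κ * (κ + 1) * ((P + t ^ 2) * (τ / t) ^ 2 * t * (τ * B * B ^ 2))))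
        ≤ (t ^ 2)⁻¹ * (3080 * (κ * (κ + 1) *
          (((c₁ + 1) * t ^ 2) * (τ / t) ^ 2 * t * (τ * B * B ^ 2)))) := by gcongr
      _ = 3080 * (κ * (κ + 1) * ((c₁ + 1) * B ^ 3)) * (τ ^ 3 / t) := by
          field_simp
      _ ≤ _ := by
          gcongr
          norm_num
  refine le_trans (le_of_eq ?_) ((add_le_add (add_le_add h1 h2) h3).trans (le_of_eq ?_)) <;> ring

variable {Ω : Type*} [MeasurableSpace Ω] {P : Measure Ω} [IsProbabilityMeasure P]

section

variable {U : Matrix (Fin p) (Fin p) ℂ} {V : Matrix (Fin n) (Fin n) ℂ} {lam : Fin p → Fin K → ℝ}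
  {mu : Fin n → Fin K → ℝ}

theorem gram_left_eq (hU : U ∈ Matrix.unitaryGroup (Fin p) ℂ) (V : Matrix (Fin n) (Fin n) ℂ)
    (hlam : ∀ j r, 0 ≤ lam j r) (r : Fin K) :
    gram (fun i => leftCols n (sqrtFactor U lam) (r, i)) =
      conjDiag (Matrix.fromBlocks U 0 0 V) (Sum.elim (fun j => (lam j r : ℂ)) 0) := by
  rw [gram_leftCols, sqrtFactor_mul_conjTranspose hU hlam, ← fromBlocks_conjDiag, conjDiag_zero]

theorem gram_right_eq (U : Matrix (Fin p) (Fin p) ℂ) (hV : V ∈ Matrix.unitaryGroup (Fin n) ℂ)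
    (hmu : ∀ j r, 0 ≤ mu j r) (r : Fin K) :
    gram (fun j => rightCols p (sqrtFactor V mu) (r, j)) =
      (n : ℂ)⁻¹ • conjDiag (Matrix.fromBlocks U 0 0 V) (Sum.elim 0 (fun j => (mu j r : ℂ))) := by
  rw [gram_rightCols, sqrtFactor_mul_conjTranspose hV hmu, ← fromBlocks_conjDiag, conjDiag_zero,
    Matrix.fromBlocks_smul]
  simp

/-- Here the commutation hypotheses act: all Gram matrices are diagonal in one basis, so D is
inverted entry by entry and its inverse consists of the scalar denominators of the limiting system.
-/
theorem dysonOp_eq (hU : U ∈ Matrix.unitaryGroup (Fin p) ℂ)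
    (hV : V ∈ Matrix.unitaryGroup (Fin n) ℂ) (hlam : ∀ j r, 0 ≤ lam j r)
    (hmu : ∀ j r, 0 ≤ mu j r) (w : ℂ) (s t : Fin K → ℂ) :
    dysonOp (leftCols n (sqrtFactor U lam)) (rightCols p (sqrtFactor V mu)) w s t =
      conjDiag (Matrix.fromBlocks U 0 0 V)
        (Sum.elim (fun j => den w t (lam j)) (fun j => den w (fun r => (n : ℂ)⁻¹ * s r) (mu j))) := by
  have hW := fromBlocks_mem_unitaryGroup hU hV
  rw [dysonOp, ← conjDiag_one hW]
  simp only [gram_left_eq hU V hlam, gram_right_eq U hV hmu, smul_smul]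
  simp only [← conjDiag_smul, ← conjDiag_add, ← conjDiag_sum]
  congr 1
  ext i
  rcases i with j | j
  · simp [den, Finset.sum_apply, mul_comm]
  · simp only [den, Pi.add_apply, Pi.smul_apply, Pi.one_apply, smul_eq_mul, mul_one,
      Finset.sum_apply, Sum.elim_inr, Pi.zero_apply, mul_zero, zero_add]
    congr 1
    exact Finset.sum_congr rfl fun r _ => by ring

/-- The quantitative Dyson equation in terms of the joint eigenvalues. -/
theorem norm_dyson_le (hn : 0 < n) {ζ : Fin K × Fin p × Fin n → Ω → ℂ}
    (hm : ∀ a, Measurable (ζ a)) (hind : iIndepFun ζ P) (hmean : ∀ a, ∫ ω, ζ a ω ∂P = 0)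
    (hvar : ∀ a, ∫ ω, ‖ζ a ω‖ ^ 2 ∂P = 1) {m₃ : ℝ}
    (hInt : ∀ a, Integrable (fun ω => ‖ζ a ω‖ ^ 3) P) (hm₃ : ∀ a, ∫ ω, ‖ζ a ω‖ ^ 3 ∂P ≤ m₃)
    (hm₃0 : 0 ≤ m₃) (hU : U ∈ Matrix.unitaryGroup (Fin p) ℂ)
    (hV : V ∈ Matrix.unitaryGroup (Fin n) ℂ) (hlam : ∀ j r, 0 ≤ lam j r)
    (hmu : ∀ j r, 0 ≤ mu j r) {τ c₁ : ℝ} (hτ : 1 ≤ τ) (hlamτ : ∀ j r, lam j r ≤ τ)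
    (hmuτ : ∀ j r, mu j r ≤ τ) (hc₁ : (p : ℝ) ≤ c₁ * n) {w : ℂ} (hw : 0 < w.im)
    {d : Fin p ⊕ Fin n → ℂ} (hd : ∀ i, ‖d i‖ ≤ τ) :
    ‖∫ ω, resolvTrace U V lam mu w d (fun q => ζ q ω) ∂P + (n : ℂ)⁻¹ * ∑ i, d i /
      Sum.elim (fun j => den w (fun r => ∫ ω, resolvTrace U V lam mu w
          (Sum.elim 0 fun j => (mu j r : ℂ)) (fun q => ζ q ω) ∂P) (lam j))
        (fun j => den w (fun r => ∫ ω, resolvTrace U V lam mu w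
          (Sum.elim (fun j => (lam j r : ℂ)) 0) (fun q => ζ q ω) ∂P) (mu j)) i‖ ≤
      dysonConst K c₁ m₃ (w.im)⁻¹ * (τ ^ 4 / √n) := by
  have hW := fromBlocks_mem_unitaryGroup hU hV
  have hn0 : (0 : ℝ) < n := by exact_mod_cast hn
  have hτ0 : 0 < τ := by linarith
  set u := leftCols n (sqrtFactor U lam) with hu
  set v := rightCols p (sqrtFactor V mu) with hv
  have ha : ∀ r, ‖gram fun i => u (r, i)‖ ≤ τ := fun r => by
    rw [hu, gram_left_eq hU V hlam]
    refine norm_conjDiag_le hW hτ0.le ?_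
    rintro (j | j)
    · simpa [abs_of_nonneg (hlam j r)] using hlamτ j r
    · simpa using hτ0.le
  have hb : ∀ r, ‖gram fun j => v (r, j)‖ ≤ τ / n := fun r => by
    rw [hv, gram_right_eq U hV hmu, norm_smul, div_eq_inv_mul]
    have : ‖conjDiag (Matrix.fromBlocks U 0 0 V) (Sum.elim 0 fun j => (mu j r : ℂ))‖ ≤ τ := by
      refine norm_conjDiag_le hW hτ0.le ?_
      rintro (j | j)
      · simpa using hτ0.le
      · simpa [abs_of_nonneg (hmu j r)] using hmuτ j r
    rw [norm_inv, Complex.norm_natCast]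
    gcongr
  have hs : τ * (τ / n) ≤ (τ / √n) ^ 2 := by
    rw [div_pow, Real.sq_sqrt hn0.le]
    exact le_of_eq (by ring)
  have key := norm_integral_trace_add_trace_mul_inv_le hn hm hind hmean hvar hInt hm₃ hm₃0 u v
    (conjDiag (Matrix.fromBlocks U 0 0 V) d) hw ha hb hτ0 (by positivity) (by positivity) hs
    (norm_conjDiag_le hW hτ0.le hd)
  set R : Ω → Matrix (Fin p ⊕ Fin n) (Fin p ⊕ Fin n) ℂ :=
    fun ω => resolv (sepModel u v fun q => ζ q ω) w with hR
  set s : Fin K → ℂ := fun r => ∫ ω, ((gram fun i => u (r, i)) * R ω).trace ∂P with hsdef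
  set t : Fin K → ℂ := fun r => ∫ ω, ((gram fun j => v (r, j)) * R ω).trace ∂P with htdef
  have es : ∀ r, ∫ ω, resolvTrace U V lam mu w (Sum.elim (fun j => (lam j r : ℂ)) 0)
      (fun q => ζ q ω) ∂P = (n : ℂ)⁻¹ * s r := fun r => by
    simp only [resolvTrace]
    rw [integral_const_mul, hsdef]
    simp only [hu, gram_left_eq hU V hlam]
    rfl
  have et : ∀ r, ∫ ω, resolvTrace U V lam mu w (Sum.elim 0 fun j => (mu j r : ℂ))
      (fun q => ζ q ω) ∂P = t r := fun r => by
    simp only [resolvTrace, htdef]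
    simp only [hv, gram_right_eq U hV hmu, Matrix.smul_mul, Matrix.trace_smul, smul_eq_mul]
    rfl
  have hintg : ∀ N : Matrix (Fin p ⊕ Fin n) (Fin p ⊕ Fin n) ℂ,
      Integrable (fun ω => (N * R ω).trace) P := fun N =>
    integrable_comp_resolv hm u v hw (φ := fun Y => (N * Y).trace)
      (Continuous.matrix_trace (continuous_const.matrix_mul continuous_id))
  have him : ∀ (κ : Type) [Fintype κ] (x : κ → Fin p ⊕ Fin n → ℂ),
      0 ≤ (∫ ω, (gram x * R ω).trace ∂P).im := fun κ _ x => by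
    have h2 : (∫ ω, (gram x * R ω).trace ∂P).im = ∫ ω, ((gram x * R ω).trace).im ∂P :=
      (integral_im (hintg (gram x))).symm
    rw [h2]
    refine integral_nonneg fun ω => ?_
    rw [Matrix.trace_mul_comm]
    exact trace_resolv_mul_gram_im_nonneg (sepModel_isHermitian _ _ _) hw x
  simp only [es, et]
  rw [dysonOp_eq hU hV hlam hmu, conjDiag_inv hW, conjDiag_mul hW, trace_conjDiag hW] at key
  · have e1 : ∫ ω, resolvTrace U V lam mu w d (fun q => ζ q ω) ∂P =
        (n : ℂ)⁻¹ * ∫ ω, (conjDiag (Matrix.fromBlocks U 0 0 V) d * R ω).trace ∂P := by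
      simp only [resolvTrace]
      rw [integral_const_mul]
      rfl
    rw [e1, ← mul_add, norm_mul, norm_inv, Complex.norm_natCast]
    refine le_trans ?_ (dysonConst_bound (Nat.cast_nonneg K) (by exact_mod_cast hn)
      (Nat.cast_nonneg p) hc₁ hm₃0 (inv_pos.2 hw) hτ)
    refine mul_le_mul_of_nonneg_left ?_ (by positivity)
    simp only [Fintype.card_sum, Fintype.card_fin, Nat.cast_add] at key
    refine le_trans (le_of_eq ?_) key
    congr 2
  · rintro (j | j)
    · exact den_ne_zero hw (fun r => him _ _) (hlam j)
    · refine den_ne_zero hw (fun r => ?_) (hmu j)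
      have := him _ (fun i => u (r, i))
      rw [show (n : ℂ)⁻¹ = (((n : ℝ)⁻¹ : ℝ) : ℂ) by push_cast; rfl, Complex.im_ofReal_mul]
      positivity

end

end ScalarDyson

end SumSeparable
end

/-! ### Sequences of models: fluctuations and the approximate system -/

noncomputable section

namespace SumSeparable

open scoped Matrix.Norms.L2Operator

section Empirical

variable {ι E : Type*} [Fintype ι] [MeasurableSpace E]

theorem coe_empirical (x : ι → E) : (empirical x : Measure E) =
    (Fintype.card ι : ℝ≥0)⁻¹ • ∑ i, Measure.dirac (x i) := by
  rw [empirical, FiniteMeasure.toMeasure_smul, FiniteMeasure.toMeasure_sum]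
  rfl

theorem integrable_empirical [MeasurableSingletonClass E] {F : Type*} [NormedAddCommGroup F]
    (x : ι → E) (f : E → F) : Integrable f (empirical x : Measure E) := by
  rw [coe_empirical]
  refine Integrable.smul_measure_nnreal ?_
  rw [integrable_finsetSum_measure]
  exact fun i _ => integrable_dirac (by simp)

theorem integral_empirical [MeasurableSingletonClass E] {F : Type*} [NormedAddCommGroup F]
    [NormedSpace ℝ F] [CompleteSpace F] (x : ι → E) (f : E → F) :
    ∫ y, f y ∂(empirical x : Measure E) = (Fintype.card ι : ℝ)⁻¹ • ∑ i, f (x i) := by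
  rw [coe_empirical, integral_smul_nnreal_measure,
    integral_finsetSum_measure fun i _ => integrable_dirac (by simp)]
  simp only [integral_dirac]
  rfl

theorem ae_empirical [MeasurableSingletonClass E] (x : ι → E) {s : E → Prop} (h : ∀ i, s (x i)) :
    ∀ᵐ y ∂(empirical x : Measure E), s y := by
  rw [coe_empirical]
  refine Measure.ae_smul_measure ?_ _
  rw [ae_finsetSum_measure_iff]
  intro i _
  rw [ae_dirac_eq]
  exact h i

theorem isProbabilityMeasure_empirical [Nonempty ι] (x : ι → E) :
    IsProbabilityMeasure (empirical x : Measure E) := by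
  refine ⟨?_⟩
  rw [coe_empirical]
  simp only [Measure.smul_apply, Measure.coe_finsetSum, Finset.sum_apply, measure_univ,
    Finset.sum_const, Finset.card_univ, nsmul_eq_mul, mul_one]
  have h : (Fintype.card ι : ℝ≥0) ≠ 0 := by exact_mod_cast Fintype.card_ne_zero
  rw [ENNReal.smul_def, smul_eq_mul, ← ENNReal.coe_natCast, ← ENNReal.coe_mul, inv_mul_cancel₀ h,
    ENNReal.coe_one]

end Empirical

section SpecData

/-- Joint eigenvectors and joint eigenvalues of the two families of scaling matrices. -/
structure SpecData (K : ℕ) (p : ℕ → ℕ) where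
  /-- the joint eigenvectors of the left matrices -/
  U : ∀ n, Matrix (Fin (p n)) (Fin (p n)) ℂ
  /-- the joint eigenvectors of the right matrices -/
  V : ∀ n, Matrix (Fin n) (Fin n) ℂ
  /-- the joint eigenvalues of the left matrices -/
  lam : ∀ n, Fin (p n) → Fin K → ℝ
  /-- the joint eigenvalues of the right matrices -/
  mu : ∀ n, Fin n → Fin K → ℝ
  hU : ∀ n, U n ∈ Matrix.unitaryGroup (Fin (p n)) ℂ
  hV : ∀ n, V n ∈ Matrix.unitaryGroup (Fin n) ℂ
  lam_nonneg : ∀ n j r, 0 ≤ lam n j r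
  mu_nonneg : ∀ n j r, 0 ≤ mu n j r

variable {Ω : Type*} [MeasurableSpace Ω]

/-- The moment and independence assumptions on the innovations. -/
structure Innovations (P : Measure Ω) {K : ℕ} {p : ℕ → ℕ} (m₃ : ℝ)
    (ζ : ∀ n, Fin K × Fin (p n) × Fin n → Ω → ℂ) : Prop where
  meas : ∀ n a, Measurable (ζ n a)
  indep : ∀ n, iIndepFun (ζ n) P
  mean : ∀ n a, ∫ ω, ζ n a ω ∂P = 0
  var : ∀ n a, ∫ ω, ‖ζ n a ω‖ ^ 2 ∂P = 1
  integrable : ∀ n a, Integrable (fun ω => ‖ζ n a ω‖ ^ 3) P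
  third : ∀ n a, ∫ ω, ‖ζ n a ω‖ ^ 3 ∂P ≤ m₃

/-- The asymptotic regime for the joint eigenvalues. -/
structure Regime {K : ℕ} {p : ℕ → ℕ} (S : SpecData K p) (c C : ℝ)
    (H G : Measure (Fin K → ℝ)) : Prop where
  ratio : Tendsto (fun n : ℕ => (p n : ℝ) / n) atTop (𝓝 c)
  left : WeakLimit atTop (fun n => (empirical (S.lam n) : Measure (Fin K → ℝ))) H
  right : WeakLimit atTop (fun n => (empirical (S.mu n) : Measure (Fin K → ℝ))) G
  left_trace : ∀ᶠ n in atTop, ∀ r, ∑ j, S.lam n j r ≤ C * n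
  right_trace : ∀ᶠ n in atTop, ∀ r, ∑ j, S.mu n j r ≤ C * n

/-- A slowly growing bound for the joint eigenvalues. -/
structure SlowBound {K : ℕ} {p : ℕ → ℕ} (S : SpecData K p) (τ : ℕ → ℝ) : Prop where
  one_le : ∀ n, 1 ≤ τ n
  lam_le : ∀ n j r, S.lam n j r ≤ τ n
  mu_le : ∀ n j r, S.mu n j r ≤ τ n
  tendsto : Tendsto (fun n : ℕ => τ n ^ 4 / √n) atTop (𝓝 0)
  summable : Summable fun n : ℕ => τ n ^ 4 / (n : ℝ) ^ 2

namespace SpecData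

variable {K : ℕ} {p : ℕ → ℕ} (S : SpecData K p)

/-- `resolvTrace` for the matrices of the sequence. -/
def rt (n : ℕ) (w : ℂ) (d : Fin (p n) ⊕ Fin n → ℂ) (x : Fin K × Fin (p n) × Fin n → ℂ) : ℂ :=
  resolvTrace (S.U n) (S.V n) (S.lam n) (S.mu n) w d x

/-- The weights of the left matrices. -/
def dl (n : ℕ) (r : Fin K) : Fin (p n) ⊕ Fin n → ℂ := Sum.elim (fun j => (S.lam n j r : ℂ)) 0

/-- The weights of the right matrices. -/
def dr (n : ℕ) (r : Fin K) : Fin (p n) ⊕ Fin n → ℂ := Sum.elim 0 fun j => (S.mu n j r : ℂ)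

end SpecData

/-- By Tonelli the series of the |f_n|⁴ has finite expectation, hence converges almost surely, and
its terms tend to zero. -/
theorem ae_tendsto_zero_of_summable_pow_four {P : Measure Ω} {f : ℕ → Ω → ℂ}
    (hf : ∀ n, Measurable (f n)) (hi : ∀ n, Integrable (fun ω => ‖f n ω‖ ^ 4) P) {e : ℕ → ℝ}
    (he : Summable e) (hfe : ∀ n, ∫ ω, ‖f n ω‖ ^ 4 ∂P ≤ e n) :
    ∀ᵐ ω ∂P, Tendsto (fun n => f n ω) atTop (𝓝 0) := by
  have he0 : ∀ n, 0 ≤ e n := fun n => (integral_nonneg fun ω => by positivity).trans (hfe n)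
  have h1 : ∀ n, ∫⁻ ω, ENNReal.ofReal (‖f n ω‖ ^ 4) ∂P ≤ ENNReal.ofReal (e n) := fun n => by
    rw [← ofReal_integral_eq_lintegral_ofReal (hi n) (ae_of_all _ fun ω => by positivity)]
    exact ENNReal.ofReal_le_ofReal (hfe n)
  have hmeas : ∀ n, Measurable fun ω => ENNReal.ofReal (‖f n ω‖ ^ 4) := fun n =>
    ((hf n).norm.pow_const 4).ennreal_ofReal
  have h2 : ∫⁻ ω, ∑' n, ENNReal.ofReal (‖f n ω‖ ^ 4) ∂P ≠ ∞ := by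
    rw [lintegral_tsum fun n => (hmeas n).aemeasurable]
    refine ne_top_of_le_ne_top ?_ (ENNReal.tsum_le_tsum h1)
    rw [← ENNReal.ofReal_tsum_of_nonneg he0 he]
    exact ENNReal.ofReal_ne_top
  filter_upwards [ae_lt_top' (Measurable.tsum hmeas).aemeasurable h2] with ω hω
  have h3 := ENNReal.tendsto_atTop_zero_of_tsum_ne_top hω.ne
  have h4 : Tendsto (fun n => ‖f n ω‖ ^ 4) atTop (𝓝 0) := by
    have := (ENNReal.tendsto_toReal ENNReal.zero_ne_top).comp h3
    refine this.congr fun n => ?_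
    simp
  rw [tendsto_zero_iff_norm_tendsto_zero]
  have h5 := h4.rpow_const (p := (4 : ℝ)⁻¹) (Or.inr (by norm_num))
  rw [Real.zero_rpow (by norm_num)] at h5
  refine h5.congr fun n => ?_
  rw [← Real.rpow_natCast, ← Real.rpow_mul (norm_nonneg _)]
  norm_num

variable {P : Measure Ω} {K : ℕ} {p : ℕ → ℕ} {S : SpecData K p}
  {ζ : ∀ n, Fin K × Fin (p n) × Fin n → Ω → ℂ} {m₃ : ℝ} {τ : ℕ → ℝ}

theorem SpecData.measurable_rt (hζ : Innovations P m₃ ζ) {w : ℂ} (hw : 0 < w.im) (n : ℕ)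
    (d : Fin (p n) ⊕ Fin n → ℂ) : Measurable fun ω => S.rt n w d fun q => ζ n q ω :=
  (continuous_resolvTrace _ _ _ _ hw d).measurable.comp (measurable_pi_lambda _ (hζ.meas n))

theorem SpecData.integrable_comp_rt [IsProbabilityMeasure P] (hζ : Innovations P m₃ ζ) {w : ℂ}
    (hw : 0 < w.im) (n : ℕ) (d : Fin (p n) ⊕ Fin n → ℂ) {E : Type*} [NormedAddCommGroup E]
    [MeasurableSpace E] [BorelSpace E] [SecondCountableTopology E] {f : ℂ → E}
    (hf : Continuous f) : Integrable (fun ω => f (S.rt n w d fun q => ζ n q ω)) P := by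
  have h := integrable_comp_resolv (P := P) (hζ.meas n) (leftCols n (sqrtFactor (S.U n) (S.lam n)))
    (rightCols (p n) (sqrtFactor (S.V n) (S.mu n))) hw
    (φ := fun Y => f ((n : ℂ)⁻¹ *
      (conjDiag (Matrix.fromBlocks (S.U n) 0 0 (S.V n)) d * Y).trace))
    (hf.comp (continuous_const.mul
      (Continuous.matrix_trace (continuous_const.matrix_mul continuous_id))))
  exact h

variable [IsProbabilityMeasure P]

/-- The fourth moment of the unnormalized trace is of order (n τ²)². The normalization n⁻⁴ leaves τ⁴
/ n², which is summable. -/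
theorem ae_tendsto_rt_sub_integral (hζ : Innovations P m₃ ζ) (hτ : SlowBound S τ) {w : ℂ}
    (hw : 0 < w.im) {d : ∀ n, Fin (p n) ⊕ Fin n → ℂ} (hd : ∀ n i, ‖d n i‖ ≤ τ n) :
    ∀ᵐ ω ∂P, Tendsto (fun n => S.rt n w (d n) (fun q => ζ n q ω) -
      ∫ ω', S.rt n w (d n) (fun q => ζ n q ω') ∂P) atTop (𝓝 0) := by
  refine ae_tendsto_zero_of_summable_pow_four
    (e := fun n => 384 * (4 * (K + 1) * (w.im)⁻¹) ^ 4 * (τ n ^ 4 / (n : ℝ) ^ 2))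
    (fun n => (SpecData.measurable_rt hζ hw n _).sub_const _) (fun n => ?_)
    (hτ.summable.mul_left _) (fun n => ?_)
  · exact SpecData.integrable_comp_rt hζ hw n (d n) (f := fun y => ‖y - _‖ ^ 4) (by fun_prop)
  · rcases Nat.eq_zero_or_pos n with h0 | hn
    · subst h0
      simp [SpecData.rt, resolvTrace]
    have hn' : (0 : ℝ) < n := by exact_mod_cast hn
    have hτ0 : 0 < τ n := lt_of_lt_of_le one_pos (hτ.one_le n)
    have hB : 0 < (w.im)⁻¹ := inv_pos.2 hw
    set M := conjDiag (Matrix.fromBlocks (S.U n) 0 0 (S.V n)) (d n) with hM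
    have hMn : ‖M‖ ≤ τ n :=
      norm_conjDiag_le (fromBlocks_mem_unitaryGroup (S.hU n) (S.hV n)) hτ0.le (hd n)
    have key := integral_norm_trace_sub_pow_four_le hn (hζ.meas n) (hζ.indep n)
      (leftCols n (sqrtFactor (S.U n) (S.lam n))) (rightCols (p n) (sqrtFactor (S.V n) (S.mu n)))
      M hw (c := 4 * (K + 1) * (τ n * (w.im)⁻¹)) (by positivity) (by gcongr; linarith)
    have e : ∀ ω, ‖S.rt n w (d n) (fun q => ζ n q ω) -
        ∫ ω', S.rt n w (d n) (fun q => ζ n q ω') ∂P‖ ^ 4 = ((n : ℝ)⁻¹) ^ 4 *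
        ‖(M * resolv (sepModel (leftCols n (sqrtFactor (S.U n) (S.lam n)))
          (rightCols (p n) (sqrtFactor (S.V n) (S.mu n))) fun a => ζ n a ω) w).trace -
        ∫ ω', (M * resolv (sepModel (leftCols n (sqrtFactor (S.U n) (S.lam n)))
          (rightCols (p n) (sqrtFactor (S.V n) (S.mu n))) fun a => ζ n a ω') w).trace ∂P‖ ^ 4 :=
      fun ω => by
        simp only [SpecData.rt, resolvTrace]
        rw [integral_const_mul, ← mul_sub, norm_mul, norm_inv, Complex.norm_natCast, mul_pow]
        rfl
    simp only [e]
    rw [integral_const_mul]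
    calc _ ≤ ((n : ℝ)⁻¹) ^ 4 * (384 * (n * (4 * (K + 1) * (τ n * (w.im)⁻¹)) ^ 2) ^ 2) := by
          gcongr
      _ = _ := by
          field_simp

theorem SpecData.norm_dl_le (hτ : SlowBound S τ) (n : ℕ) (r : Fin K) (i : Fin (p n) ⊕ Fin n) :
    ‖S.dl n r i‖ ≤ τ n := by
  rcases i with j | j
  · simpa [SpecData.dl, abs_of_nonneg (S.lam_nonneg n j r)] using hτ.lam_le n j r
  · simpa [SpecData.dl] using zero_le_one.trans (hτ.one_le n)

theorem SpecData.norm_dr_le (hτ : SlowBound S τ) (n : ℕ) (r : Fin K) (i : Fin (p n) ⊕ Fin n) :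
    ‖S.dr n r i‖ ≤ τ n := by
  rcases i with j | j
  · simpa [SpecData.dr] using zero_le_one.trans (hτ.one_le n)
  · simpa [SpecData.dr, abs_of_nonneg (S.mu_nonneg n j r)] using hτ.mu_le n j r

/-- The expected normalized traces. -/
def SpecData.ea (S : SpecData K p) (P : Measure Ω) (ζ : ∀ n, Fin K × Fin (p n) × Fin n → Ω → ℂ)
    (w : ℂ) (n : ℕ) (r : Fin K) : ℂ := ∫ ω, S.rt n w (S.dl n r) (fun q => ζ n q ω) ∂P

/-- The expected normalized traces on the right. -/
def SpecData.eb (S : SpecData K p) (P : Measure Ω) (ζ : ∀ n, Fin K × Fin (p n) × Fin n → Ω → ℂ)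
    (w : ℂ) (n : ℕ) (r : Fin K) : ℂ := ∫ ω, S.rt n w (S.dr n r) (fun q => ζ n q ω) ∂P

/-- Three choices of the weights d are used: the joint eigenvalues on the left and those on the
right give the two halves of the system, and the indicator of the left block gives the trace of the
resolvent of S. -/
theorem tendsto_dyson (hζ : Innovations P m₃ ζ) (hm₃ : 0 ≤ m₃) (hτ : SlowBound S τ) {c : ℝ}
    (hc : Tendsto (fun n : ℕ => (p n : ℝ) / n) atTop (𝓝 c)) {w : ℂ}
    (hw : 0 < w.im) {d : ∀ n, Fin (p n) ⊕ Fin n → ℂ} (hd : ∀ n i, ‖d n i‖ ≤ τ n) :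
    Tendsto (fun n => ∫ ω, S.rt n w (d n) (fun q => ζ n q ω) ∂P + (n : ℂ)⁻¹ * ∑ i, d n i /
      Sum.elim (fun j => den w (S.eb P ζ w n) (S.lam n j))
        (fun j => den w (S.ea P ζ w n) (S.mu n j)) i) atTop (𝓝 0) := by
  refine squeeze_zero_norm' (a := fun n =>
    dysonConst K (c + 1) m₃ (w.im)⁻¹ * (τ n ^ 4 / √n)) ?_ ?_
  · filter_upwards [eventually_gt_atTop 0, hc.eventually_lt_const (lt_add_one c)] with n hn hcn
    have hn' : (0 : ℝ) < n := by exact_mod_cast hn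
    exact norm_dyson_le hn (hζ.meas n) (hζ.indep n) (hζ.mean n) (hζ.var n) (hζ.integrable n)
      (hζ.third n) hm₃ (S.hU n) (S.hV n) (S.lam_nonneg n) (S.mu_nonneg n) (hτ.one_le n)
      (hτ.lam_le n) (hτ.mu_le n) ((div_le_iff₀ hn').1 hcn.le) hw (hd n)
  · simpa using hτ.tendsto.const_mul (dysonConst K (c + 1) m₃ (w.im)⁻¹)

theorem tendsto_ea_add (hζ : Innovations P m₃ ζ) (hm₃ : 0 ≤ m₃) (hτ : SlowBound S τ) {c : ℝ}
    (hc : Tendsto (fun n : ℕ => (p n : ℝ) / n) atTop (𝓝 c)) {w : ℂ} (hw : 0 < w.im) (r : Fin K) :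
    Tendsto (fun n => S.ea P ζ w n r + ((p n / n : ℝ) : ℂ) *
      ∫ x, (x r : ℂ) / den w (S.eb P ζ w n) x ∂(empirical (S.lam n) : Measure (Fin K → ℝ)))
      atTop (𝓝 0) := by
  refine (tendsto_dyson hζ hm₃ hτ hc hw (d := fun n => S.dl n r)
    fun n i => SpecData.norm_dl_le hτ n r i).congr fun n => ?_
  rw [integral_empirical, Fintype.sum_sum_type, Fintype.card_fin]
  simp only [SpecData.dl, Sum.elim_inl, Sum.elim_inr, Pi.zero_apply, zero_div,
    Finset.sum_const_zero, add_zero, SpecData.ea, Complex.real_smul]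
  congr 1
  rcases Nat.eq_zero_or_pos (p n) with h0 | h0
  · have : IsEmpty (Fin (p n)) := by rw [h0]; infer_instance
    simp
  · have : (p n : ℂ) ≠ 0 := by exact_mod_cast h0.ne'
    push_cast
    field_simp

theorem tendsto_eb_add (hζ : Innovations P m₃ ζ) (hm₃ : 0 ≤ m₃) (hτ : SlowBound S τ) {c : ℝ}
    (hc : Tendsto (fun n : ℕ => (p n : ℝ) / n) atTop (𝓝 c)) {w : ℂ} (hw : 0 < w.im) (r : Fin K) :
    Tendsto (fun n => S.eb P ζ w n r +
      ∫ x, (x r : ℂ) / den w (S.ea P ζ w n) x ∂(empirical (S.mu n) : Measure (Fin K → ℝ)))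
      atTop (𝓝 0) := by
  refine (tendsto_dyson hζ hm₃ hτ hc hw (d := fun n => S.dr n r)
    fun n i => SpecData.norm_dr_le hτ n r i).congr fun n => ?_
  rw [integral_empirical, Fintype.sum_sum_type, Fintype.card_fin]
  simp only [SpecData.dr, Sum.elim_inl, Sum.elim_inr, Pi.zero_apply, zero_div,
    Finset.sum_const_zero, zero_add, SpecData.eb, Complex.real_smul]
  push_cast
  rfl

theorem tendsto_one_add (hζ : Innovations P m₃ ζ) (hm₃ : 0 ≤ m₃) (hτ : SlowBound S τ) {c : ℝ}
    (hc : Tendsto (fun n : ℕ => (p n : ℝ) / n) atTop (𝓝 c)) {w : ℂ} (hw : 0 < w.im) :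
    Tendsto (fun n => ∫ ω, S.rt n w (Sum.elim 1 0) (fun q => ζ n q ω) ∂P + ((p n / n : ℝ) : ℂ) *
      ∫ x, 1 / den w (S.eb P ζ w n) x ∂(empirical (S.lam n) : Measure (Fin K → ℝ)))
      atTop (𝓝 0) := by
  refine (tendsto_dyson hζ hm₃ hτ hc hw (d := fun n => Sum.elim 1 0)
    fun n i => ?_).congr fun n => ?_
  · rcases i with j | j
    · simpa using hτ.one_le n
    · simpa using zero_le_one.trans (hτ.one_le n)
  rw [integral_empirical, Fintype.sum_sum_type, Fintype.card_fin]
  simp only [Sum.elim_inl, Sum.elim_inr, Pi.zero_apply, Pi.one_apply, zero_div,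
    Finset.sum_const_zero, add_zero, Complex.real_smul]
  congr 1
  rcases Nat.eq_zero_or_pos (p n) with h0 | h0
  · have : IsEmpty (Fin (p n)) := by rw [h0]; infer_instance
    simp
  · have : (p n : ℂ) ≠ 0 := by exact_mod_cast h0.ne'
    push_cast
    field_simp

end SpecData

end SumSeparable
end

/-! ### Limits of expected traces along ultrafilters -/

noncomputable section

namespace SumSeparable

open scoped Matrix.Norms.L2Operator

section Traces

variable {K : ℕ} {p : ℕ → ℕ} {S : SpecData K p}

/-- Only the ℓ¹ norm of the weights enters, in contrast to a bound by dimension times operator norm.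
The trace bound on the scaling matrices thus keeps the expected traces bounded although τ grows. -/
theorem SpecData.norm_rt_le {w : ℂ} (hw : 0 < w.im) (n : ℕ) (d : Fin (p n) ⊕ Fin n → ℂ)
    (x : Fin K × Fin (p n) × Fin n → ℂ) :
    ‖S.rt n w d x‖ ≤ (n : ℝ)⁻¹ * ((w.im)⁻¹ * ∑ i, ‖d i‖) := by
  rw [SpecData.rt, resolvTrace, norm_mul, norm_inv, Complex.norm_natCast]
  refine mul_le_mul_of_nonneg_left ?_ (by positivity)
  have hW := fromBlocks_mem_unitaryGroup (S.hU n) (S.hV n)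
  set W := Matrix.fromBlocks (S.U n) 0 0 (S.V n)
  have hW' : Wᴴ ∈ unitary (Matrix (Fin (p n) ⊕ Fin n) (Fin (p n) ⊕ Fin n) ℂ) := Unitary.star_mem hW
  rw [Matrix.trace_mul_comm, trace_mul_conjDiag, Finset.mul_sum]
  refine (norm_sum_le _ _).trans (Finset.sum_le_sum fun i _ => ?_)
  rw [norm_mul]
  refine mul_le_mul_of_nonneg_right ((norm_diag_le _ i).trans ?_) (norm_nonneg _)
  rw [CStarRing.norm_mul_mem_unitary _ hW, CStarRing.norm_mem_unitary_mul _ hW']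
  exact norm_resolv_le (hermModel_isHermitian _ _ _ _ _) hw

theorem SpecData.rt_dl_im_nonneg {w : ℂ} (hw : 0 < w.im) (n : ℕ) (r : Fin K)
    (x : Fin K × Fin (p n) × Fin n → ℂ) : 0 ≤ (S.rt n w (S.dl n r) x).im := by
  rw [SpecData.rt, resolvTrace, SpecData.dl, ← gram_left_eq (S.hU n) (S.V n) (S.lam_nonneg n),
    show (n : ℂ)⁻¹ = (((n : ℝ)⁻¹ : ℝ) : ℂ) by push_cast; rfl, Complex.im_ofReal_mul,
    Matrix.trace_mul_comm]
  exact mul_nonneg (by positivity)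
    (trace_resolv_mul_gram_im_nonneg (hermModel_isHermitian _ _ _ _ _) hw _)

theorem SpecData.rt_dr_im_nonneg {w : ℂ} (hw : 0 < w.im) (n : ℕ) (r : Fin K)
    (x : Fin K × Fin (p n) × Fin n → ℂ) : 0 ≤ (S.rt n w (S.dr n r) x).im := by
  rw [SpecData.rt, resolvTrace, SpecData.dr, ← smul_eq_mul, ← Matrix.trace_smul, ← Matrix.smul_mul,
    ← gram_right_eq (S.U n) (S.hV n) (S.mu_nonneg n), Matrix.trace_mul_comm]
  exact trace_resolv_mul_gram_im_nonneg (hermModel_isHermitian _ _ _ _ _) hw _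

/-- Weights on the left block see only w (Y Yᴴ - w²)⁻¹, and the trace of the resolvent of a positive
matrix against a positive semi-definite one is a Stieltjes transform, here at w². -/
theorem SpecData.exists_stieltjes_rt (S : SpecData K p) (n : ℕ) {e : Fin (p n) → ℝ}
    (he : ∀ j, 0 ≤ e j) (x : Fin K × Fin (p n) × Fin n → ℂ) :
    ∃ μ : Measure ℝ, IsFiniteMeasure μ ∧ μ (Set.Ici 0)ᶜ = 0 ∧
      μ Set.univ = ENNReal.ofReal ((n : ℝ)⁻¹ * ∑ j, e j) ∧ ∀ w : ℂ, 0 < w.im →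
        S.rt n w (Sum.elim (fun j => (e j : ℂ)) 0) x = w * stieltjes μ (w ^ 2) := by
  set Y : Matrix (Fin (p n)) (Fin n) ℂ := (√n : ℂ)⁻¹ • ∑ r, sqrtFactor (S.U n) (S.lam n) r *
    (Matrix.of fun i j => x (r, i, j)) * (sqrtFactor (S.V n) (S.mu n) r)ᴴ with hY
  have hN : (((n : ℂ)⁻¹) • conjDiag (S.U n) fun j => (e j : ℂ)).PosSemidef :=
    (posSemidef_conjDiag (S.U n) he).smul (by
      rw [show (n : ℂ)⁻¹ = (((n : ℝ)⁻¹ : ℝ) : ℂ) by push_cast; rfl, Complex.zero_le_real]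
      positivity)
  obtain ⟨μ, hfin, h0, hmass, hst⟩ :=
    exists_stieltjes_eq_trace (Matrix.posSemidef_self_mul_conjTranspose Y) hN
  refine ⟨μ, hfin, h0, ?_, fun w hw => ?_⟩
  · rw [hmass, Matrix.trace_smul, trace_conjDiag (S.hU n), smul_eq_mul,
      show (n : ℂ)⁻¹ = (((n : ℝ)⁻¹ : ℝ) : ℂ) by push_cast; rfl, Complex.re_ofReal_mul,
      Complex.re_sum]
    simp
  · rw [← hst _ fun x hx => ofReal_ne_sq hw hx, Matrix.smul_mul, Matrix.trace_smul, smul_eq_mul,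
      mul_left_comm, ← trace_mul_resolv_fromBlocks Y _ hw, SpecData.rt, resolvTrace,
      ← fromBlocks_conjDiag, conjDiag_zero]
    congr 4
    exact sepModel_cols _ _ fun r => Matrix.of fun i j => x (r, i, j)

end Traces

section Limits

variable {Ω : Type*} [MeasurableSpace Ω] {P : Measure Ω} [IsProbabilityMeasure P]
  {K : ℕ} {p : ℕ → ℕ} {S : SpecData K p}
  {ζ : ∀ n, Fin K × Fin (p n) × Fin n → Ω → ℂ} {m₃ : ℝ} {τ : ℕ → ℝ}

/-- Expectations are followed along one realization: concentration holds simultaneously at countably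
many points for almost every ω, and compactness is applied to the random measures at one such ω. -/
theorem exists_tendsto_integral_rt_on (hζ : Innovations P m₃ ζ) (hτ : SlowBound S τ)
    (𝒰 : Ultrafilter ℕ) (h𝒰 : (𝒰 : Filter ℕ) ≤ atTop) {D : Set ℂ} (hD : D.Countable)
    (hDp : ∀ w ∈ D, 0 < w.im) {e : ∀ n, Fin (p n) → ℝ} (he : ∀ n j, 0 ≤ e n j)
    (heτ : ∀ n j, e n j ≤ τ n) (C : ℝ≥0) (hC : ∀ᶠ n : ℕ in atTop, ∑ j, e n j ≤ C * n) :
    ∃ ν : Measure ℝ, IsFiniteMeasure ν ∧ ν (Set.Ici 0)ᶜ = 0 ∧ ∀ w ∈ D,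
      Tendsto (fun n => ∫ ω, S.rt n w (Sum.elim (fun j => (e n j : ℂ)) 0) (fun q => ζ n q ω) ∂P)
        𝒰 (𝓝 (w * stieltjes ν (w ^ 2))) := by
  have hae : ∀ᵐ ω ∂P, ∀ w ∈ D, Tendsto (fun n =>
      S.rt n w (Sum.elim (fun j => (e n j : ℂ)) 0) (fun q => ζ n q ω) -
      ∫ ω', S.rt n w (Sum.elim (fun j => (e n j : ℂ)) 0) (fun q => ζ n q ω') ∂P)
      atTop (𝓝 0) := by
    rw [ae_ball_iff hD]
    intro w hw
    refine ae_tendsto_rt_sub_integral hζ hτ (hDp w hw) fun n i => ?_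
    rcases i with j | j
    · simpa [abs_of_nonneg (he n j)] using heτ n j
    · simpa using zero_le_one.trans (hτ.one_le n)
  obtain ⟨ω, hω⟩ := hae.exists
  choose μ hfin h0 hmass hst using fun n => S.exists_stieltjes_rt n (he n) (fun q => ζ n q ω)
  have hbd : ∀ᶠ n in (𝒰 : Filter ℕ), μ n Set.univ ≤ C := by
    filter_upwards [h𝒰 hC, h𝒰 (eventually_gt_atTop 0)] with n hn hpos
    have hn' : (0 : ℝ) < n := by exact_mod_cast hpos
    rw [hmass, ← ENNReal.ofReal_coe_nnreal]
    refine ENNReal.ofReal_le_ofReal ?_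
    rwa [inv_mul_le_iff₀ hn', mul_comm]
  obtain ⟨ν, hν, hν0, hlim⟩ := exists_tendsto_stieltjes 𝒰 μ h0 C hbd
  refine ⟨ν, hν, hν0, fun w hw => ?_⟩
  have h1 := (hlim (w ^ 2) fun x hx => ofReal_ne_sq (hDp w hw) hx).const_mul w
  have h2 := h1.sub ((hω w hw).mono_left h𝒰)
  rw [sub_zero] at h2
  refine h2.congr fun n => ?_
  rw [hst n w (hDp w hw)]
  ring

theorem continuousOn_stieltjes_sq {ν : Measure ℝ} [IsFiniteMeasure ν] (hν : ν (Set.Ici 0)ᶜ = 0) :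
    ContinuousOn (fun w => stieltjes ν (w ^ 2)) {w : ℂ | 0 < w.im} := fun w hw => by
  have h1 := (differentiableAt_stieltjes isClosed_Ici hν (z := w ^ 2)
    fun x hx => ofReal_ne_sq hw hx).continuousAt
  exact (ContinuousAt.comp (f := fun w : ℂ => w ^ 2) h1
    (continuous_pow 2).continuousAt).continuousWithinAt

/-- The countable version is used for a dense set D and for D with w adjoined. The two limits agree
on D, hence everywhere by continuity, so the measure found for D serves every w. -/
theorem exists_tendsto_integral_rt (hζ : Innovations P m₃ ζ) (hτ : SlowBound S τ)
    (𝒰 : Ultrafilter ℕ) (h𝒰 : (𝒰 : Filter ℕ) ≤ atTop) {e : ∀ n, Fin (p n) → ℝ}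
    (he : ∀ n j, 0 ≤ e n j) (heτ : ∀ n j, e n j ≤ τ n) (C : ℝ≥0)
    (hC : ∀ᶠ n : ℕ in atTop, ∑ j, e n j ≤ C * n) :
    ∃ ν : Measure ℝ, IsFiniteMeasure ν ∧ ν (Set.Ici 0)ᶜ = 0 ∧ ∀ w : ℂ, 0 < w.im →
      Tendsto (fun n => ∫ ω, S.rt n w (Sum.elim (fun j => (e n j : ℂ)) 0) (fun q => ζ n q ω) ∂P)
        𝒰 (𝓝 (w * stieltjes ν (w ^ 2))) := by
  obtain ⟨s, hs, hsd⟩ := TopologicalSpace.exists_countable_dense ℂ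
  let D : Set ℂ := {w : ℂ | 0 < w.im} ∩ s
  have hD : D.Countable := hs.mono Set.inter_subset_right
  have hDcl : {w : ℂ | 0 < w.im} ⊆ closure D := hsd.open_subset_closure_inter isOpen_upperHalfPlane
  obtain ⟨ν, hν, hν0, hlim⟩ := exists_tendsto_integral_rt_on hζ hτ 𝒰 h𝒰 hD (fun w hw => hw.1)
    he heτ C hC
  refine ⟨ν, hν, hν0, fun w hw => ?_⟩
  obtain ⟨ν', hν', hν0', hlim'⟩ := exists_tendsto_integral_rt_on hζ hτ 𝒰 h𝒰 (hD.insert w)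
    (by
      rintro v (rfl | hv)
      · exact hw
      · exact hv.1) he heτ C hC
  have hEq : Set.EqOn (fun w => stieltjes ν (w ^ 2)) (fun w => stieltjes ν' (w ^ 2))
      {w : ℂ | 0 < w.im} := by
    refine Set.EqOn.of_subset_closure (s := D) (fun v hv => ?_) (continuousOn_stieltjes_sq hν0)
      (continuousOn_stieltjes_sq hν0') Set.inter_subset_left hDcl
    have hv0 : v ≠ 0 := fun h => by
      have := hv.1
      simp [h] at this
    exact mul_left_cancel₀ hv0 (tendsto_nhds_unique (hlim v hv) (hlim' v (Or.inr hv)))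
  have h1 := hlim' w (Or.inl rfl)
  have h2 : stieltjes ν (w ^ 2) = stieltjes ν' (w ^ 2) := hEq hw
  rwa [h2]

theorem exists_sq_eq {z : ℂ} (hz : 0 < z.im) : ∃ w : ℂ, 0 < w.im ∧ w ^ 2 = z := by
  obtain ⟨w, hw⟩ := IsAlgClosed.exists_pow_nat_eq z (n := 2) two_pos
  have hne : w.im ≠ 0 := fun h => by
    rw [← hw, pow_two, Complex.mul_im, h] at hz
    simp at hz
  rcases lt_or_gt_of_ne hne with h | h
  · exact ⟨-w, by simpa using h, by rw [neg_sq, hw]⟩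
  · exact ⟨w, h, hw⟩

theorem WeakLimit.mono {ι : Type*} {l l' : Filter ι} {Hn : ι → Measure (Fin K → ℝ)}
    {H : Measure (Fin K → ℝ)} (h : WeakLimit l Hn H) (hl : l' ≤ l) : WeakLimit l' Hn H :=
  ⟨hl h.prob, h.nonneg, h.integrable, h.nonneg_lim, fun f => (h.tendsto f).mono_left hl⟩

variable {c C : ℝ} {H G : Measure (Fin K → ℝ)} [IsProbabilityMeasure H] [IsProbabilityMeasure G]

/-- Along an ultrafilter, the expected traces converge to a solution of the system. -/
theorem exists_solution_of_ultrafilter (hζ : Innovations P m₃ ζ) (hm₃ : 0 ≤ m₃)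
    (hτ : SlowBound S τ) (hS : Regime S c C H G) (hc : 0 < c) (hCp : 0 ≤ C)
    (hHr : ∀ r, ¬ ∀ᵐ x ∂H, x r = 0) (hGr : ∀ r, ¬ ∀ᵐ x ∂G, x r = 0)
    (𝒰 : Ultrafilter ℕ) (h𝒰 : (𝒰 : Filter ℕ) ≤ atTop) :
    ∃ (h : ℂ → Fin K → ℂ) (ρ : Measure ℝ), (∀ r, IsStieltjesOf (Set.Ici 0) fun z => h z r) ∧
      SolvesSystem c H G h ∧ IsFiniteMeasure ρ ∧ ρ (Set.Ici 0)ᶜ = 0 ∧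
      (∀ z : ℂ, 0 < z.im → stieltjes ρ z =
        ∫ x : Fin K → ℝ, 1 / (-z * (1 + ∑ s, (x s : ℂ) *
          opO z (fun t => (c : ℂ) * h z t) G s)) ∂H) ∧
      ∀ w : ℂ, 0 < w.im →
        Tendsto (fun n => ∫ ω, S.rt n w (Sum.elim 1 0) (fun q => ζ n q ω) ∂P) 𝒰
          (𝓝 (c * (w * stieltjes ρ (w ^ 2)))) := by
  have hcc : (c : ℂ) ≠ 0 := by exact_mod_cast hc.ne'
  have hstsmul : ∀ (ν : Measure ℝ) (z : ℂ),
      stieltjes (ENNReal.ofReal c⁻¹ • ν) z = (c : ℂ)⁻¹ * stieltjes ν z := fun ν z => by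
    rw [stieltjes, integral_smul_measure, ENNReal.toReal_ofReal (by positivity), Complex.real_smul,
      stieltjes]
    push_cast
    rfl
  have hA := fun r => exists_tendsto_integral_rt (S := S) hζ hτ 𝒰 h𝒰
    (e := fun n j => S.lam n j r) (fun n j => S.lam_nonneg n j r) (fun n j => hτ.lam_le n j r)
    ⟨C, hCp⟩ (by
      filter_upwards [hS.left_trace] with n hn
      exact hn r)
  choose ν hνfin hν0 hνlim using hA
  obtain ⟨ρ', hρfin, hρ0, hρlim⟩ := exists_tendsto_integral_rt (S := S) hζ hτ 𝒰 h𝒰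
    (e := fun n j => 1) (fun n j => zero_le_one) (fun n j => hτ.one_le n) ⟨c + 1, by positivity⟩ (by
      filter_upwards [eventually_gt_atTop 0, hS.ratio.eventually_lt_const (lt_add_one c)]
        with n hn hcn
      have hn' : (0 : ℝ) < n := by exact_mod_cast hn
      simp only [Finset.sum_const, Finset.card_univ, Fintype.card_fin, nsmul_eq_mul, mul_one]
      exact (div_le_iff₀ hn').1 hcn.le)
  have hsys : ∀ w : ℂ, 0 < w.im → ∃ b₀ : Fin K → ℂ,
      (∀ r, 0 < (w * stieltjes (ν r) (w ^ 2)).im) ∧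
      (∀ r, w * stieltjes (ν r) (w ^ 2) = -(c * ∫ x, (x r : ℂ) / den w b₀ x ∂H)) ∧
      (∀ r, b₀ r = -∫ x, (x r : ℂ) / den w (fun s => w * stieltjes (ν s) (w ^ 2)) x ∂G) ∧
      w * stieltjes ρ' (w ^ 2) = -(c * ∫ x, 1 / den w b₀ x ∂H) := by
    intro w hw
    -- The right-hand traces need no representing measure: they are bounded by the trace bound, and
    -- a limit for each w separately is enough, since the second equation of the system expresses it
    -- through the left-hand limits.
    have hbb : ∀ r, ∃ b, Tendsto (fun n => S.eb P ζ w n r) 𝒰 (𝓝 b) := fun r => by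
      have hmem : ∀ᶠ n in (𝒰 : Filter ℕ),
          S.eb P ζ w n r ∈ Metric.closedBall (0 : ℂ) ((w.im)⁻¹ * C) := by
        filter_upwards [h𝒰 hS.right_trace, h𝒰 (eventually_gt_atTop 0)] with n hn hpos
        have hn' : (0 : ℝ) < n := by exact_mod_cast hpos
        rw [mem_closedBall_zero_iff, SpecData.eb]
        have hb : ∀ ω, ‖S.rt n w (S.dr n r) (fun q => ζ n q ω)‖ ≤ (w.im)⁻¹ * C := fun ω => by
          refine (SpecData.norm_rt_le hw n _ _).trans ?_
          have e1 : ∑ i, ‖S.dr n r i‖ = ∑ j, S.mu n j r := by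
            rw [Fintype.sum_sum_type]
            simp [SpecData.dr, abs_of_nonneg, S.mu_nonneg]
          rw [e1, inv_mul_le_iff₀ hn']
          have := mul_le_mul_of_nonneg_left (hn r) (inv_pos.2 hw).le
          linarith
        have := norm_integral_le_of_norm_le_const (μ := P) (ae_of_all _ hb)
        simpa using this
      obtain ⟨b, -, hb⟩ := (isCompact_closedBall (0 : ℂ) ((w.im)⁻¹ * C)).ultrafilter_le_nhds'
        (𝒰.map fun n => S.eb P ζ w n r) hmem
      exact ⟨b, hb⟩
    choose b₀ hb₀ using hbb
    have hi : ∀ n (d : Fin (p n) ⊕ Fin n → ℂ), (∀ ω, 0 ≤ (S.rt n w d fun q => ζ n q ω).im) →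
        0 ≤ (∫ ω, S.rt n w d (fun q => ζ n q ω) ∂P).im := fun n d hd => by
      have h1 := SpecData.integrable_comp_rt (S := S) hζ hw n d (f := id) continuous_id
      have h2 : (∫ ω, S.rt n w d (fun q => ζ n q ω) ∂P).im =
          ∫ ω, (S.rt n w d fun q => ζ n q ω).im ∂P := (integral_im h1).symm
      rw [h2]
      exact integral_nonneg hd
    obtain ⟨ha₀, -, hae, hbe, hone⟩ := limit_system (hS.left.mono h𝒰) (hS.right.mono h𝒰) hHr hGr
      hc (hS.ratio.mono_left h𝒰) hw (a := S.ea P ζ w) (b := S.eb P ζ w)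
      (a₀ := fun r => w * stieltjes (ν r) (w ^ 2)) (b₀ := b₀)
      (Eventually.of_forall fun n r => hi n _ fun ω => SpecData.rt_dl_im_nonneg hw n r _)
      (Eventually.of_forall fun n r => hi n _ fun ω => SpecData.rt_dr_im_nonneg hw n r _)
      (fun r => hνlim r w hw) hb₀
      (fun r => (tendsto_ea_add hζ hm₃ hτ hS.ratio hw r).mono_left h𝒰)
      (fun r => (tendsto_eb_add hζ hm₃ hτ hS.ratio hw r).mono_left h𝒰)
    refine ⟨b₀, ha₀, hae, hbe, ?_⟩
    have h1 := (tendsto_one_add hζ hm₃ hτ hS.ratio hw).mono_left h𝒰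
    have h2 : Tendsto (fun n => ∫ ω, S.rt n w (Sum.elim 1 0) (fun q => ζ n q ω) ∂P) 𝒰
        (𝓝 (w * stieltjes ρ' (w ^ 2))) := (hρlim w hw).congr fun n => by
      simp only [Complex.ofReal_one]
      rfl
    have h3 : Tendsto (fun n : ℕ => ((p n / n : ℝ) : ℂ)) 𝒰 (𝓝 (c : ℂ)) :=
      (Complex.continuous_ofReal.tendsto _).comp (hS.ratio.mono_left h𝒰)
    have h4 := h2.add (h3.mul hone)
    have h5 := tendsto_nhds_unique h1 h4
    exact eq_neg_of_add_eq_zero_left h5.symm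
  -- The traces are normalized by n but h by p, which accounts for c⁻¹. Division by w turns the
  -- equations in w into the system in z = w².
  have hO : ∀ w : ℂ, 0 < w.im → ∀ b₀ : Fin K → ℂ,
      (∀ r, b₀ r = -∫ x, (x r : ℂ) / den w (fun s => w * stieltjes (ν s) (w ^ 2)) x ∂G) →
      ∀ s, opO (w ^ 2) (fun t => (c : ℂ) * ((c : ℂ)⁻¹ * stieltjes (ν t) (w ^ 2))) G s =
        b₀ s / w := fun w hw b₀ hb₀ s => by
    have hw0 : w ≠ 0 := fun h => by simp [h] at hw
    rw [hb₀ s, ← opO_sq_eq hw0]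
    congr 1
    funext t
    field_simp
  refine ⟨fun z r => (c : ℂ)⁻¹ * stieltjes (ν r) z, ENNReal.ofReal c⁻¹ • ρ', fun r => ?_, ?_, ?_,
    ?_, ?_, ?_⟩
  · refine ⟨ENNReal.ofReal c⁻¹ • ν r, ?_, ?_, fun z _ => (hstsmul _ z).symm⟩
    · have := hνfin r
      exact Measure.smul_finite _ ENNReal.ofReal_ne_top
    · rw [Measure.smul_apply, hν0 r, smul_zero]
  · intro z hz r
    obtain ⟨w, hw, rfl⟩ := exists_sq_eq hz
    have hw0 : w ≠ 0 := fun h => by simp [h] at hw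
    obtain ⟨b₀, ha, hae, hbe, -⟩ := hsys w hw
    -- Positivity is known for w s(w²), not for s(w²). It shows that the measure is nonzero, and
    -- this gives Im s > 0 on the whole upper half-plane.
    have hne : ν r ≠ 0 := fun h => by
      have := ha r
      simp [h, stieltjes] at this
    have := hνfin r
    refine ⟨?_, ?_⟩
    · rw [show (c : ℂ)⁻¹ = ((c⁻¹ : ℝ) : ℂ) by push_cast; rfl, Complex.im_ofReal_mul]
      exact mul_pos (inv_pos.2 hc) (im_stieltjes_pos hne hz)
    · simp only [hO w hw b₀ hbe]
      have e1 : ∀ x : Fin K → ℝ, (x r : ℂ) / (-w ^ 2 * (1 + ∑ s, (x s : ℂ) * (b₀ s / w))) =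
          -w⁻¹ * ((x r : ℂ) / den w b₀ x) := fun x => by
        rw [div_eq_mul_one_div, one_div_sq_eq hw0]
        ring
      simp only [e1]
      rw [integral_const_mul]
      have h1 := hae r
      have h2 : stieltjes (ν r) (w ^ 2) = w⁻¹ * -(c * ∫ x, (x r : ℂ) / den w b₀ x ∂H) := by
        rw [← h1]
        field_simp
      rw [h2]
      field_simp
  · exact Measure.smul_finite _ ENNReal.ofReal_ne_top
  · rw [Measure.smul_apply, hρ0, smul_zero]
  · intro z hz
    obtain ⟨w, hw, rfl⟩ := exists_sq_eq hz
    have hw0 : w ≠ 0 := fun h => by simp [h] at hw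
    obtain ⟨b₀, ha, hae, hbe, h1⟩ := hsys w hw
    rw [hstsmul]
    simp only [hO w hw b₀ hbe]
    have e1 : ∀ x : Fin K → ℝ, 1 / (-w ^ 2 * (1 + ∑ s, (x s : ℂ) * (b₀ s / w))) =
        -w⁻¹ * (1 / den w b₀ x) := fun x => by
      rw [one_div_sq_eq hw0]
      ring
    simp only [e1]
    rw [integral_const_mul]
    have h2 : stieltjes ρ' (w ^ 2) = w⁻¹ * -(c * ∫ x, 1 / den w b₀ x ∂H) := by
      rw [← h1]
      field_simp
    rw [h2]
    field_simp
  · intro w hw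
    rw [hstsmul]
    have e : (c : ℂ) * (w * ((c : ℂ)⁻¹ * stieltjes ρ' (w ^ 2))) = w * stieltjes ρ' (w ^ 2) := by
      field_simp
    rw [e]
    refine (hρlim w hw).congr fun n => ?_
    simp only [Complex.ofReal_one]
    rfl

end Limits

end SumSeparable
end

/-! ### First moments, the limit law and convergence of expectations -/

noncomputable section

namespace SumSeparable

open scoped Matrix.Norms.L2Operator

section FirstMoments

variable {K : ℕ} {ι : Type*} {l : Filter ι} {Hn : ι → Measure (Fin K → ℝ)}
  {H : Measure (Fin K → ℝ)}

/-- The truncation of a coordinate, as a bounded continuous function. -/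
def truncCoord (r : Fin K) (m : ℕ) : BoundedContinuousFunction (Fin K → ℝ) ℝ :=
  BoundedContinuousFunction.ofNormedAddCommGroup (fun x => min (max (x r) 0) m) (by fun_prop) m
    fun x => by
      have h0 : 0 ≤ min (max (x r) 0) (m : ℝ) := le_min (le_max_right _ _) (Nat.cast_nonneg m)
      rw [Real.norm_of_nonneg h0]
      exact min_le_right _ _

/-- Weak convergence bounds the integrals of the truncated coordinates by C, and Fatou's lemma
removes the truncation. First moments need not converge. -/
theorem WeakLimit.integrable_lim [l.NeBot] [IsProbabilityMeasure H] (h : WeakLimit l Hn H)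
    (r : Fin K) {C : ℝ} (hC : ∀ᶠ i in l, ∫ x, x r ∂(Hn i) ≤ C) : Integrable (fun x => x r) H := by
  have hbd : ∀ m : ℕ, ∫ x, truncCoord r m x ∂H ≤ C := fun m => by
    refine le_of_tendsto (h.tendsto (truncCoord r m)) ?_
    filter_upwards [hC, h.prob] with i hi hp
    refine le_trans (integral_mono_ae ((truncCoord r m).integrable _) (h.integrable i r) ?_) hi
    filter_upwards [h.nonneg i] with x hx
    change min (max (x r) 0) (m : ℝ) ≤ x r
    rw [max_eq_left (hx r)]
    exact min_le_left _ _
  have hl : ∀ m : ℕ, ∫⁻ x, ENNReal.ofReal (truncCoord r m x) ∂H ≤ ENNReal.ofReal C := fun m => by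
    rw [← ofReal_integral_eq_lintegral_ofReal ((truncCoord r m).integrable _)
      (ae_of_all _ fun x => le_min (le_max_right _ _) (Nat.cast_nonneg m))]
    exact ENNReal.ofReal_le_ofReal (hbd m)
  have hmeas : Measurable fun x : Fin K → ℝ => x r := measurable_pi_apply r
  refine ⟨hmeas.aestronglyMeasurable, ?_⟩
  rw [hasFiniteIntegral_iff_ofReal (by
    filter_upwards [h.nonneg_lim] with x hx
    exact hx r)]
  refine lt_of_le_of_lt ?_ (ENNReal.ofReal_lt_top (r := C))
  have h1 : ∀ x : Fin K → ℝ, ENNReal.ofReal (x r) ≤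
      liminf (fun m : ℕ => ENNReal.ofReal (truncCoord r m x)) atTop := fun x => by
    have ht : Tendsto (fun m : ℕ => ENNReal.ofReal (truncCoord r m x)) atTop
        (𝓝 (ENNReal.ofReal (max (x r) 0))) := by
      refine tendsto_const_nhds.congr' ?_
      obtain ⟨N, hN⟩ := exists_nat_ge (max (x r) 0)
      filter_upwards [eventually_ge_atTop N] with m hm
      have : (N : ℝ) ≤ m := by exact_mod_cast hm
      change _ = ENNReal.ofReal (min (max (x r) 0) (m : ℝ))
      rw [min_eq_left (hN.trans this)]
    rw [ht.liminf_eq]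
    exact ENNReal.ofReal_le_ofReal (le_max_left _ _)
  calc ∫⁻ x, ENNReal.ofReal (x r) ∂H
      ≤ ∫⁻ x, liminf (fun m : ℕ => ENNReal.ofReal (truncCoord r m x)) atTop ∂H := lintegral_mono h1
    _ ≤ liminf (fun m : ℕ => ∫⁻ x, ENNReal.ofReal (truncCoord r m x) ∂H) atTop :=
        lintegral_liminf_le fun m => ((truncCoord r m).continuous.measurable).ennreal_ofReal
    _ ≤ ENNReal.ofReal C := by
        refine (liminf_le_liminf (Eventually.of_forall hl)).trans ?_
        simp

theorem integral_coord_pos (hH : ∀ᵐ x ∂H, ∀ r, 0 ≤ x r) {r : Fin K}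
    (hi : Integrable (fun x => x r) H) (hr : ¬ ∀ᵐ x ∂H, x r = 0) : 0 < ∫ x, x r ∂H := by
  have h0 : 0 ≤ᵐ[H] fun x => x r := by
    filter_upwards [hH] with x hx
    exact hx r
  refine (integral_nonneg_of_ae h0).lt_of_ne' fun h => hr ?_
  exact (integral_eq_zero_iff_of_nonneg_ae h0 hi).1 h

theorem Regime.integrable_left {p : ℕ → ℕ} {S : SpecData K p} {c C : ℝ}
    {H G : Measure (Fin K → ℝ)} [IsProbabilityMeasure H] (hS : Regime S c C H G) (hc : 0 < c)
    (hCp : 0 ≤ C) (r : Fin K) : Integrable (fun x => x r) H := by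
  -- The sums are bounded by C n, while the empirical measure divides by p, and p ≥ (c / 2) n
  -- eventually.
  refine hS.left.integrable_lim r (C := C * (c / 2)⁻¹) ?_
  filter_upwards [hS.left_trace, hS.ratio.eventually_const_lt (half_lt_self hc),
    eventually_gt_atTop 0] with n hn hr hpos
  have hn' : (0 : ℝ) < n := by exact_mod_cast hpos
  rw [lt_div_iff₀ hn'] at hr
  have hp0 : (0 : ℝ) < p n := lt_of_le_of_lt (by positivity) hr
  rw [integral_empirical, Fintype.card_fin, smul_eq_mul, inv_mul_le_iff₀ hp0]
  refine (hn r).trans ?_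
  rw [mul_left_comm]
  refine mul_le_mul_of_nonneg_left ?_ hCp
  rw [← div_eq_mul_inv, le_div_iff₀ (by positivity)]
  linarith

theorem Regime.integrable_right {p : ℕ → ℕ} {S : SpecData K p} {c C : ℝ}
    {H G : Measure (Fin K → ℝ)} [IsProbabilityMeasure G] (hS : Regime S c C H G) (r : Fin K) :
    Integrable (fun x => x r) G := by
  refine hS.right.integrable_lim r (C := C) ?_
  filter_upwards [hS.right_trace, eventually_gt_atTop 0] with n hn hpos
  have hn' : (0 : ℝ) < n := by exact_mod_cast hpos
  rw [integral_empirical, Fintype.card_fin, smul_eq_mul, inv_mul_le_iff₀ hn', mul_comm]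
  exact hn r

end FirstMoments

section Solution

variable {K : ℕ} {H G : Measure (Fin K → ℝ)}

/-- A solution of the system, with the measure whose Stieltjes transform it defines. -/
structure IsLimitLaw (c : ℝ) (H G : Measure (Fin K → ℝ)) (h : ℂ → Fin K → ℂ) (ρ : Measure ℝ) :
    Prop where
  isStieltjes : ∀ r, IsStieltjesOf (Set.Ici 0) fun z => h z r
  solves : SolvesSystem c H G h
  finite : IsFiniteMeasure ρ
  nonneg : ρ (Set.Ici 0)ᶜ = 0
  eq : ∀ z : ℂ, 0 < z.im → stieltjes ρ z =
    ∫ x : Fin K → ℝ, 1 / (-z * (1 + ∑ s, (x s : ℂ) *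
      opO z (fun t => (c : ℂ) * h z t) G s)) ∂H

theorem IsStieltjesOf.mono {E E' : Set ℝ} (hE : E ⊆ E') {s : ℂ → ℂ} (h : IsStieltjesOf E s) :
    IsStieltjesOf E' s := by
  obtain ⟨μ, hμ, h0, hs⟩ := h
  exact ⟨μ, hμ, measure_mono_null (Set.compl_subset_compl.2 hE) h0, hs⟩

theorem IsLimitLaw.stieltjes_sq_unique {c : ℝ} (hc : 0 < c)
    {h h' : ℂ → Fin K → ℂ}
    {ρ ρ' : Measure ℝ} (hL : IsLimitLaw c H G h ρ) (hL' : IsLimitLaw c H G h' ρ')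
    (hH : ∀ᵐ x ∂H, ∀ r, 0 ≤ x r) (hG : ∀ᵐ x ∂G, ∀ r, 0 ≤ x r)
    (hHint : ∀ r, Integrable (fun x => x r) H)
    (hGint : ∀ r, Integrable (fun x => x r) G) (hGpos : ∀ r, 0 < ∫ x, x r ∂G) {w : ℂ}
    (hw : 0 < w.im) : stieltjes ρ (w ^ 2) = stieltjes ρ' (w ^ 2) := by
  have := hL.finite
  have := hL'.finite
  refine stieltjes_sq_eq hL.nonneg hL'.nonneg (fun z hz => ?_) hw
  rw [hL.eq z hz, hL'.eq z hz, eq_of_solves hc hH hG hHint hGint hGpos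
    (fun r => (hL.isStieltjes r).mono (Set.subset_univ _))
    (fun r => (hL'.isStieltjes r).mono (Set.subset_univ _)) hL.solves hL'.solves hz]

variable [IsProbabilityMeasure H]

/-- The mass of ρ is the limit of y s(iy) / i. In the defining integral the denominators tend to 1,
so this limit is the mass of H and nothing escapes to infinity. -/
theorem IsLimitLaw.isProbabilityMeasure {c : ℝ} (hc : 0 < c) {h : ℂ → Fin K → ℂ} {ρ : Measure ℝ}
    (hL : IsLimitLaw c H G h ρ) (hH : ∀ᵐ x ∂H, ∀ r, 0 ≤ x r) (hG : ∀ᵐ x ∂G, ∀ r, 0 ≤ x r)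
    (hGint : ∀ r, Integrable (fun x => x r) G) (hGpos : ∀ r, 0 < ∫ x, x r ∂G) :
    IsProbabilityMeasure ρ := by
  have := hL.finite
  have hq := asympPos_of_solves (fun r => (hL.isStieltjes r).mono (Set.subset_univ _)) hL.solves
  have hO := (hq.const_mul hc).opO hG hGint hGpos
  obtain ⟨k, hk, hlow⟩ := hO.le_norm
  set O : ℝ → Fin K → ℂ := fun y =>
    opO (Complex.I * y) (fun r => (c : ℂ) * h (Complex.I * y) r) G with hOdef
  have h1 : Tendsto (fun y : ℝ => ∫ x, Complex.I / (1 + ∑ s, (x s : ℂ) * O y s) ∂H) atTop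
      (𝓝 (∫ _, Complex.I ∂H)) := by
    refine tendsto_integral_filter_of_dominated_convergence (fun _ => 2) ?_ ?_
      (integrable_const _) ?_
    · refine Eventually.of_forall fun y => Measurable.aestronglyMeasurable ?_
      fun_prop
    · filter_upwards [hlow] with y hy
      filter_upwards [hH] with x hx
      have h2 := (hy.2 x hx).1
      rw [norm_div, Complex.norm_I, div_le_iff₀ (by linarith)]
      linarith
    · refine ae_of_all _ fun x => ?_
      have := (hO.tendsto_sum x).inv₀ one_ne_zero |>.const_mul Complex.I
      simpa [div_eq_mul_inv] using this
  have h2 := tendsto_mul_stieltjes ρ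
  have h3 : Tendsto (fun y : ℝ => (y : ℂ) * stieltjes ρ (Complex.I * y)) atTop
      (𝓝 (∫ _, Complex.I ∂H)) := by
    refine h1.congr' ?_
    filter_upwards [eventually_gt_atTop 0] with y hy
    rw [hL.eq _ (by simpa using hy), ← integral_const_mul]
    refine integral_congr_ae (ae_of_all _ fun x => ?_)
    have hy' : (y : ℂ) ≠ 0 := by exact_mod_cast hy.ne'
    have e : (y : ℂ) * (-(Complex.I * y))⁻¹ = Complex.I := by
      rw [mul_inv_eq_iff_eq_mul₀ (neg_ne_zero.2 (mul_ne_zero Complex.I_ne_zero hy')),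
        mul_neg, ← mul_assoc, Complex.I_mul_I]
      ring
    simp only [hOdef]
    rw [one_div, mul_inv, ← mul_assoc, e, div_eq_mul_inv]
  have h4 := tendsto_nhds_unique h2 h3
  rw [integral_const, probReal_univ (μ := H), one_smul] at h4
  have h5 : ((ρ.real Set.univ : ℝ) : ℂ) = 1 :=
    mul_left_cancel₀ Complex.I_ne_zero (by rw [h4, mul_one])
  have h6 : ρ.real Set.univ = 1 := by exact_mod_cast h5
  refine ⟨?_⟩
  rw [← ENNReal.toReal_eq_one_iff]
  exact h6

variable {Ω : Type*} [MeasurableSpace Ω] {P : Measure Ω} [IsProbabilityMeasure P]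
  {p : ℕ → ℕ} {S : SpecData K p}
  {ζ : ∀ n, Fin K × Fin (p n) × Fin n → Ω → ℂ} {m₃ : ℝ} {τ : ℕ → ℝ} {c C : ℝ}
  [IsProbabilityMeasure G]

/-- Every ultrafilter yields some solution, and by uniqueness all solutions define the same law.
Convergence along all ultrafilters is convergence. -/
theorem tendsto_integral_rt_one (hζ : Innovations P m₃ ζ) (hm₃ : 0 ≤ m₃)
    (hτ : SlowBound S τ) (hS : Regime S c C H G) (hc : 0 < c) (hCp : 0 ≤ C)
    (hHr : ∀ r, ¬ ∀ᵐ x ∂H, x r = 0) (hGr : ∀ r, ¬ ∀ᵐ x ∂G, x r = 0)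
    {h : ℂ → Fin K → ℂ} {ρ : Measure ℝ} (hL : IsLimitLaw c H G h ρ) {w : ℂ} (hw : 0 < w.im) :
    Tendsto (fun n => ∫ ω, S.rt n w (Sum.elim 1 0) (fun q => ζ n q ω) ∂P) atTop
      (𝓝 (c * (w * stieltjes ρ (w ^ 2)))) := by
  rw [tendsto_iff_ultrafilter]
  intro 𝒰 h𝒰
  obtain ⟨h', ρ', h1, h2, h3, h4, h5, h6⟩ :=
    exists_solution_of_ultrafilter hζ hm₃ hτ hS hc hCp hHr hGr 𝒰 h𝒰
  have hGint := hS.integrable_right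
  rw [hL.stieltjes_sq_unique hc ⟨h1, h2, h3, h4, h5⟩ hS.left.nonneg_lim hS.right.nonneg_lim
    (hS.integrable_left hc hCp) hGint
    (fun r => integral_coord_pos hS.right.nonneg_lim (hGint r) (hGr r)) hw]
  exact h6 w hw

end Solution

end SumSeparable
end

/-! ### Truncation of the joint eigenvalues -/

noncomputable section

namespace SumSeparable

open scoped Matrix.Norms.L2Operator

section Truncation

variable {K : ℕ} {p : ℕ → ℕ}

/-- The truncation of a vector: it is replaced by zero if one coordinate exceeds `t`. -/
def truncVec (t : ℝ) (x : Fin K → ℝ) : Fin K → ℝ := if ∀ s, x s ≤ t then x else 0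

theorem truncVec_nonneg (t : ℝ) {x : Fin K → ℝ} (hx : ∀ s, 0 ≤ x s) (r : Fin K) :
    0 ≤ truncVec t x r := by
  unfold truncVec
  split_ifs
  · exact hx r
  · exact le_rfl

theorem truncVec_le {t : ℝ} (ht : 0 ≤ t) (x : Fin K → ℝ) (r : Fin K) : truncVec t x r ≤ t := by
  unfold truncVec
  split_ifs with h
  · exact h r
  · exact ht

theorem truncVec_le_self (t : ℝ) {x : Fin K → ℝ} (hx : ∀ s, 0 ≤ x s) (r : Fin K) :
    truncVec t x r ≤ x r := by
  unfold truncVec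
  split_ifs
  · exact le_rfl
  · exact hx r

/-- The number of vectors that the truncation changes. -/
def numBad {m : ℕ} (t : ℝ) (x : Fin m → Fin K → ℝ) : ℕ :=
  (Finset.univ.filter fun j => truncVec t (x j) ≠ x j).card

/-- Markov's inequality: a vector that is changed has a coordinate above t. -/
theorem numBad_mul_le {m : ℕ} (t : ℝ) {x : Fin m → Fin K → ℝ}
    (hx : ∀ j s, 0 ≤ x j s) : numBad t x * t ≤ ∑ r, ∑ j, x j r := by
  rw [Finset.sum_comm, numBad, ← nsmul_eq_mul]
  refine (Finset.card_nsmul_le_sum (Finset.univ.filter fun j => truncVec t (x j) ≠ x j)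
    (fun j => ∑ r, x j r) t fun j hj => ?_).trans
    (Finset.sum_le_sum_of_subset_of_nonneg (Finset.filter_subset _ _)
      fun j _ _ => Finset.sum_nonneg fun r _ => hx j r)
  have h1 := (Finset.mem_filter.1 hj).2
  have h2 : ¬ ∀ s, x j s ≤ t := fun h => h1 (if_pos h)
  push Not at h2
  obtain ⟨s, hs⟩ := h2
  exact hs.le.trans (Finset.single_le_sum (fun r _ => hx j r) (Finset.mem_univ s))

/-- The truncated spectral data. -/
def SpecData.trunc (S : SpecData K p) (τ : ℕ → ℝ) : SpecData K p where
  U := S.U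
  V := S.V
  lam n j := truncVec (τ n) (S.lam n j)
  mu n j := truncVec (τ n) (S.mu n j)
  hU := S.hU
  hV := S.hV
  lam_nonneg n j := truncVec_nonneg _ (S.lam_nonneg n j)
  mu_nonneg n j := truncVec_nonneg _ (S.mu_nonneg n j)

theorem rank_sqrtFactor_sub_le {m : ℕ} (U : Matrix (Fin m) (Fin m) ℂ) (x : Fin m → Fin K → ℝ)
    (t : ℝ) (r : Fin K) :
    (sqrtFactor U x r - sqrtFactor U (fun j => truncVec t (x j)) r).rank ≤ numBad t x := by
  have e : sqrtFactor U x r - sqrtFactor U (fun j => truncVec t (x j)) r =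
      conjDiag U ((fun j => (√(x j r) : ℂ)) + (-1 : ℂ) • fun j => (√(truncVec t (x j) r) : ℂ)) := by
    rw [conjDiag_add, conjDiag_smul, neg_one_smul, ← sub_eq_add_neg]
    rfl
  rw [e]
  refine (rank_conjDiag_le _ _).trans (Finset.card_le_card fun j hj => ?_)
  rw [Finset.mem_filter] at hj ⊢
  refine ⟨hj.1, fun h => hj.2 ?_⟩
  simp [h]

theorem rank_smul_le {ι κ : Type*} [Fintype ι] [Fintype κ] [DecidableEq κ] (c : ℂ)
    (X : Matrix ι κ ℂ) : (c • X).rank ≤ X.rank := by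
  have : c • X = X * (c • (1 : Matrix κ κ ℂ)) := by rw [Matrix.mul_smul, Matrix.mul_one]
  rw [this]
  exact Matrix.rank_mul_le_left _ _

/-- Changing the two square roots one after the other in each of the K summands costs rank at most
the number of changed vectors, whatever the innovations are. Hermitization doubles the rank. -/
theorem rank_hermModel_sub_le {p n : ℕ} (U : Matrix (Fin p) (Fin p) ℂ)
    (V : Matrix (Fin n) (Fin n) ℂ) (lam : Fin p → Fin K → ℝ) (mu : Fin n → Fin K → ℝ) (t : ℝ)
    (x : Fin K × Fin p × Fin n → ℂ) :
    (hermModel U V lam mu x -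
      hermModel U V (fun j => truncVec t (lam j)) (fun j => truncVec t (mu j)) x).rank ≤
      2 * (K * (numBad t lam + numBad t mu)) := by
  set Z : Fin K → Matrix (Fin p) (Fin n) ℂ := fun r => Matrix.of fun i j => x (r, i, j) with hZ
  have e : ∀ (lam : Fin p → Fin K → ℝ) (mu : Fin n → Fin K → ℝ), hermModel U V lam mu x =
      Matrix.fromBlocks 0 ((√n : ℂ)⁻¹ • ∑ r, sqrtFactor U lam r * Z r * (sqrtFactor V mu r)ᴴ)
        ((√n : ℂ)⁻¹ • ∑ r, sqrtFactor U lam r * Z r * (sqrtFactor V mu r)ᴴ)ᴴ 0 := fun lam mu =>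
    sepModel_cols (sqrtFactor U lam) (sqrtFactor V mu) Z
  have e2 : ∀ Y Y' : Matrix (Fin p) (Fin n) ℂ, Matrix.fromBlocks 0 Y Yᴴ 0 -
      Matrix.fromBlocks 0 Y' Y'ᴴ 0 = Matrix.fromBlocks 0 (Y - Y') (Y - Y')ᴴ 0 := fun Y Y' => by
    rw [sub_eq_add_neg, Matrix.fromBlocks_neg, Matrix.fromBlocks_add, Matrix.conjTranspose_sub]
    simp [sub_eq_add_neg]
  rw [e, e, e2]
  refine (rank_fromBlocks_off_le _).trans (Nat.mul_le_mul_left 2 ?_)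
  rw [← smul_sub, ← Finset.sum_sub_distrib]
  refine (rank_smul_le _ _).trans ((rank_sum_le _ _).trans ?_)
  have h1 : ∀ r, (sqrtFactor U lam r * Z r * (sqrtFactor V mu r)ᴴ -
      sqrtFactor U (fun j => truncVec t (lam j)) r * Z r *
        (sqrtFactor V (fun j => truncVec t (mu j)) r)ᴴ).rank ≤ numBad t lam + numBad t mu := by
    intro r
    have e3 : sqrtFactor U lam r * Z r * (sqrtFactor V mu r)ᴴ -
      sqrtFactor U (fun j => truncVec t (lam j)) r * Z r *
        (sqrtFactor V (fun j => truncVec t (mu j)) r)ᴴ =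
      (sqrtFactor U lam r - sqrtFactor U (fun j => truncVec t (lam j)) r) *
        (Z r * (sqrtFactor V mu r)ᴴ) +
      sqrtFactor U (fun j => truncVec t (lam j)) r * Z r *
        (sqrtFactor V mu r - sqrtFactor V (fun j => truncVec t (mu j)) r)ᴴ := by
      simp only [Matrix.conjTranspose_sub, Matrix.sub_mul, Matrix.mul_sub, Matrix.mul_assoc]
      abel
    rw [e3]
    refine (rank_add_le _ _).trans (add_le_add ?_ ?_)
    · exact (Matrix.rank_mul_le_left _ _).trans (rank_sqrtFactor_sub_le U lam t r)
    · refine (Matrix.rank_mul_le_right _ _).trans ?_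
      rw [Matrix.rank_conjTranspose]
      exact rank_sqrtFactor_sub_le V mu t r
  refine (Finset.sum_le_sum fun r _ => h1 r).trans ?_
  simp

variable {S : SpecData K p} {c C : ℝ} {H G : Measure (Fin K → ℝ)} {τ : ℕ → ℝ}

theorem tendsto_numBad_div {m : ℕ → ℕ} {x : ∀ n, Fin (m n) → Fin K → ℝ}
    (hx : ∀ n j s, 0 ≤ x n j s) (hC : ∀ᶠ n : ℕ in atTop, ∀ r, ∑ j, x n j r ≤ C * n)
    (hτ : Tendsto τ atTop atTop) :
    Tendsto (fun n : ℕ => (numBad (τ n) (x n) : ℝ) / n) atTop (𝓝 0) := by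
  have h0 : Tendsto (fun n => K * C / τ n) atTop (𝓝 0) := tendsto_const_nhds.div_atTop hτ
  refine tendsto_of_tendsto_of_tendsto_of_le_of_le' tendsto_const_nhds h0
    (Eventually.of_forall fun n => by positivity) ?_
  filter_upwards [hC, hτ.eventually_gt_atTop 0, eventually_gt_atTop 0] with n hn hτn hpos
  have hn' : (0 : ℝ) < n := by exact_mod_cast hpos
  rw [div_le_div_iff₀ hn' hτn]
  refine (numBad_mul_le (τ n) (hx n)).trans ((Finset.sum_le_sum fun r _ => hn r).trans ?_)
  simp [mul_assoc]

theorem abs_integral_empirical_trunc_sub_le {m : ℕ} (t : ℝ) (x : Fin m → Fin K → ℝ)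
    (f : BoundedContinuousFunction (Fin K → ℝ) ℝ) :
    |∫ y, f y ∂(empirical (fun j => truncVec t (x j)) : Measure (Fin K → ℝ)) -
      ∫ y, f y ∂(empirical x : Measure (Fin K → ℝ))| ≤ 2 * ‖f‖ * (numBad t x / m) := by
  rw [integral_empirical, integral_empirical, ← smul_sub, ← Finset.sum_sub_distrib,
    Fintype.card_fin, smul_eq_mul, abs_mul, abs_of_nonneg (by positivity : (0 : ℝ) ≤ (m : ℝ)⁻¹)]
  have h1 : |∑ j, (f (truncVec t (x j)) - f (x j))| ≤ numBad t x * (2 * ‖f‖) := by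
    refine (Finset.abs_sum_le_sum_abs _ _).trans ?_
    rw [numBad, ← nsmul_eq_mul, ← Finset.sum_const,
      ← Finset.sum_filter_add_sum_filter_not _ fun j => truncVec t (x j) ≠ x j]
    have h2 : ∑ j with ¬ truncVec t (x j) ≠ x j, |f (truncVec t (x j)) - f (x j)| = 0 := by
      refine Finset.sum_eq_zero fun j hj => ?_
      have := (Finset.mem_filter.1 hj).2
      rw [not_not] at this
      rw [this, sub_self, abs_zero]
    rw [h2, add_zero]
    refine Finset.sum_le_sum fun j _ => ?_
    exact (abs_sub _ _).trans (by
      have h3 := f.norm_coe_le_norm (truncVec t (x j))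
      have h4 := f.norm_coe_le_norm (x j)
      rw [Real.norm_eq_abs] at h3 h4
      linarith)
  calc _ ≤ (m : ℝ)⁻¹ * (numBad t x * (2 * ‖f‖)) := by gcongr
    _ = _ := by ring

theorem WeakLimit.trunc {m : ℕ → ℕ} {x : ∀ n, Fin (m n) → Fin K → ℝ}
    (hx : ∀ n j s, 0 ≤ x n j s)
    (h : WeakLimit atTop (fun n => (empirical (x n) : Measure (Fin K → ℝ))) H)
    (hm : ∀ᶠ n in atTop, 0 < m n)
    (hb : Tendsto (fun n : ℕ => (numBad (τ n) (x n) : ℝ) / m n) atTop (𝓝 0)) :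
    WeakLimit atTop
      (fun n => (empirical (fun j => truncVec (τ n) (x n j)) : Measure (Fin K → ℝ))) H where
  prob := by
    filter_upwards [hm] with n hn
    have : Nonempty (Fin (m n)) := ⟨⟨0, hn⟩⟩
    exact isProbabilityMeasure_empirical _
  nonneg n := ae_empirical _ fun j => truncVec_nonneg _ (hx n j)
  integrable n r := integrable_empirical _ _
  nonneg_lim := h.nonneg_lim
  tendsto f := by
    have h1 : Tendsto (fun n =>
        ∫ y, f y ∂(empirical (fun j => truncVec (τ n) (x n j)) : Measure (Fin K → ℝ)) -
        ∫ y, f y ∂(empirical (x n) : Measure (Fin K → ℝ))) atTop (𝓝 0) := by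
      refine squeeze_zero_norm (fun n => abs_integral_empirical_trunc_sub_le (τ n) (x n) f) ?_
      simpa using hb.const_mul (2 * ‖f‖)
    have h2 := h1.add (h.tendsto f)
    rw [zero_add] at h2
    exact h2.congr fun n => by ring

/-- Only o(n) vectors change, so the weak limits persist, and truncation can only decrease the
traces. -/
theorem Regime.trunc (hS : Regime S c C H G) (hc : 0 < c) (hτ : Tendsto τ atTop atTop) :
    Regime (S.trunc τ) c C H G where
  ratio := hS.ratio
  left := by
    have hp : ∀ᶠ n in atTop, 0 < p n := by
      filter_upwards [hS.ratio.eventually_const_lt hc] with n hn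
      by_contra h
      simp [Nat.eq_zero_of_not_pos h] at hn
    refine hS.left.trunc S.lam_nonneg hp ?_
    have h1 := (tendsto_numBad_div S.lam_nonneg hS.left_trace hτ).div hS.ratio hc.ne'
    rw [zero_div] at h1
    refine h1.congr' ?_
    filter_upwards [eventually_gt_atTop 0] with n hn
    have hn' : (n : ℝ) ≠ 0 := by exact_mod_cast hn.ne'
    simp only [Pi.div_apply]
    rw [div_div_div_cancel_right₀ hn']
  right := hS.right.trunc S.mu_nonneg (eventually_gt_atTop 0)
    (tendsto_numBad_div S.mu_nonneg hS.right_trace hτ)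
  left_trace := by
    filter_upwards [hS.left_trace] with n hn r
    exact (Finset.sum_le_sum fun j _ => truncVec_le_self _ (S.lam_nonneg n j) r).trans (hn r)
  right_trace := by
    filter_upwards [hS.right_trace] with n hn r
    exact (Finset.sum_le_sum fun j _ => truncVec_le_self _ (S.mu_nonneg n j) r).trans (hn r)

/-- A perturbation of rank o(n) moves the normalized trace by o(1). This is deterministic and holds
for every array x. -/
theorem tendsto_rt_sub_trunc (hS : Regime S c C H G) (hτ : Tendsto τ atTop atTop) {w : ℂ}
    (hw : 0 < w.im) (x : ∀ n, Fin K × Fin (p n) × Fin n → ℂ) :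
    Tendsto (fun n => S.rt n w (Sum.elim 1 0) (x n) - (S.trunc τ).rt n w (Sum.elim 1 0) (x n))
      atTop (𝓝 0) := by
  refine squeeze_zero_norm (a := fun n => 4 * K * (w.im)⁻¹ *
    ((numBad (τ n) (S.lam n) : ℝ) / n + (numBad (τ n) (S.mu n) : ℝ) / n)) (fun n => ?_) ?_
  · rw [SpecData.rt, SpecData.rt, resolvTrace, resolvTrace, ← mul_sub, norm_mul, norm_inv,
      Complex.norm_natCast]
    set M := conjDiag (Matrix.fromBlocks (S.U n) 0 0 (S.V n)) (Sum.elim 1 0)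
    have hM : ‖M‖ ≤ 1 := by
      refine norm_conjDiag_le (fromBlocks_mem_unitaryGroup (S.hU n) (S.hV n)) zero_le_one ?_
      rintro (j | j) <;> simp
    have h1 := norm_trace_mul_resolv_sub_le
      (hermModel_isHermitian (S.U n) (S.V n) (fun j => truncVec (τ n) (S.lam n j))
        (fun j => truncVec (τ n) (S.mu n j)) (x n))
      (hermModel_isHermitian (S.U n) (S.V n) (S.lam n) (S.mu n) (x n)) hw M
    rw [norm_sub_rev] at h1
    have h2 : ((hermModel (S.U n) (S.V n) (S.lam n) (S.mu n) (x n) -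
        hermModel (S.U n) (S.V n) (fun j => truncVec (τ n) (S.lam n j))
        (fun j => truncVec (τ n) (S.mu n j)) (x n)).rank : ℝ) ≤
        2 * (K * (numBad (τ n) (S.lam n) + numBad (τ n) (S.mu n))) := by
      exact_mod_cast rank_hermModel_sub_le (S.U n) (S.V n) (S.lam n) (S.mu n) (τ n) (x n)
    have hB : 0 < (w.im)⁻¹ := inv_pos.2 hw
    calc _ ≤ (n : ℝ)⁻¹ * (2 * (K * (numBad (τ n) (S.lam n) + numBad (τ n) (S.mu n))) *
          (1 * (2 * (w.im)⁻¹))) := by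
          refine mul_le_mul_of_nonneg_left (h1.trans ?_) (by positivity)
          gcongr
      _ = _ := by ring
  · have h1 := (tendsto_numBad_div S.lam_nonneg hS.left_trace hτ).add
      (tendsto_numBad_div S.mu_nonneg hS.right_trace hτ)
    simpa using h1.const_mul (4 * K * (w.im)⁻¹)

/-- The truncation level `n^{1/16}`. -/
def level (n : ℕ) : ℝ := max 1 ((n : ℝ) ^ (1 / 16 : ℝ))

theorem tendsto_level : Tendsto level atTop atTop :=
  tendsto_atTop_mono (fun _ => le_max_right _ _)
    ((tendsto_rpow_atTop (by norm_num)).comp tendsto_natCast_atTop_atTop)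

theorem level_pow_four {n : ℕ} (hn : 0 < n) : level n ^ 4 = (n : ℝ) ^ (1 / 4 : ℝ) := by
  have h1 : (1 : ℝ) ≤ n := by exact_mod_cast hn
  rw [level, max_eq_right (Real.one_le_rpow h1 (by norm_num)), ← Real.rpow_natCast,
    ← Real.rpow_mul (Nat.cast_nonneg n)]
  norm_num

/-- τ⁴ = n^{1/4} gives τ⁴ / √n = n^{-1/4} → 0 and τ⁴ / n² = n^{-7/4}, which is summable. -/
theorem slowBound_trunc (S : SpecData K p) : SlowBound (S.trunc level) level where
  one_le n := le_max_left _ _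
  lam_le n j r := truncVec_le (zero_le_one.trans (le_max_left _ _)) _ r
  mu_le n j r := truncVec_le (zero_le_one.trans (le_max_left _ _)) _ r
  tendsto := by
    have h : Tendsto (fun n : ℕ => (n : ℝ) ^ (-(1 / 4) : ℝ)) atTop (𝓝 0) :=
      (tendsto_rpow_neg_atTop (by norm_num)).comp tendsto_natCast_atTop_atTop
    refine h.congr' ?_
    filter_upwards [eventually_gt_atTop 0] with n hn
    have hn' : (0 : ℝ) < n := by exact_mod_cast hn
    rw [level_pow_four hn, Real.sqrt_eq_rpow, ← Real.rpow_sub hn']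
    norm_num
  summable := by
    have h : Summable fun n : ℕ => (n : ℝ) ^ (-(7 / 4) : ℝ) :=
      Real.summable_nat_rpow.2 (by norm_num)
    refine h.congr fun n => ?_
    rcases Nat.eq_zero_or_pos n with rfl | hn
    · simp
    have hn' : (0 : ℝ) < n := by exact_mod_cast hn
    rw [level_pow_four hn, ← Real.rpow_natCast, ← Real.rpow_sub hn']
    norm_num

variable {Ω : Type*} [MeasurableSpace Ω] {P : Measure Ω} [IsProbabilityMeasure P]
  {ζ : ∀ n, Fin K × Fin (p n) × Fin n → Ω → ℂ} {m₃ : ℝ}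
  [IsProbabilityMeasure H] [IsProbabilityMeasure G]

/-- Existence of a solution. -/
theorem Regime.exists_isLimitLaw (hζ : Innovations P m₃ ζ) (hm₃ : 0 ≤ m₃)
    (hS : Regime S c C H G) (hc : 0 < c) (hCp : 0 ≤ C)
    (hHr : ∀ r, ¬ ∀ᵐ x ∂H, x r = 0) (hGr : ∀ r, ¬ ∀ᵐ x ∂G, x r = 0) :
    ∃ h ρ, IsLimitLaw c H G h ρ := by
  -- Existence comes from the random model itself: any ultrafilter finer than `atTop` produces a
  -- solution.
  obtain ⟨h, ρ, h1, h2, h3, h4, h5, -⟩ := exists_solution_of_ultrafilter hζ hm₃ (slowBound_trunc S)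
    (hS.trunc hc tendsto_level) hc hCp hHr hGr (Ultrafilter.of atTop) (Ultrafilter.of_le atTop)
  exact ⟨h, ρ, h1, h2, h3, h4, h5⟩

/-- Almost sure convergence of the normalized trace of the resolvent. -/
theorem Regime.ae_tendsto_rt (hζ : Innovations P m₃ ζ) (hm₃ : 0 ≤ m₃)
    (hS : Regime S c C H G) (hc : 0 < c) (hCp : 0 ≤ C)
    (hHr : ∀ r, ¬ ∀ᵐ x ∂H, x r = 0) (hGr : ∀ r, ¬ ∀ᵐ x ∂G, x r = 0)
    {h : ℂ → Fin K → ℂ} {ρ : Measure ℝ} (hL : IsLimitLaw c H G h ρ) {w : ℂ} (hw : 0 < w.im) :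
    ∀ᵐ ω ∂P, Tendsto (fun n => S.rt n w (Sum.elim 1 0) (fun q => ζ n q ω)) atTop
      (𝓝 (c * (w * stieltjes ρ (w ^ 2)))) := by
  have hτ := slowBound_trunc S
  have h1 := tendsto_integral_rt_one hζ hm₃ hτ (hS.trunc hc tendsto_level) hc hCp hHr hGr hL hw
  filter_upwards [ae_tendsto_rt_sub_integral hζ hτ hw (d := fun n => Sum.elim 1 0) fun n i => by
    rcases i with j | j
    · simpa using hτ.one_le n
    · simpa using zero_le_one.trans (hτ.one_le n)] with ω hω
  have h2 := ((tendsto_rt_sub_trunc hS tendsto_level hw fun n q => ζ n q ω).add hω).add h1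
  rw [add_zero, zero_add] at h2
  refine h2.congr fun n => ?_
  ring

end Truncation

end SumSeparable
end

/-! ### Joint diagonalization, measurability and the sample covariance matrix -/

noncomputable section

namespace SumSeparable

section JointSpectrum

open Module.End

open scoped Function in
/-- Commuting symmetric operators have a common orthonormal basis of eigenvectors. -/
theorem exists_orthonormalBasis_of_commute {E : Type*} [NormedAddCommGroup E]
    [InnerProductSpace ℂ E] [FiniteDimensional ℂ E] {m K : ℕ} (hm : Module.finrank ℂ E = m)
    {T : Fin K → E →ₗ[ℂ] E} (hT : ∀ r, (T r).IsSymmetric) (hC : ∀ r s, Commute (T r) (T s)) :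
    ∃ (b : OrthonormalBasis (Fin m) ℂ E) (lam : Fin m → Fin K → ℝ),
      ∀ r j, T r (b j) = (lam j r : ℂ) • b j := by
  classical
  -- Indexing by tuples of actual eigenvalues gives a finite family. Tuples with an entry that is
  -- not an eigenvalue span only the zero subspace.
  let V : (∀ r, Eigenvalues (T r)) → Submodule ℂ E := fun α => ⨅ r, eigenspace (T r) (α r)
  have hinj : Function.Injective fun (α : ∀ r, Eigenvalues (T r)) (r : Fin K) => (α r : ℂ) :=
    fun α β h => funext fun r => Subtype.ext (congrFun h r)
  have hV : OrthogonalFamily ℂ (fun α => V α) fun α => (V α).subtypeₗᵢ :=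
    (LinearMap.IsSymmetric.orthogonalFamily_iInf_eigenspaces hT).comp hinj
  have htop : ⨆ α, V α = ⊤ := by
    rw [eq_top_iff, ← LinearMap.IsSymmetric.iSup_iInf_eq_top_of_commute hT fun r s _ => hC r s]
    refine iSup_le fun χ => ?_
    by_cases h : ∀ r, HasEigenvalue (T r) (χ r)
    · exact le_iSup V fun r => ⟨χ r, h r⟩
    · push Not at h
      obtain ⟨r, hr⟩ := h
      refine (iInf_le _ r).trans ?_
      rw [HasEigenvalue, HasUnifEigenvalue, not_not] at hr
      rw [show eigenspace (T r) (χ r) = ⊥ from hr]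
      exact bot_le
  have hInt : DirectSum.IsInternal V := by
    rw [hV.isInternal_iff, htop, Submodule.top_orthogonal_eq_bot]
  refine ⟨hInt.subordinateOrthonormalBasis hm hV,
    fun j r => (hInt.subordinateOrthonormalBasisIndex hm j hV r : ℂ).re, fun r j => ?_⟩
  have h1 := hInt.subordinateOrthonormalBasis_subordinate hm j hV
  have h2 := mem_eigenspace_iff.1 ((Submodule.mem_iInf _).1 h1 r)
  rw [h2]
  congr 1
  exact (Complex.conj_eq_iff_re.1
    ((hT r).conj_eigenvalue_eq_self (hInt.subordinateOrthonormalBasisIndex hm j hV r).2)).symm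

theorem exists_isJointSpectrum {K m : ℕ} {A : Fin K → Matrix (Fin m) (Fin m) ℂ}
    (hA : ∀ r, (A r).IsHermitian) (hC : ∀ r s, Commute (A r) (A s)) :
    ∃ lam, IsJointSpectrum A lam := by
  obtain ⟨b, lam, h⟩ := exists_orthonormalBasis_of_commute (m := m) (by simp)
    (T := fun r => (Matrix.toEuclideanLin (A r) : EuclideanSpace ℂ (Fin m) →ₗ[ℂ] _))
    (fun r => Matrix.isSymmetric_toEuclideanLin_iff.2 (hA r)) (fun r s => by
      ext v i
      simpa [Matrix.toEuclideanLin, Matrix.mulVec_mulVec] using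
        congrFun (congrArg (fun M => M *ᵥ (v : Fin m → ℂ)) (hC r s).eq) i)
  let U : Matrix (Fin m) (Fin m) ℂ := Matrix.of fun i j => b j i
  have hU : U ∈ Matrix.unitaryGroup (Fin m) ℂ := by
    rw [Matrix.mem_unitaryGroup_iff']
    ext i j
    have := orthonormal_iff_ite.1 b.orthonormal i j
    rw [Matrix.mul_apply, Matrix.one_apply, ← this, PiLp.inner_apply]
    simp [U, Matrix.star_apply, mul_comm]
  refine ⟨lam, U, hU, fun r => ?_⟩
  have h1 : A r * U = U * Matrix.diagonal fun j => (lam j r : ℂ) := by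
    ext i j
    have := congrArg (fun v : EuclideanSpace ℂ (Fin m) => v i) (h r j)
    simpa [Matrix.toEuclideanLin, Matrix.mulVec, dotProduct, U, Matrix.mul_apply, mul_comm,
      Matrix.diagonal_apply] using this
  rw [← h1, Matrix.mul_assoc, show U * Uᴴ = 1 from Matrix.mem_unitaryGroup_iff.1 hU,
    Matrix.mul_one]

/-- The joint spectrum of commuting positive semi-definite matrices. -/
theorem exists_conjDiag_eq {K m : ℕ} {A : Fin K → Matrix (Fin m) (Fin m) ℂ}
    (hA : ∀ r, (A r).PosSemidef) (hC : ∀ r s, Commute (A r) (A s)) :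
    ∃ (U : Matrix (Fin m) (Fin m) ℂ) (lam : Fin m → Fin K → ℝ),
      U ∈ Matrix.unitaryGroup (Fin m) ℂ ∧ (∀ j r, 0 ≤ lam j r) ∧
      (∀ r, A r = conjDiag U fun j => (lam j r : ℂ)) ∧ jointESD A = empirical lam := by
  obtain ⟨lam, h⟩ := exists_isJointSpectrum (fun r => (hA r).isHermitian) hC
  have hE := h.jointESD_eq
  obtain ⟨U, hU, hUA⟩ := h
  refine ⟨U, lam, hU, fun j r => ?_, hUA, hE⟩
  have hU' : Uᴴ * U = 1 := Matrix.mem_unitaryGroup_iff'.1 hU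
  have h1 : Uᴴ * A r * U = Matrix.diagonal fun j => (lam j r : ℂ) := by
    rw [hUA r, Matrix.mul_assoc, Matrix.mul_assoc, Matrix.mul_assoc, hU', Matrix.mul_one,
      ← Matrix.mul_assoc, hU', Matrix.one_mul]
  have h2 := ((hA r).conjTranspose_mul_mul_same U).diag_nonneg (i := j)
  rw [h1, Matrix.diagonal_apply_eq] at h2
  exact_mod_cast h2

theorem cfcSqrt_conjDiag {K m : ℕ} {U : Matrix (Fin m) (Fin m) ℂ}
    (hU : U ∈ Matrix.unitaryGroup (Fin m) ℂ) {lam : Fin m → Fin K → ℝ} (hlam : ∀ j r, 0 ≤ lam j r)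
    (r : Fin K) : CFC.sqrt (conjDiag U fun j => (lam j r : ℂ)) = sqrtFactor U lam r := by
  have hp : (sqrtFactor U lam r).PosSemidef := posSemidef_conjDiag U fun j => Real.sqrt_nonneg _
  refine CFC.sqrt_unique ?_ (Matrix.nonneg_iff_posSemidef.2 hp)
  rw [← sqrtFactor_mul_conjTranspose hU hlam r, hp.isHermitian.eq]

end JointSpectrum

section Measurability

variable {m : ℕ}

theorem measurableSet_posSemidef :
    MeasurableSet {a : Fin m → Fin m → ℂ | (Matrix.of a).PosSemidef} := by
  refine IsClosed.measurableSet ?_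
  simp only [Matrix.posSemidef_iff_dotProduct_mulVec, Matrix.IsHermitian, Set.ofPred_and,
    Set.ofPred_forall]
  have hc : Continuous fun a : Fin m → Fin m → ℂ => Matrix.of a := continuous_id
  refine (isClosed_eq hc.matrix_conjTranspose hc).inter (isClosed_iInter fun x => ?_)
  exact isClosed_le continuous_const
    (continuous_const.dotProduct (hc.matrix_mulVec continuous_const))

/-- The square root of a matrix is a Borel function. -/
theorem measurable_cfcSqrt :
    Measurable fun a : Fin m → Fin m → ℂ => Matrix.of.symm (CFC.sqrt (Matrix.of a)) := by
  let D : Set (Fin m → Fin m → ℂ) := {a | (Matrix.of a).PosSemidef}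
  have hD : MeasurableSet D := measurableSet_posSemidef
  -- Squaring is Borel and injective on the positive semi-definite matrices, so images of Borel sets
  -- are Borel. The preimage of s under the square root is the image of s ∩ D, together with the
  -- complement of D if 0 ∈ s, because the square root is 0 there by convention.
  let f : (Fin m → Fin m → ℂ) → Fin m → Fin m → ℂ := fun a => Matrix.of a * Matrix.of a
  have hf : Measurable f := by
    refine measurable_pi_lambda _ fun i => measurable_pi_lambda _ fun j => ?_
    simp only [f, Matrix.mul_apply, Matrix.of_apply]
    fun_prop
  have hinj : Set.InjOn f D := fun a ha b hb h => by
    have := (CFC.mul_self_eq_mul_self_iff (Matrix.of a) (Matrix.of b)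
      (Matrix.nonneg_iff_posSemidef.2 ha) (Matrix.nonneg_iff_posSemidef.2 hb)).1 h
    exact this
  have h0 : ∀ a ∉ D, (CFC.sqrt (Matrix.of a) : Matrix (Fin m) (Fin m) ℂ) = 0 := fun a ha => by
    rw [CFC.sqrt, cfcₙ_apply_of_not_predicate]
    exact fun h => ha (Matrix.nonneg_iff_posSemidef.1 h)
  intro s hs
  have hfD : ∀ a, a ∈ f '' (s ∩ D) ↔ Matrix.of.symm (CFC.sqrt (Matrix.of a)) ∈ s ∧ a ∈ D := by
    refine fun a => ⟨?_, fun ⟨h1, h2⟩ => ⟨_, ⟨h1, Matrix.nonneg_iff_posSemidef.1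
      (CFC.sqrt_nonneg (Matrix.of a))⟩, CFC.sqrt_mul_sqrt_self (Matrix.of a)
        (Matrix.nonneg_iff_posSemidef.2 h2)⟩⟩
    rintro ⟨b, ⟨hbs, hbD⟩, rfl⟩
    have h1 : CFC.sqrt (Matrix.of (f b)) = Matrix.of b :=
      CFC.sqrt_mul_self (Matrix.of b) (Matrix.nonneg_iff_posSemidef.2 hbD)
    refine ⟨by rw [h1]; exact hbs, ?_⟩
    have h2 : (Matrix.of b * (Matrix.of b)ᴴ).PosSemidef := Matrix.posSemidef_self_mul_conjTranspose _
    rwa [show (Matrix.of b)ᴴ = Matrix.of b from hbD.isHermitian] at h2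
  have hm := (hs.inter hD).image_of_measurable_injOn hf (hinj.mono Set.inter_subset_right)
  by_cases h0s : (0 : Fin m → Fin m → ℂ) ∈ s
  · convert hm.union hD.compl using 1
    ext a
    rw [Set.mem_union, hfD, Set.mem_preimage, Set.mem_compl_iff]
    by_cases ha : a ∈ D
    · simp [ha]
    · rw [h0 a ha]
      simpa [ha] using h0s
  · convert hm using 1
    ext a
    rw [hfD, Set.mem_preimage]
    by_cases ha : a ∈ D
    · simp [ha]
    · rw [h0 a ha]
      simpa [ha] using h0s

theorem measurable_trace_inv :
    Measurable fun a : Fin m → Fin m → ℂ => ((Matrix.of a)⁻¹).trace := by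
  have hc : Continuous fun a : Fin m → Fin m → ℂ => Matrix.of a := continuous_id
  simp only [Matrix.inv_def, Matrix.trace_smul, Ring.inverse_eq_inv', smul_eq_mul]
  exact hc.matrix_det.measurable.inv.mul hc.matrix_adjugate.matrix_trace.measurable

/-- The normalized trace of `(S + s)⁻¹` for the sample covariance matrix `S`. -/
def covTrace {K p n : ℕ} (s : ℝ) (A : Fin K → Matrix (Fin p) (Fin p) ℂ)
    (B : Fin K → Matrix (Fin n) (Fin n) ℂ) (Z : Fin K → Matrix (Fin p) (Fin n) ℂ) : ℂ :=
  (p : ℂ)⁻¹ * ((sampleCov (dataMatrix A B Z) - (-s : ℂ) • (1 : Matrix (Fin p) (Fin p) ℂ))⁻¹).trace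

/-- Written through the matrix itself, the transform is measurable in the scaling matrices and the
innovations, and no measurable choice of eigenvectors or eigenvalues is required. -/
theorem measurable_covTrace {K p n : ℕ} (s : ℝ) {X : Type*} [MeasurableSpace X]
    {A : X → Fin K → Fin p → Fin p → ℂ} {B : X → Fin K → Fin n → Fin n → ℂ}
    {Z : X → Fin K → Fin p → Fin n → ℂ} (hA : Measurable A) (hB : Measurable B)
    (hZ : Measurable Z) : Measurable fun x => covTrace s (A x) (B x) (Z x) := by
  have h1 : ∀ i j, Measurable fun x => dataMatrix (A x) (B x) (Z x) i j := fun i j => by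
    have hA' : ∀ r k, Measurable fun x => CFC.sqrt (Matrix.of (A x r)) i k := fun r k =>
      (measurable_pi_apply k).comp ((measurable_pi_apply i).comp
        (measurable_cfcSqrt.comp ((measurable_pi_apply r).comp hA)) :)
    have hB' : ∀ r k, Measurable fun x => CFC.sqrt (Matrix.of (B x r)) k j := fun r k =>
      (measurable_pi_apply j).comp ((measurable_pi_apply k).comp
        (measurable_cfcSqrt.comp ((measurable_pi_apply r).comp hB)) :)
    have hZ' : ∀ r k l, Measurable fun x => Z x r k l := fun r k l => by fun_prop
    simp only [dataMatrix, Matrix.sum_apply, Matrix.mul_apply]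
    exact Finset.measurable_sum _ fun r _ => Finset.measurable_sum _ fun l _ =>
      (Finset.measurable_sum _ fun k _ => (hA' r k).mul (hZ' r k l)).mul (hB' r l)
  refine (measurable_trace_inv.comp (g := fun a : Fin p → Fin p → ℂ => ((Matrix.of a)⁻¹).trace)
    (f := fun x => (sampleCov (dataMatrix (A x) (B x) (Z x)) -
      (-s : ℂ) • (1 : Matrix (Fin p) (Fin p) ℂ) : Matrix (Fin p) (Fin p) ℂ)) ?_).const_mul _
  refine measurable_pi_lambda _ fun i => measurable_pi_lambda _ fun j => ?_
  simp only [sampleCov, Matrix.sub_apply, Matrix.smul_apply, Matrix.mul_apply,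
    Matrix.conjTranspose_apply, Complex.real_smul]
  refine (Measurable.const_mul ?_ _).sub_const _
  exact Finset.measurable_sum _ fun k _ => (h1 i k).mul (continuous_star.measurable.comp (h1 j k))

end Measurability

section ESD

variable {p n : ℕ}

theorem posSemidef_sampleCov (X : Matrix (Fin p) (Fin n) ℂ) : (sampleCov X).PosSemidef :=
  (Matrix.posSemidef_self_mul_conjTranspose X).smul (by positivity)

theorem esd_compl_Ici (X : Matrix (Fin p) (Fin n) ℂ) :
    (esd (sampleCov_isHermitian X) : Measure ℝ) (Set.Ici 0)ᶜ = 0 :=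
  ae_empirical _ (s := fun x => x ∈ Set.Ici 0) fun i => (posSemidef_sampleCov X).eigenvalues_nonneg i

theorem stieltjes_esd {S : Matrix (Fin p) (Fin p) ℂ} (hS : S.IsHermitian) {z : ℂ}
    (hz : ∀ i, (hS.eigenvalues i : ℂ) ≠ z) :
    stieltjes (esd hS) z = (p : ℂ)⁻¹ * ((S - z • (1 : Matrix (Fin p) (Fin p) ℂ))⁻¹).trace := by
  have h1 : ((S - z • (1 : Matrix (Fin p) (Fin p) ℂ))⁻¹).trace =
      ∑ i, 1 / ((hS.eigenvalues i : ℂ) - z) := by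
    have hU := hS.eigenvectorUnitary.2
    rw [← Matrix.one_mul (S - _)⁻¹]
    conv_lhs => rw [hS.eq_conjDiag]
    rw [trace_mul_inv_sub hU 1 _ hz, Matrix.mul_one]
    refine Finset.sum_congr rfl fun i _ => ?_
    have h2 : (hS.eigenvectorUnitary : Matrix (Fin p) (Fin p) ℂ)ᴴ *
        (hS.eigenvectorUnitary : Matrix (Fin p) (Fin p) ℂ) = 1 := Matrix.mem_unitaryGroup_iff'.1 hU
    rw [h2, Matrix.one_apply_eq]
  rw [h1, stieltjes, esd, integral_empirical, Complex.real_smul, Fintype.card_fin,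
    Complex.ofReal_inv, Complex.ofReal_natCast]

theorem stieltjes_esd_eq_covTrace {K : ℕ} {s : ℝ} (hs : 0 < s)
    (A : Fin K → Matrix (Fin p) (Fin p) ℂ) (B : Fin K → Matrix (Fin n) (Fin n) ℂ)
    (Z : Fin K → Matrix (Fin p) (Fin n) ℂ) :
    stieltjes (esd (sampleCov_isHermitian (dataMatrix A B Z))) (-s) = covTrace s A B Z := by
  rw [stieltjes_esd, covTrace]
  intro i h
  have h1 := (posSemidef_sampleCov (dataMatrix A B Z)).eigenvalues_nonneg i
  have h2 : (posSemidef_sampleCov (dataMatrix A B Z)).isHermitian.eigenvalues i = -s := by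
    exact_mod_cast h
  linarith

theorem SpecData.covTrace_eq_rt {K : ℕ} {p : ℕ → ℕ} (S : SpecData K p) {n : ℕ} {s : ℝ} {w : ℂ}
    (hw : 0 < w.im) (hws : w ^ 2 = -s) {A : Fin K → Matrix (Fin (p n)) (Fin (p n)) ℂ}
    {B : Fin K → Matrix (Fin n) (Fin n) ℂ} (hA : ∀ r, A r = conjDiag (S.U n) fun j => (S.lam n j r : ℂ))
    (hB : ∀ r, B r = conjDiag (S.V n) fun j => (S.mu n j r : ℂ))
    (hn : 0 < n) (Z : Fin K → Matrix (Fin (p n)) (Fin n) ℂ) :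
    covTrace s A B Z = ((p n : ℂ) / n)⁻¹ * (w⁻¹ *
      S.rt n w (Sum.elim 1 0) fun q => Z q.1 q.2.1 q.2.2) := by
  have hw0 : w ≠ 0 := fun h => by simp [h] at hw
  have hn0 : (n : ℂ) ≠ 0 := by exact_mod_cast hn.ne'
  set Y : Matrix (Fin (p n)) (Fin n) ℂ := (√n : ℂ)⁻¹ • ∑ r, sqrtFactor (S.U n) (S.lam n) r *
    Z r * (sqrtFactor (S.V n) (S.mu n) r)ᴴ with hY
  have h1 : S.rt n w (Sum.elim 1 0) (fun q => Z q.1 q.2.1 q.2.2) =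
      (n : ℂ)⁻¹ * (w * ((Y * Yᴴ - w ^ 2 • (1 : Matrix (Fin (p n)) (Fin (p n)) ℂ))⁻¹).trace) := by
    have h2 := trace_mul_resolv_fromBlocks Y 1 hw
    rw [Matrix.one_mul] at h2
    rw [← h2, SpecData.rt, resolvTrace, hermModel, sepModel_cols, ← fromBlocks_conjDiag,
      conjDiag_zero, conjDiag_one (S.hU n)]
  have h3 : sampleCov (dataMatrix A B Z) = Y * Yᴴ := by
    have hX : dataMatrix A B Z = ∑ r, sqrtFactor (S.U n) (S.lam n) r *
        Z r * (sqrtFactor (S.V n) (S.mu n) r)ᴴ := by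
      refine Finset.sum_congr rfl fun r _ => ?_
      rw [hA r, hB r, cfcSqrt_conjDiag (S.hU n) (S.lam_nonneg n),
        cfcSqrt_conjDiag (S.hV n) (S.mu_nonneg n)]
      congr 1
      exact ((posSemidef_conjDiag (S.V n) fun j => Real.sqrt_nonneg (S.mu n j r)).isHermitian).symm
    rw [hY, ← hX, sampleCov, Matrix.conjTranspose_smul, Matrix.smul_mul, Matrix.mul_smul, smul_smul]
    have e : (√n : ℂ)⁻¹ * star (√n : ℂ)⁻¹ = (((n : ℝ)⁻¹ : ℝ) : ℂ) := by
      rw [star_inv₀, Complex.star_def, Complex.conj_ofReal, ← mul_inv, ← Complex.ofReal_mul,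
        Real.mul_self_sqrt (Nat.cast_nonneg n), Complex.ofReal_inv]
    rw [e]
    ext i j
    simp [Matrix.smul_apply]
  rw [h1, covTrace, h3, ← hws]
  field_simp

end ESD

end SumSeparable
end

/-! ### Fixed scaling matrices and conditioning on them -/

noncomputable section

namespace SumSeparable

section FixedScaling

variable {K : ℕ} {p : ℕ → ℕ} {c : ℝ}

theorem eventually_pos_of_ratio (hc : 0 < c)
    (hpn : Tendsto (fun n : ℕ => (p n : ℝ) / (n : ℝ)) atTop (𝓝 c)) :
    ∀ᶠ n in atTop, 0 < n ∧ 0 < p n ∧ (p n : ℝ) ≤ (c + 1) * n := by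
  filter_upwards [hpn.eventually_const_lt hc, hpn.eventually_lt_const (lt_add_one c),
    eventually_gt_atTop 0] with n h1 h2 hn
  have hn' : (0 : ℝ) < n := by exact_mod_cast hn
  refine ⟨hn, ?_, ((div_lt_iff₀ hn').1 h2).le⟩
  rcases Nat.eq_zero_or_pos (p n) with h | h
  · simp [h] at h1
  · exact h

theorem WeakLimit.of_empirical {m : ℕ → ℕ} (hm : ∀ᶠ n in atTop, 0 < m n)
    {x : ∀ n, Fin (m n) → Fin K → ℝ} (hx : ∀ n j r, 0 ≤ x n j r)
    {H : ProbabilityMeasure (Fin K → ℝ)} (hH : ∀ᵐ x ∂(H : Measure (Fin K → ℝ)), ∀ r, 0 ≤ x r)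
    (hlim : Tendsto (fun n => empirical (x n)) atTop (𝓝 H.toFiniteMeasure)) :
    WeakLimit atTop (fun n => (empirical (x n) : Measure (Fin K → ℝ)))
      (H : Measure (Fin K → ℝ)) where
  prob := by
    filter_upwards [hm] with n hn
    have : Nonempty (Fin (m n)) := ⟨⟨0, hn⟩⟩
    exact isProbabilityMeasure_empirical _
  nonneg n := ae_empirical _ fun j => hx n j
  integrable n r := integrable_empirical _ _
  nonneg_lim := hH
  tendsto := FiniteMeasure.tendsto_iff_forall_integral_tendsto.1 hlim

/-- The hypotheses on the scaling matrices, for fixed matrices, in terms of joint eigenvalues. -/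
theorem exists_regime {A : ∀ n, Fin K → Matrix (Fin (p n)) (Fin (p n)) ℂ}
    {B : ∀ n, Fin K → Matrix (Fin n) (Fin n) ℂ} (hc : 0 < c)
    (hpn : Tendsto (fun n : ℕ => (p n : ℝ) / (n : ℝ)) atTop (𝓝 c))
    (hA : ∀ n r, (A n r).PosSemidef) (hB : ∀ n r, (B n r).PosSemidef)
    {H G : ProbabilityMeasure (Fin K → ℝ)}
    (hH : ∀ᵐ x ∂(H : Measure (Fin K → ℝ)), ∀ r, 0 ≤ x r)
    (hG : ∀ᵐ x ∂(G : Measure (Fin K → ℝ)), ∀ r, 0 ≤ x r)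
    (hAl : Tendsto (fun n => jointESD (A n)) atTop (𝓝 H.toFiniteMeasure))
    (hBl : Tendsto (fun n => jointESD (B n)) atTop (𝓝 G.toFiniteMeasure))
    {C₀ : ℝ} (hC₀ : 0 < C₀)
    (htr : limsup (fun n : ℕ => ⨆ r : Fin K,
        max (ENNReal.ofReal ((A n r).trace.re / (p n : ℝ)))
          (ENNReal.ofReal ((B n r).trace.re / (n : ℝ)))) atTop < ENNReal.ofReal C₀)
    (hAc : ∀ n r s, Commute (A n r) (A n s)) (hBc : ∀ n r s, Commute (B n r) (B n s)) :
    ∃ S : SpecData K p, Regime S c (C₀ * (c + 1)) (H : Measure (Fin K → ℝ)) (G : Measure _) ∧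
      (∀ n r, A n r = conjDiag (S.U n) fun j => (S.lam n j r : ℂ)) ∧
      ∀ n r, B n r = conjDiag (S.V n) fun j => (S.mu n j r : ℂ) := by
  choose U lam hU hlam hUA hlamE using fun n => exists_conjDiag_eq (hA n) (hAc n)
  choose V mu hV hmu hVB hmuE using fun n => exists_conjDiag_eq (hB n) (hBc n)
  have hpos := eventually_pos_of_ratio hc hpn
  have htA : ∀ n r, (A n r).trace.re = ∑ j, lam n j r := fun n r => by
    rw [hUA n r, trace_conjDiag (hU n), Complex.re_sum]
    simp
  have htB : ∀ n r, (B n r).trace.re = ∑ j, mu n j r := fun n r => by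
    rw [hVB n r, trace_conjDiag (hV n), Complex.re_sum]
    simp
  -- Both traces are finally compared with n. Since p ≤ (c + 1) n eventually, C₀ (c + 1) serves for
  -- both.
  have hev : ∀ᶠ n : ℕ in atTop, ∀ r, ∑ j, lam n j r ≤ C₀ * p n ∧ ∑ j, mu n j r ≤ C₀ * n := by
    filter_upwards [eventually_lt_of_limsup_lt htr, hpos] with n hn hn' r
    obtain ⟨h1, h2, -⟩ := hn'
    have h3 := (le_iSup (fun r : Fin K => max (ENNReal.ofReal ((A n r).trace.re / (p n : ℝ)))
      (ENNReal.ofReal ((B n r).trace.re / (n : ℝ)))) r).trans_lt hn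
    rw [max_lt_iff, ENNReal.ofReal_lt_ofReal_iff hC₀, ENNReal.ofReal_lt_ofReal_iff hC₀,
      div_lt_iff₀ (by exact_mod_cast h2), div_lt_iff₀ (by exact_mod_cast h1), htA, htB] at h3
    exact ⟨h3.1.le, h3.2.le⟩
  refine ⟨⟨U, V, lam, mu, hU, hV, hlam, hmu⟩, ⟨hpn, ?_, ?_, ?_, ?_⟩, hUA, hVB⟩
  · refine WeakLimit.of_empirical (hpos.mono fun n h => h.2.1) hlam hH ?_
    simpa only [hlamE] using hAl
  · refine WeakLimit.of_empirical (hpos.mono fun n h => h.1) hmu hG ?_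
    simpa only [hmuE] using hBl
  · filter_upwards [hev, hpos] with n h1 h2 r
    refine (h1 r).1.trans ?_
    rw [mul_assoc]
    exact mul_le_mul_of_nonneg_left h2.2.2 hC₀.le
  · filter_upwards [hev] with n h1 r
    refine (h1 r).2.trans ?_
    have hn : (0 : ℝ) ≤ n := Nat.cast_nonneg n
    have : 0 ≤ C₀ * c * n := by positivity
    linarith

variable {Ω : Type*} [MeasurableSpace Ω] {P : Measure Ω} [IsProbabilityMeasure P]

/-- |x|³ ≤ 1 + |x|^{4+η}. The later estimates use the third absolute moment only. -/
theorem integrable_norm_pow_three_of_moment {f : Ω → ℂ} (hf : Measurable f) {η : ℝ} (hη : 0 < η)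
    {M : ℝ≥0} (h : ∫⁻ ω, ‖f ω‖ₑ ^ (4 + η) ∂P ≤ M) :
    Integrable (fun ω => ‖f ω‖ ^ 3) P ∧ ∫ ω, ‖f ω‖ ^ 3 ∂P ≤ 1 + M := by
  have h1 : ∫⁻ ω, ENNReal.ofReal (‖f ω‖ ^ 3) ∂P ≤ ENNReal.ofReal (1 + M) := by
    calc ∫⁻ ω, ENNReal.ofReal (‖f ω‖ ^ 3) ∂P ≤ ∫⁻ ω, (1 + ‖f ω‖ₑ ^ (4 + η)) ∂P := by
          refine lintegral_mono fun ω => ?_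
          rw [ENNReal.ofReal_pow (norm_nonneg _), ofReal_norm, ← ENNReal.rpow_natCast]
          rcases le_total ‖f ω‖ₑ 1 with h | h
          · exact (ENNReal.rpow_le_one h (by norm_num)).trans le_self_add
          · refine (ENNReal.rpow_le_rpow_of_exponent_le h ?_).trans le_add_self
            push_cast
            linarith
      _ = 1 + ∫⁻ ω, ‖f ω‖ₑ ^ (4 + η) ∂P := by
          rw [lintegral_add_left measurable_const, lintegral_const, measure_univ, mul_one]
      _ ≤ 1 + M := by gcongr
      _ = ENNReal.ofReal (1 + M) := by
          rw [ENNReal.ofReal_add zero_le_one M.coe_nonneg, ENNReal.ofReal_one, ENNReal.ofReal_coe_nnreal]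
  have hm : AEStronglyMeasurable (fun ω => ‖f ω‖ ^ 3) P := (hf.norm.pow_const 3).aestronglyMeasurable
  have hi : Integrable (fun ω => ‖f ω‖ ^ 3) P := by
    refine (lintegral_ofReal_ne_top_iff_integrable hm (ae_of_all _ fun ω => by positivity)).1 ?_
    exact ne_top_of_le_ne_top ENNReal.ofReal_ne_top h1
  refine ⟨hi, ?_⟩
  rw [← ofReal_integral_eq_lintegral_ofReal hi (ae_of_all _ fun ω => by positivity)] at h1
  exact (ENNReal.ofReal_le_ofReal_iff (by positivity)).1 h1

variable {Z : (n : ℕ) → Fin K → Ω → Matrix (Fin (p n)) (Fin n) ℂ} {m₃ C : ℝ}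
  {H G : Measure (Fin K → ℝ)} [IsProbabilityMeasure H] [IsProbabilityMeasure G]
  {S : SpecData K p}

/-- Almost sure convergence of the Stieltjes transforms on the negative half-line, for fixed
scaling matrices. -/
theorem Regime.ae_tendsto_covTrace (hS : Regime S c C H G)
    (hζ : Innovations P m₃ fun n (q : Fin K × Fin (p n) × Fin n) ω => Z n q.1 ω q.2.1 q.2.2)
    (hm₃ : 0 ≤ m₃) (hc : 0 < c) (hCp : 0 ≤ C)
    (hHr : ∀ r, ¬ ∀ᵐ x ∂H, x r = 0) (hGr : ∀ r, ¬ ∀ᵐ x ∂G, x r = 0)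
    {h : ℂ → Fin K → ℂ} {ρ : Measure ℝ} (hL : IsLimitLaw c H G h ρ)
    {A : ∀ n, Fin K → Matrix (Fin (p n)) (Fin (p n)) ℂ}
    {B : ∀ n, Fin K → Matrix (Fin n) (Fin n) ℂ}
    (hA : ∀ n r, A n r = conjDiag (S.U n) fun j => (S.lam n j r : ℂ))
    (hB : ∀ n r, B n r = conjDiag (S.V n) fun j => (S.mu n j r : ℂ)) {s : ℝ} (hs : 0 < s) :
    ∀ᵐ ω ∂P, Tendsto (fun n => covTrace s (A n) (B n) fun r => Z n r ω) atTop
      (𝓝 (stieltjes ρ (-s))) := by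
  -- A point of the upper half-plane whose square is the negative number -s.
  set w : ℂ := Complex.I * (√s : ℂ) with hwdef
  have hw : 0 < w.im := by simpa [hwdef] using hs
  have hw0 : w ≠ 0 := fun h => by simp [h] at hw
  have hws : w ^ 2 = -s := by
    rw [hwdef, mul_pow, Complex.I_sq, ← Complex.ofReal_pow, Real.sq_sqrt hs.le, neg_one_mul]
  have hc0 : (c : ℂ) ≠ 0 := by exact_mod_cast hc.ne'
  have hr : Tendsto (fun n : ℕ => ((p n : ℂ) / n)⁻¹) atTop (𝓝 (c : ℂ)⁻¹) := by
    refine Tendsto.inv₀ ?_ hc0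
    refine ((Complex.continuous_ofReal.tendsto c).comp hS.ratio).congr fun n => ?_
    simp
  filter_upwards [hS.ae_tendsto_rt hζ hm₃ hc hCp hHr hGr hL hw] with ω hω
  have h1 := hr.mul (hω.const_mul w⁻¹)
  rw [hws, show (c : ℂ)⁻¹ * (w⁻¹ * (c * (w * stieltjes ρ (-s)))) = stieltjes ρ (-s) by
    field_simp] at h1
  refine h1.congr' ?_
  filter_upwards [eventually_gt_atTop 0] with n hn
  exact (S.covTrace_eq_rt hw hws (hA n) (hB n) hn fun r => Z n r ω).symm

end FixedScaling

section Independence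

variable {Ω X Y : Type*} [MeasurableSpace Ω] [MeasurableSpace X] [MeasurableSpace Y]
  {P : Measure Ω} [IsProbabilityMeasure P]

/-- A property of independent variables holds almost surely if it does for almost every fixed value
of the first one. -/
theorem ae_of_indepFun {f : Ω → X} {g : Ω → Y} (hf : Measurable f) (hg : Measurable g)
    (h : IndepFun f g P) {T : Set (X × Y)} (hT : MeasurableSet T)
    (hae : ∀ᵐ ω ∂P, ∀ᵐ ω' ∂P, (f ω, g ω') ∈ T) : ∀ᵐ ω ∂P, (f ω, g ω) ∈ T := by
  have hmap := (indepFun_iff_map_prod_eq_prod_map_map hf.aemeasurable hg.aemeasurable).1 h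
  have := Measure.isProbabilityMeasure_map (μ := P) hg.aemeasurable
  have h1 : ∀ᵐ z ∂(P.map fun ω => (f ω, g ω)), z ∈ T := by
    rw [hmap, ae_iff]
    change (P.map f).prod (P.map g) Tᶜ = 0
    rw [Measure.measure_prod_null hT.compl]
    have hm := measurable_measure_prodMk_left (ν := P.map g) hT.compl
    refine (ae_map_iff hf.aemeasurable (hm (measurableSet_singleton 0))).2 ?_
    filter_upwards [hae] with ω hω
    change P.map g (Prod.mk (f ω) ⁻¹' Tᶜ) = 0
    rw [Measure.map_apply hg (measurable_prodMk_left hT.compl)]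
    exact hω
  exact ae_of_ae_map (hf.prodMk hg).aemeasurable h1

end Independence

end SumSeparable
end

/-! ### Assembly of the theorem -/

open SumSeparable in
theorem theorem4p1
    {Ω : Type*} [MeasurableSpace Ω] (P : Measure Ω) [IsProbabilityMeasure P]
    (K : ℕ) (p : ℕ → ℕ) (c : ℝ)
    -- the innovation matrices and the (possibly random) scaling matrices
    (Z : (n : ℕ) → Fin K → Ω → Matrix (Fin (p n)) (Fin n) ℂ)
    (A : (n : ℕ) → Fin K → Ω → Matrix (Fin (p n)) (Fin (p n)) ℂ)
    (B : (n : ℕ) → Fin K → Ω → Matrix (Fin n) (Fin n) ℂ)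
    (hZ_meas : ∀ n r i j, Measurable fun ω => Z n r ω i j)
    (hA_meas : ∀ n r i j, Measurable fun ω => A n r ω i j)
    (hB_meas : ∀ n r i j, Measurable fun ω => B n r ω i j)
    -- the scaling matrices are independent of the innovations
    (hAB_indep : IndepFun
      (fun ω => ((fun n r i j => A n r ω i j, fun n r i j => B n r ω i j) :
        ((n : ℕ) → Fin K → Fin (p n) → Fin (p n) → ℂ) × ((n : ℕ) → Fin K → Fin n → Fin n → ℂ)))
      (fun ω => (fun n r i j => Z n r ω i j : (n : ℕ) → Fin K → Fin (p n) → Fin n → ℂ)) P)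
    -- T1
    (hc : 0 < c) (hpn : Tendsto (fun n : ℕ => (p n : ℝ) / (n : ℝ)) atTop (𝓝 c))
    -- T2
    (hZ_indep : ∀ n, iIndepFun
      (fun (q : Fin K × Fin (p n) × Fin n) ω => Z n q.1 ω q.2.1 q.2.2) P)
    (hZ_mean : ∀ n r i j, ∫ ω, Z n r ω i j ∂P = 0)
    (hZ_var : ∀ n r i j, ∫ ω, ‖Z n r ω i j‖ ^ 2 ∂P = 1)
    (η : ℝ) (hη : 0 < η) (M : ℝ≥0)
    (hZ_moment : ∀ n r i j, ∫⁻ ω, ‖Z n r ω i j‖ₑ ^ (4 + η) ∂P ≤ M)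
    -- T3
    (hA_psd : ∀ᵐ ω ∂P, ∀ n r, (A n r ω).PosSemidef)
    (hB_psd : ∀ᵐ ω ∂P, ∀ n r, (B n r ω).PosSemidef)
    (H G : ProbabilityMeasure (Fin K → ℝ))
    (hH_nonneg : ∀ᵐ x ∂(H : Measure (Fin K → ℝ)), ∀ r, 0 ≤ x r)
    (hG_nonneg : ∀ᵐ x ∂(G : Measure (Fin K → ℝ)), ∀ r, 0 ≤ x r)
    (hA_lim : ∀ᵐ ω ∂P,
      Tendsto (fun n => jointESD fun r => A n r ω) atTop (𝓝 H.toFiniteMeasure))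
    (hB_lim : ∀ᵐ ω ∂P,
      Tendsto (fun n => jointESD fun r => B n r ω) atTop (𝓝 G.toFiniteMeasure))
    (hH_ne : (H : Measure (Fin K → ℝ)) ≠ Measure.dirac 0)
    (hG_ne : (G : Measure (Fin K → ℝ)) ≠ Measure.dirac 0)
    (hH_coord : ∀ r, ¬ ∀ᵐ x ∂(H : Measure (Fin K → ℝ)), x r = 0)
    (hG_coord : ∀ r, ¬ ∀ᵐ x ∂(G : Measure (Fin K → ℝ)), x r = 0)
    -- T4
    (C₀ : ℝ) (hC₀ : 0 < C₀)
    (hAB_trace : ∀ᵐ ω ∂P,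
      limsup (fun n : ℕ => ⨆ r : Fin K,
        max (ENNReal.ofReal ((A n r ω).trace.re / (p n : ℝ)))
          (ENNReal.ofReal ((B n r ω).trace.re / (n : ℝ)))) atTop < ENNReal.ofReal C₀)
    -- T5
    (hA_comm : ∀ᵐ ω ∂P, ∀ n r s, Commute (A n r ω) (A n s ω))
    (hB_comm : ∀ᵐ ω ∂P, ∀ n r s, Commute (B n r ω) (B n s ω)) :
    ∃ (h : ℂ → Fin K → ℂ) (F : ProbabilityMeasure ℝ),
      -- `h` is a solution in the class of Stieltjes transforms of measures on `[0, ∞)`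
      (∀ r, IsStieltjesOf (Set.Ici 0) fun z => h z r) ∧
      SolvesSystem c (H : Measure (Fin K → ℝ)) (G : Measure (Fin K → ℝ)) h ∧
      -- it is the only one, even in the class of Stieltjes transforms of measures on `ℝ`
      (∀ h' : ℂ → Fin K → ℂ, (∀ r, IsStieltjesOf Set.univ fun z => h' z r) →
        SolvesSystem c (H : Measure (Fin K → ℝ)) (G : Measure (Fin K → ℝ)) h' →
        ∀ z : ℂ, 0 < z.im → h' z = h z) ∧
      -- the Stieltjes transform of `F`
      (∀ z : ℂ, 0 < z.im → stieltjes (F : Measure ℝ) z =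
        ∫ x : Fin K → ℝ, 1 / (-z * (1 + ∑ s, (x s : ℂ) *
          opO z (fun t => (c : ℂ) * h z t) (G : Measure (Fin K → ℝ)) s))
          ∂(H : Measure (Fin K → ℝ))) ∧
      -- almost sure weak convergence of the empirical spectral distributions
      (∀ᵐ ω ∂P, Tendsto
        (fun n => esd (sampleCov_isHermitian
          (dataMatrix (fun r => A n r ω) (fun r => B n r ω) (fun r => Z n r ω))))
        atTop (𝓝 F.toFiniteMeasure)) := by
  have hζ : Innovations P (1 + M) fun n (q : Fin K × Fin (p n) × Fin n) ω =>
      Z n q.1 ω q.2.1 q.2.2 :=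
    { meas := fun n q => hZ_meas n q.1 q.2.1 q.2.2
      indep := hZ_indep
      mean := fun n q => hZ_mean n q.1 q.2.1 q.2.2
      var := fun n q => hZ_var n q.1 q.2.1 q.2.2
      integrable := fun n q => (integrable_norm_pow_three_of_moment
        (hZ_meas n q.1 q.2.1 q.2.2) hη (hZ_moment n q.1 q.2.1 q.2.2)).1
      third := fun n q => (integrable_norm_pow_three_of_moment
        (hZ_meas n q.1 q.2.1 q.2.2) hη (hZ_moment n q.1 q.2.1 q.2.2)).2 }
  have hm₃ : (0 : ℝ) ≤ 1 + M := by positivity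
  have hC : 0 ≤ C₀ * (c + 1) := by positivity
  have hreg : ∀ᵐ ω ∂P, ∃ S : SpecData K p,
      Regime S c (C₀ * (c + 1)) (H : Measure (Fin K → ℝ)) (G : Measure (Fin K → ℝ)) ∧
      (∀ n r, A n r ω = conjDiag (S.U n) fun j => (S.lam n j r : ℂ)) ∧
      ∀ n r, B n r ω = conjDiag (S.V n) fun j => (S.mu n j r : ℂ) := by
    filter_upwards [hA_psd, hB_psd, hA_lim, hB_lim, hAB_trace, hA_comm, hB_comm]
      with ω h1 h2 h3 h4 h5 h6 h7
    exact exists_regime hc hpn h1 h2 hH_nonneg hG_nonneg h3 h4 hC₀ h5 h6 h7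
  -- One realization of the scaling matrices suffices to construct h and the law ρ, because the
  -- system involves only c and the non-random H and G.
  obtain ⟨ω₀, S, hS, -, -⟩ := hreg.exists
  obtain ⟨h, ρ, hL⟩ := hS.exists_isLimitLaw hζ hm₃ hc hC hH_coord hG_coord
  have hHint := hS.integrable_left hc hC
  have hGint := hS.integrable_right
  have hGpos := fun r => integral_coord_pos hG_nonneg (hGint r) (hG_coord r)
  have hρ := hL.isProbabilityMeasure hc hH_nonneg hG_nonneg hGint hGpos
  refine ⟨h, ⟨ρ, hρ⟩, hL.isStieltjes, hL.solves, fun h' hst hs z hz => ?_, hL.eq, ?_⟩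
  · exact eq_of_solves hc hH_nonneg hG_nonneg hHint hGint hGpos hst
      (fun r => (hL.isStieltjes r).mono (Set.subset_univ _)) hs hL.solves hz
  have hpos : ∀ q : ℕ, (0 : ℝ) < 1 + (q : ℝ)⁻¹ := fun q => by positivity
  -- Countably many points -(1 + 1/q) on the negative axis suffice, so the exceptional null sets can
  -- be united.
  have hall : ∀ᵐ ω ∂P, ∀ q : ℕ, Tendsto (fun n => covTrace (1 + (q : ℝ)⁻¹) (fun r => A n r ω)
      (fun r => B n r ω) fun r => Z n r ω) atTop (𝓝 (stieltjes ρ (-(1 + (q : ℝ)⁻¹ : ℝ)))) := by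
    refine ae_all_iff.2 fun q => ?_
    let T : Set ((((n : ℕ) → Fin K → Fin (p n) → Fin (p n) → ℂ) ×
        ((n : ℕ) → Fin K → Fin n → Fin n → ℂ)) × ((n : ℕ) → Fin K → Fin (p n) → Fin n → ℂ)) :=
      {x | Tendsto (fun n => covTrace (1 + (q : ℝ)⁻¹) (x.1.1 n) (x.1.2 n) (x.2 n)) atTop
        (𝓝 (stieltjes ρ (-(1 + (q : ℝ)⁻¹ : ℝ))))}
    have hT : MeasurableSet T := by
      refine measurableSet_tendsto _ fun n => ?_
      exact measurable_covTrace _ ((measurable_pi_apply n).comp (measurable_fst.comp measurable_fst))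
        ((measurable_pi_apply n).comp (measurable_snd.comp measurable_fst))
        ((measurable_pi_apply n).comp measurable_snd)
    refine ae_of_indepFun (T := T) (Measurable.prodMk ?_ ?_) ?_ hAB_indep hT ?_
    · exact measurable_pi_lambda _ fun n => measurable_pi_lambda _ fun r =>
        measurable_pi_lambda _ fun i => measurable_pi_lambda _ fun j => hA_meas n r i j
    · exact measurable_pi_lambda _ fun n => measurable_pi_lambda _ fun r =>
        measurable_pi_lambda _ fun i => measurable_pi_lambda _ fun j => hB_meas n r i j
    · exact measurable_pi_lambda _ fun n => measurable_pi_lambda _ fun r =>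
        measurable_pi_lambda _ fun i => measurable_pi_lambda _ fun j => hZ_meas n r i j
    -- The scaling matrices are frozen at ω while the innovations stay random. The spectral data
    -- depend on ω, but the limit ρ does not.
    · filter_upwards [hreg] with ω hω
      obtain ⟨S, hS, hSA, hSB⟩ := hω
      exact hS.ae_tendsto_covTrace hζ hm₃ hc hC hH_coord hG_coord hL hSA hSB (hpos q)
  filter_upwards [hall] with ω hω
  rw [FiniteMeasure.tendsto_iff_forall_integral_tendsto]
  refine tendsto_integral_of_tendsto_stieltjes (fun n => esd_compl_Ici _) hL.nonneg ?_ fun q => ?_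
  -- The masses agree as soon as p n > 0. For p n = 0 the empirical spectral distribution is the
  -- zero measure.
  · refine tendsto_const_nhds.congr' ?_
    filter_upwards [eventually_pos_of_ratio hc hpn] with n hn
    have : Nonempty (Fin (p n)) := ⟨⟨0, hn.2.1⟩⟩
    have he := isProbabilityMeasure_empirical (sampleCov_isHermitian (dataMatrix (fun r => A n r ω)
      (fun r => B n r ω) (fun r => Z n r ω))).eigenvalues
    exact (probReal_univ (μ := ρ)).trans (@probReal_univ _ _ _ he).symm
  · refine (hω q).congr fun n => ?_
    rw [← stieltjes_esd_eq_covTrace (hpos q)]
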